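/- Let $F_0$ be a complete discretely valued field with ring of integers $O_{F_0}$, uniformizer $\pi_0$ and perfect residue field $k$ of characteristic $\neq 2$. Let $F=F_0(\pi)$ with $\pi^2=\pi_0$, so that $O_F=O_{F_0}[\pi]$. Let $n=2m>3$ and $n=r+s$ with $0\le s\le r$. Let $V=F^n$ with standard basis $e_1,\dots,e_n$, let $\phi$ be the hermitian form with $\phi(e_i,e_{n+1-j})=\delta_{ij}$, put $(x,y)=\tfrac12\mathrm{Tr}_{F/F_0}\phi(x,y)$ and $$\Lambda_m=\mathrm{span}_{O_F}\{\pi^{-1}e_1,\dots,\pi^{-1}e_m,e_{m+1},\dots,e_n\}.$$ The form $(\ ,\ )$ takes values in $O_{F_0}$ on $\Lambda_m$. For an $O_F$-algebra $R$, write $t$ and $\pi$ for the operators $\pi\otimes 1$ and $1\otimes\pi$ on $\Lambda_m\otimes_{O_{F_0}}R$. The splitting model ${\rm M}^{\rm spl}$ is the $O_F$-scheme whose $R$-points, for $O_F$-algebras $R$, are the pairs $(\mathcal F,\mathcal G)$ of locally direct summands $\mathcal G\subset\mathcal F\subset\Lambda_m\otimes_{O_{F_0}}R$ of ranks $s$ and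 $n$ such that 1. $\mathcal F$ is totally isotropic for $(\ ,\ )$; 2. (splitting condition) $(t+\pi)\mathcal F\subset\mathcal G$ and $(t-\pi)\mathcal G=0$; 3. (spin condition) at every point of $\mathrm{Spec}\,R$ the rank of $t+\pi$ on $\mathcal F$ has the same parity as $s$. For a point $x=(\mathcal F,\mathcal G)$ of the special fiber ${\rm M}^{\rm spl}\otimes_{O_F} k$, with values in its residue field $\kappa(x)$, let $\mathcal G^{\perp'}=t(\mathcal G^{\perp})$. This is the dual of $\mathcal G\subset t\Lambda_m$ under the modified pairing $\{tx,ty\}=(tx,y)$ on $t(\Lambda_m\otimes\kappa(x))$. For integers $h,l$ let $X_{h,l}$ be the set of points $x$ of the special fiber with $\dim t\mathcal F=h$ and $\dim(\mathcal G\cap\mathcal G^{\perp'})=l$. Then the functor above is represented by an $O_F$-scheme ${\rm M}^{\rm spl}$, and the following hold. (a) The special fiber is the disjoint union $${\rm M}^{\rm spl}\otimes k=\coprod_{\substack{0\le h\le l\le s\\ h\equiv l\equiv s \bmod 2}}X_{h,l}.$$ (b) For every pair $(h,l)$ with $h\equiv l\equiv s \bmod 2$ and $0\le h\le l\le s$,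 the stratum $X_{h,l}$ is nonempty and locally closed. With its reduced subscheme structure it is smooth over $k$, and it is equidimensional of dimension $$rs-\frac{(l-h)(l-h-1)}{2},$$ i.e. all its irreducible components have this dimension. -/

import Mathlib

open CategoryTheory AlgebraicGeometry TensorProduct

universe u

namespace SplittingModel

noncomputable section

/-! ### The hermitian space and the lattice -/

/-- The ring `O_F = O₀[π]`, `π² = π₀`. If `O₀` is a discrete valuation ring with uniformizer `π₀`
and fraction field `F₀`, this is the ring of integers of the ramified quadratic extension
`F = F₀(π)`. -/
abbrev RingOfInt {O₀ : Type u} [CommRing O₀] (π₀ : O₀) : Type u := QuadraticAlgebra O₀ π₀ 0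

section Lattice

variable {O₀ : Type u} [CommRing O₀] (π₀ : O₀)
variable (F₀ : Type u) [Field F₀] [Algebra O₀ F₀]

/-- The quadratic extension `F = F₀(π)`, `π² = π₀`, of the fraction field `F₀` of `O₀`. -/
abbrev QuadExt : Type u := QuadraticAlgebra F₀ (algebraMap O₀ F₀ π₀) 0

/-- The element `π` of `F`. -/
abbrev unif : QuadExt π₀ F₀ := QuadraticAlgebra.omega

/-- The `F`-vector space `V = Fⁿ`, `n = 2m`, with standard basis `e₁, …, eₙ`. -/
abbrev HermSpace (m : ℕ) : Type u := Fin (2 * m) → QuadExt π₀ F₀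

variable {m : ℕ}

/-- The split hermitian form: `φ(e_i, e_{n+1-j}) = δ_{ij}`. -/
def herm (x y : HermSpace π₀ F₀ m) : QuadExt π₀ F₀ := ∑ i, star (x i) * y i.rev

theorem trace_herm (x y : HermSpace π₀ F₀ m) :
    QuadraticAlgebra.trace (herm π₀ F₀ x y) =
      2 * ∑ i, ((x i).re * (y i.rev).re - algebraMap O₀ F₀ π₀ * (x i).im * (y i.rev).im) := by
  simp only [herm, map_sum, Finset.mul_sum]
  refine Finset.sum_congr rfl fun i _ => ?_
  simp only [QuadraticAlgebra.trace_def, QuadraticAlgebra.re_mul, QuadraticAlgebra.re_star,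
    QuadraticAlgebra.im_star]
  ring

variable (m) in
/-- The symmetric `F₀`-bilinear form `(x, y) = ½ Tr_{F/F₀} φ(x, y)` on `V`. -/
def symmForm : LinearMap.BilinForm F₀ (HermSpace π₀ F₀ m) :=
  LinearMap.mk₂ F₀ (fun x y => (1 / 2 : F₀) * QuadraticAlgebra.trace (herm π₀ F₀ x y))
    (by
      intro x x' y
      simp only [trace_herm, ← mul_add, ← Finset.sum_add_distrib]
      congr 2
      refine Finset.sum_congr rfl fun i _ => ?_
      simp; ring)
    (by
      intro c x y
      simp only [trace_herm, smul_eq_mul, Finset.mul_sum]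
      refine Finset.sum_congr rfl fun i _ => ?_
      simp; ring)
    (by
      intro x y y'
      simp only [trace_herm, ← mul_add, ← Finset.sum_add_distrib]
      congr 2
      refine Finset.sum_congr rfl fun i _ => ?_
      simp; ring)
    (by
      intro c x y
      simp only [trace_herm, smul_eq_mul, Finset.mul_sum]
      refine Finset.sum_congr rfl fun i _ => ?_
      simp; ring)

theorem symmForm_apply (x y : HermSpace π₀ F₀ m) :
    symmForm π₀ F₀ m x y = (1 / 2 : F₀) * QuadraticAlgebra.trace (herm π₀ F₀ x y) := rfl

/-- The `O_F`-generators `π⁻¹e₁, …, π⁻¹e_m, e_{m+1}, …, e_n` of `Λ_m`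
(note that `π⁻¹ = π₀⁻¹ π`). -/
def latticeGen (i : Fin (2 * m)) : HermSpace π₀ F₀ m :=
  Pi.single i (if (i : ℕ) < m then (algebraMap O₀ F₀ π₀)⁻¹ • unif π₀ F₀ else 1)

/-- The `O₀`-generators of `Λ_m`: the `O_F`-generators, and their multiples by `π`. -/
def latticeVec : Fin (2 * m) ⊕ Fin (2 * m) → HermSpace π₀ F₀ m :=
  Sum.elim (latticeGen π₀ F₀) (fun i => unif π₀ F₀ • latticeGen π₀ F₀ i)

variable (m) in
/-- The lattice `Λ_m = span_{O_F} {π⁻¹e₁, …, π⁻¹e_m, e_{m+1}, …, e_n}` of `V`, as an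
`O₀`-module. -/
def lattice : Submodule O₀ (HermSpace π₀ F₀ m) :=
  Submodule.span O₀ (Set.range (latticeVec π₀ F₀))

variable {π₀ F₀} in
theorem unif_smul_mem {x : HermSpace π₀ F₀ m} (hx : x ∈ lattice π₀ F₀ m) :
    unif π₀ F₀ • x ∈ lattice π₀ F₀ m := by
  induction hx using Submodule.span_induction with
  | mem x h =>
    obtain ⟨i | i, rfl⟩ := h
    · exact Submodule.subset_span ⟨Sum.inr i, rfl⟩
    · have : unif π₀ F₀ • latticeVec π₀ F₀ (Sum.inr i) =
          π₀ • latticeVec π₀ F₀ (Sum.inl i) := by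
        simp only [latticeVec, Sum.elim_inr, Sum.elim_inl, smul_smul]
        rw [QuadraticAlgebra.omega_mul_omega_eq_algebraMap, map_zero, zero_mul, add_zero,
          algebraMap_smul, algebraMap_smul]
      rw [this]
      exact Submodule.smul_mem _ _ (Submodule.subset_span ⟨Sum.inl i, rfl⟩)
  | zero => rw [smul_zero]; exact Submodule.zero_mem _
  | add x y _ _ hx hy => rw [smul_add]; exact Submodule.add_mem _ hx hy
  | smul a x _ hx => rw [smul_comm]; exact Submodule.smul_mem _ _ hx

variable (m) in
/-- The `O₀`-linear endomorphism `t` of `Λ_m` induced by multiplication by `π`. -/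
def latticeT : lattice π₀ F₀ m →ₗ[O₀] lattice π₀ F₀ m where
  toFun x := ⟨unif π₀ F₀ • x.1, unif_smul_mem x.2⟩
  map_add' _ _ := Subtype.ext (smul_add _ _ _)
  map_smul' _ _ := Subtype.ext (smul_comm _ _ _)

variable {π₀ F₀} in
theorem coord_integral {x : HermSpace π₀ F₀ m} (hx : x ∈ lattice π₀ F₀ m) (i : Fin (2 * m)) :
    (x i).re ∈ (algebraMap O₀ F₀).range ∧
      algebraMap O₀ F₀ π₀ * (x i).im ∈ (algebraMap O₀ F₀).range ∧
      (m ≤ (i : ℕ) → (x i).im ∈ (algebraMap O₀ F₀).range) := by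
  induction hx using Submodule.span_induction with
  | mem x h =>
    have hc : algebraMap O₀ F₀ π₀ * (algebraMap O₀ F₀ π₀)⁻¹ ∈ (algebraMap O₀ F₀).range := by
      by_cases h0 : algebraMap O₀ F₀ π₀ = 0
      · rw [h0, zero_mul]; exact zero_mem _
      · rw [mul_inv_cancel₀ h0]; exact one_mem _
    have hc' := mul_comm (algebraMap O₀ F₀ π₀) (algebraMap O₀ F₀ π₀)⁻¹ ▸ hc
    obtain ⟨j | j, rfl⟩ := h <;> rcases eq_or_ne i j with rfl | hij
    · by_cases hm : (i : ℕ) < m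
      · simpa [latticeVec, latticeGen, hm, zero_mem] using hc
      · simp [latticeVec, latticeGen, hm, zero_mem, one_mem, QuadraticAlgebra.re_one,
          QuadraticAlgebra.im_one]
    · simp [latticeVec, latticeGen, hij, zero_mem]
    · by_cases hm : (i : ℕ) < m
      · simpa [latticeVec, latticeGen, hm, zero_mem] using hc'
      · simp [latticeVec, latticeGen, hm, zero_mem, one_mem]
    · simp [latticeVec, latticeGen, hij, zero_mem]
  | zero => simp [zero_mem]
  | add x y _ _ hx hy =>
    refine ⟨add_mem hx.1 hy.1, ?_, fun h => add_mem (hx.2.2 h) (hy.2.2 h)⟩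
    simpa [mul_add] using add_mem hx.2.1 hy.2.1
  | smul a x _ hx =>
    have ha : algebraMap O₀ F₀ a ∈ (algebraMap O₀ F₀).range := ⟨a, rfl⟩
    simp only [Pi.smul_apply, QuadraticAlgebra.re_smul, QuadraticAlgebra.im_smul,
      Algebra.smul_def (A := F₀) a]
    refine ⟨mul_mem ha hx.1, ?_, fun h => mul_mem ha (hx.2.2 h)⟩
    rw [mul_left_comm]
    exact mul_mem ha hx.2.1

/-- The symmetric form takes values in `O₀` on `Λ_m`, i.e. `Λ_m ⊆ Λ_m^∨`. -/
theorem lattice_le_dual : lattice π₀ F₀ m ≤ (symmForm π₀ F₀ m).dualSubmodule (lattice π₀ F₀ m) := by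
  intro x hx y hy
  suffices h : symmForm π₀ F₀ m x y ∈ (algebraMap O₀ F₀).range by
    obtain ⟨a, ha⟩ := h
    exact Submodule.mem_one.2 ⟨a, ha⟩
  rw [symmForm_apply, trace_herm]
  by_cases h2 : (2 : F₀) = 0
  · simp [h2, zero_mem]
  rw [← mul_assoc, one_div, inv_mul_cancel₀ h2, one_mul]
  refine sum_mem fun i _ => ?_
  obtain ⟨h1, h3, h4⟩ := coord_integral hx i
  obtain ⟨k1, k3, k4⟩ := coord_integral hy i.rev
  refine sub_mem (mul_mem h1 k1) ?_
  by_cases hi : m ≤ (i : ℕ)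
  · rw [mul_right_comm]
    exact mul_mem k3 (h4 hi)
  · refine mul_mem h3 (k4 ?_)
    have := i.rev.2
    rw [Fin.val_rev] at *
    omega

variable [IsDomain O₀] [IsFractionRing O₀ F₀]

variable (m) in
/-- The `O₀`-valued symmetric bilinear form on `Λ_m` induced by `( , )`. -/
def latticeForm : LinearMap.BilinForm O₀ (lattice π₀ F₀ m) :=
  haveI : Module.IsTorsionFree O₀ F₀ := inferInstance
  ((symmForm π₀ F₀ m).dualSubmoduleToDual (lattice π₀ F₀ m)) ∘ₗ
    Submodule.inclusion (lattice_le_dual π₀ F₀)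

theorem latticeForm_apply (x y : lattice π₀ F₀ m) :
    algebraMap O₀ F₀ (latticeForm π₀ F₀ m x y) = symmForm π₀ F₀ m x y := by
  simp [latticeForm]

variable (m) in
/-- The `O_F`-module `Λ_m ⊗_{O₀} O_F`. For an `O_F`-algebra `R` one has
`R ⊗_{O_F} (O_F ⊗_{O₀} Λ_m) = R ⊗_{O₀} Λ_m`. -/
abbrev OFLattice : Type u := RingOfInt π₀ ⊗[O₀] lattice π₀ F₀ m

end Lattice

/-! ### Linear algebra of the Grassmannian functor -/

section Grassmannian

variable {O L : Type u} [CommRing O] [AddCommGroup L] [Module O L] {k : ℕ}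
variable {A B : Type u} [CommRing A] [Algebra O A] [CommRing B] [Algebra O B]

/-- The base change of a point `N ⊆ A ⊗ L` of the Grassmannian along `f : A → B` is the
`B`-submodule of `B ⊗ L` generated by the image of `N`. -/
theorem grassmannian_map_eq_span (f : A →ₐ[O] B) (N : Module.Grassmannian A (A ⊗[O] L) k) :
    (Module.Grassmannian.map f N).toSubmodule =
      Submodule.span B (f.toLinearMap.rTensor L '' (N.toSubmodule : Set (A ⊗[O] L))) := by
  let : Algebra A B := f.toAlgebra
  let : IsScalarTower O A B :=
    IsScalarTower.of_algebraMap_eq' <| IsScalarTower.algebraMap_eq O A B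
  let e := AlgebraTensorModule.cancelBaseChange O A B B L
  have he : ∀ x : A ⊗[O] L, e (1 ⊗ₜ[A] x) = f.toLinearMap.rTensor L x := by
    intro x
    induction x with
    | zero => simp
    | add x y hx hy => rw [TensorProduct.tmul_add, map_add, map_add, hx, hy]
    | tmul a l =>
      simp [e, Algebra.smul_def, RingHom.algebraMap_toAlgebra]
  rw [Module.Grassmannian.map_toSubmodule]
  have hk : LinearMap.ker (N.toSubmodule.mkQ.baseChange B) = N.toSubmodule.baseChange B := by
    apply SetLike.coe_injective
    have h := lTensor_mkQ B N.toSubmodule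
    ext x
    exact SetLike.ext_iff.1 h x
  have : LinearMap.ker (Module.Grassmannian.baseChangeMkQ B N.toSubmodule) =
      (LinearMap.ker (N.toSubmodule.mkQ.baseChange B)).map e.toLinearMap := by
    ext x
    constructor
    · intro hx
      exact ⟨e.symm x, hx, e.apply_symm_apply x⟩
    · rintro ⟨y, hy, rfl⟩
      change N.toSubmodule.mkQ.baseChange B (e.symm (e y)) = 0
      rw [e.symm_apply_apply]
      exact hy
  rw [this, hk, Submodule.baseChange_eq_span, Submodule.map_span]
  congr 1
  ext x
  constructor
  · rintro ⟨_, ⟨y, hy, rfl⟩, rfl⟩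
    exact ⟨y, hy, (he y).symm⟩
  · rintro ⟨y, hy, rfl⟩
    exact ⟨_, ⟨y, hy, rfl⟩, he y⟩

end Grassmannian

/-! ### The splitting model -/

section Splitting

variable {O₀ : Type u} [CommRing O₀] [IsDomain O₀] (π₀ : O₀)
variable (F₀ : Type u) [Field F₀] [Algebra O₀ F₀] [IsFractionRing O₀ F₀]

section Operators

variable (m : ℕ) (R : Type u) [CommRing R] [Algebra (RingOfInt π₀) R]

/-- The operator `t = π ⊗ 1` on `Λ_m ⊗_{O₀} R`: the action of `π` on the factor `Λ_m`. -/
def tOp : R ⊗[RingOfInt π₀] OFLattice π₀ F₀ m →ₗ[R] R ⊗[RingOfInt π₀] OFLattice π₀ F₀ m :=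
  ((latticeT π₀ F₀ m).baseChange (RingOfInt π₀)).baseChange R

/-- The operator `π = 1 ⊗ π` on `Λ_m ⊗_{O₀} R`: multiplication by the image of `π` in `R`. -/
def piOp : R ⊗[RingOfInt π₀] OFLattice π₀ F₀ m →ₗ[R] R ⊗[RingOfInt π₀] OFLattice π₀ F₀ m :=
  LinearMap.lsmul R _ (algebraMap (RingOfInt π₀) R QuadraticAlgebra.omega)

/-- The symmetric form `( , )` on `Λ_m ⊗_{O₀} R`. -/
def formOver : LinearMap.BilinForm R (R ⊗[RingOfInt π₀] OFLattice π₀ F₀ m) :=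
  ((latticeForm π₀ F₀ m).baseChange (RingOfInt π₀)).baseChange R

end Operators

section BaseChange

variable {π₀ F₀} {m : ℕ} {A B : Type u} [CommRing A] [Algebra (RingOfInt π₀) A]
  [CommRing B] [Algebra (RingOfInt π₀) B] (f : A →ₐ[RingOfInt π₀] B)

theorem tOp_rTensor (x : A ⊗[RingOfInt π₀] OFLattice π₀ F₀ m) :
    tOp π₀ F₀ m B (f.toLinearMap.rTensor _ x) = f.toLinearMap.rTensor _ (tOp π₀ F₀ m A x) := by
  induction x with
  | zero => simp
  | add x y hx hy => simp only [map_add, hx, hy]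
  | tmul a l => simp [tOp]

theorem piOp_rTensor (x : A ⊗[RingOfInt π₀] OFLattice π₀ F₀ m) :
    piOp π₀ F₀ m B (f.toLinearMap.rTensor _ x) = f.toLinearMap.rTensor _ (piOp π₀ F₀ m A x) := by
  simp [piOp]

theorem formOver_rTensor (x y : A ⊗[RingOfInt π₀] OFLattice π₀ F₀ m) :
    formOver π₀ F₀ m B (f.toLinearMap.rTensor _ x) (f.toLinearMap.rTensor _ y) =
      f (formOver π₀ F₀ m A x y) := by
  induction x with
  | zero => simp
  | add x x' hx hx' => simp only [map_add, LinearMap.add_apply, hx, hx']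
  | tmul a l =>
    induction y with
    | zero => simp
    | add y y' hy hy' => simp only [map_add, hy, hy']
    | tmul b l' => simp [formOver]

end BaseChange

open Module in
/-- The points of the splitting model `M^spl` of signature `(r, s)`, `r + s = n = 2m`, over an
`O_F`-algebra `R`: pairs of direct summands `G ⊆ F ⊆ Λ_m ⊗_{O₀} R` of ranks `s` and `n`
(`Grassmannian R M k` consists of the submodules of `M` with locally free quotient of rank `k`;
since `Λ_m ⊗_{O₀} R` is free of rank `2n`, the quotients by `F` and `G` have ranks `n` and
`2n - s = n + r`). -/
@[ext]
structure SplPoint (m r s : ℕ) (R : Type u) [CommRing R] [Algebra (RingOfInt π₀) R] where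
  /-- the summand `F` of rank `n` -/
  F : Grassmannian R (R ⊗[RingOfInt π₀] OFLattice π₀ F₀ m) (2 * m)
  /-- the summand `G` of rank `s` -/
  G : Grassmannian R (R ⊗[RingOfInt π₀] OFLattice π₀ F₀ m) (2 * m + r)
  le : G.toSubmodule ≤ F.toSubmodule
  isotropic : ∀ x ∈ F.toSubmodule, ∀ y ∈ F.toSubmodule, formOver π₀ F₀ m R x y = 0
  /-- splitting condition `(t + π) F ⊆ G` -/
  split_F : F.toSubmodule.map (tOp π₀ F₀ m R + piOp π₀ F₀ m R) ≤ G.toSubmodule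
  /-- splitting condition `(t - π) G = 0` -/
  split_G : G.toSubmodule.map (tOp π₀ F₀ m R - piOp π₀ F₀ m R) = ⊥
  /-- spin condition: at every field-valued point, the rank of `t + π` on `F` has the same parity
  as `s` -/
  spin : ∀ (K : Type u) [Field K] [Algebra (RingOfInt π₀) K] (f : R →ₐ[RingOfInt π₀] K),
    finrank K ((Grassmannian.map f F).toSubmodule.map (tOp π₀ F₀ m K + piOp π₀ F₀ m K)) ≡ s
      [MOD 2]

variable {π₀ F₀} {m r s : ℕ}

open Module in
/-- Base change of points of the splitting model. -/
def SplPoint.map {A B : Type u} [CommRing A] [Algebra (RingOfInt π₀) A]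
    [CommRing B] [Algebra (RingOfInt π₀) B] (f : A →ₐ[RingOfInt π₀] B)
    (x : SplPoint π₀ F₀ m r s A) : SplPoint π₀ F₀ m r s B where
  F := Grassmannian.map f x.F
  G := Grassmannian.map f x.G
  le := by
    rw [grassmannian_map_eq_span, grassmannian_map_eq_span]
    exact Submodule.span_mono (Set.image_mono x.le)
  isotropic := by
    rw [grassmannian_map_eq_span]
    intro y hy z hz
    induction hy, hz using Submodule.span_induction₂ with
    | mem_mem y z hy hz =>
      obtain ⟨y, hy, rfl⟩ := hy
      obtain ⟨z, hz, rfl⟩ := hz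
      rw [formOver_rTensor, x.isotropic y hy z hz, map_zero]
    | zero_left z _ => simp
    | zero_right y _ => simp
    | add_left y y' z _ _ _ h h' => simp [h, h']
    | add_right y z z' _ _ _ h h' => simp [h, h']
    | smul_left c y z _ _ h => simp [h]
    | smul_right c y z _ _ h => simp [h]
  split_F := by
    rw [grassmannian_map_eq_span, grassmannian_map_eq_span, Submodule.map_span, Submodule.span_le]
    rintro _ ⟨_, ⟨y, hy, rfl⟩, rfl⟩
    refine Submodule.subset_span ⟨(tOp π₀ F₀ m A + piOp π₀ F₀ m A) y,
      x.split_F ⟨y, hy, rfl⟩, ?_⟩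
    simp only [LinearMap.add_apply, map_add, tOp_rTensor, piOp_rTensor]
  split_G := by
    rw [grassmannian_map_eq_span, Submodule.map_span, Submodule.span_eq_bot]
    rintro _ ⟨_, ⟨y, hy, rfl⟩, rfl⟩
    have h : (tOp π₀ F₀ m A - piOp π₀ F₀ m A) y = 0 := by
      rw [← Submodule.mem_bot A, ← x.split_G]
      exact ⟨y, hy, rfl⟩
    rw [LinearMap.sub_apply, tOp_rTensor, piOp_rTensor, ← map_sub, ← LinearMap.sub_apply, h,
      map_zero]
  spin K _ _ g := by
    rw [← Grassmannian.map_comp]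
    exact x.spin K (g.comp f)

variable (π₀ F₀ m r s) in
/-- The splitting model `M^spl` as a functor on `O_F`-algebras. -/
def splFunctor : CommAlgCat.{u} (CommRingCat.of (RingOfInt π₀)) ⥤ Type u where
  obj R := SplPoint π₀ F₀ m r s R
  map f := ↾(SplPoint.map f.hom)
  map_id R := by
    refine ConcreteCategory.hom_ext _ _ fun x => ?_
    exact SplPoint.ext (Module.Grassmannian.map_id _ R x.F) (Module.Grassmannian.map_id _ R x.G)
  map_comp f g := by
    refine ConcreteCategory.hom_ext _ _ fun x => ?_
    exact SplPoint.ext (Module.Grassmannian.map_comp _ f.hom g.hom x.F)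
      (Module.Grassmannian.map_comp _ f.hom g.hom x.G)

end Splitting

/-! ### The special fiber and its stratification -/

section SpecialFiber

open Limits

variable {O₀ : Type u} [CommRing O₀] [IsDomain O₀] {π₀ : O₀}
variable {F₀ : Type u} [Field F₀] [Algebra O₀ F₀] [IsFractionRing O₀ F₀] {m r s : ℕ}

variable (π₀ F₀ m r s) in
/-- An identification of the functor of points of the `O_F`-scheme `M` on affine `O_F`-schemes
with the functor `M^spl`. It determines `M` uniquely up to unique isomorphism. -/
abbrev SplRepresentation (M : Over (Spec (CommRingCat.of (RingOfInt π₀)))) : Type _ :=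
  splFunctor π₀ F₀ m r s ≅ (algSpec (CommRingCat.of (RingOfInt π₀))).rightOp ⋙ yoneda.obj M

/-- The special fiber `M ⊗ k` of an `O_F`-scheme `M`. -/
abbrev specialFiber (M : Over (Spec (CommRingCat.of (RingOfInt π₀)))) (k : Type u) [CommRing k]
    [Algebra (RingOfInt π₀) k] : Scheme.{u} :=
  pullback M.hom (Spec.map (CommRingCat.ofHom (algebraMap (RingOfInt π₀) k)))

/-- The structure morphism `M ⊗ k ⟶ Spec k`. -/
abbrev specialFiberToSpec (M : Over (Spec (CommRingCat.of (RingOfInt π₀)))) (k : Type u)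
    [CommRing k] [Algebra (RingOfInt π₀) k] :
    specialFiber M k ⟶ Spec (CommRingCat.of k) :=
  pullback.snd M.hom (Spec.map (CommRingCat.ofHom (algebraMap (RingOfInt π₀) k)))

/-- The residue field `κ(x)` of a point of a scheme `X` over `Spec O`, as an `O`-algebra. -/
def residueAlg {O : CommRingCat.{u}} (X : Over (Spec O)) (x : X.left) : CommAlgCat.{u} O :=
  letI := (Spec.preimage (X.left.fromSpecResidueField x ≫ X.hom)).hom.toAlgebra
  CommAlgCat.of O (X.left.residueField x)

/-- The canonical morphism `Spec κ(x) ⟶ X` over `Spec O`. -/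
def fromSpecResidueAlg {O : CommRingCat.{u}} (X : Over (Spec O)) (x : X.left) :
    (algSpec O).obj (Opposite.op (residueAlg X x)) ⟶ X :=
  Over.homMk (X.left.fromSpecResidueField x)
    (Spec.map_preimage (X.left.fromSpecResidueField x ≫ X.hom)).symm

/-- The special fiber of `M`, as a scheme over `Spec O_F`. -/
abbrev specialFiberOver (M : Over (Spec (CommRingCat.of (RingOfInt π₀)))) (k : Type u) [CommRing k]
    [Algebra (RingOfInt π₀) k] : Over (Spec (CommRingCat.of (RingOfInt π₀))) :=
  Over.mk (pullback.fst M.hom (Spec.map (CommRingCat.ofHom (algebraMap (RingOfInt π₀) k))) ≫ M.hom)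

section Invariants

variable (π₀ F₀ m)
variable {K : Type u} [CommRing K] [Algebra (RingOfInt π₀) K]

/-- The dual `G^{⊥'} ⊆ (t - π) Λ_m` of `G ⊆ (t + π) Λ_m` under the modified pairing
`{(t + π) x, (t - π) y} = ((t + π) x, y)`: it consists of all `(t - π) y` such that
`{g, (t - π) y} = (g, y) = 0` for every `g ∈ G`, i.e. `G^{⊥'} = (t - π) G^⊥`. -/
def modDual (G : Submodule K (K ⊗[RingOfInt π₀] OFLattice π₀ F₀ m)) :
    Submodule K (K ⊗[RingOfInt π₀] OFLattice π₀ F₀ m) :=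
  ((formOver π₀ F₀ m K).orthogonal G).map (tOp π₀ F₀ m K - piOp π₀ F₀ m K)

end Invariants

section Strata

variable {M : Over (Spec (CommRingCat.of (RingOfInt π₀)))}
  (e : SplRepresentation π₀ F₀ m r s M) {k : Type u} [CommRing k] [Algebra (RingOfInt π₀) k]

/-- The pair `(F, G)` of subspaces of `Λ_m ⊗ κ(x)` corresponding to a point `x` of the special
fiber of `M^spl`. -/
def pairAt (x : specialFiber M k) :
    SplPoint π₀ F₀ m r s (residueAlg (specialFiberOver M k) x) :=
  e.inv.app (residueAlg (specialFiberOver M k) x)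
    (fromSpecResidueAlg (specialFiberOver M k) x ≫
      Over.homMk (pullback.fst M.hom
        (Spec.map (CommRingCat.ofHom (algebraMap (RingOfInt π₀) k)))) rfl)

/-- The stratum `X_{h,l}` of the special fiber of `M^spl`: the set of points `x` such that the pair
`(F, G)` at `x` has `dim t F = h` and `dim (G ∩ G^{⊥'}) = l`. -/
def stratum (k : Type u) [CommRing k] [Algebra (RingOfInt π₀) k] (h l : ℕ) :
    Set (specialFiber M k) :=
  {x | Module.finrank (residueAlg (specialFiberOver M k) x)
        ((pairAt e x).F.toSubmodule.map (tOp π₀ F₀ m _)) = h ∧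
      Module.finrank (residueAlg (specialFiberOver M k) x)
        ((pairAt e x).G.toSubmodule ⊓ modDual π₀ F₀ m (pairAt e x).G.toSubmodule :
          Submodule _ _) = l}

end Strata

/-- The index set of the stratification: pairs `0 ≤ h ≤ l ≤ s` with `h ≡ l ≡ s` modulo `2`. -/
def strataIndex (s : ℕ) : Set (ℕ × ℕ) :=
  {p | p.1 ≤ p.2 ∧ p.2 ≤ s ∧ p.1 ≡ s [MOD 2] ∧ p.2 ≡ s [MOD 2]}

end SpecialFiber

/-- `ι : Z ⟶ X` exhibits `Z` as the reduced locally closed subscheme of `X` with underlying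
set `S`. -/
structure IsReducedSubscheme {X Z : Scheme.{u}} (ι : Z ⟶ X) (S : Set X) : Prop where
  isImmersion : IsImmersion ι
  isReduced : IsReduced Z
  range_eq : Set.range ι = S

/-- A scheme is equidimensional of dimension `d` if all its irreducible components have
dimension `d`. -/
def IsEquidimensional (X : Scheme.{u}) (d : ℕ) : Prop :=
  ∀ C ∈ irreducibleComponents X, topologicalKrullDim C = d

end
end SplittingModel

open SplittingModel

/-! Write n = 2m. Over O_F the lattice has the basis b_i, (t - π) b_i (`ofBasis`). In its
coordinates (x, y) the operator t + π is (x, y) ↦ (2πx, x), t - π is (x, y) ↦ (0, x - 2πy), and the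
symmetric form is {x, y'} + {x', y}, where { , } is the standard alternating form `alt` on Rⁿ. The
points of the model become pairs of submodules of R²ⁿ (`SplPoint.isSpl`, `IsSpl.toSplPoint`), and
the arithmetic of O_F enters only through the image of 2π and the invertibility of 2.

Representability. A direct summand is locally a graph over a coordinate subspace. A totally
isotropic F of rank n lies, at a field-valued point, in a chart with coordinates x_j (j ∈ J) and y_i
(n + 1 - i ∉ J) (`exists_eq_graph_chartSet`), and there the rank of t + π on F has the parity of
|J|, because a skew form has even rank (`finrank_map_fstHalf_modEq`). Thus the spin condition just
selects the charts with |J| ≡ s mod 2. Each chart is a closed subscheme of an affine space, and two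
charts overlap where a product of two minors is invertible. `ChartedFunctor` turns such data into a
Zariski sheaf, namely families of points over the stalks that locally come from charts, and this
sheaf is representable since the charts are a cover by open immersions.

Strata. On the special fiber 2π = 0, so G = 0 ⊕ U with U of rank s, and tF corresponds to the
projection T of F to the x-coordinates. Since F is isotropic and contains G, T lies in the radical U
∩ U^⊥, whose dimension is l; hence h ≤ l ≤ s. The alternating form on U has rank s - l, which is
even, and spin gives h ≡ s (`exists_hasType`). Conversely F is recovered from U, T and an
alternating form B on T as the set of (x, y) with x ∈ T and {x', y} = B(x', x) for x' ∈ T. The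
parameters number l(n - l) - l(l - 1)/2 for the radical, (s - l)(n - s - l) for a complement of it
in U orthogonal to it, h(l - h) for T and h(h - 1)/2 for B; the sum is rs - (l - h)(l - h - 1)/2
(`StratumIndex.card_vars`).

Scheme structure. For combinatorial data D (charts of the radical, of U and of T) these parameters
define a pair over any ring (`conditions_param`), in particular a universal pair over the model
`Cell`, a polynomial ring with a Gram determinant inverted. The parameters can be read off from
suitably normalized elements of F and G (`IsFrame`), and these exist in a whole neighbourhood in the
special fiber, not only on the stratum (`exists_frame`). So the morphism from the model to the
special fiber has a left inverse locally and is a closed immersion into an open subscheme. Its image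
is the stratum, because a field-valued point of the stratum is determined by its parameters
(`IsFrame.eq_param`); this is `hasSmoothChart_stratum`. Gluing the reduced structures
(`exists_reducedSubscheme`) gives smoothness and the dimension; the origin of a suitable model gives
nonemptiness. -/

namespace SplittingModel
set_option linter.unusedSectionVars false
noncomputable section

/-! ### Submodules of free modules and coordinate charts -/

section Graph

variable {Q : Type} {R S T : Type*} [CommRing R] [CommRing S] [CommRing T]

/-- The extension of scalars of a submodule of `R^Q` along a ring homomorphism. -/
def extend (φ : R →+* S) (N : Submodule R (Q → R)) : Submodule S (Q → S) :=
  Submodule.span S ((fun v q => φ (v q)) '' (N : Set (Q → R)))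

theorem mem_extend (φ : R →+* S) {N : Submodule R (Q → R)} {v : Q → R} (hv : v ∈ N) :
    (fun q => φ (v q)) ∈ extend φ N :=
  Submodule.subset_span ⟨v, hv, rfl⟩

theorem extend_le (φ : R →+* S) {N : Submodule R (Q → R)} {N' : Submodule S (Q → S)} :
    extend φ N ≤ N' ↔ ∀ v ∈ N, (fun q => φ (v q)) ∈ N' := by
  rw [extend, Submodule.span_le, Set.image_subset_iff]
  rfl

theorem extend_mono (φ : R →+* S) {N N' : Submodule R (Q → R)} (h : N ≤ N') :
    extend φ N ≤ extend φ N' :=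
  (extend_le φ).2 fun _ hv => mem_extend φ (h hv)

theorem extend_span (φ : R →+* S) (s : Set (Q → R)) :
    extend φ (Submodule.span R s) = Submodule.span S ((fun v q => φ (v q)) '' s) := by
  refine le_antisymm ((extend_le φ).2 fun v hv => ?_) (Submodule.span_mono (Set.image_mono
    Submodule.subset_span))
  induction hv using Submodule.span_induction with
  | mem v h => exact Submodule.subset_span ⟨v, h, rfl⟩
  | zero => convert Submodule.zero_mem _ using 1; ext q; simp
  | add v w _ _ hv hw => convert Submodule.add_mem _ hv hw using 1; ext q; simp
  | smul a v _ hv => convert Submodule.smul_mem _ (φ a) hv using 1; ext q; simp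

theorem extend_extend (φ : R →+* S) (ψ : S →+* T) (N : Submodule R (Q → R)) :
    extend ψ (extend φ N) = extend (ψ.comp φ) N := by
  rw [extend.eq_def φ, extend_span, Set.image_image]
  rfl

theorem extend_id (N : Submodule R (Q → R)) : extend (RingHom.id R) N = N :=
  le_antisymm ((extend_le _).2 fun _ hv => hv) fun _ hv => mem_extend (RingHom.id R) hv

variable [DecidableEq Q]

/-- The submodule of `R^Q` which is the graph of the matrix `b` over the coordinates in `P`. -/
def graph (P : Finset Q) (b : Q → Q → R) : Submodule R (Q → R) where
  carrier := {v | ∀ q ∉ P, v q = ∑ p ∈ P, v p * b p q}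
  add_mem' {v w} hv hw q hq := by simp [hv q hq, hw q hq, add_mul, Finset.sum_add_distrib]
  zero_mem' q _ := by simp
  smul_mem' a v hv q hq := by simp [hv q hq, Finset.mul_sum, mul_assoc]

theorem mem_graph {P : Finset Q} {b : Q → Q → R} {v : Q → R} :
    v ∈ graph P b ↔ ∀ q ∉ P, v q = ∑ p ∈ P, v p * b p q := Iff.rfl

/-- The standard basis of `graph P b`. -/
def graphRow (P : Finset Q) (b : Q → Q → R) (p q : Q) : R :=
  if q ∈ P then if q = p then 1 else 0 else b p q

theorem graphRow_self {P : Finset Q} (b : Q → Q → R) (p : Q) {q : Q} (hq : q ∈ P) :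
    graphRow P b p q = if q = p then 1 else 0 := if_pos hq

theorem graphRow_of_notMem {P : Finset Q} (b : Q → Q → R) (p : Q) {q : Q} (hq : q ∉ P) :
    graphRow P b p q = b p q := if_neg hq

theorem graphRow_mem {P : Finset Q} (b : Q → Q → R) {p : Q} (hp : p ∈ P) :
    graphRow P b p ∈ graph P b := by
  intro q hq
  rw [graphRow_of_notMem b p hq, Finset.sum_congr rfl fun p' hp' => by
    rw [graphRow_self b p hp'], Finset.sum_eq_single p]
  · simp
  · intro p' _ h; simp [h]
  · intro h; exact absurd hp h

theorem eq_sum_graphRow {P : Finset Q} {b : Q → Q → R} {v : Q → R} (hv : v ∈ graph P b) :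
    v = ∑ p ∈ P, v p • graphRow P b p := by
  ext q
  rw [Finset.sum_apply]
  by_cases hq : q ∈ P
  · rw [Finset.sum_eq_single q]
    · simp [graphRow_self b q hq]
    · intro p _ h; simp [graphRow_self b p hq, h.symm]
    · intro h; exact absurd hq h
  · rw [hv q hq]
    refine Finset.sum_congr rfl fun p _ => ?_
    simp [graphRow_of_notMem b p hq]

theorem graph_eq_span (P : Finset Q) (b : Q → Q → R) :
    graph P b = Submodule.span R (graphRow P b '' P) := by
  refine le_antisymm (fun v hv => ?_) (Submodule.span_le.2 ?_)
  · rw [eq_sum_graphRow hv]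
    exact Submodule.sum_mem _ fun p hp =>
      Submodule.smul_mem _ _ (Submodule.subset_span ⟨p, hp, rfl⟩)
  · rintro _ ⟨p, hp, rfl⟩
    exact graphRow_mem b hp

theorem graph_le_iff {P : Finset Q} {b : Q → Q → R} {N : Submodule R (Q → R)} :
    graph P b ≤ N ↔ ∀ p ∈ P, graphRow P b p ∈ N := by
  rw [graph_eq_span, Submodule.span_le, Set.image_subset_iff]
  rfl

/-- A graph is spanned by rows with entries 0, 1 and `b p q`, all of which are preserved by ring
homomorphisms. Base change of charts therefore needs no flatness. -/
theorem extend_graph (φ : R →+* S) (P : Finset Q) (b : Q → Q → R) :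
    extend φ (graph P b) = graph P fun p q => φ (b p q) := by
  rw [graph_eq_span, extend_span, graph_eq_span, Set.image_image]
  congr 2
  ext p q
  by_cases hq : q ∈ P <;> simp [graphRow, hq, apply_ite φ]

theorem eq_of_mem_graph {P : Finset Q} {b : Q → Q → R} {v w : Q → R} (hv : v ∈ graph P b)
    (hw : w ∈ graph P b) (h : ∀ p ∈ P, v p = w p) : v = w := by
  rw [eq_sum_graphRow hv, eq_sum_graphRow hw]
  exact Finset.sum_congr rfl fun p hp => by rw [h p hp]

theorem graph_injective {P : Finset Q} {b b' : Q → Q → R} (h : graph P b = graph P b') {p q : Q}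
    (hp : p ∈ P) (hq : q ∉ P) : b p q = b' p q := by
  have := eq_of_mem_graph (h ▸ graphRow_mem b hp) (graphRow_mem b' hp) fun p' hp' => by
    rw [graphRow_self b p hp', graphRow_self b' p hp']
  simpa [graphRow_of_notMem _ p hq] using congrFun this q

theorem graph_congr {P : Finset Q} {b b' : Q → Q → R} (h : ∀ p ∈ P, ∀ q ∉ P, b p q = b' p q) :
    graph P b = graph P b' := by
  ext v
  refine forall_congr' fun q => forall_congr' fun hq => ?_
  rw [Finset.sum_congr rfl fun p hp => by rw [h p hp q hq]]

/-- A submodule in which vectors are determined by their coordinates in `P`, and which contains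
normalized vectors, is a graph. -/
theorem eq_graph {P : Finset Q} {N : Submodule R (Q → R)} (n : Q → Q → R)
    (hn : ∀ p ∈ P, n p ∈ N) (hn' : ∀ p ∈ P, ∀ q ∈ P, n p q = if q = p then 1 else 0)
    (h0 : ∀ v ∈ N, (∀ p ∈ P, v p = 0) → v = 0) : N = graph P n := by
  have hrow : ∀ p ∈ P, graphRow P n p = n p := fun p hp => by
    ext q
    by_cases hq : q ∈ P
    · rw [graphRow_self n p hq, hn' p hp q hq]
    · rw [graphRow_of_notMem n p hq]
  refine le_antisymm (fun v hv => ?_) (graph_le_iff.2 fun p hp => (hrow p hp).symm ▸ hn p hp)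
  have := h0 (v - ∑ p ∈ P, v p • n p) (N.sub_mem hv (N.sum_mem fun p hp =>
    N.smul_mem _ (hn p hp))) fun q hq => by
      rw [Pi.sub_apply, Finset.sum_apply, Finset.sum_eq_single q]
      · simp [hn' q hq q hq]
      · intro p hp h; simp [hn' p hp q hq, h.symm]
      · intro h; exact absurd hq h
  rw [sub_eq_zero.1 this]
  exact Submodule.sum_mem _ fun p hp => Submodule.smul_mem _ _
    ((hrow p hp) ▸ graphRow_mem n hp)

/-- The matrix of coordinates in `P'` of the standard basis of `graph P b`. -/
def minor (P P' : Finset Q) (b : Q → Q → R) : Matrix P P' R := fun p q => graphRow P b p q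

/-- Vectors with coordinate matrix of invertible determinant can be normalized. -/
theorem exists_normalized {P : Finset Q} {N : Submodule R (Q → R)} (u : P → Q → R)
    (hu : ∀ p, u p ∈ N) :
    ∃ n : Q → Q → R, (∀ p, n p ∈ N) ∧ ∀ p ∈ P, ∀ q ∈ P,
      n p q = if q = p then (Matrix.of fun p q : P => u p q).det else 0 := by
  set M : Matrix P P R := Matrix.of fun p q : P => u p q
  -- Cramer's rule: the adjugate replaces the inverse matrix, so the determinant need not be a unit
  -- here. The value 0 outside P is a default.
  refine ⟨fun p => if hp : p ∈ P then ∑ p' : P, M.adjugate ⟨p, hp⟩ p' • u p' else 0,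
    fun p => ?_, fun p hp q hq => ?_⟩
  · dsimp only
    split_ifs with hp
    · exact N.sum_mem fun p' _ => N.smul_mem _ (hu p')
    · exact N.zero_mem
  · have := congrFun (congrFun M.adjugate_mul ⟨p, hp⟩) ⟨q, hq⟩
    rw [Matrix.mul_apply, Matrix.smul_apply, Matrix.one_apply] at this
    simp only [hp, dite_true, Finset.sum_apply, Pi.smul_apply, smul_eq_mul]
    refine this.trans ?_
    by_cases h : q = p
    · simp [h]
    · simp [h, Ne.symm h]

/-- If both charts apply, expanding the rows of one graph in the rows of the other gives an inverse
of the minor. If the minor is invertible, the rows can be normalized by Cramer's rule. This makes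
the overlap of two charts the nonvanishing locus of one function. -/
theorem exists_eq_graph_iff {P P' : Finset Q} (e : P ≃ P') (b : Q → Q → R) :
    (∃ b', graph P b = graph P' b') ↔ IsUnit ((minor P P' b).submatrix id e).det := by
  constructor
  · rintro ⟨b', h⟩
    have hrow : ∀ p' : P', graphRow P' b' p' ∈ graph P b := fun p' =>
      h ▸ graphRow_mem b' p'.2
    have : (Matrix.of fun (p' p : P) => graphRow P' b' (e p') p) *
        (minor P P' b).submatrix id e = 1 := by
      ext i j
      rw [Matrix.mul_apply, Matrix.one_apply]
      have := congrFun (eq_sum_graphRow (hrow (e i))) (e j)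
      rw [graphRow_self b' _ (e j).2, Finset.sum_apply, ← Finset.sum_coe_sort] at this
      simp only [Pi.smul_apply, smul_eq_mul] at this
      simp only [Matrix.of_apply, Matrix.submatrix_apply, minor, id]
      rw [← this]
      simp [Subtype.ext_iff.symm, eq_comm]
    exact IsUnit.of_mul_eq_one_right _ (by rw [← Matrix.det_mul, this, Matrix.det_one])
  · intro h
    set M := (minor P P' b).submatrix id e with hM
    obtain ⟨d, hd⟩ := h
    obtain ⟨n, hn, hn'⟩ := exists_normalized (P := P') (N := graph P b)
      (fun p => graphRow P b (e.symm p)) (fun p => graphRow_mem b (e.symm p).2)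
    have hdet : (Matrix.of fun p q : P' => graphRow P b (e.symm p) q).det = d := by
      rw [hd, ← Matrix.det_submatrix_equiv_self e]
      congr 1
      ext i j
      simp [hM, minor]
    refine ⟨_, eq_graph (fun p => (↑d⁻¹ : R) • n p) (fun p _ => Submodule.smul_mem _ _ (hn p))
      (fun p hp q hq => ?_) fun v hv h0 => ?_⟩
    · rw [Pi.smul_apply, hn' p hp q hq, hdet]
      split_ifs <;> simp
    · have hv' : Matrix.vecMul (fun p : P => v p) M = 0 := by
        ext j
        have := congrFun (eq_sum_graphRow hv) (e j)
        rw [h0 _ (e j).2, Finset.sum_apply, ← Finset.sum_coe_sort] at this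
        rw [Matrix.vecMul, dotProduct, Pi.zero_apply, this]
        rfl
      have h1 : (fun p : P => v p) = 0 := by
        have := congrArg (fun w => Matrix.vecMul w M.adjugate) hv'
        simp only [Matrix.vecMul_vecMul, M.mul_adjugate, Matrix.zero_vecMul,
          Matrix.vecMul_smul, Matrix.vecMul_one, ← hd] at this
        have h2 := congrArg (fun w => (↑d⁻¹ : R) • w) this
        simpa [smul_smul] using h2
      refine eq_of_mem_graph hv (Submodule.zero_mem _) fun p hp => ?_
      exact congrFun h1 ⟨p, hp⟩

end Graph

/-! ### Coordinate charts over fields -/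

section Field

variable {Q : Type} [DecidableEq Q] {K : Type*} [Field K]

/-- The restriction of a subspace of `K^Q` to the coordinates in `P`. -/
def restrictTo (U : Submodule K (Q → K)) (P : Finset Q) : U →ₗ[K] (P → K) :=
  (LinearMap.funLeft K K ((↑) : P → Q)) ∘ₗ U.subtype

@[simp] theorem restrictTo_apply (U : Submodule K (Q → K)) (P : Finset Q) (u : U) (p : P) :
    restrictTo U P u p = u.1 p := rfl

/-- Take P ⊆ P₀ minimal among the sets on which restriction of U is injective. If restriction to P
were not onto, a linear relation would hold on its image, and a coordinate with nonzero coefficient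
in the relation could be dropped from P. -/
theorem exists_finset_eq_graph [Fintype Q] (U : Submodule K (Q → K)) (P₀ : Finset Q)
    (h₀ : ∀ u ∈ U, (∀ p ∈ P₀, u p = 0) → u = 0) :
    ∃ P ⊆ P₀, P.card = Module.finrank K U ∧ ∃ b, U = graph P b := by
  classical
  obtain ⟨P, ⟨hP, hP₀⟩, hmin⟩ := Finset.exists_minimal (s := P₀.powerset.filter fun P =>
    ∀ u ∈ U, (∀ p ∈ P, u p = 0) → u = 0) ⟨P₀, by simpa using h₀⟩ |>.imp fun P h =>
      (⟨by simpa using h.1, h.2⟩ : (P ⊆ P₀ ∧ ∀ u ∈ U, (∀ p ∈ P, u p = 0) → u = 0) ∧ _)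
  have hinj : Function.Injective (restrictTo U P) := by
    rw [← LinearMap.ker_eq_bot, LinearMap.ker_eq_bot']
    intro u hu
    exact Subtype.ext (hP₀ u u.2 fun p hp => congrFun hu ⟨p, hp⟩)
  have hsurj : Function.Surjective (restrictTo U P) := by
    rw [← LinearMap.range_eq_top]
    by_contra hne
    obtain ⟨c, hc, hle⟩ := Submodule.exists_le_ker_of_lt_top _ (lt_top_iff_ne_top.2 hne)
    have hcoef : ∀ w : P → K, c w = ∑ p, w p * c (Pi.single p 1) := fun w => by
      conv_lhs => rw [pi_eq_sum_univ' w]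
      simp [map_sum]
    obtain ⟨p, hp⟩ : ∃ p, c (Pi.single p 1) ≠ 0 := by
      by_contra! h
      exact hc (LinearMap.ext fun w => by simp [hcoef w, h])
    have hmem : P.erase p ∈ P₀.powerset.filter fun P =>
        ∀ u ∈ U, (∀ p ∈ P, u p = 0) → u = 0 := by
      rw [Finset.mem_filter, Finset.mem_powerset]
      refine ⟨(Finset.erase_subset _ _).trans hP, fun u hu h => hP₀ u hu fun q hq => ?_⟩
      by_cases hqp : q = p
      · have h1 : c (restrictTo U P ⟨u, hu⟩) = 0 := hle ⟨_, rfl⟩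
        rw [hcoef, Finset.sum_eq_single p] at h1
        · rw [hqp]; simpa [hp] using h1
        · intro q' _ hq'
          rw [restrictTo_apply]
          dsimp only
          rw [h q' (Finset.mem_erase.2 ⟨fun h => hq' (Subtype.ext h), q'.2⟩),
            zero_mul]
        · intro h; exact absurd (Finset.mem_univ _) h
      · exact h q (Finset.mem_erase.2 ⟨hqp, hq⟩)
    have := hmin hmem (Finset.erase_subset _ _) p.2
    simp at this
  refine ⟨P, hP, ?_, ?_⟩
  · rw [(LinearEquiv.ofBijective _ ⟨hinj, hsurj⟩).finrank_eq]
    simp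
  · choose u hu using fun p : P => hsurj (Pi.single p 1)
    refine ⟨_, eq_graph (fun p => if hp : p ∈ P then (u ⟨p, hp⟩).1 else 0) (fun p hp => ?_)
      (fun p hp q hq => ?_) hP₀⟩
    · simp [hp]
    · have := congrFun (hu ⟨p, hp⟩) ⟨q, hq⟩
      simpa [hp, Pi.single_apply] using this

theorem finrank_graph [Fintype Q] (P : Finset Q) (b : Q → Q → K) :
    Module.finrank K (graph P b) = P.card := by
  have hbij : Function.Bijective (restrictTo (graph P b) P) := by
    constructor
    · rw [← LinearMap.ker_eq_bot, LinearMap.ker_eq_bot']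
      intro u hu
      exact Subtype.ext (eq_of_mem_graph u.2 (Submodule.zero_mem _) fun p hp =>
        congrFun hu ⟨p, hp⟩)
    · intro w
      refine ⟨⟨∑ p : P, w p • graphRow P b p, Submodule.sum_mem _ fun p _ =>
        Submodule.smul_mem _ _ (graphRow_mem b p.2)⟩, ?_⟩
      ext q
      simp [graphRow_self b _ q.2, Subtype.ext_iff.symm]
  rw [(LinearEquiv.ofBijective _ hbij).finrank_eq]
  simp

theorem exists_eq_graph_of_card [Fintype Q] (U : Submodule K (Q → K)) (P : Finset Q)
    (hP : P.card = Module.finrank K U) (h₀ : ∀ u ∈ U, (∀ p ∈ P, u p = 0) → u = 0) :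
    ∃ b, U = graph P b := by
  obtain ⟨P', h, h1, h2⟩ := exists_finset_eq_graph U P h₀
  rwa [Finset.eq_of_subset_of_card_le h (hP.trans h1.symm).le] at h2

/-- Elements of a module over a ring which span, after extension to a field, a subspace with
chart `P`, can be normalized after inverting one element. -/
theorem exists_normalized_of_extend [Fintype Q] {R : Type*} [CommRing R] (φ : R →+* K)
    {N : Submodule R (Q → R)} {P : Finset Q} {b : Q → Q → K} (h : extend φ N = graph P b) :
    ∃ f : R, φ f ≠ 0 ∧ ∃ n : Q → Q → R, (∀ p, n p ∈ N) ∧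
      ∀ p ∈ P, ∀ q ∈ P, n p q = if q = p then f else 0 := by
  classical
  set s : Set (P → K) := (fun v (p : P) => φ (v p)) '' (N : Set (Q → R))
  -- The images of elements of N span the graph over K, and the graph projects onto `P → K`.
  have hs : Submodule.span K s = ⊤ := by
    rw [eq_top_iff]
    rintro w -
    have hmem : (∑ p : P, w p • graphRow P b p) ∈ extend φ N :=
      h ▸ Submodule.sum_mem _ fun p _ => Submodule.smul_mem _ _ (graphRow_mem b p.2)
    have := Submodule.mem_map_of_mem (f := LinearMap.funLeft K K ((↑) : P → Q)) hmem
    rw [extend, Submodule.map_span, Set.image_image] at this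
    have hw : LinearMap.funLeft K K ((↑) : P → Q) (∑ p : P, w p • graphRow P b p) = w := by
      ext q
      rw [LinearMap.funLeft_apply, Finset.sum_apply, Finset.sum_eq_single q]
      · simp [graphRow_self b _ q.2]
      · intro p _ hp
        simp [graphRow_self b _ q.2, hp.symm]
      · simp
    rw [hw] at this
    exact this
  -- A basis of `P → K` is chosen among images of elements of N; the determinant of the lifts is the
  -- element to be inverted.
  obtain ⟨t, hts, htspan, htli⟩ := exists_linearIndependent K s
  rw [hs] at htspan
  let B := Module.Basis.mk htli (by simp [htspan])
  let eB : P ≃ t := (Pi.basisFun K P).indexEquiv B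
  have hmem : ∀ p : P, ∃ v ∈ N, (fun q : P => φ (v q)) = (eB p : P → K) := fun p =>
    hts (eB p).2
  choose v hv hv' using hmem
  refine ⟨(Matrix.of fun p q : P => v p q).det, ?_, exists_normalized v hv⟩
  rw [RingHom.map_det, ← isUnit_iff_ne_zero, ← Matrix.isUnit_iff_isUnit_det,
    ← Matrix.linearIndependent_rows_iff_isUnit]
  have : (φ.mapMatrix (Matrix.of fun p q : P => v p q)).row = fun p => (eB p : P → K) := by
    ext p q
    exact congrFun (hv' p) q
  rw [this]
  exact htli.comp eB eB.injective

/-- The rank of a skew-symmetric form is even in characteristic different from `2`. -/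
theorem even_finrank_sub_finrank_ker {U : Type*} [AddCommGroup U] [Module K U]
    [FiniteDimensional K U] (h2 : (2 : K) ≠ 0) (B : LinearMap.BilinForm K U)
    (hB : ∀ x y, B x y = -B y x) :
    Even (Module.finrank K U - Module.finrank K (LinearMap.ker B)) := by
  classical
  obtain ⟨C, hC⟩ := (LinearMap.ker B).exists_isCompl
  have hdim := Submodule.finrank_add_eq_of_isCompl hC
  have : Module.finrank K U - Module.finrank K (LinearMap.ker B) = Module.finrank K C := by omega
  rw [this]
  -- The form descends to a nondegenerate one on any complement of its kernel.
  have hnd : (B.restrict C).Nondegenerate := by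
    rw [LinearMap.BilinForm.nondegenerate_iff_ker_eq_bot, LinearMap.ker_eq_bot']
    intro c hc
    have : (c : U) ∈ LinearMap.ker B := by
      rw [LinearMap.mem_ker]
      ext y
      obtain ⟨a, ha, d, hd, rfl⟩ := Submodule.mem_sup.1
        (show y ∈ LinearMap.ker B ⊔ C from hC.sup_eq_top ▸ Submodule.mem_top)
      rw [map_add, hB c a, LinearMap.mem_ker.1 ha]
      have := LinearMap.congr_fun hc ⟨d, hd⟩
      simpa using this
    exact Subtype.ext (Submodule.disjoint_def.1 hC.disjoint _ this c.2)
  let b := Module.finBasis K C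
  have hdet := (LinearMap.BilinForm.nondegenerate_iff_det_ne_zero b).1 hnd
  set M := LinearMap.BilinForm.toMatrix b (B.restrict C)
  have hskew : M.transpose = -M := by
    ext i j
    simp only [M, Matrix.transpose_apply, Matrix.neg_apply, LinearMap.BilinForm.toMatrix_apply]
    exact hB _ _
  -- A skew matrix of odd size has determinant equal to its own negative, hence zero as 2 ≠ 0.
  have h1 : M.det = (-1) ^ Module.finrank K C * M.det := by
    conv_lhs => rw [← Matrix.det_transpose, hskew, Matrix.det_neg, Fintype.card_fin]
  by_contra hodd
  rw [Nat.not_even_iff_odd] at hodd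
  rw [hodd.neg_one_pow] at h1
  have : (2 : K) * M.det = 0 := by linear_combination h1
  exact (mul_ne_zero h2 hdet) this

end Field

/-! ### Localization and gluing of submodules of free modules -/

section Localization

variable {Q : Type} [Fintype Q] [DecidableEq Q] {R : Type*} [CommRing R]

theorem mem_extend_of_isUnit {S : Type*} [CommRing S] (φ : R →+* S) {N : Submodule R (Q → R)}
    {v : Q → R} {a : R} (ha : IsUnit (φ a)) (h : a • v ∈ N) :
    (fun q => φ (v q)) ∈ extend φ N := by
  have := Submodule.smul_mem _ (↑ha.unit⁻¹ : S) (mem_extend φ h)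
  convert this using 1
  ext q
  simp [← mul_assoc]

/-- Elements of the extension of a submodule to a localization. -/
theorem exists_smul_mem_of_mem_extend {S : Type*} [CommRing S] [Algebra R S] (M : Submonoid R)
    [IsLocalization M S] {N : Submodule R (Q → R)} {w : Q → S}
    (hw : w ∈ extend (algebraMap R S) N) :
    ∃ a ∈ M, ∃ v ∈ N, algebraMap R S a • w = fun q => algebraMap R S (v q) := by
  induction hw using Submodule.span_induction with
  | mem w h =>
    obtain ⟨v, hv, rfl⟩ := h
    exact ⟨1, M.one_mem, v, hv, by simp⟩
  | zero => exact ⟨1, M.one_mem, 0, N.zero_mem, by ext; simp⟩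
  | add w w' _ _ h h' =>
    obtain ⟨a, ha, v, hv, e⟩ := h
    obtain ⟨a', ha', v', hv', e'⟩ := h'
    refine ⟨a * a', M.mul_mem ha ha', a' • v + a • v',
      N.add_mem (N.smul_mem _ hv) (N.smul_mem _ hv'), ?_⟩
    ext q
    have h1 := congrFun e q
    have h2 := congrFun e' q
    simp only [Pi.smul_apply, smul_eq_mul, Pi.add_apply, map_add, map_mul] at *
    linear_combination algebraMap R S a' * h1 + algebraMap R S a * h2
  | smul c w _ h =>
    obtain ⟨a, ha, v, hv, e⟩ := h
    obtain ⟨⟨r, t⟩, hrt⟩ := IsLocalization.surj M c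
    refine ⟨a * t, M.mul_mem ha t.2, r • v, N.smul_mem _ hv, ?_⟩
    ext q
    have h1 := congrFun e q
    simp only [Pi.smul_apply, smul_eq_mul, map_mul] at *
    linear_combination (algebraMap R S r) * h1 + algebraMap R S a * w q * hrt

theorem mem_extend_iff {S : Type*} [CommRing S] [Algebra R S] (M : Submonoid R)
    [IsLocalization M S] {N : Submodule R (Q → R)} {v : Q → R} :
    (fun q => algebraMap R S (v q)) ∈ extend (algebraMap R S) N ↔ ∃ a ∈ M, a • v ∈ N := by
  constructor
  · intro h
    obtain ⟨a, ha, w, hw, e⟩ := exists_smul_mem_of_mem_extend M h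
    have : ∀ q, ∃ c : M, c * (a * v q) = c * w q := fun q => by
      have := congrFun e q
      simp only [Pi.smul_apply, smul_eq_mul, ← map_mul] at this
      exact (IsLocalization.eq_iff_exists M S).1 this
    choose c hc using this
    -- There are finitely many coordinates, so the product of their denominators works for all of
    -- them.
    refine ⟨(∏ q, (c q : R)) * a, M.mul_mem (prod_mem fun q _ => (c q).2) ha, ?_⟩
    convert N.smul_mem (∏ q, (c q : R)) hw using 1
    ext q
    simp only [Pi.smul_apply, smul_eq_mul]
    rw [← Finset.mul_prod_erase _ _ (Finset.mem_univ q)]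
    linear_combination (∏ x ∈ Finset.univ.erase q, (c x : R)) * hc q
  · rintro ⟨a, ha, h⟩
    exact mem_extend_of_isUnit _ (IsLocalization.map_units S ⟨a, ha⟩) h

/-- The ideal of elements which multiply a vector into a submodule. -/
def multiplierIdeal (N : Submodule R (Q → R)) (v : Q → R) : Ideal R where
  carrier := {a | a • v ∈ N}
  add_mem' ha hb := by simpa [add_smul] using N.add_mem ha hb
  zero_mem' := by simp
  smul_mem' c a ha := by simpa [mul_smul] using N.smul_mem c ha

/-- The radical of the multiplier ideal is the intersection of the primes containing it. So
membership of `v` in N at every prime of the basic open set of `f` is witnessed by one power of `f`.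
-/
theorem exists_pow_smul_mem {N : Submodule R (Q → R)} {v : Q → R} {f : R}
    (h : ∀ p : PrimeSpectrum R, f ∉ p.asIdeal → ∃ a ∉ p.asIdeal, a • v ∈ N) :
    ∃ e : ℕ, f ^ e • v ∈ N := by
  have : f ∈ (multiplierIdeal N v).radical := by
    rw [Ideal.radical_eq_sInf, Ideal.mem_sInf]
    rintro p ⟨hle, hp⟩
    by_contra hf
    obtain ⟨a, ha, hav⟩ := h ⟨p, hp⟩ hf
    exact ha (hle hav)
  exact this

variable (L : PrimeSpectrum R → Type*) [∀ p, CommRing (L p)] [∀ p, Algebra R (L p)]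
  [∀ p, IsLocalization.AtPrime (L p) p.asIdeal]

theorem extend_le_of_stalks {S : Type*} [CommRing S] [Algebra R S] (f : R)
    [IsLocalization.Away f S] {N N' : Submodule R (Q → R)}
    (h : ∀ p : PrimeSpectrum R, f ∉ p.asIdeal →
      extend (algebraMap R (L p)) N ≤ extend (algebraMap R (L p)) N') :
    extend (algebraMap R S) N ≤ extend (algebraMap R S) N' := by
  refine (extend_le _).2 fun v hv => ?_
  obtain ⟨e, he⟩ := exists_pow_smul_mem (N := N') (v := v) (f := f) fun p hp =>
    (mem_extend_iff p.asIdeal.primeCompl).1 (h p hp (mem_extend (algebraMap R (L p)) hv))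
  exact (mem_extend_iff (Submonoid.powers f)).2 ⟨_, ⟨e, rfl⟩, he⟩

theorem le_of_stalks {N N' : Submodule R (Q → R)}
    (h : ∀ p : PrimeSpectrum R, extend (algebraMap R (L p)) N ≤ extend (algebraMap R (L p)) N') :
    N ≤ N' := by
  intro v hv
  obtain ⟨e, he⟩ := exists_pow_smul_mem (N := N') (v := v) (f := 1) fun p hp =>
    (mem_extend_iff p.asIdeal.primeCompl).1 (h p (mem_extend (algebraMap R (L p)) hv))
  simpa using he

theorem eq_of_stalks {N N' : Submodule R (Q → R)}
    (h : ∀ p : PrimeSpectrum R, extend (algebraMap R (L p)) N = extend (algebraMap R (L p)) N') :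
    N = N' :=
  le_antisymm (le_of_stalks L fun p => (h p).le) (le_of_stalks L fun p => (h p).ge)

/-- N is the module of all vectors whose images lie in every ξ p. That it generates ξ p is a matter
of quasi-compactness: finitely many of the given basic open sets cover the spectrum, and a power of
`f p` clears denominators on each of them. -/
theorem exists_glue (ξ : ∀ p, Submodule (L p) (Q → L p))
    (h : ∀ p : PrimeSpectrum R, ∃ f ∉ p.asIdeal, ∃ N : Submodule R (Q → R),
      ∀ p' : PrimeSpectrum R, f ∉ p'.asIdeal → extend (algebraMap R (L p')) N = ξ p') :
    ∃ N : Submodule R (Q → R), ∀ p, extend (algebraMap R (L p)) N = ξ p := by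
  classical
  choose f hf N' hN' using h
  let N : Submodule R (Q → R) :=
    { carrier := {v | ∀ p, (fun q => algebraMap R (L p) (v q)) ∈ ξ p}
      add_mem' := fun hv hw p => by
        convert (ξ p).add_mem (hv p) (hw p) using 1; ext q; simp
      zero_mem' := fun p => by convert (ξ p).zero_mem using 1; ext q; simp
      smul_mem' := fun c v hv p => by
        convert (ξ p).smul_mem (algebraMap R (L p) c) (hv p) using 1; ext q; simp }
  have hspan : Ideal.span (Set.range f) = ⊤ := by
    by_contra hne
    obtain ⟨I, hI, hle⟩ := Ideal.exists_le_maximal _ hne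
    exact hf ⟨I, hI.isPrime⟩ (hle (Ideal.subset_span ⟨_, rfl⟩))
  obtain ⟨t, ht, ht1⟩ := (Ideal.span_eq_top_iff_finite _).1 hspan
  have ht2 : ∀ p : PrimeSpectrum R, ∃ g ∈ t, g ∉ p.asIdeal := fun p => by
    by_contra! hle
    exact p.2.ne_top (top_le_iff.1 (ht1 ▸ Ideal.span_le.2 hle))
  refine ⟨N, fun p => le_antisymm ((extend_le _).2 fun v hv => hv p) ?_⟩
  rw [← hN' p p (hf p), extend_le]
  intro v hv
  have key : ∀ g ∈ t, ∃ e : ℕ, ∀ p' : PrimeSpectrum R, g ∉ p'.asIdeal →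
      (fun q => algebraMap R (L p') ((f p ^ e • v) q)) ∈ ξ p' := by
    intro g hg
    obtain ⟨j, rfl⟩ := ht hg
    obtain ⟨e, he⟩ := exists_pow_smul_mem (N := N' j) (v := v) (f := f p * f j) fun p' hp' => by
      have h1 : f p ∉ p'.asIdeal := fun h => hp' (p'.asIdeal.mul_mem_right _ h)
      have h2 : f j ∉ p'.asIdeal := fun h => hp' (p'.asIdeal.mul_mem_left _ h)
      refine (mem_extend_iff (S := L p') p'.asIdeal.primeCompl).1 ?_
      rw [hN' j p' h2, ← hN' p p' h1]
      exact mem_extend _ hv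
    refine ⟨e, fun p' hp' => ?_⟩
    rw [← hN' j p' hp']
    refine (mem_extend_iff p'.asIdeal.primeCompl).2 ⟨f j ^ e, Submonoid.pow_mem _ hp' e, ?_⟩
    rwa [smul_smul, mul_comm, ← mul_pow]
  choose! e he using key
  -- The sum of the exponents over the finite cover dominates each of them, so one multiplier serves
  -- at all primes.
  refine (mem_extend_iff p.asIdeal.primeCompl).2
    ⟨f p ^ (∑ g ∈ t, e g), Submonoid.pow_mem _ (hf p) _, fun p' => ?_⟩
  obtain ⟨g, hg, hgp⟩ := ht2 p'
  convert (ξ p').smul_mem (algebraMap R (L p') (f p ^ (∑ g ∈ t.erase g, e g))) (he g hg p' hgp)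
    using 1
  ext q
  rw [← Finset.add_sum_erase _ _ hg, pow_add]
  simp only [Pi.smul_apply, smul_eq_mul, map_mul]
  ring

end Localization

/-! ### Submodules which are locally graphs -/

section LocGraph

variable {Q : Type} [Fintype Q] [DecidableEq Q]

/-- A submodule of `R^Q` is locally a graph of rank `c` if it has a chart, locally on `Spec R`. -/
def IsLocGraph {R : Type*} [CommRing R] (c : ℕ) (N : Submodule R (Q → R)) : Prop :=
  ∀ p : PrimeSpectrum R, ∃ f ∉ p.asIdeal, ∃ P : Finset Q, P.card = c ∧
    ∃ b, extend (algebraMap R (Localization.Away f)) N = graph P b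

variable {R : Type*} [CommRing R]

theorem isLocGraph_graph (P : Finset Q) (b : Q → Q → R) : IsLocGraph P.card (graph P b) :=
  fun p => ⟨1, fun h => p.2.ne_top ((Ideal.eq_top_iff_one _).2 h), P, rfl, _, extend_graph _ _ _⟩

theorem IsLocGraph.exists_chart_of_isUnit {c : ℕ} {N : Submodule R (Q → R)} (h : IsLocGraph c N)
    (p : PrimeSpectrum R) {S : Type*} [CommRing S] (φ : R →+* S)
    (hφ : ∀ a ∉ p.asIdeal, IsUnit (φ a)) :
    ∃ P : Finset Q, P.card = c ∧ ∃ b, extend φ N = graph P b := by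
  obtain ⟨f, hf, P, hP, b, hb⟩ := h p
  refine ⟨P, hP, fun p q => IsLocalization.Away.lift f (hφ f hf) (b p q), ?_⟩
  have e : (IsLocalization.Away.lift f (hφ f hf)).comp
      (algebraMap R (Localization.Away f)) = φ := IsLocalization.Away.lift_comp f _
  rw [← extend_graph, ← hb, extend_extend, e]

theorem IsLocGraph.exists_chart {c : ℕ} {N : Submodule R (Q → R)} (h : IsLocGraph c N)
    {K : Type*} [Field K] (φ : R →+* K) :
    ∃ P : Finset Q, P.card = c ∧ ∃ b, extend φ N = graph P b :=
  h.exists_chart_of_isUnit ⟨RingHom.ker φ, RingHom.ker_isPrime φ⟩ φ fun _ ha =>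
    isUnit_iff_ne_zero.2 ha

theorem IsLocGraph.finrank {c : ℕ} {N : Submodule R (Q → R)} (h : IsLocGraph c N)
    {K : Type*} [Field K] (φ : R →+* K) : Module.finrank K (extend φ N) = c := by
  obtain ⟨P, hP, b, hb⟩ := h.exists_chart φ
  rw [hb, finrank_graph, hP]

/-- A chart at a field-valued point extends to a neighbourhood. -/
theorem IsLocGraph.exists_extend_eq_graph {c : ℕ} {N : Submodule R (Q → R)} (h : IsLocGraph c N)
    {K : Type*} [Field K] (φ : R →+* K) {P : Finset Q} {b₀ : Q → Q → K}
    (hb₀ : extend φ N = graph P b₀) :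
    ∃ f, φ f ≠ 0 ∧ ∃ b, extend (algebraMap R (Localization.Away f)) N = graph P b := by
  obtain ⟨f, hf, P', hP', b, hb⟩ := h ⟨RingHom.ker φ, RingHom.ker_isPrime φ⟩
  have hf : φ f ≠ 0 := hf
  have hcard : P'.card = P.card := by
    rw [hP', ← h.finrank φ, hb₀, finrank_graph]
  let e : P' ≃ P := Finset.equivOfCardEq hcard
  set ψ : Localization.Away f →+* K :=
    IsLocalization.Away.lift f (isUnit_iff_ne_zero.2 hf) with hψ
  have hψφ : ψ.comp (algebraMap R _) = φ := IsLocalization.Away.lift_comp f _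
  set d := ((minor P' P b).submatrix id e).det with hd
  have hψd : ψ d ≠ 0 := by
    have : ∃ b', graph P' (fun p q => ψ (b p q)) = graph P b' :=
      ⟨b₀, by rw [← extend_graph, ← hb, extend_extend, hψφ, hb₀]⟩
    rw [exists_eq_graph_iff e] at this
    have hdet : ((minor P' P fun p q => ψ (b p q)).submatrix id e).det = ψ d := by
      rw [hd, RingHom.map_det]
      congr 1
      ext p q
      simp only [minor, graphRow, RingHom.mapMatrix_apply, Matrix.map_apply, Matrix.submatrix_apply,
        id, apply_ite ψ, map_one, map_zero]
    rw [← hdet]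
    exact this.ne_zero
  -- The minor `d` passing from the known chart P' to P lives over the localization at `f`;
  -- inverting `d` there amounts to inverting its numerator `a` in R.
  obtain ⟨a, ⟨_, n, rfl⟩, hda⟩ : ∃ a : R, ∃ s : Submonoid.powers f,
      d * algebraMap R _ s.1 = algebraMap R _ a := by
    obtain ⟨⟨a, s⟩, h⟩ := IsLocalization.surj (Submonoid.powers f) d
    exact ⟨a, s, h⟩
  refine ⟨f * a, ?_, ?_⟩
  · rw [map_mul]
    refine mul_ne_zero hf ?_
    rw [← hψφ, RingHom.comp_apply, ← hda, map_mul]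
    refine mul_ne_zero hψd ?_
    rw [← RingHom.comp_apply, hψφ]
    simpa using pow_ne_zero n hf
  · have hu : IsUnit (algebraMap R (Localization.Away (f * a)) (f * a)) :=
      IsLocalization.Away.algebraMap_isUnit _
    rw [map_mul] at hu
    set χ : Localization.Away f →+* Localization.Away (f * a) :=
      IsLocalization.Away.lift f (isUnit_of_mul_isUnit_left hu)
    have hχ : χ.comp (algebraMap R _) = algebraMap R _ := IsLocalization.Away.lift_comp f _
    have hb' : extend (algebraMap R (Localization.Away (f * a))) N =
        graph P' fun p q => χ (b p q) := by rw [← hχ, ← extend_extend, hb, extend_graph]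
    rw [hb']
    refine (exists_eq_graph_iff e _).2 ?_
    have hχd : IsUnit (χ d) := by
      refine isUnit_of_mul_isUnit_left (y := χ (algebraMap R _ (f ^ n))) ?_
      rw [← map_mul, hda, ← RingHom.comp_apply, hχ]
      exact isUnit_of_mul_isUnit_right hu
    have hdet : ((minor P' P fun p q => χ (b p q)).submatrix id e).det = χ d := by
      rw [hd, RingHom.map_det]
      congr 1
      ext p q
      simp only [minor, graphRow, RingHom.mapMatrix_apply, Matrix.map_apply, Matrix.submatrix_apply,
        id, apply_ite χ, map_one, map_zero]
    rw [hdet]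
    exact hχd

end LocGraph

/-! ### Points of Grassmannians as submodules of `R^Q` which are locally graphs -/

section GraphQuotient

variable {Q : Type} [Fintype Q] [DecidableEq Q] {R : Type*} [CommRing R]

/-- The equations of a graph. -/
def graphEquations (P : Finset Q) (b : Q → Q → R) : (Q → R) →ₗ[R] ({q // q ∉ P} → R) where
  toFun v q := v q - ∑ p ∈ P, v p * b p q
  map_add' v w := by
    ext q
    simp only [Pi.add_apply, add_mul, Finset.sum_add_distrib]
    ring
  map_smul' c v := by
    ext q
    simp only [Pi.smul_apply, smul_eq_mul, mul_assoc, ← Finset.mul_sum, RingHom.id_apply, mul_sub]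

theorem ker_graphEquations (P : Finset Q) (b : Q → Q → R) :
    LinearMap.ker (graphEquations P b) = graph P b := by
  ext v
  rw [LinearMap.mem_ker, mem_graph, funext_iff]
  simp only [graphEquations, LinearMap.coe_mk, AddHom.coe_mk, Pi.zero_apply, sub_eq_zero,
    Subtype.forall]

theorem graphEquations_surjective (P : Finset Q) (b : Q → Q → R) :
    Function.Surjective (graphEquations P b) := by
  intro w
  refine ⟨fun q => if h : q ∈ P then 0 else w ⟨q, h⟩, ?_⟩
  ext q
  simp only [graphEquations, LinearMap.coe_mk, AddHom.coe_mk, q.2, dite_false, sub_eq_self]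
  exact Finset.sum_eq_zero fun p hp => by simp [hp]

/-- The quotient by a graph is free. -/
def quotientGraphEquiv (P : Finset Q) (b : Q → Q → R) :
    ((Q → R) ⧸ graph P b) ≃ₗ[R] ({q // q ∉ P} → R) :=
  (Submodule.quotEquivOfEq _ _ (ker_graphEquations P b).symm).trans
    ((graphEquations P b).quotKerEquivOfSurjective (graphEquations_surjective P b))

/-- Nested submodules with finite projective quotients of the same rank are equal. -/
theorem eq_of_le_of_rankAtStalk_eq {V : Type*} [AddCommGroup V] [Module R V] {N N' : Submodule R V}
    (h : N' ≤ N) [Module.Finite R (V ⧸ N')] [Module.Projective R (V ⧸ N')]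
    [Module.Projective R (V ⧸ N)]
    (hr : Module.rankAtStalk (R := R) (V ⧸ N') = Module.rankAtStalk (V ⧸ N)) : N' = N := by
  let f : (V ⧸ N') →ₗ[R] V ⧸ N := Submodule.factor h
  have hf : Function.Surjective f := Submodule.factor_surjective h
  have : Module.Finite R (V ⧸ N) := Module.Finite.of_surjective f hf
  obtain ⟨g, hg⟩ := Module.projective_lifting_property f .id hf
  have hg' : ∀ x, f (g x) = x := fun x => LinearMap.congr_fun hg x
  -- The surjection of quotients splits as its target is projective. Its kernel is then finite
  -- projective of rank 0, hence zero.
  let e : (V ⧸ N') ≃ₗ[R] LinearMap.ker f × (V ⧸ N) :=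
    { toFun := fun x => (⟨x - g (f x), by simp [hg']⟩, f x)
      map_add' := fun x y => Prod.ext (Subtype.ext (by simp; abel)) (map_add f x y)
      map_smul' := fun c x => Prod.ext (Subtype.ext (by simp [smul_sub])) (map_smul f c x)
      invFun := fun z => z.1 + g z.2
      left_inv := fun x => by simp
      right_inv := fun z => by
        have : f z.1 = 0 := z.1.2
        refine Prod.ext (Subtype.ext ?_) ?_ <;> simp [hg', this] }
  have hker : Module.Finite R (LinearMap.ker f) :=
    Module.Finite.of_surjective ((LinearMap.fst R _ _) ∘ₗ e.toLinearMap)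
      (Prod.fst_surjective.comp e.surjective)
  have hproj : Module.Projective R (LinearMap.ker f) :=
    Module.Projective.of_split (e.symm.toLinearMap ∘ₗ LinearMap.inl R _ _)
      ((LinearMap.fst R _ _) ∘ₗ e.toLinearMap) (by ext x; simp)
  have h0 : Module.rankAtStalk (R := R) (LinearMap.ker f) = 0 := by
    have := Module.rankAtStalk_eq_of_equiv e
    rw [Module.rankAtStalk_prod, hr] at this
    simpa using this
  have := Module.rankAtStalk_eq_zero_iff_subsingleton.1 h0
  refine le_antisymm h fun v hv => ?_
  have hx : Submodule.Quotient.mk v ∈ LinearMap.ker f := by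
    change f (Submodule.Quotient.mk v) = 0
    exact (Submodule.Quotient.mk_eq_zero N).2 hv
  have := Subsingleton.elim (⟨_, hx⟩ : LinearMap.ker f) 0
  exact (Submodule.Quotient.mk_eq_zero N').1 (congrArg Subtype.val this)

theorem graph_le_extend_away {N : Submodule R (Q → R)} {P : Finset Q} {f : R} (n : Q → Q → R)
    (hn : ∀ p, n p ∈ N) (hn' : ∀ p ∈ P, ∀ q ∈ P, n p q = if q = p then f else 0) :
    graph P (fun p q => IsLocalization.Away.invSelf f * algebraMap R _ (n p q)) ≤
      extend (algebraMap R (Localization.Away f)) N := by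
  rw [graph_le_iff]
  intro p hp
  convert Submodule.smul_mem _ (IsLocalization.Away.invSelf (S := Localization.Away f) f)
    (mem_extend (algebraMap R (Localization.Away f)) (hn p)) using 1
  ext q
  by_cases hq : q ∈ P
  · rw [graphRow_self _ _ hq, Pi.smul_apply, hn' p hp q hq]
    split_ifs
    · rw [smul_eq_mul, mul_comm, IsLocalization.Away.mul_invSelf]
    · simp
  · rw [graphRow_of_notMem _ _ hq]
    rfl

instance {S : Type*} [CommRing S] [Algebra R S] (M : Submonoid R) [IsLocalization M S] :
    IsLocalizedModule M ((Algebra.linearMap R S).compLeft Q) :=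
  inferInstanceAs (IsLocalizedModule M
    (LinearMap.pi fun i : Q => Algebra.linearMap R S ∘ₗ LinearMap.proj i))

theorem extend_eq_localized' {S : Type*} [CommRing S] [Algebra R S] (M : Submonoid R)
    [IsLocalization M S] (N : Submodule R (Q → R)) :
    extend (algebraMap R S) N = N.localized' S M ((Algebra.linearMap R S).compLeft Q) := by
  rw [Submodule.localized'_eq_span]
  rfl

theorem IsLocGraph.finitePresentation {c : ℕ} {N : Submodule R (Q → R)} (h : IsLocGraph c N) :
    Module.FinitePresentation R ((Q → R) ⧸ N) := by
  choose f hf P hP b hb using h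
  have hspan : Ideal.span (Set.range f) = ⊤ := by
    by_contra hne
    obtain ⟨I, hI, hle⟩ := Ideal.exists_le_maximal _ hne
    exact hf ⟨I, hI.isPrime⟩ (hle (Ideal.subset_span ⟨_, rfl⟩))
  refine Module.FinitePresentation.of_localizationSpan' (Set.range f) hspan
    (Rₚ := fun g => Localization.Away g.1)
    (fun g => N.toLocalizedQuotient' (Localization.Away g.1) (Submonoid.powers g.1)
      ((Algebra.linearMap R (Localization.Away g.1)).compLeft Q)) ?_
  rintro ⟨_, p, rfl⟩
  have e := (extend_eq_localized' (S := Localization.Away (f p)) (Submonoid.powers (f p)) N).symm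
  rw [hb] at e
  have := Module.FinitePresentation.of_equiv (quotientGraphEquiv (P p) (b p)).symm
  exact Module.FinitePresentation.of_equiv (Submodule.quotEquivOfEq _ _ e).symm

theorem IsLocGraph.free_localized {c : ℕ} {N : Submodule R (Q → R)} (h : IsLocGraph c N)
    (p : PrimeSpectrum R) : Nonempty (Σ' P : Finset Q, Σ' _ : P.card = c,
      ((Q → Localization.AtPrime p.asIdeal) ⧸ N.localized' (Localization.AtPrime p.asIdeal)
        p.asIdeal.primeCompl
        ((Algebra.linearMap R (Localization.AtPrime p.asIdeal)).compLeft Q)) ≃ₗ[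
        Localization.AtPrime p.asIdeal] ({q // q ∉ P} → Localization.AtPrime p.asIdeal)) := by
  obtain ⟨P, hP, b, hb⟩ := h.exists_chart_of_isUnit p
    (algebraMap R (Localization.AtPrime p.asIdeal))
    (fun a ha => IsLocalization.map_units _ (⟨a, ha⟩ : p.asIdeal.primeCompl))
  rw [extend_eq_localized' p.asIdeal.primeCompl] at hb
  exact ⟨⟨P, hP, (Submodule.quotEquivOfEq _ _ hb).trans (quotientGraphEquiv P b)⟩⟩

/-- A finitely presented module with free stalks is projective, and over a chart the quotient is
free on the coordinates outside P. -/
theorem IsLocGraph.projective {c : ℕ} {N : Submodule R (Q → R)} (h : IsLocGraph c N) :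
    Module.Projective R ((Q → R) ⧸ N) := by
  have := h.finitePresentation
  rw [← Module.freeLocus_eq_univ_iff, Set.eq_univ_iff_forall]
  intro p
  rw [Module.mem_freeLocus_of_isLocalization p (Localization.AtPrime p.asIdeal) _
    (N.toLocalizedQuotient' (Localization.AtPrime p.asIdeal) p.asIdeal.primeCompl
      ((Algebra.linearMap R (Localization.AtPrime p.asIdeal)).compLeft Q))]
  obtain ⟨P, _, e⟩ := h.free_localized p
  exact Module.Free.of_equiv e.symm

theorem IsLocGraph.rankAtStalk {c : ℕ} {N : Submodule R (Q → R)} (h : IsLocGraph c N)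
    (p : PrimeSpectrum R) :
    Module.rankAtStalk (R := R) ((Q → R) ⧸ N) p = Fintype.card Q - c := by
  obtain ⟨P, hP, e⟩ := h.free_localized p
  have e' := (IsLocalizedModule.linearEquiv p.asIdeal.primeCompl
    (LocalizedModule.mkLinearMap p.asIdeal.primeCompl ((Q → R) ⧸ N))
    (N.toLocalizedQuotient' (Localization.AtPrime p.asIdeal) p.asIdeal.primeCompl
      ((Algebra.linearMap R (Localization.AtPrime p.asIdeal)).compLeft Q))).extendScalarsOfIsLocalization p.asIdeal.primeCompl
      (Localization.AtPrime p.asIdeal)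
  rw [Module.rankAtStalk, (e'.trans e).finrank_eq]
  simp [Fintype.card_subtype_compl, hP]

end GraphQuotient

/-! ### Points of Grassmannians of a base-changed free module in coordinates -/

section Coordinates

variable {O L : Type u} [CommRing O] [AddCommGroup L] [Module O L] {Q : Type} [Fintype Q]
  [DecidableEq Q] (B : Module.Basis Q O L) {k : ℕ}
variable {A A' : Type u} [CommRing A] [Algebra O A] [CommRing A'] [Algebra O A']

variable (A) in
/-- The coordinates on the base change of a free module. -/
def coordEquiv : A ⊗[O] L ≃ₗ[A] (Q → A) := (Algebra.TensorProduct.basis A B).equivFun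

theorem coordEquiv_tmul (a : A) (l : L) (q : Q) :
    coordEquiv B A (a ⊗ₜ l) q = a * algebraMap O A (B.repr l q) := by
  simp [coordEquiv, Algebra.TensorProduct.basis_repr_tmul]

theorem coordEquiv_rTensor (f : A →ₐ[O] A') (x : A ⊗[O] L) :
    coordEquiv B A' (f.toLinearMap.rTensor L x) = fun q => f (coordEquiv B A x q) := by
  induction x with
  | zero => ext; simp
  | add x y hx hy => ext q; simp [hx, hy]
  | tmul a l => ext q; simp [coordEquiv_tmul]

variable (A) in
/-- Submodules of `A ⊗ L` in coordinates. -/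
def coordSubmodule : Submodule A (A ⊗[O] L) ≃o Submodule A (Q → A) :=
  Submodule.orderIsoMapComap (coordEquiv B A)

theorem coordSubmodule_apply (N : Submodule A (A ⊗[O] L)) :
    coordSubmodule B A N = N.map (coordEquiv B A).toLinearMap := rfl

theorem coordSubmodule_map (f : A →ₐ[O] A') (N : Module.Grassmannian A (A ⊗[O] L) k) :
    coordSubmodule B A' (Module.Grassmannian.map f N).toSubmodule =
      extend (f : A →+* A') (coordSubmodule B A N.toSubmodule) := by
  rw [grassmannian_map_eq_span, coordSubmodule_apply, Submodule.map_span, extend]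
  congr 1
  ext v
  constructor
  · rintro ⟨_, ⟨x, hx, rfl⟩, rfl⟩
    exact ⟨_, ⟨x, hx, rfl⟩, (coordEquiv_rTensor B f x).symm⟩
  · rintro ⟨_, ⟨x, hx, rfl⟩, rfl⟩
    exact ⟨_, ⟨x, hx, rfl⟩, coordEquiv_rTensor B f x⟩

variable (A) in
/-- Quotients in coordinates. -/
def coordQuotient (N : Submodule A (A ⊗[O] L)) :
    ((A ⊗[O] L) ⧸ N) ≃ₗ[A] (Q → A) ⧸ coordSubmodule B A N :=
  Submodule.Quotient.equiv _ _ (coordEquiv B A) rfl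

/-- A chart of the fiber at `p` yields elements of N which are normalized after inverting some `f`.
Their graph is contained in the localization of N, and the two quotients are projective of equal
rank, so `eq_of_le_of_rankAtStalk_eq` forces equality. -/
theorem isLocGraph_coordSubmodule (N : Module.Grassmannian A (A ⊗[O] L) k) :
    IsLocGraph (Fintype.card Q - k) (coordSubmodule B A N.toSubmodule) := by
  intro p
  let φ : A →ₐ[O] p.asIdeal.ResidueField := IsScalarTower.toAlgHom O A _
  let NK := Module.Grassmannian.map φ N
  have hNK := coordSubmodule_map B φ N
  have hrank : Module.finrank p.asIdeal.ResidueField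
      (coordSubmodule B _ NK.toSubmodule) = Fintype.card Q - k := by
    have h1 := NK.rankAtStalk_eq ⊥
    rw [Module.rankAtStalk_eq_finrank_of_free, Pi.natCast_apply,
      (coordQuotient B _ NK.toSubmodule).finrank_eq] at h1
    have h2 := Submodule.finrank_quotient_add_finrank (coordSubmodule B _ NK.toSubmodule)
    rw [Module.finrank_fintype_fun_eq_card] at h2
    simp only [Nat.cast_id] at h1
    omega
  obtain ⟨P, -, hP, b, hb⟩ := exists_finset_eq_graph (coordSubmodule B _ NK.toSubmodule)
    Finset.univ fun u _ h => funext fun q => h q (Finset.mem_univ q)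
  rw [hrank] at hP
  rw [hNK] at hb
  obtain ⟨f, hf, n, hn, hn'⟩ := exists_normalized_of_extend _ hb
  refine ⟨f, ?_, P, hP, fun p q => IsLocalization.Away.invSelf f * algebraMap A _ (n p q), ?_⟩
  · intro hfp
    exact hf ((Ideal.algebraMap_residueField_eq_zero).2 hfp)
  · let χ : A →ₐ[O] Localization.Away f := IsScalarTower.toAlgHom O A _
    let Nf := Module.Grassmannian.map χ N
    have hNf := coordSubmodule_map B χ N
    replace hNf : coordSubmodule B _ Nf.toSubmodule =
      extend (algebraMap A (Localization.Away f)) (coordSubmodule B A N.toSubmodule) := hNf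
    rw [← hNf]
    symm
    have e1 := quotientGraphEquiv P fun p q =>
      IsLocalization.Away.invSelf (S := Localization.Away f) f * algebraMap A _ (n p q)
    have e2 := coordQuotient B _ Nf.toSubmodule
    have := Module.Finite.equiv e1.symm
    have := Module.Projective.of_equiv e1.symm
    have := Module.Projective.of_equiv e2
    refine eq_of_le_of_rankAtStalk_eq ?_ ?_
    · rw [hNf]
      exact graph_le_extend_away n hn hn'
    · rw [Module.rankAtStalk_eq_of_equiv e1, ← Module.rankAtStalk_eq_of_equiv e2]
      ext p'
      have hnt : Nontrivial (Localization.Away f) := p'.nontrivial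
      -- The truncated subtraction `card Q - (card Q - k)` equals `k` only under this bound, which
      -- is read off at the residue field.
      have hk : k ≤ Fintype.card Q := by
        have h1 := NK.rankAtStalk_eq ⊥
        rw [Module.rankAtStalk_eq_finrank_of_free, Pi.natCast_apply,
          (coordQuotient B _ NK.toSubmodule).finrank_eq] at h1
        have h2 := Submodule.finrank_quotient_add_finrank (coordSubmodule B _ NK.toSubmodule)
        rw [Module.finrank_fintype_fun_eq_card] at h2
        simp only [Nat.cast_id] at h1
        omega
      rw [Nf.rankAtStalk_eq]
      simp [Fintype.card_subtype_compl, hP]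
      omega

/-- A point of the Grassmannian from a submodule of `A^Q` which is locally a graph. -/
def grassmannianOfCoord {c : ℕ} {N : Submodule A (Q → A)} (h : IsLocGraph c N)
    (hk : Fintype.card Q - c = k) : Module.Grassmannian A (A ⊗[O] L) k :=
  have e : ((Q → A) ⧸ N) ≃ₗ[A] (A ⊗[O] L) ⧸ (coordSubmodule B A).symm N :=
    ((coordQuotient B A ((coordSubmodule B A).symm N)).trans
      (Submodule.quotEquivOfEq _ _ ((coordSubmodule B A).apply_symm_apply N))).symm
  { toSubmodule := (coordSubmodule B A).symm N
    finite_quotient := Module.Finite.equiv e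
    projective_quotient := have := h.projective; Module.Projective.of_equiv e
    rankAtStalk_eq := fun p => by
      rw [← Module.rankAtStalk_eq_of_equiv e, h.rankAtStalk, hk] }

@[simp] theorem coordSubmodule_grassmannianOfCoord {c : ℕ} {N : Submodule A (Q → A)}
    (h : IsLocGraph c N) (hk : Fintype.card Q - c = k) :
    coordSubmodule B A (grassmannianOfCoord B h hk).toSubmodule = N :=
  (coordSubmodule B A).apply_symm_apply N

end Coordinates

/-! ### The splitting model in coordinates -/

section Concrete

variable {m : ℕ} {R : Type*} [CommRing R]

/-- The index set of the coordinates of `Λ_m ⊗ R`. -/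
abbrev Ind (m : ℕ) : Type := Fin (2 * m) ⊕ Fin (2 * m)

/-- The signs in the symplectic form. -/
def sgn (i : Fin (2 * m)) : ℤ := if (i : ℕ) < m then -1 else 1

theorem sgn_rev (i : Fin (2 * m)) : sgn i.rev = -sgn i := by
  have := i.2
  simp only [sgn, Fin.val_rev]
  split_ifs <;> omega

theorem sgn_mul_self (i : Fin (2 * m)) : sgn i * sgn i = 1 := by
  simp only [sgn]; split_ifs <;> rfl

/-- The standard alternating form `{u, v} = ∑ ε_i u_i v_{n+1-i}` on `Rⁿ`. -/
def alt : LinearMap.BilinForm R (Fin (2 * m) → R) :=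
  LinearMap.mk₂ R (fun u v => ∑ i, (sgn i : R) * (u i * v i.rev))
    (fun u u' v => by
      rw [← Finset.sum_add_distrib]; exact Finset.sum_congr rfl fun i _ => by simp; ring)
    (fun c u v => by
      rw [smul_eq_mul, Finset.mul_sum]; exact Finset.sum_congr rfl fun i _ => by simp; ring)
    (fun u v v' => by
      rw [← Finset.sum_add_distrib]; exact Finset.sum_congr rfl fun i _ => by simp; ring)
    (fun c u v => by
      rw [smul_eq_mul, Finset.mul_sum]; exact Finset.sum_congr rfl fun i _ => by simp; ring)

theorem alt_apply (u v : Fin (2 * m) → R) : alt u v = ∑ i, (sgn i : R) * (u i * v i.rev) := rfl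

theorem alt_swap (u v : Fin (2 * m) → R) : alt u v = -alt v u := by
  rw [alt_apply, alt_apply, ← Finset.sum_neg_distrib, ← Equiv.sum_comp Fin.revPerm]
  refine Finset.sum_congr rfl fun i _ => ?_
  rw [Fin.revPerm_apply, sgn_rev, Fin.rev_rev]
  push_cast
  ring

theorem alt_map {S : Type*} [CommRing S] (φ : R →+* S) (u v : Fin (2 * m) → R) :
    alt (fun i => φ (u i)) (fun i => φ (v i)) = φ (alt u v) := by
  simp [alt_apply]

/-- The first half of the coordinates. -/
def fstHalf : (Ind m → R) →ₗ[R] (Fin (2 * m) → R) := LinearMap.funLeft R R Sum.inl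

/-- The second half of the coordinates. -/
def sndHalf : (Ind m → R) →ₗ[R] (Fin (2 * m) → R) := LinearMap.funLeft R R Sum.inr

@[simp] theorem fstHalf_apply (v : Ind m → R) (i) : fstHalf v i = v (Sum.inl i) := rfl
@[simp] theorem sndHalf_apply (v : Ind m → R) (i) : sndHalf v i = v (Sum.inr i) := rfl

/-- The symmetric form in coordinates. -/
def symm : LinearMap.BilinForm R (Ind m → R) :=
  alt.compl₁₂ fstHalf sndHalf + (alt.compl₁₂ fstHalf sndHalf).flip

theorem symm_apply (v w : Ind m → R) :
    symm v w = alt (fstHalf v) (sndHalf w) + alt (fstHalf w) (sndHalf v) := rfl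

theorem symm_map {S : Type*} [CommRing S] (φ : R →+* S) (v w : Ind m → R) :
    symm (fun i => φ (v i)) (fun i => φ (w i)) = φ (symm v w) := by
  rw [symm_apply, symm_apply, map_add, ← alt_map, ← alt_map]
  rfl

/-- The operator `t + π` in coordinates, where `ϖ` is the image of `2π`. -/
def opPlus (ϖ : R) : (Ind m → R) →ₗ[R] (Ind m → R) where
  toFun v := Sum.elim (fun i => ϖ * v (Sum.inl i)) fun i => v (Sum.inl i)
  map_add' v w := by ext (i | i) <;> simp [mul_add]
  map_smul' c v := by ext (i | i) <;> simp [mul_left_comm]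

/-- The operator `t - π` in coordinates, where `ϖ` is the image of `2π`. -/
def opMinus (ϖ : R) : (Ind m → R) →ₗ[R] (Ind m → R) where
  toFun v := Sum.elim (fun _ => 0) fun i => v (Sum.inl i) - ϖ * v (Sum.inr i)
  map_add' v w := by ext (i | i) <;> simp [mul_add]; ring
  map_smul' c v := by ext (i | i) <;> simp [mul_left_comm, mul_sub]

@[simp] theorem opPlus_inl (ϖ : R) (v : Ind m → R) (i) :
    opPlus ϖ v (Sum.inl i) = ϖ * v (Sum.inl i) := rfl
@[simp] theorem opPlus_inr (ϖ : R) (v : Ind m → R) (i) :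
    opPlus ϖ v (Sum.inr i) = v (Sum.inl i) := rfl
@[simp] theorem opMinus_inl (ϖ : R) (v : Ind m → R) (i) :
    opMinus ϖ v (Sum.inl i) = 0 := rfl
@[simp] theorem opMinus_inr (ϖ : R) (v : Ind m → R) (i) :
    opMinus ϖ v (Sum.inr i) = v (Sum.inl i) - ϖ * v (Sum.inr i) := rfl

theorem opPlus_map {S : Type*} [CommRing S] (φ : R →+* S) (ϖ : R) (v : Ind m → R) :
    opPlus (φ ϖ) (fun i => φ (v i)) = fun i => φ (opPlus ϖ v i) := by
  ext (i | i) <;> simp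

theorem opMinus_map {S : Type*} [CommRing S] (φ : R →+* S) (ϖ : R) (v : Ind m → R) :
    opMinus (φ ϖ) (fun i => φ (v i)) = fun i => φ (opMinus ϖ v i) := by
  ext (i | i) <;> simp

end Concrete

/-- The conditions defining the splitting model, in coordinates. -/
structure IsSpl {m : ℕ} (s : ℕ) {R : Type u} [CommRing R] (ϖ : R)
    (F G : Submodule R (Ind m → R)) : Prop where
  locGraph_F : IsLocGraph (2 * m) F
  locGraph_G : IsLocGraph s G
  le : G ≤ F
  isotropic : ∀ x ∈ F, ∀ y ∈ F, symm x y = 0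
  split_F : ∀ x ∈ F, opPlus ϖ x ∈ G
  split_G : ∀ x ∈ G, opMinus ϖ x = 0
  spin : ∀ (K : Type u) [Field K] (φ : R →+* K),
    Module.finrank K ((extend φ F).map (opPlus (φ ϖ))) ≡ s [MOD 2]

/-! ### The lattice in coordinates adapted to t + π and t - π -/

section Lattice

variable {O₀ : Type u} [CommRing O₀] [IsDomain O₀] (π₀ : O₀)
variable (F₀ : Type u) [Field F₀] [Algebra O₀ F₀] [IsFractionRing O₀ F₀] {m : ℕ}

theorem sum_latticeVec_apply (c : Ind m → O₀) (i : Fin (2 * m)) :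
    (∑ q, c q • latticeVec π₀ F₀ q) i =
      c (Sum.inl i) • latticeVec π₀ F₀ (Sum.inl i) i +
        c (Sum.inr i) • latticeVec π₀ F₀ (Sum.inr i) i := by
  rw [Finset.sum_apply, Fintype.sum_sum_type, Finset.sum_eq_single i, Finset.sum_eq_single i]
  · rfl
  · intro j _ hj
    simp [latticeVec, latticeGen, hj.symm]
  · simp
  · intro j _ hj
    simp [latticeVec, latticeGen, hj.symm]
  · simp

/-- For i among the first m indices the generator is π₀⁻¹π e_i and its multiple by π is e_i, so real
and imaginary parts exchange roles compared with the last m indices. -/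
theorem sum_latticeVec_re_im (h0 : π₀ ≠ 0) (c : Ind m → O₀) (i : Fin (2 * m)) :
    ((∑ q, c q • latticeVec π₀ F₀ q) i).re =
        algebraMap O₀ F₀ (if (i : ℕ) < m then c (Sum.inr i) else c (Sum.inl i)) ∧
      ((∑ q, c q • latticeVec π₀ F₀ q) i).im =
        if (i : ℕ) < m then (algebraMap O₀ F₀ π₀)⁻¹ * algebraMap O₀ F₀ (c (Sum.inl i))
        else algebraMap O₀ F₀ (c (Sum.inr i)) := by
  have h0' : algebraMap O₀ F₀ π₀ ≠ 0 := by
    rwa [Ne, FaithfulSMul.algebraMap_eq_zero_iff]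
  rw [sum_latticeVec_apply]
  by_cases hi : (i : ℕ) < m <;>
    simp [latticeVec, latticeGen, hi, Algebra.smul_def (A := F₀), h0', mul_comm,
      QuadraticAlgebra.re_one (R := F₀), QuadraticAlgebra.im_one (R := F₀)]

theorem linearIndependent_latticeVec (h0 : π₀ ≠ 0) :
    LinearIndependent O₀ (latticeVec π₀ F₀ (m := m)) := by
  have h0' : algebraMap O₀ F₀ π₀ ≠ 0 := by
    rwa [Ne, FaithfulSMul.algebraMap_eq_zero_iff]
  rw [Fintype.linearIndependent_iff]
  intro c hc
  have key : ∀ i : Fin (2 * m), c (Sum.inl i) = 0 ∧ c (Sum.inr i) = 0 := by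
    intro i
    obtain ⟨h1, h2⟩ := sum_latticeVec_re_im π₀ F₀ h0 c i
    rw [hc] at h1 h2
    by_cases hi : (i : ℕ) < m
    · simp only [hi, if_true, Pi.zero_apply, QuadraticAlgebra.re_zero,
        QuadraticAlgebra.im_zero] at h1 h2
      have h2' := (mul_eq_zero.1 h2.symm).resolve_left (inv_ne_zero h0')
      exact ⟨(FaithfulSMul.algebraMap_eq_zero_iff O₀ F₀).1 h2',
        (FaithfulSMul.algebraMap_eq_zero_iff O₀ F₀).1 h1.symm⟩
    · simp only [hi, if_false, Pi.zero_apply, QuadraticAlgebra.re_zero,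
        QuadraticAlgebra.im_zero] at h1 h2
      exact ⟨(FaithfulSMul.algebraMap_eq_zero_iff O₀ F₀).1 h1.symm,
        (FaithfulSMul.algebraMap_eq_zero_iff O₀ F₀).1 h2.symm⟩
  rintro (i | i)
  exacts [(key i).1, (key i).2]

variable {π₀}

variable (m) in
/-- The `O₀`-basis of `Λ_m` given by the generators and their multiples by `π`. -/
def latticeBasis (h0 : π₀ ≠ 0) : Module.Basis (Ind m) O₀ (lattice π₀ F₀ m) :=
  Module.Basis.span (linearIndependent_latticeVec π₀ F₀ h0)

theorem latticeBasis_apply (h0 : π₀ ≠ 0) (q : Ind m) :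
    (latticeBasis F₀ m h0 q : HermSpace π₀ F₀ m) = latticeVec π₀ F₀ q :=
  congrArg Subtype.val (Module.Basis.span_apply (linearIndependent_latticeVec π₀ F₀ h0) q)

theorem sum_latticeBasis_repr (h0 : π₀ ≠ 0) (v : lattice π₀ F₀ m) :
    (v : HermSpace π₀ F₀ m) = ∑ q, (latticeBasis F₀ m h0).repr v q • latticeVec π₀ F₀ q := by
  conv_lhs => rw [← (latticeBasis F₀ m h0).sum_repr v]
  rw [AddSubmonoidClass.coe_finsetSum]
  refine Finset.sum_congr rfl fun q _ => ?_
  rw [Submodule.coe_smul, latticeBasis_apply]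

theorem latticeT_repr (h0 : π₀ ≠ 0) (v : lattice π₀ F₀ m) (i : Fin (2 * m)) :
    (latticeBasis F₀ m h0).repr (latticeT π₀ F₀ m v) (Sum.inl i) =
        π₀ * (latticeBasis F₀ m h0).repr v (Sum.inr i) ∧
      (latticeBasis F₀ m h0).repr (latticeT π₀ F₀ m v) (Sum.inr i) =
        (latticeBasis F₀ m h0).repr v (Sum.inl i) := by
  set B := latticeBasis F₀ m h0 with hB
  have h0' : algebraMap O₀ F₀ π₀ ≠ 0 := by
    rwa [Ne, FaithfulSMul.algebraMap_eq_zero_iff]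
  have hinj := FaithfulSMul.algebraMap_injective O₀ F₀
  obtain ⟨h1, h2⟩ := sum_latticeVec_re_im π₀ F₀ h0 (B.repr v) i
  obtain ⟨h3, h4⟩ := sum_latticeVec_re_im π₀ F₀ h0 (B.repr (latticeT π₀ F₀ m v)) i
  rw [← sum_latticeBasis_repr] at h1 h2 h3 h4
  have h5 : ((latticeT π₀ F₀ m v : HermSpace π₀ F₀ m) i).re =
      algebraMap O₀ F₀ π₀ * ((v : HermSpace π₀ F₀ m) i).im := by
    simp [latticeT]
  have h6 : ((latticeT π₀ F₀ m v : HermSpace π₀ F₀ m) i).im = ((v : HermSpace π₀ F₀ m) i).re := by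
    simp [latticeT]
  rw [h5, h2] at h3
  rw [h6, h1] at h4
  by_cases hi : (i : ℕ) < m
  · simp only [hi, if_true] at h3 h4
    rw [mul_inv_cancel_left₀ h0'] at h3
    refine ⟨hinj ?_, (hinj h3).symm⟩
    rw [map_mul, h4, mul_inv_cancel_left₀ h0']
  · simp only [hi, if_false] at h3 h4
    refine ⟨hinj ?_, (hinj h4).symm⟩
    rw [map_mul, h3]

/-- Exactly one of i and n + 1 - i is among the first m indices, so in each product of imaginary
parts the factor π₀ is cancelled by one π₀⁻¹. The exchange of real and imaginary parts on the first
half produces the signs of `alt`. -/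
theorem latticeForm_repr (h0 : π₀ ≠ 0) (h2 : (2 : O₀) ≠ 0) (v w : lattice π₀ F₀ m) :
    latticeForm π₀ F₀ m v w =
      symm ((latticeBasis F₀ m h0).repr v) ((latticeBasis F₀ m h0).repr w) := by
  set B := latticeBasis F₀ m h0 with hB
  have h0' : algebraMap O₀ F₀ π₀ ≠ 0 := by
    rwa [Ne, FaithfulSMul.algebraMap_eq_zero_iff]
  have h2' : (2 : F₀) ≠ 0 := by
    rw [← map_ofNat (algebraMap O₀ F₀), Ne, FaithfulSMul.algebraMap_eq_zero_iff]
    exact h2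
  apply FaithfulSMul.algebraMap_injective O₀ F₀
  rw [latticeForm_apply, symmForm_apply, trace_herm, ← mul_assoc, one_div, inv_mul_cancel₀ h2',
    one_mul, symm_apply, alt_swap (fstHalf _) (sndHalf (⇑(B.repr v))), ← sub_eq_add_neg, alt_apply,
    alt_apply, ← Finset.sum_sub_distrib, map_sum]
  refine Finset.sum_congr rfl fun i _ => ?_
  have hi' : (i.rev : ℕ) < m ↔ ¬ (i : ℕ) < m := by
    have := i.2
    rw [Fin.val_rev]
    omega
  obtain ⟨h3, h4⟩ := sum_latticeVec_re_im π₀ F₀ h0 (B.repr v) i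
  obtain ⟨h5, h6⟩ := sum_latticeVec_re_im π₀ F₀ h0 (B.repr w) i.rev
  rw [← sum_latticeBasis_repr] at h3 h4 h5 h6
  rw [h3, h4, h5, h6]
  by_cases hi : (i : ℕ) < m
  · simp only [hi, hi', if_true, not_true, if_false, sgn, fstHalf_apply, sndHalf_apply]
    rw [mul_inv_cancel_left₀ h0']
    push_cast
    simp
    ring
  · simp only [hi, hi', if_true, not_false_iff, if_false, sgn, fstHalf_apply, sndHalf_apply]
    rw [mul_right_comm, mul_inv_cancel_left₀ h0']
    push_cast
    simp
    ring

/-- The change of coordinates `(X, X') ↦ (X + π X', X')`. -/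
def shear {R : Type*} [CommRing R] (a : R) : (Ind m → R) ≃ₗ[R] (Ind m → R) where
  toFun v := Sum.elim (fun i => v (Sum.inl i) + a * v (Sum.inr i)) fun i => v (Sum.inr i)
  invFun v := Sum.elim (fun i => v (Sum.inl i) - a * v (Sum.inr i)) fun i => v (Sum.inr i)
  map_add' v w := by ext (i | i) <;> simp; ring
  map_smul' c v := by ext (i | i) <;> simp; ring
  left_inv v := by ext (i | i) <;> simp
  right_inv v := by ext (i | i) <;> simp

/-- The extra term is `a` times {y, y'} + {y', y}, which vanishes by skew-symmetry. -/
theorem symm_shear {R : Type*} [CommRing R] (a : R) (v w : Ind m → R) :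
    symm (shear a v) (shear a w) = symm v w := by
  have h : ∀ v : Ind m → R, fstHalf (shear a v) = fstHalf v + a • sndHalf v := fun v => rfl
  have h' : ∀ v : Ind m → R, sndHalf (shear a v) = sndHalf v := fun v => rfl
  rw [symm_apply, symm_apply]
  simp only [h, h', map_add, LinearMap.add_apply, map_smul, LinearMap.smul_apply]
  rw [alt_swap (sndHalf v) (sndHalf w)]
  simp
  ring

variable (m) in
/-- The `O_F`-basis `b_i, (t - π) b_i` of `O_F ⊗ Λ_m`. -/
def ofBasis (h0 : π₀ ≠ 0) : Module.Basis (Ind m) (RingOfInt π₀) (OFLattice π₀ F₀ m) :=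
  Module.Basis.ofEquivFun ((coordEquiv (latticeBasis F₀ m h0) (RingOfInt π₀)).trans
    (shear QuadraticAlgebra.omega))

theorem ofBasis_repr (h0 : π₀ ≠ 0) (x : OFLattice π₀ F₀ m) :
    ⇑((ofBasis F₀ m h0).repr x) =
      shear QuadraticAlgebra.omega (coordEquiv (latticeBasis F₀ m h0) (RingOfInt π₀) x) := by
  funext q
  rw [ofBasis, Module.Basis.ofEquivFun_repr_apply]
  rfl

theorem algebraMap_eq_omega_mul :
    algebraMap O₀ (RingOfInt π₀) π₀ = QuadraticAlgebra.omega * QuadraticAlgebra.omega := by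
  rw [QuadraticAlgebra.omega_mul_omega_eq_algebraMap, map_zero, zero_mul, add_zero]

theorem repr_baseChange_latticeT (h0 : π₀ ≠ 0) (x : OFLattice π₀ F₀ m) :
    (∀ i, (ofBasis F₀ m h0).repr ((latticeT π₀ F₀ m).baseChange (RingOfInt π₀) x) (Sum.inl i) =
      QuadraticAlgebra.omega * (ofBasis F₀ m h0).repr x (Sum.inl i)) ∧
    ∀ i, (ofBasis F₀ m h0).repr ((latticeT π₀ F₀ m).baseChange (RingOfInt π₀) x) (Sum.inr i) =
      (ofBasis F₀ m h0).repr x (Sum.inl i) -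
        QuadraticAlgebra.omega * (ofBasis F₀ m h0).repr x (Sum.inr i) := by
  have key : ∀ i,
      coordEquiv (latticeBasis F₀ m h0) (RingOfInt π₀)
          ((latticeT π₀ F₀ m).baseChange (RingOfInt π₀) x) (Sum.inl i) =
        QuadraticAlgebra.omega * QuadraticAlgebra.omega *
          coordEquiv (latticeBasis F₀ m h0) (RingOfInt π₀) x (Sum.inr i) ∧
      coordEquiv (latticeBasis F₀ m h0) (RingOfInt π₀)
          ((latticeT π₀ F₀ m).baseChange (RingOfInt π₀) x) (Sum.inr i) =
        coordEquiv (latticeBasis F₀ m h0) (RingOfInt π₀) x (Sum.inl i) := by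
    intro i
    induction x using TensorProduct.induction_on with
    | zero => simp
    | add x y hx hy =>
      simp only [map_add, Pi.add_apply, hx.1, hy.1, hx.2, hy.2]
      exact ⟨(mul_add _ _ _).symm, trivial⟩
    | tmul a l =>
      rw [LinearMap.baseChange_tmul, coordEquiv_tmul, coordEquiv_tmul, coordEquiv_tmul,
        coordEquiv_tmul, (latticeT_repr F₀ h0 l i).1, (latticeT_repr F₀ h0 l i).2, map_mul,
        algebraMap_eq_omega_mul]
      exact ⟨by ring, rfl⟩
  constructor
  · intro i
    rw [ofBasis_repr, ofBasis_repr]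
    simp only [shear, LinearEquiv.coe_mk, LinearMap.coe_mk, AddHom.coe_mk, Sum.elim_inl]
    rw [(key i).1, (key i).2]
    ring
  · intro i
    rw [ofBasis_repr, ofBasis_repr]
    simp only [shear, LinearEquiv.coe_mk, LinearMap.coe_mk, AddHom.coe_mk, Sum.elim_inl,
      Sum.elim_inr]
    rw [(key i).2]
    ring

theorem baseChange_latticeForm_repr (h0 : π₀ ≠ 0) (h2 : (2 : O₀) ≠ 0) (x y : OFLattice π₀ F₀ m) :
    (latticeForm π₀ F₀ m).baseChange (RingOfInt π₀) x y =
      symm ((ofBasis F₀ m h0).repr x) ((ofBasis F₀ m h0).repr y) := by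
  rw [ofBasis_repr, ofBasis_repr, symm_shear]
  induction x using TensorProduct.induction_on with
  | zero => simp
  | add x x' hx hx' => simp only [map_add, LinearMap.add_apply, hx, hx']
  | tmul a l =>
    induction y using TensorProduct.induction_on with
    | zero => simp
    | add y y' hy hy' => simp only [map_add, hy, hy']
    | tmul b l' =>
      have h : ∀ (a : RingOfInt π₀) (l : lattice π₀ F₀ m),
          coordEquiv (latticeBasis F₀ m h0) (RingOfInt π₀) (a ⊗ₜ l) =
            a • fun q => algebraMap O₀ (RingOfInt π₀) ((latticeBasis F₀ m h0).repr l q) := by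
        intro a l
        funext q
        rw [coordEquiv_tmul]
        rfl
      rw [h, h, LinearMap.map_smul₂, map_smul, symm_map, ← latticeForm_repr F₀ h0 h2]
      simp [Algebra.smul_def]
      ring

variable (R : Type u) [CommRing R] [Algebra (RingOfInt π₀) R]

/-- The image of `2π` in an `O_F`-algebra. -/
def twoPi (π₀ : O₀) (R : Type u) [CommRing R] [Algebra (RingOfInt π₀) R] : R :=
  algebraMap (RingOfInt π₀) R (2 * QuadraticAlgebra.omega)

theorem coordEquiv_ofBasis_tmul (h0 : π₀ ≠ 0) (a : R) (x : OFLattice π₀ F₀ m) :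
    coordEquiv (ofBasis F₀ m h0) R (a ⊗ₜ x) =
      a • fun q => algebraMap (RingOfInt π₀) R ((ofBasis F₀ m h0).repr x q) := by
  ext1 q
  rw [coordEquiv_tmul]
  rfl

variable {R}

theorem coordEquiv_tOp (h0 : π₀ ≠ 0) (x : R ⊗[RingOfInt π₀] OFLattice π₀ F₀ m) :
    (∀ i, coordEquiv (ofBasis F₀ m h0) R (tOp π₀ F₀ m R x) (Sum.inl i) =
      algebraMap (RingOfInt π₀) R QuadraticAlgebra.omega *
        coordEquiv (ofBasis F₀ m h0) R x (Sum.inl i)) ∧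
    ∀ i, coordEquiv (ofBasis F₀ m h0) R (tOp π₀ F₀ m R x) (Sum.inr i) =
      coordEquiv (ofBasis F₀ m h0) R x (Sum.inl i) -
        algebraMap (RingOfInt π₀) R QuadraticAlgebra.omega *
          coordEquiv (ofBasis F₀ m h0) R x (Sum.inr i) := by
  rw [← forall_and]
  intro i
  induction x with
  | zero => simp
  | add x y hx hy =>
    simp only [map_add, Pi.add_apply, hx.1, hx.2, hy.1, hy.2]
    exact ⟨by ring, by ring⟩
  | tmul a l =>
    obtain ⟨h1, h2⟩ := repr_baseChange_latticeT F₀ h0 l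
    rw [tOp, LinearMap.baseChange_tmul, coordEquiv_tmul, coordEquiv_tmul, coordEquiv_tmul,
      coordEquiv_tmul, h1, h2, map_sub, map_mul, map_mul]
    exact ⟨by ring, by ring⟩

theorem coordEquiv_tOp_add_piOp (h0 : π₀ ≠ 0) (x : R ⊗[RingOfInt π₀] OFLattice π₀ F₀ m) :
    coordEquiv (ofBasis F₀ m h0) R ((tOp π₀ F₀ m R + piOp π₀ F₀ m R) x) =
      opPlus (twoPi π₀ R) (coordEquiv (ofBasis F₀ m h0) R x) := by
  obtain ⟨h1, h2⟩ := coordEquiv_tOp F₀ h0 x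
  ext (i | i)
  · simp only [LinearMap.add_apply, map_add, Pi.add_apply, h1, piOp, LinearMap.lsmul_apply,
      map_smul, Pi.smul_apply, smul_eq_mul, opPlus_inl, twoPi, map_mul, map_ofNat]
    ring
  · simp only [LinearMap.add_apply, map_add, Pi.add_apply, h2, piOp, LinearMap.lsmul_apply,
      map_smul, Pi.smul_apply, smul_eq_mul, opPlus_inr]
    ring

theorem coordEquiv_tOp_sub_piOp (h0 : π₀ ≠ 0) (x : R ⊗[RingOfInt π₀] OFLattice π₀ F₀ m) :
    coordEquiv (ofBasis F₀ m h0) R ((tOp π₀ F₀ m R - piOp π₀ F₀ m R) x) =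
      opMinus (twoPi π₀ R) (coordEquiv (ofBasis F₀ m h0) R x) := by
  obtain ⟨h1, h2⟩ := coordEquiv_tOp F₀ h0 x
  ext (i | i)
  · simp only [LinearMap.sub_apply, map_sub, Pi.sub_apply, h1, piOp, LinearMap.lsmul_apply,
      map_smul, Pi.smul_apply, smul_eq_mul, opMinus_inl]
    ring
  · simp only [LinearMap.sub_apply, map_sub, Pi.sub_apply, h2, piOp, LinearMap.lsmul_apply,
      map_smul, Pi.smul_apply, smul_eq_mul, opMinus_inr, twoPi, map_mul, map_ofNat]
    ring

theorem formOver_coordEquiv (h0 : π₀ ≠ 0) (h2 : (2 : O₀) ≠ 0)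
    (x y : R ⊗[RingOfInt π₀] OFLattice π₀ F₀ m) :
    formOver π₀ F₀ m R x y =
      symm (coordEquiv (ofBasis F₀ m h0) R x) (coordEquiv (ofBasis F₀ m h0) R y) := by
  induction x with
  | zero => simp
  | add x x' hx hx' => simp only [map_add, LinearMap.add_apply, hx, hx']
  | tmul a l =>
    induction y with
    | zero => simp
    | add y y' hy hy' => simp only [map_add, hy, hy']
    | tmul b l' =>
      rw [coordEquiv_ofBasis_tmul, coordEquiv_ofBasis_tmul, LinearMap.map_smul₂,
        map_smul, symm_map, ← baseChange_latticeForm_repr F₀ h0 h2, formOver,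
        LinearMap.BilinForm.baseChange_tmul]
      simp [Algebra.smul_def]
      ring

theorem map_twoPi {R R' : Type u} [CommRing R] [CommRing R'] [Algebra (RingOfInt π₀) R]
    [Algebra (RingOfInt π₀) R'] (f : R →ₐ[RingOfInt π₀] R') : f (twoPi π₀ R) = twoPi π₀ R' :=
  f.commutes _

variable {F₀} {r s : ℕ}

theorem coordSubmodule_map_op {h0 : π₀ ≠ 0} (T : _ →ₗ[R] _) (T' : (Ind m → R) →ₗ[R] (Ind m → R))
    (h : ∀ x, coordEquiv (ofBasis F₀ m h0) R (T x) = T' (coordEquiv (ofBasis F₀ m h0) R x))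
    (N : Submodule R (R ⊗[RingOfInt π₀] OFLattice π₀ F₀ m)) :
    coordSubmodule (ofBasis F₀ m h0) R (N.map T) = (coordSubmodule (ofBasis F₀ m h0) R N).map T' := by
  rw [coordSubmodule_apply, coordSubmodule_apply, ← Submodule.map_comp, ← Submodule.map_comp]
  rw [show (coordEquiv (ofBasis F₀ m h0) R).toLinearMap ∘ₗ T =
    T' ∘ₗ (coordEquiv (ofBasis F₀ m h0) R).toLinearMap from LinearMap.ext h]

theorem mem_coordSubmodule {h0 : π₀ ≠ 0} (N : Submodule R (R ⊗[RingOfInt π₀] OFLattice π₀ F₀ m))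
    (x : R ⊗[RingOfInt π₀] OFLattice π₀ F₀ m) :
    coordEquiv (ofBasis F₀ m h0) R x ∈ coordSubmodule (ofBasis F₀ m h0) R N ↔ x ∈ N :=
  ⟨fun ⟨_, hy, e⟩ => (coordEquiv (ofBasis F₀ m h0) R).injective e ▸ hy, fun h => ⟨x, h, rfl⟩⟩

theorem finrank_coordSubmodule {h0 : π₀ ≠ 0}
    (N : Submodule R (R ⊗[RingOfInt π₀] OFLattice π₀ F₀ m)) :
    Module.finrank R (coordSubmodule (ofBasis F₀ m h0) R N) = Module.finrank R N :=
  LinearEquiv.finrank_map_eq (coordEquiv (ofBasis F₀ m h0) R) N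

theorem SplPoint.isSpl (h0 : π₀ ≠ 0) (h2 : (2 : O₀) ≠ 0) (hrs : r + s = 2 * m)
    (x : SplPoint π₀ F₀ m r s R) :
    IsSpl s (twoPi π₀ R) (coordSubmodule (ofBasis F₀ m h0) R x.F.toSubmodule)
      (coordSubmodule (ofBasis F₀ m h0) R x.G.toSubmodule) where
  locGraph_F := by
    convert isLocGraph_coordSubmodule (ofBasis F₀ m h0) x.F using 1
    simp
  locGraph_G := by
    convert isLocGraph_coordSubmodule (ofBasis F₀ m h0) x.G using 1
    simp
    omega
  le := (coordSubmodule (ofBasis F₀ m h0) R).monotone x.le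
  isotropic := by
    rintro _ ⟨v, hv, rfl⟩ _ ⟨w, hw, rfl⟩
    exact (formOver_coordEquiv F₀ h0 h2 v w).symm.trans (x.isotropic v hv w hw)
  split_F := by
    rintro _ ⟨v, hv, rfl⟩
    change opPlus _ (coordEquiv (ofBasis F₀ m h0) R v) ∈ _
    rw [← coordEquiv_tOp_add_piOp, mem_coordSubmodule]
    exact x.split_F ⟨v, hv, rfl⟩
  split_G := by
    rintro _ ⟨v, hv, rfl⟩
    change opMinus _ (coordEquiv (ofBasis F₀ m h0) R v) = 0
    have h : (tOp π₀ F₀ m R - piOp π₀ F₀ m R) v = 0 := by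
      rw [← Submodule.mem_bot R, ← x.split_G]
      exact ⟨v, hv, rfl⟩
    rw [← coordEquiv_tOp_sub_piOp, h, map_zero]
  spin K _ φ := by
    -- `IsSpl` quantifies over bare ring homomorphisms to fields; K receives its O_F-structure
    -- through φ.
    let : Algebra (RingOfInt π₀) K := (φ.comp (algebraMap (RingOfInt π₀) R)).toAlgebra
    let f : R →ₐ[RingOfInt π₀] K := { φ with commutes' := fun _ => rfl }
    have h := x.spin K f
    rw [← finrank_coordSubmodule (h0 := h0),
      coordSubmodule_map_op _ _ (coordEquiv_tOp_add_piOp F₀ h0), coordSubmodule_map,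
      ← map_twoPi f] at h
    exact h

/-- The point of the splitting model with the given coordinates. -/
def IsSpl.toSplPoint (h0 : π₀ ≠ 0) (h2 : (2 : O₀) ≠ 0) (hrs : r + s = 2 * m)
    {F G : Submodule R (Ind m → R)} (h : IsSpl s (twoPi π₀ R) F G) : SplPoint π₀ F₀ m r s R where
  F := grassmannianOfCoord (ofBasis F₀ m h0) h.locGraph_F (by simp)
  G := grassmannianOfCoord (ofBasis F₀ m h0) h.locGraph_G (by simp; omega)
  le := (coordSubmodule (ofBasis F₀ m h0) R).symm.monotone h.le
  isotropic v hv w hw := by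
    rw [← mem_coordSubmodule (h0 := h0), coordSubmodule_grassmannianOfCoord] at hv hw
    rw [formOver_coordEquiv F₀ h0 h2, h.isotropic _ hv _ hw]
  split_F := by
    rintro _ ⟨v, hv, rfl⟩
    have hv' := (mem_coordSubmodule (h0 := h0) _ _).2 hv
    rw [← mem_coordSubmodule (h0 := h0), coordEquiv_tOp_add_piOp,
      coordSubmodule_grassmannianOfCoord]
    rw [coordSubmodule_grassmannianOfCoord] at hv'
    exact h.split_F _ hv'
  split_G := by
    rw [eq_bot_iff]
    rintro _ ⟨v, hv, rfl⟩
    have hv' := (mem_coordSubmodule (h0 := h0) _ _).2 hv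
    rw [coordSubmodule_grassmannianOfCoord] at hv'
    rw [Submodule.mem_bot, ← (coordEquiv (ofBasis F₀ m h0) R).map_eq_zero_iff,
      coordEquiv_tOp_sub_piOp, h.split_G _ hv']
  spin K _ _ f := by
    have h' := h.spin K f
    rw [← finrank_coordSubmodule (h0 := h0),
      coordSubmodule_map_op _ _ (coordEquiv_tOp_add_piOp F₀ h0), coordSubmodule_map,
      coordSubmodule_grassmannianOfCoord, ← map_twoPi f]
    exact h'

theorem SplPoint.ext_coord (h0 : π₀ ≠ 0) {x y : SplPoint π₀ F₀ m r s R}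
    (hF : coordSubmodule (ofBasis F₀ m h0) R x.F.toSubmodule =
      coordSubmodule (ofBasis F₀ m h0) R y.F.toSubmodule)
    (hG : coordSubmodule (ofBasis F₀ m h0) R x.G.toSubmodule =
      coordSubmodule (ofBasis F₀ m h0) R y.G.toSubmodule) : x = y :=
  SplPoint.ext (Module.Grassmannian.ext ((coordSubmodule (ofBasis F₀ m h0) R).injective hF))
    (Module.Grassmannian.ext ((coordSubmodule (ofBasis F₀ m h0) R).injective hG))

end Lattice

/-! ### Gluing schemes from a functor of points with charts -/

section StalkGluing

open TopologicalSpace Opposite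

variable {T : Scheme.{u}}

theorem exists_section_of_germs (U : T.Opens) (t : ∀ y : T, T.presheaf.stalk y)
    (h : ∀ x ∈ U, ∃ V : T.Opens, x ∈ V ∧ ∃ s : Γ(T, V), ∀ (y : T) (hy : y ∈ V),
      T.presheaf.germ V y hy s = t y) :
    ∃ s : Γ(T, U), ∀ (y : T) (hy : y ∈ U), T.presheaf.germ U y hy s = t y := by
  choose V hV s hs using h
  let W : U → T.Opens := fun x => V x x.2 ⊓ U
  obtain ⟨g, hg, -⟩ : ∃! g : Γ(T, U), ∀ x : U, T.presheaf.map
      (homOfLE (inf_le_right : W x ≤ U)).op g = T.presheaf.map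
        (homOfLE (inf_le_left : W x ≤ V x x.2)).op (s x x.2) := T.sheaf.existsUnique_gluing' W U
    (fun x => homOfLE inf_le_right)
    (fun x hx => Opens.mem_iSup.2 ⟨⟨x, hx⟩, hV x hx, hx⟩)
    (fun x => T.presheaf.map (homOfLE inf_le_left).op (s x x.2))
    (fun x x' => TopCat.Presheaf.section_ext T.sheaf _ _ _ fun y hy => by
      change T.presheaf.germ _ y hy (T.presheaf.map _ (T.presheaf.map _ _)) =
        T.presheaf.germ _ y hy (T.presheaf.map _ (T.presheaf.map _ _))
      rw [TopCat.Presheaf.germ_res_apply, TopCat.Presheaf.germ_res_apply,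
        TopCat.Presheaf.germ_res_apply, TopCat.Presheaf.germ_res_apply, hs, hs])
  refine ⟨g, fun y hy => ?_⟩
  have hyW : y ∈ W ⟨y, hy⟩ := ⟨hV y hy, hy⟩
  have := congrArg (T.presheaf.germ (W ⟨y, hy⟩) y hyW) (hg ⟨y, hy⟩)
  rwa [TopCat.Presheaf.germ_res_apply, TopCat.Presheaf.germ_res_apply, hs] at this

theorem ringHom_ext_of_germs {C : CommRingCat.{u}} {U : T.Opens} {φ ψ : C ⟶ Γ(T, U)}
    (h : ∀ (y : T) (hy : y ∈ U), φ ≫ T.presheaf.germ U y hy = ψ ≫ T.presheaf.germ U y hy) :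
    φ = ψ := by
  ext c
  exact TopCat.Presheaf.section_ext T.sheaf U _ _ fun y hy => ConcreteCategory.congr_hom (h y hy) c

/-- Ring homomorphisms into the stalks which are locally induced by ring homomorphisms into
sections glue. -/
theorem exists_ringHom_of_germs {C : CommRingCat.{u}} (U : T.Opens)
    (χ : ∀ y : T, C ⟶ T.presheaf.stalk y)
    (h : ∀ x ∈ U, ∃ V : T.Opens, x ∈ V ∧ ∃ ψ : C ⟶ Γ(T, V), ∀ (y : T) (hy : y ∈ V),
      ψ ≫ T.presheaf.germ V y hy = χ y) :
    ∃ ψ : C ⟶ Γ(T, U), ∀ (y : T) (hy : y ∈ U), ψ ≫ T.presheaf.germ U y hy = χ y := by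
  have key : ∀ c : C, ∃ s : Γ(T, U), ∀ (y : T) (hy : y ∈ U),
      T.presheaf.germ U y hy s = χ y c := fun c => by
    refine exists_section_of_germs U (fun y => χ y c) fun x hx => ?_
    obtain ⟨V, hV, ψ, hψ⟩ := h x hx
    exact ⟨V, hV, ψ c, fun y hy => ConcreteCategory.congr_hom (hψ y hy) c⟩
  choose s hs using key
  have hext : ∀ a b : Γ(T, U), (∀ (y : T) (hy : y ∈ U),
      T.presheaf.germ U y hy a = T.presheaf.germ U y hy b) → a = b :=
    fun a b h => TopCat.Presheaf.section_ext T.sheaf U a b h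
  refine ⟨CommRingCat.ofHom
    { toFun := s
      map_one' := hext _ _ fun y hy => by rw [hs, map_one, map_one]
      map_mul' := fun a b => hext _ _ fun y hy => by
        rw [hs, map_mul, map_mul, hs, hs]
      map_zero' := hext _ _ fun y hy => by rw [hs, map_zero, map_zero]
      map_add' := fun a b => hext _ _ fun y hy => by
        rw [hs, map_add, map_add, hs, hs] }, fun y hy => ?_⟩
  ext c
  exact hs c y hy

theorem isUnit_of_germs {U : T.Opens} (a : Γ(T, U))
    (h : ∀ (y : T) (hy : y ∈ U), IsUnit (T.presheaf.germ U y hy a)) : IsUnit a :=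
  T.toLocallyRingedSpace.toRingedSpace.isUnit_of_isUnit_germ U a h

/-- The ring homomorphism `A → O_{T,y}` induced by a morphism `T → Spec A`. -/
def stalkHom {A : CommRingCat.{u}} (g : T ⟶ Spec A) (y : T) : A ⟶ T.presheaf.stalk y :=
  ((Scheme.ΓSpecIso A).inv ≫ g.appTop) ≫ T.presheaf.germ ⊤ y (Opens.mem_top y)

theorem stalkHom_comp {T' : Scheme.{u}} {A : CommRingCat.{u}} (h : T' ⟶ T) (g : T ⟶ Spec A)
    (y : T') : stalkHom (h ≫ g) y = stalkHom g (h y) ≫ h.stalkMap y := by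
  have e : T.presheaf.germ ⊤ (h y) (Opens.mem_top _) ≫ h.stalkMap y =
      h.appTop ≫ T'.presheaf.germ ⊤ y (Opens.mem_top y) :=
    Scheme.Hom.germ_stalkMap h ⊤ y (Opens.mem_top _)
  rw [stalkHom, stalkHom, Category.assoc, Category.assoc, Category.assoc, e, Scheme.Hom.comp_appTop,
    Category.assoc]

theorem stalkHom_ext {A : CommRingCat.{u}} {g g' : T ⟶ Spec A}
    (h : ∀ y, stalkHom g y = stalkHom g' y) : g = g' :=
  (ΓSpec.adjunction.homEquiv T (op A)).symm.injective <| Quiver.Hom.unop_inj <|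
    ringHom_ext_of_germs (fun y _ => h y)

theorem exists_stalkHom_eq {A : CommRingCat.{u}} (ψ : A ⟶ Γ(T, ⊤)) :
    ∃ g : T ⟶ Spec A, ∀ y, stalkHom g y = ψ ≫ T.presheaf.germ ⊤ y (Opens.mem_top y) := by
  refine ⟨ΓSpec.adjunction.homEquiv T (op A) ψ.op, fun y => ?_⟩
  rw [stalkHom, ΓSpecIso_inv_ΓSpec_adjunction_homEquiv]

theorem exists_stalkHom_eq_of_germs {A : CommRingCat.{u}} (χ : ∀ y : T, A ⟶ T.presheaf.stalk y)
    (h : ∀ x : T, ∃ V : T.Opens, x ∈ V ∧ ∃ ψ : A ⟶ Γ(T, V), ∀ (y : T) (hy : y ∈ V),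
      ψ ≫ T.presheaf.germ V y hy = χ y) :
    ∃ g : T ⟶ Spec A, ∀ y, stalkHom g y = χ y := by
  obtain ⟨ψ, hψ⟩ := exists_ringHom_of_germs ⊤ χ fun x _ => h x
  obtain ⟨g, hg⟩ := exists_stalkHom_eq ψ
  exact ⟨g, fun y => (hg y).trans (hψ y trivial)⟩

end StalkGluing

/-- A functor on rings with a family of points such that every point is determined by
its classifying homomorphism, and the overlap of two of these charts is given by a single
inequality. -/
structure ChartedFunctor where
  /-- the functor -/
  L : CommRingCat.{u} ⥤ Type u
  /-- the index set of the charts -/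
  ι : Type u
  /-- the coordinate rings of the charts -/
  A : ι → CommRingCat.{u}
  /-- the universal points of the charts -/
  a : ∀ i, L.obj (A i)
  injective : ∀ (i : ι) {S : CommRingCat.{u}} (ψ ψ' : A i ⟶ S), L.map ψ (a i) = L.map ψ' (a i) → ψ = ψ'
  /-- the equation of the complement of the overlap of two charts -/
  d : ι → ∀ j, A j
  isUnit_iff : ∀ (i j : ι) {S : CommRingCat.{u}} (ψ : A j ⟶ S),
    (∃ χ : A i ⟶ S, L.map χ (a i) = L.map ψ (a j)) ↔ IsUnit (ψ (d i j))

namespace ChartedFunctor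

open Opposite Limits

variable (E : ChartedFunctor.{u})

/-- Families of points over the stalks of a scheme which are locally induced by charts. -/
def IsLocal {T : Scheme.{u}} (ξ : ∀ x : T, E.L.obj (T.presheaf.stalk x)) : Prop :=
  ∀ x : T, ∃ U : T.Opens, x ∈ U ∧ ∃ i, ∃ ψ : E.A i ⟶ Γ(T, U), ∀ (y : T) (hy : y ∈ U),
    ξ y = E.L.map (ψ ≫ T.presheaf.germ U y hy) (E.a i)

variable {E}

/-- Pull-back of families of points over the stalks. -/
def pullbackStalks {T T' : Scheme.{u}} (h : T' ⟶ T) (ξ : ∀ x : T, E.L.obj (T.presheaf.stalk x)) :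
    ∀ x : T', E.L.obj (T'.presheaf.stalk x) :=
  fun x => E.L.map (h.stalkMap x) (ξ (h x))

theorem IsLocal.pullbackStalks {T T' : Scheme.{u}} (h : T' ⟶ T)
    {ξ : ∀ x : T, E.L.obj (T.presheaf.stalk x)} (hξ : E.IsLocal ξ) :
    E.IsLocal (pullbackStalks h ξ) := by
  intro x
  obtain ⟨U, hx, i, ψ, hψ⟩ := hξ (h x)
  refine ⟨h ⁻¹ᵁ U, hx, i, ψ ≫ h.app U, fun y hy => ?_⟩
  have hy' : h y ∈ U := hy
  have e : T.presheaf.germ U (h y) hy' ≫ h.stalkMap y =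
      h.app U ≫ T'.presheaf.germ (h ⁻¹ᵁ U) y hy := Scheme.Hom.germ_stalkMap h U y hy'
  rw [ChartedFunctor.pullbackStalks, hψ _ hy', ← Functor.map_comp_apply, Category.assoc, e,
    Category.assoc]

variable (E)

/-- The functor of local families of points over the stalks. -/
def stalkFunctor : Scheme.{u}ᵒᵖ ⥤ Type u where
  obj T := {ξ : ∀ x : T.unop, E.L.obj (T.unop.presheaf.stalk x) // E.IsLocal ξ}
  map h := ↾fun ξ => ⟨pullbackStalks h.unop ξ.1, ξ.2.pullbackStalks h.unop⟩
  map_id T := by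
    refine ConcreteCategory.hom_ext _ _ fun ξ => Subtype.ext (funext fun x => ?_)
    exact (congrArg (fun f => E.L.map f (ξ.1 x)) (Scheme.Hom.stalkMap_id T.unop x)).trans
      (Functor.map_id_apply E.L _ _)
  map_comp h g := by
    refine ConcreteCategory.hom_ext _ _ fun ξ => Subtype.ext (funext fun x => ?_)
    exact (congrArg (fun f => E.L.map f (ξ.1 (h.unop (g.unop x))))
      (Scheme.Hom.stalkMap_comp g.unop h.unop x)).trans (Functor.map_comp_apply E.L _ _ _)

variable {E}

/-- A local family which is pointwise in a chart is induced by a morphism to the chart. -/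
theorem exists_stalkHom {T : Scheme.{u}} {ξ : ∀ x : T, E.L.obj (T.presheaf.stalk x)}
    (hξ : E.IsLocal ξ) (i : E.ι) (h : ∀ x : T, ∃ χ : E.A i ⟶ T.presheaf.stalk x,
      ξ x = E.L.map χ (E.a i)) :
    ∃ g : T ⟶ Spec (E.A i), ∀ x, ξ x = E.L.map (stalkHom g x) (E.a i) := by
  choose χ hχ using h
  obtain ⟨g, hg⟩ := exists_stalkHom_eq_of_germs χ fun x => by
    obtain ⟨U, hx, j, ψ, hψ⟩ := hξ x
    -- Lying in chart `i` at every stalk makes the overlap equation a unit in every stalk, hence a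
    -- unit on U. The classifying homomorphism then exists over U, and its germs are the given ones
    -- by injectivity.
    have hu : IsUnit (ψ (E.d i j)) := isUnit_of_germs _ fun y hy => by
      have := (E.isUnit_iff i j (ψ ≫ T.presheaf.germ U y hy)).1
        ⟨χ y, (hχ y).symm.trans (hψ y hy)⟩
      rwa [ConcreteCategory.comp_apply] at this
    obtain ⟨ψ', hψ'⟩ := (E.isUnit_iff i j ψ).2 hu
    refine ⟨U, hx, ψ', fun y hy => E.injective i _ _ ?_⟩
    rw [Functor.map_comp_apply, hψ', ← Functor.map_comp_apply, ← hψ, hχ]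
  exact ⟨g, fun x => by rw [hg, hχ]⟩

/-- The locus where a local family is in a given chart. -/
def chartLocus (i : E.ι) {T : Scheme.{u}} (ξ : ∀ x : T, E.L.obj (T.presheaf.stalk x)) : Set T :=
  {x | ∃ χ : E.A i ⟶ T.presheaf.stalk x, ξ x = E.L.map χ (E.a i)}

/-- Where the family is induced by chart `j`, the locus of chart `i` is the basic open set of the
overlap equation. -/
theorem isOpen_chartLocus (i : E.ι) {T : Scheme.{u}}
    {ξ : ∀ x : T, E.L.obj (T.presheaf.stalk x)} (hξ : E.IsLocal ξ) :
    IsOpen (chartLocus i ξ) := by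
  rw [isOpen_iff_forall_mem_open]
  rintro x ⟨χ, hχ⟩
  obtain ⟨U, hx, j, ψ, hψ⟩ := hξ x
  have hu : ∀ (y : T) (hy : y ∈ U), y ∈ T.basicOpen (ψ (E.d i j)) ↔
      ∃ χ : E.A i ⟶ T.presheaf.stalk y, ξ y = E.L.map χ (E.a i) := fun y hy => by
    rw [Scheme.mem_basicOpen _ _ _ hy, ← ConcreteCategory.comp_apply, ← E.isUnit_iff i j, ← hψ y hy]
    exact ⟨fun ⟨χ, h⟩ => ⟨χ, h.symm⟩, fun ⟨χ, h⟩ => ⟨χ, h.symm⟩⟩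
  exact ⟨T.basicOpen (ψ (E.d i j)), fun y hy => (hu y (T.basicOpen_le _ hy)).1 hy,
    (T.basicOpen _).2, (hu x hx).2 ⟨χ, hχ⟩⟩

/-- The stalk maps are local homomorphisms, so they reflect invertibility of the overlap equation.
-/
theorem mem_chartLocus_pullbackStalks (i : E.ι) {T T' : Scheme.{u}} (h : T' ⟶ T)
    {ξ : ∀ x : T, E.L.obj (T.presheaf.stalk x)} (hξ : E.IsLocal ξ) (x : T') :
    x ∈ chartLocus i (pullbackStalks h ξ) ↔ h x ∈ chartLocus i ξ := by
  constructor
  · rintro ⟨χ, hχ⟩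
    obtain ⟨U, hx, j, ψ, hψ⟩ := hξ (h x)
    have h1 : IsUnit ((ψ ≫ T.presheaf.germ U (h x) hx ≫ h.stalkMap x) (E.d i j)) := by
      rw [← E.isUnit_iff i j]
      refine ⟨χ, ?_⟩
      rw [← hχ, pullbackStalks, hψ _ hx, ← Functor.map_comp_apply, Category.assoc]
    have h2 : IsUnit ((ψ ≫ T.presheaf.germ U (h x) hx) (E.d i j)) := by
      rw [← Category.assoc, ConcreteCategory.comp_apply] at h1
      exact isUnit_of_map_unit (h.stalkMap x).hom _ h1
    obtain ⟨χ', h3⟩ := (E.isUnit_iff i j _).2 h2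
    exact ⟨χ', by rw [h3, ← hψ]⟩
  · rintro ⟨χ, hχ⟩
    exact ⟨χ ≫ h.stalkMap x, by rw [pullbackStalks, hχ, Functor.map_comp_apply]⟩

variable (E)

/-- The morphism from a chart. -/
def chart (i : E.ι) : yoneda.obj (Spec (E.A i)) ⟶ E.stalkFunctor where
  app T := ↾fun g => ⟨fun y => E.L.map (stalkHom (T := T.unop) g y) (E.a i),
    fun x => ⟨⊤, trivial, i, (Scheme.ΓSpecIso (E.A i)).inv ≫ Scheme.Hom.appTop (X := T.unop) g,
      fun _ _ => rfl⟩⟩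
  naturality T T' h := by
    refine ConcreteCategory.hom_ext _ _ fun g => Subtype.ext (funext fun x => ?_)
    change E.L.map (stalkHom (h.unop ≫ g) x) (E.a i) =
      E.L.map (h.unop.stalkMap x) (E.L.map (stalkHom g (h.unop x)) (E.a i))
    rw [stalkHom_comp, Functor.map_comp_apply]

theorem chart_app_injective (i : E.ι) {T : Scheme.{u}} {g g' : T ⟶ Spec (E.A i)}
    (h : (E.chart i).app (op T) g = (E.chart i).app (op T) g') : g = g' :=
  stalkHom_ext fun y => E.injective i _ _ (congrFun (congrArg Subtype.val h) y)

end ChartedFunctor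

namespace ChartedFunctor

open Opposite Limits

variable {E : ChartedFunctor.{u}}

/-- Transport of a point over a stalk along an equality of points. -/
def transport {T : Scheme.{u}} {x y : T} (h : x = y) (ζ : E.L.obj (T.presheaf.stalk y)) :
    E.L.obj (T.presheaf.stalk x) := h ▸ ζ

theorem map_stalkMap_transport {T T' : Scheme.{u}} {h h' : T' ⟶ T} (e : h = h') (x : T')
    {t : T} (hx : h x = t) (hx' : h' x = t) (ζ : E.L.obj (T.presheaf.stalk t)) :
    E.L.map (h.stalkMap x) (transport hx ζ) = E.L.map (h'.stalkMap x) (transport hx' ζ) := by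
  subst e
  rfl

theorem map_stalkMap_comp {T T' T'' : Scheme.{u}} (h : T' ⟶ T) (g : T'' ⟶ T') (x : T'')
    {t : T} (hx : h (g x) = t) (hx' : (g ≫ h) x = t) (ζ : E.L.obj (T.presheaf.stalk t)) :
    E.L.map (g.stalkMap x) (E.L.map (h.stalkMap (g x)) (transport hx ζ)) =
      E.L.map ((g ≫ h).stalkMap x) (transport hx' ζ) := by
  subst hx
  exact ((congrArg (fun f => E.L.map f ζ)
    (Scheme.Hom.stalkMap_comp g h x)).trans (Functor.map_comp_apply E.L _ _ _)).symm

theorem map_stalkMap_injective {T T' : Scheme.{u}} (h : T' ⟶ T) [IsOpenImmersion h] (x : T') :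
    Function.Injective (E.L.map (h.stalkMap x)) := by
  intro a b hab
  have := congrArg (E.L.map (inv (h.stalkMap x))) hab
  rwa [← Functor.map_comp_apply, ← Functor.map_comp_apply, IsIso.hom_inv_id,
    Functor.map_id_apply, Functor.map_id_apply] at this

/-- Stalk maps of open immersions are invertible, so any member of the cover through `t` prescribes
a value at `t`. Two members agree because both are compared at a point of their fiber product, where
the family is compatible. -/
theorem exists_unique_stalk {T : Scheme.{u}} {R : Presieve T}
    (hR : R ∈ Scheme.precoverage IsOpenImmersion T) {ξ : Presieve.FamilyOfElements E.stalkFunctor R}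
    (hξ : ξ.Compatible) (t : T) :
    ∃ ζ : E.L.obj (T.presheaf.stalk t), ∀ ⦃Y : Scheme.{u}⦄ (f : Y ⟶ T) (hf : R f) (y : Y)
      (hy : f y = t), E.L.map (f.stalkMap y) (transport hy ζ) = (ξ f hf).1 y := by
  obtain ⟨Y, f, hf, y, rfl⟩ := Scheme.JointlySurjective.exists_eq R hR t
  have hopen := hR.2
  have hof : IsOpenImmersion f := hopen hf
  refine ⟨E.L.map (inv (f.stalkMap y)) ((ξ f hf).1 y), ?_⟩
  intro Y' f' hf' y' hy'
  have hof' : IsOpenImmersion f' := hopen hf'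
  obtain ⟨z, hz, hz'⟩ := Scheme.Pullback.exists_preimage_pullback y y' hy'.symm
  subst hz hz'
  apply map_stalkMap_injective (pullback.snd f f') z
  have h1 : (pullback.snd f f' ≫ f') z = f (pullback.fst f f' z) := hy'
  have h2 : (pullback.fst f f' ≫ f) z = f (pullback.fst f f' z) := rfl
  have hc := congrFun (congrArg Subtype.val (hξ (pullback.fst f f') (pullback.snd f f') hf hf'
    pullback.condition)) z
  refine (map_stalkMap_comp f' (pullback.snd f f') z hy' h1 _).trans (Eq.trans ?_ hc)
  rw [map_stalkMap_transport pullback.condition.symm z h1 h2, ← map_stalkMap_comp f _ z rfl h2]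
  refine congrArg _ ?_
  change E.L.map (f.stalkMap _) (E.L.map _ _) = _
  rw [← Functor.map_comp_apply, IsIso.inv_hom_id, Functor.map_id_apply]
  rfl

-- Families over the stalks glue point by point, and being locally induced by a chart is a local
-- condition. No sheaf property of the functor `E.L` is needed.
variable (E) in
theorem isSheaf_stalkFunctor : Presieve.IsSheaf Scheme.zariskiTopology E.stalkFunctor := by
  rw [Precoverage.isSheaf_toGrothendieck_iff_of_isStableUnderBaseChange]
  intro T R hR ξ hξ
  choose ζ hζ using exists_unique_stalk hR hξ
  have hζ' : ∀ ⦃Y : Scheme.{u}⦄ (f : Y ⟶ T) (hf : R f) (y : Y),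
      E.L.map (f.stalkMap y) (ζ (f y)) = (ξ f hf).1 y := fun Y f hf y => hζ (f y) f hf y rfl
  have hlocal : E.IsLocal ζ := by
    intro t
    obtain ⟨Y, f, hf, y, rfl⟩ := Scheme.JointlySurjective.exists_eq R hR t
    have hof : IsOpenImmersion f := hR.2 hf
    obtain ⟨U, hy, i, ψ, hψ⟩ := (ξ f hf).2 y
    refine ⟨f ''ᵁ U, ⟨y, hy, rfl⟩, i, ψ ≫ (f.appIso U).inv, ?_⟩
    rintro _ ⟨y', hy', rfl⟩
    refine map_stalkMap_injective f y' ((hζ' f hf y').trans ((hψ y' hy').trans ?_))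
    have hm : f y' ∈ f ''ᵁ U := ⟨y', hy', rfl⟩
    have e : (f.appIso U).inv ≫ T.presheaf.germ (f ''ᵁ U) (f y') hm ≫ f.stalkMap y' =
        Y.presheaf.germ U y' hy' := by
      rw [Scheme.Hom.germ_stalkMap, Scheme.Hom.appIso_inv_app_assoc]
      exact TopCat.Presheaf.germ_res _ _ _ _
    refine (congrArg (fun g => E.L.map (ψ ≫ g) (E.a i)) e.symm).trans ?_
    refine Eq.trans ?_ (Functor.map_comp_apply E.L _ (f.stalkMap y') (E.a i))
    simp only [Category.assoc]
    rfl
  refine ⟨⟨ζ, hlocal⟩, fun Y f hf => Subtype.ext (funext fun y => hζ' f hf y), ?_⟩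
  intro ζ' h'
  refine Subtype.ext (funext fun t => ?_)
  obtain ⟨Y, f, hf, y, rfl⟩ := Scheme.JointlySurjective.exists_eq R hR t
  have hof : IsOpenImmersion f := hR.2 hf
  apply map_stalkMap_injective f y
  rw [hζ' f hf y]
  exact congrFun (congrArg Subtype.val (h' f hf)) y

-- The fiber product of a chart with a scheme T over the functor of local families is the open chart
-- locus in T: over this locus `exists_stalkHom` produces the morphism to the chart, and it is
-- unique.
variable (E) in
theorem isOpenImmersion_chart (i : E.ι) : IsOpenImmersion.presheaf (E.chart i) := by
  refine MorphismProperty.relative.of_exists fun T g => ?_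
  obtain ⟨ξ, rfl⟩ := yonedaEquiv.symm.surjective g
  let W : T.Opens := ⟨chartLocus i ξ.1, isOpen_chartLocus i ξ.2⟩
  obtain ⟨p, hp⟩ := exists_stalkHom (ξ.2.pullbackStalks W.ι) i fun x =>
    (mem_chartLocus_pullbackStalks i W.ι ξ.2 x).2 x.2
  refine ⟨W, yoneda.map p, W.ι, ?_, inferInstance⟩
  have hw : ∀ (Z : Scheme.{u}) (h : Z ⟶ W), (E.chart i).app (op Z) (h ≫ p) =
      E.stalkFunctor.map (h ≫ W.ι).op ξ := by
    intro Z h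
    have h1 : (E.chart i).app (op W) p = E.stalkFunctor.map W.ι.op ξ :=
      Subtype.ext (funext fun x => (hp x).symm)
    have h2 := NatTrans.naturality_apply (E.chart i) h.op p
    refine h2.trans ?_
    rw [h1, op_comp, Functor.map_comp_apply]
  refine IsPullback.of_forall_isPullback_app fun Z => ?_
  rw [Types.isPullback_iff]
  refine ⟨ConcreteCategory.hom_ext _ _ fun h => hw _ h, ?_, ?_⟩
  · rintro h h' ⟨-, e⟩
    exact (cancel_mono W.ι).1 e
  · intro (q : unop Z ⟶ Spec (E.A i)) (h : unop Z ⟶ T) e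
    replace e : (E.chart i).app Z q = E.stalkFunctor.map h.op ξ := e
    have hrange : Set.range h ⊆ Set.range W.ι := by
      rintro _ ⟨z, rfl⟩
      rw [Scheme.Opens.range_ι]
      refine (mem_chartLocus_pullbackStalks i h ξ.2 z).1 ?_
      exact ⟨stalkHom q z, (congrFun (congrArg Subtype.val e) z).symm⟩
    refine ⟨IsOpenImmersion.lift W.ι h hrange, ?_, IsOpenImmersion.lift_fac _ _ _⟩
    apply E.chart_app_injective i
    refine (hw _ _).trans ?_
    rw [IsOpenImmersion.lift_fac]
    exact e.symm

/-- Every point of the base lies in the chart locus of some chart, and these loci are open, so the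
family comes from charts on an open cover. -/
instance isLocallySurjective_chart :
    Presheaf.IsLocallySurjective Scheme.zariskiTopology (Sigma.desc E.chart) where
  imageSieve_mem {T} ξ := by
    rw [Scheme.mem_grothendieckTopology_iff]
    choose i χ hχ using fun t : T => show ∃ i, t ∈ chartLocus i ξ.1 by
      obtain ⟨U, ht, i, ψ, hψ⟩ := ξ.2 t
      exact ⟨i, _, hψ t ht⟩
    let W : T → T.Opens := fun t => ⟨chartLocus (i t) ξ.1, isOpen_chartLocus (i t) ξ.2⟩
    refine ⟨Scheme.Cover.mkOfCovers T (fun t => W t) (fun t => (W t).ι)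
      (fun t => ⟨t, ⟨t, χ t, hχ t⟩, rfl⟩), ?_⟩
    rintro _ _ ⟨t⟩
    obtain ⟨p, hp⟩ := exists_stalkHom (ξ.2.pullbackStalks (W t).ι) (i t) fun x =>
      (mem_chartLocus_pullbackStalks (i t) (W t).ι ξ.2 x).2 x.2
    refine ⟨(Sigma.ι (fun i => yoneda.obj (Spec (E.A i))) (i t)).app _ p, ?_⟩
    have : (Sigma.ι (fun i => yoneda.obj (Spec (E.A i))) (i t)) ≫ Sigma.desc E.chart =
      E.chart (i t) := Sigma.ι_desc _ _
    have := ConcreteCategory.congr_hom (NatTrans.congr_app this (op (W t))) p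
    refine this.trans ?_
    exact Subtype.ext (funext fun x => (hp x).symm)

variable (E) in
theorem exists_representableBy : ∃ M : Scheme.{u}, Nonempty (E.stalkFunctor.RepresentableBy M) :=
  ⟨_, ⟨Scheme.LocalRepresentability.representableBy
    (F := ⟨E.stalkFunctor, (isSheaf_iff_isSheaf_of_type _ _).2 E.isSheaf_stalkFunctor⟩)
    E.isOpenImmersion_chart⟩⟩

end ChartedFunctor

/-! ### Charts of the splitting model -/

section Conditions

variable {m : ℕ} {R : Type*} [CommRing R]

/-- The closed conditions defining the splitting model. -/
structure SplConditions (ϖ : R) (F G : Submodule R (Ind m → R)) : Prop where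
  le : G ≤ F
  isotropic : ∀ x ∈ F, ∀ y ∈ F, symm x y = 0
  split_F : ∀ x ∈ F, opPlus ϖ x ∈ G
  split_G : ∀ x ∈ G, opMinus ϖ x = 0

theorem IsSpl.conditions {s : ℕ} {R : Type u} [CommRing R] {ϖ : R} {F G : Submodule R (Ind m → R)}
    (h : IsSpl s ϖ F G) : SplConditions ϖ F G :=
  ⟨h.le, h.isotropic, h.split_F, h.split_G⟩

theorem SplConditions.extend {ϖ : R} {F G : Submodule R (Ind m → R)} (h : SplConditions ϖ F G)
    {S : Type*} [CommRing S] (φ : R →+* S) :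
    SplConditions (φ ϖ) (extend φ F) (extend φ G) where
  le := extend_mono φ h.le
  isotropic x hx y hy := by
    induction hx, hy using Submodule.span_induction₂ with
    | mem_mem x y hx hy =>
      obtain ⟨x, hx, rfl⟩ := hx
      obtain ⟨y, hy, rfl⟩ := hy
      rw [symm_map, h.isotropic x hx y hy, map_zero]
    | zero_left y _ => simp
    | zero_right x _ => simp
    | add_left x x' y _ _ _ h h' => simp [h, h']
    | add_right x y y' _ _ _ h h' => simp [h, h']
    | smul_left c x y _ _ h => simp [h]
    | smul_right c x y _ _ h => simp [h]
  split_F x hx := by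
    induction hx using Submodule.span_induction with
    | mem x hx =>
      obtain ⟨x, hx, rfl⟩ := hx
      rw [opPlus_map]
      exact mem_extend φ (h.split_F x hx)
    | zero => rw [map_zero]; exact Submodule.zero_mem _
    | add x y _ _ h h' => rw [map_add]; exact Submodule.add_mem _ h h'
    | smul c x _ h => rw [map_smul]; exact Submodule.smul_mem _ c h
  split_G x hx := by
    induction hx using Submodule.span_induction with
    | mem x hx =>
      obtain ⟨x, hx, rfl⟩ := hx
      rw [opMinus_map, h.split_G x hx]
      ext; simp
    | zero => rw [map_zero]
    | add x y _ _ h h' => rw [map_add, h, h', add_zero]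
    | smul c x _ h => rw [map_smul, h, smul_zero]

/-- The set of coordinates `x_j`, `j ∈ J`, and `y_i`, `n + 1 - i ∉ J`. -/
def chartSet (J : Finset (Fin (2 * m))) : Finset (Ind m) :=
  J.disjSum (Jᶜ.map Fin.revPerm.toEmbedding)

@[simp] theorem inl_mem_chartSet {J : Finset (Fin (2 * m))} {i} :
    Sum.inl i ∈ chartSet J ↔ i ∈ J := by simp [chartSet]

@[simp] theorem inr_mem_chartSet {J : Finset (Fin (2 * m))} {i} :
    Sum.inr i ∈ chartSet J ↔ i.rev ∉ J := by
  simp only [chartSet, Finset.inr_mem_disjSum, Finset.mem_map, Finset.mem_compl,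
    Equiv.coe_toEmbedding, Fin.revPerm_apply]
  exact ⟨by rintro ⟨j, hj, rfl⟩; rwa [Fin.rev_rev], fun h => ⟨_, h, Fin.rev_rev _⟩⟩

theorem card_chartSet (J : Finset (Fin (2 * m))) : (chartSet J).card = 2 * m := by
  rw [chartSet, Finset.card_disjSum, Finset.card_map, Finset.card_compl, Fintype.card_fin]
  have := J.card_le_univ
  rw [Fintype.card_fin] at this
  omega

end Conditions

/-! ### Charts of isotropic subspaces over a field and the spin parity -/

section FieldCharts

variable {m : ℕ} {K : Type*} [Field K]

/-- The operator depends only on x, and x ↦ (ϖx, x) is injective for every ϖ. The spin condition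
thus has the same form in both fibers. -/
theorem finrank_map_opPlus (ϖ : K) (F : Submodule K (Ind m → K)) :
    Module.finrank K (F.map (opPlus ϖ)) = Module.finrank K (F.map fstHalf) := by
  let T : (Fin (2 * m) → K) →ₗ[K] (Ind m → K) :=
    { toFun := fun v => Sum.elim (fun i => ϖ * v i) v
      map_add' := fun v w => by ext (i | i) <;> simp [mul_add]
      map_smul' := fun c v => by ext (i | i) <;> simp [mul_left_comm] }
  have hT : Function.Injective T := fun v w h => funext fun i => congrFun h (Sum.inr i)
  have : F.map (opPlus ϖ) = (F.map fstHalf).map T := by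
    rw [← Submodule.map_comp]
    rfl
  rw [this]
  exact (Submodule.equivMapOfInjective T hT _).finrank_eq.symm

theorem sgn_ne_zero (i : Fin (2 * m)) : (sgn i : K) ≠ 0 := by
  simp only [sgn]
  split_ifs <;> simp

/-- An isotropic subspace of maximal dimension is in the chart of a set `J` such that the
projection to the first half of the coordinates is in the chart of `J`. -/
theorem exists_eq_graph_chartSet {F : Submodule K (Ind m → K)}
    (hF : Module.finrank K F = 2 * m) (hiso : ∀ x ∈ F, ∀ y ∈ F, symm x y = 0)
    {J : Finset (Fin (2 * m))} {b₀} (hJ : F.map fstHalf = graph J b₀) :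
    ∃ b, F = graph (chartSet J) b := by
  refine exists_eq_graph_of_card F _ ((card_chartSet J).trans hF.symm) fun u hu h => ?_
  have hx : fstHalf u = 0 := by
    have h1 : fstHalf u ∈ graph J b₀ := hJ ▸ ⟨u, hu, rfl⟩
    exact eq_of_mem_graph h1 (Submodule.zero_mem _) fun j hj => h _ (inl_mem_chartSet.2 hj)
  have hy : ∀ i, u (Sum.inr i) = 0 := by
    intro i
    by_cases hi : i.rev ∈ J
    -- Pair `u` with an element of F whose x-part is the row of `i.rev`. The y-coordinates of `u`
    -- belonging to the chart vanish by assumption, so isotropy leaves only ± the coordinate y_i of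
    -- `u`.
    · have h1 : graphRow J b₀ i.rev ∈ F.map fstHalf := hJ ▸ graphRow_mem b₀ hi
      obtain ⟨f, hf, hfi⟩ := h1
      have h2 := hiso f hf u hu
      rw [symm_apply, hx, map_zero, LinearMap.zero_apply, add_zero, hfi, alt_apply,
        Finset.sum_eq_single i.rev] at h2
      · rw [graphRow_self _ _ hi, if_pos rfl, one_mul, Fin.rev_rev] at h2
        exact (mul_eq_zero.1 h2).resolve_left (sgn_ne_zero _)
      · intro j _ hj
        by_cases hjJ : j ∈ J
        · rw [graphRow_self _ _ hjJ, if_neg hj, zero_mul, mul_zero]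
        · rw [sndHalf_apply, h _ (inr_mem_chartSet.2 (by rwa [Fin.rev_rev])), mul_zero, mul_zero]
      · simp
    · exact h _ (inr_mem_chartSet.2 hi)
  ext (i | i)
  · exact congrFun hx i
  · exact hy i

/-- On the kernel U of F → K^J, of dimension n - |J|, the form {x, y'} is skew because F is
isotropic, and its kernel is the subspace x = 0, of dimension n - rank. The difference of the two
dimensions is the rank of a skew form, hence even. -/
theorem finrank_map_fstHalf_modEq (h2 : (2 : K) ≠ 0) {J : Finset (Fin (2 * m))} {b}
    (hiso : ∀ x ∈ graph (chartSet J) b, ∀ y ∈ graph (chartSet J) b, symm x y = (0 : K)) :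
    Module.finrank K ((graph (chartSet J) b).map fstHalf) ≡ J.card [MOD 2] := by
  set F := graph (chartSet J) b with hF
  let p : F →ₗ[K] (J → K) := (LinearMap.funLeft K K ((↑) : J → Fin (2 * m))) ∘ₗ
    fstHalf ∘ₗ F.subtype
  have hp : ∀ (f : F) (j : J), p f j = f.1 (Sum.inl j) := fun _ _ => rfl
  have hpsurj : Function.Surjective p := by
    intro w
    refine ⟨∑ j : J, w j • ⟨graphRow (chartSet J) b (Sum.inl j),
      graphRow_mem b (inl_mem_chartSet.2 j.2)⟩, ?_⟩
    ext j
    rw [map_sum, Finset.sum_apply, Finset.sum_eq_single j]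
    · rw [map_smul, Pi.smul_apply, hp]
      change w j • graphRow (chartSet J) b (Sum.inl j.1) (Sum.inl j.1) = _
      rw [graphRow_self _ _ (inl_mem_chartSet.2 j.2)]
      simp
    · intro j' _ hj'
      rw [map_smul, Pi.smul_apply, hp]
      change w j' • graphRow (chartSet J) b (Sum.inl j'.1) (Sum.inl j.1) = _
      rw [graphRow_self _ _ (inl_mem_chartSet.2 j.2)]
      simp [Subtype.ext_iff.not.1 hj'.symm]
    · simp
  let U : Submodule K F := LinearMap.ker p
  let B : LinearMap.BilinForm K U :=
    (alt.compl₁₂ (fstHalf ∘ₗ F.subtype ∘ₗ U.subtype) (sndHalf ∘ₗ F.subtype ∘ₗ U.subtype))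
  have hBapp : ∀ u v : U, B u v = alt (fstHalf u.1.1) (sndHalf v.1.1) := fun _ _ => rfl
  have hB : ∀ u v, B u v = -B v u := fun u v => by
    have := hiso u.1.1 u.1.2 v.1.1 v.1.2
    rw [symm_apply] at this
    exact eq_neg_of_add_eq_zero_left this
  have heven := even_finrank_sub_finrank_ker (U := U) h2 B hB
  have hker : LinearMap.ker B = LinearMap.ker (fstHalf ∘ₗ F.subtype ∘ₗ U.subtype) := by
    ext u
    rw [LinearMap.mem_ker, LinearMap.mem_ker]
    constructor
    · intro hu
      have huJ : ∀ j ∈ J, u.1.1 (Sum.inl j) = 0 := fun j hj => congrFun u.2 (⟨j, hj⟩ : J)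
      ext i
      change u.1.1 (Sum.inl i) = 0
      by_cases hi : i ∈ J
      · exact huJ i hi
      · have hmem : Sum.inr i.rev ∈ chartSet J := inr_mem_chartSet.2 (by rwa [Fin.rev_rev])
        -- Rows of the chart at y-coordinates lie in U, and pairing with them reads off the
        -- x-coordinates of `u` outside J.
        let v : U := ⟨⟨graphRow (chartSet J) b (Sum.inr i.rev), graphRow_mem b hmem⟩, by
          rw [LinearMap.mem_ker]
          ext j
          rw [hp]
          change graphRow (chartSet J) b (Sum.inr i.rev) (Sum.inl j.1) = _
          rw [graphRow_self _ _ (inl_mem_chartSet.2 j.2)]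
          simp⟩
        have h1 : B u v = 0 := by rw [hu]; rfl
        rw [hBapp, alt_apply, Finset.sum_eq_single i] at h1
        · have h3 : v.1.1 (Sum.inr i.rev) = 1 := by
            change graphRow _ _ _ _ = _
            rw [graphRow_self _ _ hmem, if_pos rfl]
          rw [sndHalf_apply, h3, mul_one] at h1
          exact (mul_eq_zero.1 h1).resolve_left (sgn_ne_zero _)
        · intro j _ hj
          by_cases hjJ : j ∈ J
          · rw [fstHalf_apply, huJ j hjJ, zero_mul, mul_zero]
          · have hmem' : Sum.inr j.rev ∈ chartSet J := inr_mem_chartSet.2 (by rwa [Fin.rev_rev])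
            have h3 : v.1.1 (Sum.inr j.rev) = 0 := by
              change graphRow _ _ _ _ = _
              rw [graphRow_self _ _ hmem', if_neg]
              simpa using hj
            rw [sndHalf_apply, h3, mul_zero, mul_zero]
        · simp
    · intro hu
      ext v
      rw [hBapp]
      change alt ((fstHalf ∘ₗ F.subtype ∘ₗ U.subtype) u) _ = _
      rw [hu]
      simp
  have hk : Module.finrank K (LinearMap.ker B) = Module.finrank K (LinearMap.ker
      (fstHalf ∘ₗ F.subtype)) := by
    have hmap : (LinearMap.ker B).map U.subtype = LinearMap.ker (fstHalf ∘ₗ F.subtype) := by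
      rw [hker]
      ext v
      constructor
      · rintro ⟨u, hu, rfl⟩
        exact hu
      · intro hv
        refine ⟨⟨v, LinearMap.mem_ker.2 (funext fun j => ?_)⟩, hv, rfl⟩
        exact congrFun hv (j : Fin (2 * m))
    rw [← hmap, Submodule.finrank_map_subtype_eq]
  have h3 := LinearMap.finrank_range_add_finrank_ker p
  rw [LinearMap.range_eq_top.2 hpsurj, finrank_top, Module.finrank_fintype_fun_eq_card,
    Fintype.card_coe] at h3
  have h4 := LinearMap.finrank_range_add_finrank_ker (fstHalf ∘ₗ F.subtype)
  rw [LinearMap.range_comp, Submodule.range_subtype] at h4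
  rw [hk] at heven
  have h5 : Module.finrank K (LinearMap.ker (fstHalf ∘ₗ F.subtype)) ≤ Module.finrank K U := by
    rw [← hk]; exact Submodule.finrank_le _
  obtain ⟨c, hc⟩ := heven
  change _ + Module.finrank K U = _ at h3
  rw [Nat.ModEq]
  omega

/-- Every field-valued point of the splitting model is in a chart. -/
theorem exists_chart_of_isSpl {s : ℕ} {F : Submodule K (Ind m → K)}
    (hF : Module.finrank K F = 2 * m) (hiso : ∀ x ∈ F, ∀ y ∈ F, symm x y = 0) {ϖ : K}
    (hspin : Module.finrank K (F.map (opPlus ϖ)) ≡ s [MOD 2]) :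
    ∃ J : Finset (Fin (2 * m)), J.card ≡ s [MOD 2] ∧ ∃ b, F = graph (chartSet J) b := by
  obtain ⟨J, -, hJ, b₀, hb₀⟩ := exists_finset_eq_graph (F.map fstHalf) Finset.univ
    fun u _ h => funext fun i => h i (Finset.mem_univ i)
  rw [finrank_map_opPlus] at hspin
  exact ⟨J, hJ ▸ hspin, exists_eq_graph_chartSet hF hiso hb₀⟩

end FieldCharts

/-! ### The splitting model as a charted functor -/

section Relations

variable {m : ℕ} {R S : Type*} [CommRing R] [CommRing S]

theorem map_graphRow {Q : Type} [DecidableEq Q] (φ : R →+* S) (P : Finset Q) (b : Q → Q → R)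
    (p q : Q) : φ (graphRow P b p q) = graphRow P (fun p q => φ (b p q)) p q := by
  by_cases hq : q ∈ P <;> simp [graphRow, hq, apply_ite φ]

/-- The coordinates of `v` modulo `graph P b`. -/
def defect {Q : Type} [DecidableEq Q] (P : Finset Q) (b : Q → Q → R) (v : Q → R) (q : Q) : R :=
  if q ∈ P then 0 else v q - ∑ p ∈ P, v p * b p q

theorem defect_eq_zero_iff {Q : Type} [DecidableEq Q] {P : Finset Q} {b : Q → Q → R} {v : Q → R} :
    (∀ q, defect P b v q = 0) ↔ v ∈ graph P b := by
  rw [mem_graph]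
  refine forall_congr' fun q => ?_
  by_cases hq : q ∈ P <;> simp [defect, hq, sub_eq_zero]

theorem map_defect {Q : Type} [DecidableEq Q] (φ : R →+* S) (P : Finset Q) (b : Q → Q → R)
    (v : Q → R) (q : Q) :
    φ (defect P b v q) = defect P (fun p q => φ (b p q)) (fun q => φ (v q)) q := by
  by_cases hq : q ∈ P <;> simp [defect, hq]

/-- The equations of the splitting model in a chart. -/
def rel (P P' : Finset (Ind m)) (ϖ : R) (b c : Ind m → Ind m → R) (i : Fin 6) (p q : Ind m) : R :=
  match i with
  -- Cases 0 and 1 kill the matrix entries which do not affect the graphs, so that classifying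
  -- homomorphisms are unique. Cases 2 to 5 are G ⊆ F, isotropy and the two splitting conditions,
  -- tested on rows.
  | 0 => if p ∈ P ∧ q ∉ P then 0 else b p q
  | 1 => if p ∈ P' ∧ q ∉ P' then 0 else c p q
  | 2 => if p ∈ P' then defect P b (graphRow P' c p) q else 0
  | 3 => if p ∈ P ∧ q ∈ P then symm (graphRow P b p) (graphRow P b q) else 0
  | 4 => if p ∈ P then defect P' c (opPlus ϖ (graphRow P b p)) q else 0
  | 5 => if p ∈ P' then opMinus ϖ (graphRow P' c p) q else 0

theorem map_rel (φ : R →+* S) (P P' : Finset (Ind m)) (ϖ : R) (b c : Ind m → Ind m → R)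
    (i : Fin 6) (p q : Ind m) :
    φ (rel P P' ϖ b c i p q) =
      rel P P' (φ ϖ) (fun p q => φ (b p q)) (fun p q => φ (c p q)) i p q := by
  have h : ∀ P : Finset (Ind m), ∀ b : Ind m → Ind m → R, ∀ p,
      graphRow P (fun p q => φ (b p q)) p = fun q => φ (graphRow P b p q) :=
    fun P b p => funext fun q => (map_graphRow φ P b p q).symm
  fin_cases i <;>
    simp only [rel, apply_ite φ, map_zero, map_defect, h, symm_map, opPlus_map, opMinus_map]

/-- The entries of a matrix which are not coordinates of a chart vanish. -/
def Reduced {Q : Type} (P : Finset Q) (b : Q → Q → R) : Prop :=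
  ∀ p q, ¬ (p ∈ P ∧ q ∉ P) → b p q = 0

theorem Reduced.ext {Q : Type} [DecidableEq Q] {P : Finset Q} {b b' : Q → Q → R} (hb : Reduced P b)
    (hb' : Reduced P b') (h : graph P b = graph P b') : b = b' := by
  ext p q
  by_cases hpq : p ∈ P ∧ q ∉ P
  · exact graph_injective h hpq.1 hpq.2
  · rw [hb p q hpq, hb' p q hpq]

theorem exists_reduced {Q : Type} [DecidableEq Q] (P : Finset Q) (b : Q → Q → R) :
    ∃ b', Reduced P b' ∧ graph P b = graph P b' :=
  ⟨fun p q => if p ∈ P ∧ q ∉ P then b p q else 0, fun _ _ h => if_neg h,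
    graph_congr fun _ hp _ hq => (if_pos ⟨hp, hq⟩).symm⟩

theorem rel_eq_zero_iff {P P' : Finset (Ind m)} {ϖ : R} {b c : Ind m → Ind m → R} :
    (∀ i p q, rel P P' ϖ b c i p q = 0) ↔
      Reduced P b ∧ Reduced P' c ∧ SplConditions ϖ (graph P b) (graph P' c) := by
  constructor
  · intro h
    have h2 : ∀ p ∈ P', graphRow P' c p ∈ graph P b := fun p hp =>
      defect_eq_zero_iff.1 fun q => by simpa [rel, hp] using h 2 p q
    have h3 : ∀ p ∈ P, ∀ q ∈ P, symm (graphRow P b p) (graphRow P b q) = 0 := fun p hp q hq => by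
      simpa [rel, hp, hq] using h 3 p q
    have h4 : ∀ p ∈ P, opPlus ϖ (graphRow P b p) ∈ graph P' c := fun p hp =>
      defect_eq_zero_iff.1 fun q => by simpa [rel, hp] using h 4 p q
    have h5 : ∀ p ∈ P', opMinus ϖ (graphRow P' c p) = 0 := fun p hp =>
      funext fun q => by simpa [rel, hp] using h 5 p q
    refine ⟨fun p q hpq => ?_, fun p q hpq => ?_, graph_le_iff.2 h2, fun x hx y hy => ?_,
      fun x hx => ?_, fun x hx => ?_⟩
    · simpa [rel, hpq] using h 0 p q
    · simpa [rel, hpq] using h 1 p q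
    · rw [eq_sum_graphRow hx, eq_sum_graphRow hy, map_sum]
      refine Finset.sum_eq_zero fun q hq => ?_
      rw [map_sum, LinearMap.sum_apply]
      refine Finset.sum_eq_zero fun p hp => ?_
      simp [h3 p hp q hq]
    · rw [eq_sum_graphRow hx, map_sum]
      exact Submodule.sum_mem _ fun p hp => by
        rw [map_smul]; exact Submodule.smul_mem _ _ (h4 p hp)
    · rw [eq_sum_graphRow hx, map_sum]
      exact Finset.sum_eq_zero fun p hp => by rw [map_smul, h5 p hp, smul_zero]
  · rintro ⟨hb, hc, h⟩ i p q
    fin_cases i <;> simp only [rel] <;> split_ifs with hp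
    · rfl
    · exact hb p q hp
    · rfl
    · exact hc p q hp
    · exact defect_eq_zero_iff.2 (h.le (graphRow_mem c hp)) q
    · rfl
    · exact h.isotropic _ (graphRow_mem b hp.1) _ (graphRow_mem b hp.2)
    · rfl
    · exact defect_eq_zero_iff.2 (h.split_F _ (graphRow_mem b hp)) q
    · rfl
    · exact congrFun (h.split_G _ (graphRow_mem c hp)) q
    · rfl

end Relations

/-! ### Coordinate rings of the charts and their universal property -/

section ChartRing

variable {O : Type u} [CommRing O] (ϖ : O) {m : ℕ} (P P' : Finset (Ind m))

/-- The ideal of equations of a chart of the splitting model. -/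
def chartIdeal : Ideal (MvPolynomial ((Ind m × Ind m) ⊕ (Ind m × Ind m)) O) :=
  Ideal.span (Set.range fun i : Fin 6 × Ind m × Ind m =>
    rel P P' (MvPolynomial.C ϖ) (fun p q => MvPolynomial.X (Sum.inl (p, q)))
      (fun p q => MvPolynomial.X (Sum.inr (p, q))) i.1 i.2.1 i.2.2)

/-- The coordinate ring of a chart of the splitting model. -/
abbrev ChartRing : Type u :=
  MvPolynomial ((Ind m × Ind m) ⊕ (Ind m × Ind m)) O ⧸ chartIdeal ϖ P P'

/-- The structure map of the coordinate ring of a chart. -/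
def chartStr : O →+* ChartRing ϖ P P' := (Ideal.Quotient.mk _).comp MvPolynomial.C

/-- The coordinates of `F` in a chart. -/
def chartF (p q : Ind m) : ChartRing ϖ P P' := Ideal.Quotient.mk _ (MvPolynomial.X (Sum.inl (p, q)))

/-- The coordinates of `G` in a chart. -/
def chartG (p q : Ind m) : ChartRing ϖ P P' := Ideal.Quotient.mk _ (MvPolynomial.X (Sum.inr (p, q)))

theorem rel_chart (i : Fin 6) (p q : Ind m) :
    rel P P' (chartStr ϖ P P' ϖ) (chartF ϖ P P') (chartG ϖ P P') i p q = 0 := by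
  have := map_rel (Ideal.Quotient.mk (chartIdeal ϖ P P')) P P' (MvPolynomial.C ϖ)
    (fun p q => MvPolynomial.X (Sum.inl (p, q))) (fun p q => MvPolynomial.X (Sum.inr (p, q))) i p q
  refine Eq.trans this.symm (Ideal.Quotient.eq_zero_iff_mem.2 (Ideal.subset_span ⟨(i, p, q), rfl⟩))

variable {ϖ P P'} {S : Type u} [CommRing S]

theorem chartRing_hom_ext {φ ψ : ChartRing ϖ P P' →+* S}
    (h : φ.comp (chartStr ϖ P P') = ψ.comp (chartStr ϖ P P'))
    (hF : ∀ p q, φ (chartF ϖ P P' p q) = ψ (chartF ϖ P P' p q))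
    (hG : ∀ p q, φ (chartG ϖ P P' p q) = ψ (chartG ϖ P P' p q)) : φ = ψ := by
  refine Ideal.Quotient.ringHom_ext (MvPolynomial.ringHom_ext (fun x => ?_) ?_)
  · exact RingHom.congr_fun h x
  · rintro (⟨p, q⟩ | ⟨p, q⟩)
    · exact hF p q
    · exact hG p q

theorem chartRing_conditions (ψ : ChartRing ϖ P P' →+* S) :
    Reduced P (fun p q => ψ (chartF ϖ P P' p q)) ∧ Reduced P' (fun p q => ψ (chartG ϖ P P' p q)) ∧
      SplConditions (ψ (chartStr ϖ P P' ϖ)) (graph P fun p q => ψ (chartF ϖ P P' p q))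
        (graph P' fun p q => ψ (chartG ϖ P P' p q)) := by
  rw [← rel_eq_zero_iff]
  intro i p q
  rw [← map_rel, rel_chart, map_zero]

theorem exists_chartRing_hom (σ : O →+* S) {b c : Ind m → Ind m → S} (hb : Reduced P b)
    (hc : Reduced P' c) (h : SplConditions (σ ϖ) (graph P b) (graph P' c)) :
    ∃ ψ : ChartRing ϖ P P' →+* S, ψ.comp (chartStr ϖ P P') = σ ∧
      (∀ p q, ψ (chartF ϖ P P' p q) = b p q) ∧ ∀ p q, ψ (chartG ϖ P P' p q) = c p q := by
  let φ : MvPolynomial ((Ind m × Ind m) ⊕ (Ind m × Ind m)) O →+* S :=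
    MvPolynomial.eval₂Hom σ (Sum.elim (fun x => b x.1 x.2) fun x => c x.1 x.2)
  have hφ : ∀ a ∈ chartIdeal ϖ P P', φ a = 0 := by
    have hle : chartIdeal ϖ P P' ≤ RingHom.ker φ := by
      refine Ideal.span_le.2 ?_
      rintro _ ⟨⟨i, p, q⟩, rfl⟩
      have h0 := rel_eq_zero_iff.2 ⟨hb, hc, h⟩ i p q
      change φ (rel _ _ _ _ _ _ _ _) = 0
      rw [map_rel]
      simpa [φ] using h0
    exact fun a ha => hle ha
  refine ⟨Ideal.Quotient.lift _ φ hφ, ?_, fun p q => ?_, fun p q => ?_⟩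
  · ext x
    simp [chartStr, φ]
  · simp [chartF, φ]
  · simp [chartG, φ]

end ChartRing

/-! ### The charted functor of the splitting model -/

section Charted

variable (O : Type u) [CommRing O] (ϖ : O) (m s : ℕ)

/-- The functor of triples of an `O`-algebra structure on `R` and two submodules of `R^{2n}`. -/
def pairFunctor : CommRingCat.{u} ⥤ Type u where
  obj R := (O →+* R) × Submodule R (Ind m → R) × Submodule R (Ind m → R)
  map f := ↾fun x => (f.hom.comp x.1, extend f.hom x.2.1, extend f.hom x.2.2)
  map_id R := by
    refine ConcreteCategory.hom_ext _ _ fun x => ?_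
    exact Prod.ext rfl (Prod.ext (extend_id _) (extend_id _))
  map_comp f g := by
    refine ConcreteCategory.hom_ext _ _ fun x => ?_
    exact Prod.ext rfl (Prod.ext (extend_extend _ _ _).symm (extend_extend _ _ _).symm)

variable {O}

theorem pairFunctor_map {R S : CommRingCat.{u}} (f : R ⟶ S) (x : (pairFunctor O m).obj R) :
    (pairFunctor O m).map f x = (f.hom.comp x.1, extend f.hom x.2.1, extend f.hom x.2.2) := rfl

/-- The charts of the splitting model. -/
abbrev ChartIndex : Type u :=
  ULift.{u} ({J : Finset (Fin (2 * m)) // J.card ≡ s [MOD 2]} × {P : Finset (Ind m) // P.card = s})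

variable {m s}

/-- The coordinates of a chart on `F`. -/
abbrev ChartIndex.setF (i : ChartIndex.{u} m s) : Finset (Ind m) := chartSet i.down.1.1

/-- The coordinates of a chart on `G`. -/
abbrev ChartIndex.setG (i : ChartIndex.{u} m s) : Finset (Ind m) := i.down.2.1

theorem ChartIndex.card_setF (i j : ChartIndex.{u} m s) : i.setF.card = j.setF.card := by
  rw [card_chartSet, card_chartSet]

theorem ChartIndex.card_setG (i j : ChartIndex.{u} m s) : i.setG.card = j.setG.card := by
  rw [i.down.2.2, j.down.2.2]

/-- The universal point of a chart. -/
def chartPoint (i : ChartIndex.{u} m s) :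
    (pairFunctor O m).obj (CommRingCat.of (ChartRing ϖ i.setF i.setG)) :=
  (chartStr ϖ i.setF i.setG, graph i.setF (chartF ϖ i.setF i.setG),
    graph i.setG (chartG ϖ i.setF i.setG))

theorem map_chartPoint (i : ChartIndex.{u} m s) {S : CommRingCat.{u}}
    (ψ : CommRingCat.of (ChartRing ϖ i.setF i.setG) ⟶ S) :
    (pairFunctor O m).map ψ (chartPoint ϖ i) = (ψ.hom.comp (chartStr ϖ i.setF i.setG),
      graph i.setF (fun p q => ψ.hom (chartF ϖ i.setF i.setG p q)),
      graph i.setG (fun p q => ψ.hom (chartG ϖ i.setF i.setG p q))) := by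
  rw [pairFunctor_map, chartPoint]
  exact Prod.ext rfl (Prod.ext (extend_graph _ _ _) (extend_graph _ _ _))

/-- The spin condition does not appear: it is encoded in the index, through |J| ≡ s, and is
recovered later where 2 is invertible. -/
theorem exists_map_chartPoint_eq_iff (i : ChartIndex.{u} m s) {S : CommRingCat.{u}}
    (x : (pairFunctor O m).obj S) :
    (∃ ψ : CommRingCat.of (ChartRing ϖ i.setF i.setG) ⟶ S,
      (pairFunctor O m).map ψ (chartPoint ϖ i) = x) ↔
    SplConditions (x.1 ϖ) x.2.1 x.2.2 ∧ (∃ b, x.2.1 = graph i.setF b) ∧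
      ∃ c, x.2.2 = graph i.setG c := by
  constructor
  · rintro ⟨ψ, rfl⟩
    rw [map_chartPoint]
    exact ⟨(chartRing_conditions ψ.hom).2.2, ⟨_, rfl⟩, ⟨_, rfl⟩⟩
  · obtain ⟨σ, F, G⟩ := x
    rintro ⟨h, ⟨b, hb⟩, ⟨c, hc⟩⟩
    obtain ⟨b', hb', e⟩ := exists_reduced i.setF b
    obtain ⟨c', hc', e'⟩ := exists_reduced i.setG c
    dsimp only at h hb hc
    rw [e] at hb
    rw [e'] at hc
    subst hb hc
    obtain ⟨ψ, h1, h2, h3⟩ := exists_chartRing_hom σ hb' hc' h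
    refine ⟨CommRingCat.ofHom ψ, ?_⟩
    rw [map_chartPoint]
    simp only [CommRingCat.hom_ofHom, h1, h2, h3]
    rfl

variable (m s) in
/-- The splitting model as a charted functor. -/
def splCharted : ChartedFunctor.{u} where
  L := pairFunctor O m
  ι := ChartIndex.{u} m s
  A i := CommRingCat.of (ChartRing ϖ i.setF i.setG)
  a i := chartPoint ϖ i
  injective i S ψ ψ' h := by
    rw [map_chartPoint, map_chartPoint] at h
    obtain ⟨h1, h⟩ := Prod.ext_iff.1 h
    obtain ⟨h2, h3⟩ := Prod.ext_iff.1 h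
    have e2 := (chartRing_conditions ψ.hom).1.ext (chartRing_conditions ψ'.hom).1 h2
    have e3 := (chartRing_conditions ψ.hom).2.1.ext (chartRing_conditions ψ'.hom).2.1 h3
    exact CommRingCat.hom_ext (chartRing_hom_ext h1 (fun p q => congrFun (congrFun e2 p) q)
      fun p q => congrFun (congrFun e3 p) q)
  -- One minor decides whether F is also in chart `i`, the other whether G is; both are needed,
  -- whence the product.
  d i j := ((minor j.setF i.setF (chartF ϖ j.setF j.setG)).submatrix id
      (Finset.equivOfCardEq (j.card_setF i))).det *
    ((minor j.setG i.setG (chartG ϖ j.setF j.setG)).submatrix id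
      (Finset.equivOfCardEq (j.card_setG i))).det
  isUnit_iff i j S ψ := by
    rw [exists_map_chartPoint_eq_iff, map_chartPoint]
    have hdet : ∀ {P P' : Finset (Ind m)} (e : P ≃ P') (b : Ind m → Ind m → _),
        ψ.hom ((minor P P' b).submatrix id e).det =
          ((minor P P' fun p q => ψ.hom (b p q)).submatrix id e).det := by
      intro P P' e b
      rw [RingHom.map_det]
      congr 1
      ext p q
      exact map_graphRow _ _ _ _ _
    refine (and_iff_right (chartRing_conditions ψ.hom).2.2).trans ?_
    dsimp only
    rw [exists_eq_graph_iff (Finset.equivOfCardEq (j.card_setF i)),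
      exists_eq_graph_iff (Finset.equivOfCardEq (j.card_setG i)), ← IsUnit.mul_iff, ← hdet, ← hdet,
      ← map_mul]

/-- A point of the splitting model is locally in a chart. -/
theorem IsSpl.exists_chart {R : CommRingCat.{u}} {σ : O →+* R} {F G : Submodule R (Ind m → R)}
    (h : IsSpl s (σ ϖ) F G) (p : PrimeSpectrum R) :
    ∃ f ∉ p.asIdeal, ∃ i : ChartIndex.{u} m s,
      ∃ χ : CommRingCat.of (ChartRing ϖ i.setF i.setG) ⟶ CommRingCat.of (Localization.Away f),
        (pairFunctor O m).map χ (chartPoint ϖ i) = (pairFunctor O m).map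
          (CommRingCat.ofHom (algebraMap R (Localization.Away f)))
          ((σ, F, G) : (pairFunctor O m).obj R) := by
  let φ := algebraMap R p.asIdeal.ResidueField
  have hφ : ∀ f, φ f ≠ 0 ↔ f ∉ p.asIdeal := fun f => Ideal.algebraMap_residueField_eq_zero.not
  obtain ⟨J, hJ, b₀, hb₀⟩ := exists_chart_of_isSpl (h.locGraph_F.finrank φ)
    (h.conditions.extend φ).isotropic (h.spin _ φ)
  obtain ⟨P, hP, c₀, hc₀⟩ := h.locGraph_G.exists_chart φ
  obtain ⟨f, hf, b, hb⟩ := h.locGraph_F.exists_extend_eq_graph φ hb₀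
  obtain ⟨g, hg, c, hc⟩ := h.locGraph_G.exists_extend_eq_graph φ hc₀
  refine ⟨f * g, (hφ _).1 (by rw [map_mul]; exact mul_ne_zero hf hg), ⟨⟨J, hJ⟩, ⟨P, hP⟩⟩, ?_⟩
  rw [exists_map_chartPoint_eq_iff]
  have hu : IsUnit (algebraMap R (Localization.Away (f * g)) (f * g)) :=
    IsLocalization.Away.algebraMap_isUnit _
  rw [map_mul] at hu
  have hF : extend (algebraMap R (Localization.Away (f * g))) F = graph (chartSet J) fun p q =>
      IsLocalization.Away.lift f (isUnit_of_mul_isUnit_left hu) (b p q) := by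
    rw [← extend_graph, ← hb, extend_extend, IsLocalization.Away.lift_comp]
  have hG : extend (algebraMap R (Localization.Away (f * g))) G = graph P fun p q =>
      IsLocalization.Away.lift g (isUnit_of_mul_isUnit_right hu) (c p q) := by
    rw [← extend_graph, ← hc, extend_extend, IsLocalization.Away.lift_comp]
  exact ⟨h.conditions.extend (algebraMap R (Localization.Away (f * g))), ⟨_, hF⟩, ⟨_, hG⟩⟩

end Charted

/-! ### Points of the splitting model and families over the stalks -/

section Stalks

variable (R : CommRingCat.{u})

/-- The stalk of the structure sheaf of `Spec R`. -/
def SpecStalk (p : PrimeSpectrum R) : Type u := (Spec R).presheaf.stalk (p : Spec R)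

instance specStalkCommRing (p : PrimeSpectrum R) : CommRing (SpecStalk R p) :=
  inferInstanceAs (CommRing ((Spec R).presheaf.stalk (p : Spec R)))

instance specStalkAlgebra (p : PrimeSpectrum R) : Algebra R (SpecStalk R p) :=
  (stalkHom (𝟙 (Spec R)) p).hom.toAlgebra

instance isLocalization_specStalk (p : PrimeSpectrum R) :
    IsLocalization.AtPrime (SpecStalk R p) p.asIdeal :=
  StructureSheaf.IsLocalization.to_stalk R p

variable {R}

theorem algebraMap_germ (U : (Spec R).Opens) (p : Spec R) (hp : p ∈ U) :
    CommRingCat.ofHom (algebraMap R Γ(Spec R, U)) ≫ (Spec R).presheaf.germ U p hp =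
      stalkHom (𝟙 (Spec R)) p := by
  change ((Scheme.ΓSpecIso R).inv ≫ (Spec R).presheaf.map (homOfLE le_top).op) ≫
    (Spec R).presheaf.germ U p hp = _
  rw [Category.assoc, TopCat.Presheaf.germ_res, stalkHom, Scheme.Hom.id_appTop, Category.comp_id]

theorem isLocalization_basicOpen (f : R) (V : (Spec R).Opens)
    (hV : V = PrimeSpectrum.basicOpen f) : IsLocalization.Away f Γ(Spec R, V) := by
  subst hV
  exact StructureSheaf.IsLocalization.to_basicOpen R f

theorem stalkHom_specMap {O : CommRingCat.{u}} (σ : O ⟶ R) (p : Spec R) :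
    stalkHom (Spec.map σ) p = σ ≫ stalkHom (𝟙 (Spec R)) p := by
  have h := Scheme.ΓSpecIso_inv_naturality σ
  rw [stalkHom, ← h]
  rfl

variable {Q : Type} [Fintype Q] [DecidableEq Q]

theorem exists_extend_eq {A : Type*} [CommRing A] {S : Type*} [CommRing S] [Algebra A S]
    (M : Submonoid A) [IsLocalization M S] (N' : Submodule S (Q → S)) :
    ∃ N : Submodule A (Q → A), extend (algebraMap A S) N = N' := by
  let N : Submodule A (Q → A) :=
    (N'.restrictScalars A).comap ((Algebra.linearMap A S).compLeft Q)
  refine ⟨N, le_antisymm ((extend_le _).2 fun v hv => hv) fun w hw => ?_⟩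
  obtain ⟨a, ha⟩ := IsLocalization.exist_integer_multiples_of_finite M w
  choose v hv using ha
  have hvN : v ∈ N := by
    change (fun q => algebraMap A S (v q)) ∈ N'
    convert N'.smul_mem (algebraMap A S a) hw using 1
    ext q
    rw [hv, Algebra.smul_def]
    rfl
  have hu := IsLocalization.map_units S a
  have := Submodule.smul_mem (extend (algebraMap A S) N) (↑hu.unit⁻¹ : S) (mem_extend _ hvN)
  convert this using 1
  ext q
  simp only [Pi.smul_apply, hv, Algebra.smul_def, ← mul_assoc]
  simp

theorem eq_zero_of_stalks {A : Type*} [CommRing A] (L : PrimeSpectrum A → Type*)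
    [∀ p, CommRing (L p)] [∀ p, Algebra A (L p)] [∀ p, IsLocalization.AtPrime (L p) p.asIdeal]
    {a : A} (h : ∀ p, algebraMap A (L p) a = 0) : a = 0 := by
  obtain ⟨e, he⟩ := exists_pow_smul_mem (Q := Unit) (N := (⊥ : Submodule A (Unit → A)))
    (v := fun _ => a) (f := 1) fun p _ => by
      obtain ⟨c, hc⟩ := (IsLocalization.map_eq_zero_iff p.asIdeal.primeCompl (L p) a).1 (h p)
      exact ⟨c, c.2, funext fun _ => hc⟩
  simpa using congrFun he ()

end Stalks

/-! ### Gluing pairs of submodules over an affine scheme -/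

section Gluing

theorem exists_hom_away {A B : CommRingCat.{u}} (f : A) (g : A ⟶ B) (hf : IsUnit (g f)) :
    ∃ l : CommRingCat.of (Localization.Away f) ⟶ B,
      CommRingCat.ofHom (algebraMap A (Localization.Away f)) ≫ l = g :=
  ⟨CommRingCat.ofHom (IsLocalization.Away.lift (g := g.hom) f hf),
    CommRingCat.hom_ext (IsLocalization.Away.lift_comp (g := g.hom) f hf)⟩

variable {m s : ℕ} {A : Type u} [CommRing A] (L : PrimeSpectrum A → Type u) [∀ p, CommRing (L p)]
  [∀ p, Algebra A (L p)] [∀ p, IsLocalization.AtPrime (L p) p.asIdeal]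

/-- Submodules over an open subset of `Spec A` extend to `Spec A`. -/
theorem exists_pair_of_away (f : A) (S : Type u) [CommRing S] [Algebra A S]
    [IsLocalization.Away f S] {P P' : Finset (Ind m)} (b c : Ind m → Ind m → S) :
    ∃ F G : Submodule A (Ind m → A),
      (∃ b', extend (algebraMap A (Localization.Away f)) F = graph P b') ∧
      (∃ c', extend (algebraMap A (Localization.Away f)) G = graph P' c') ∧
      ∀ (T : Type u) [CommRing T] [Algebra A T] (χ : S →+* T),
        χ.comp (algebraMap A S) = algebraMap A T →
        extend (algebraMap A T) F = graph P (fun p q => χ (b p q)) ∧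
        extend (algebraMap A T) G = graph P' (fun p q => χ (c p q)) := by
  obtain ⟨F, hF⟩ := exists_extend_eq (A := A) (Submonoid.powers f) (graph P b)
  obtain ⟨G, hG⟩ := exists_extend_eq (A := A) (Submonoid.powers f) (graph P' c)
  have key : ∀ (T : Type u) [CommRing T] [Algebra A T] (χ : S →+* T),
        χ.comp (algebraMap A S) = algebraMap A T →
        extend (algebraMap A T) F = graph P (fun p q => χ (b p q)) ∧
        extend (algebraMap A T) G = graph P' (fun p q => χ (c p q)) := by
    intro T _ _ χ h
    rw [← h, ← extend_extend, ← extend_extend, hF, hG, extend_graph, extend_graph]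
    exact ⟨rfl, rfl⟩
  obtain ⟨h1, h2⟩ := key (Localization.Away f) (IsLocalization.Away.lift f
    (IsLocalization.Away.algebraMap_isUnit (S := Localization.Away f) f))
    (IsLocalization.Away.lift_comp f _)
  exact ⟨F, G, ⟨_, h1⟩, ⟨_, h2⟩, key⟩

/-- The closed conditions are equalities and inclusions, hence may be tested on stalks. For spin, a
homomorphism to a field factors through a stalk, where F is in a chart with |J| ≡ s, and
`finrank_map_fstHalf_modEq` applies as 2 is invertible. -/
theorem exists_isSpl_of_stalks (h2 : IsUnit (2 : A)) {ϖ : A}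
    (ξF ξG : ∀ p, Submodule (L p) (Ind m → L p))
    (key : ∀ p : PrimeSpectrum A, ∃ f ∉ p.asIdeal, ∃ F G : Submodule A (Ind m → A),
      ∃ i : ChartIndex.{u} m s,
      (∃ b, extend (algebraMap A (Localization.Away f)) F = graph i.setF b) ∧
      (∃ c, extend (algebraMap A (Localization.Away f)) G = graph i.setG c) ∧
      ∀ p' : PrimeSpectrum A, f ∉ p'.asIdeal →
        extend (algebraMap A (L p')) F = ξF p' ∧ extend (algebraMap A (L p')) G = ξG p')
    (cond : ∀ p : PrimeSpectrum A, SplConditions (algebraMap A (L p) ϖ) (ξF p) (ξG p) ∧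
      ∃ J : Finset (Fin (2 * m)), J.card ≡ s [MOD 2] ∧ ∃ b, ξF p = graph (chartSet J) b) :
    ∃ F G, IsSpl s ϖ F G ∧ ∀ p, extend (algebraMap A (L p)) F = ξF p ∧
      extend (algebraMap A (L p)) G = ξG p := by
  obtain ⟨F, hF⟩ := exists_glue L ξF fun p => by
    obtain ⟨f, hf, F, G, i, -, -, h⟩ := key p
    exact ⟨f, hf, F, fun p' hp' => (h p' hp').1⟩
  obtain ⟨G, hG⟩ := exists_glue L ξG fun p => by
    obtain ⟨f, hf, F, G, i, -, -, h⟩ := key p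
    exact ⟨f, hf, G, fun p' hp' => (h p' hp').2⟩
  refine ⟨F, G, ⟨fun p => ?_, fun p => ?_, ?_, fun x hx y hy => ?_, fun x hx => ?_, fun x hx => ?_,
    fun K _ φ => ?_⟩, fun p => ?_⟩
  · obtain ⟨f, hf, F', G', i, ⟨b, hb⟩, -, h⟩ := key p
    refine ⟨f, hf, _, card_chartSet i.down.1.1, b, hb ▸ ?_⟩
    exact le_antisymm (extend_le_of_stalks L f fun p' hp' =>
        ((hF p').trans (h p' hp').1.symm).le) (extend_le_of_stalks L f fun p' hp' =>
        ((hF p').trans (h p' hp').1.symm).ge)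
  · obtain ⟨f, hf, F', G', i, -, ⟨b, hb⟩, h⟩ := key p
    refine ⟨f, hf, _, i.down.2.2, b, hb ▸ ?_⟩
    exact le_antisymm (extend_le_of_stalks L f fun p' hp' =>
        ((hG p').trans (h p' hp').2.symm).le) (extend_le_of_stalks L f fun p' hp' =>
        ((hG p').trans (h p' hp').2.symm).ge)
  · exact le_of_stalks L fun p => by rw [hF, hG]; exact (cond p).1.le
  · refine eq_zero_of_stalks L fun p => ?_
    rw [← symm_map]
    exact (cond p).1.isotropic _ (hF p ▸ mem_extend _ hx) _ (hF p ▸ mem_extend _ hy)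
  · have hle : Submodule.span A {opPlus ϖ x} ≤ G := by
      refine le_of_stalks L fun p => ?_
      rw [extend_span, Set.image_singleton, Submodule.span_singleton_le_iff_mem, hG, ← opPlus_map]
      exact (cond p).1.split_F _ (hF p ▸ mem_extend _ hx)
    exact hle (Submodule.mem_span_singleton_self _)
  · funext q
    refine eq_zero_of_stalks L fun p => ?_
    have h := (cond p).1.split_G _ (hG p ▸ mem_extend _ hx)
    exact congrFun ((opMinus_map (algebraMap A (L p)) ϖ x).symm.trans h) q
  · let p : PrimeSpectrum A := ⟨RingHom.ker φ, RingHom.ker_isPrime φ⟩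
    have hp := p.2
    have hloc : IsLocalization p.asIdeal.primeCompl (L p) :=
      inferInstanceAs (IsLocalization.AtPrime (L p) p.asIdeal)
    let φ' : L p →+* K := IsLocalization.lift (M := p.asIdeal.primeCompl)
      fun y : p.asIdeal.primeCompl => isUnit_iff_ne_zero.2 y.2
    have hφ' : φ'.comp (algebraMap A (L p)) = φ := IsLocalization.lift_comp _
    obtain ⟨h, J, hJ, b, hb⟩ := cond p
    have h2K : (2 : K) ≠ 0 := by
      have := (h2.map φ).ne_zero
      rwa [map_ofNat] at this
    rw [finrank_map_opPlus, ← hφ', ← extend_extend, hF, hb, extend_graph]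
    refine (finrank_map_fstHalf_modEq h2K ?_).trans hJ
    rw [← extend_graph, ← hb]
    exact (h.extend φ').isotropic
  · exact ⟨hF p, hG p⟩

end Gluing

/-! ### Pairs over R as local families over the stalks of Spec R -/

section Families

open ChartedFunctor

variable {O : Type u} [CommRing O] {ϖ : O} {m s : ℕ} {R : CommRingCat.{u}}

/-- The family over the stalks of `Spec R` induced by a pair of submodules over `R`. -/
def stalkFamily (σ : O →+* R) (F G : Submodule R (Ind m → R)) (p : Spec R) :
    (pairFunctor O m).obj ((Spec R).presheaf.stalk p) :=
  (pairFunctor O m).map (stalkHom (𝟙 (Spec R)) p) ((σ, F, G) : (pairFunctor O m).obj R)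

theorem IsSpl.isLocal_stalkFamily {σ : O →+* R} {F G : Submodule R (Ind m → R)}
    (h : IsSpl s (σ ϖ) F G) : (splCharted ϖ m s).IsLocal (T := Spec R) (stalkFamily σ F G) := by
  intro p
  obtain ⟨f, hf, i, χ, hχ⟩ := h.exists_chart ϖ p
  let V : (Spec R).Opens := PrimeSpectrum.basicOpen f
  let S : CommRingCat := Γ(Spec R, V)
  have : IsLocalization.Away f S := isLocalization_basicOpen f V rfl
  have hu : IsUnit (algebraMap R S f) := IsLocalization.Away.algebraMap_isUnit f
  obtain ⟨lft, hl⟩ := exists_hom_away f (CommRingCat.ofHom (algebraMap R S)) hu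
  refine ⟨V, hf, i, χ ≫ lft, fun y hy => ?_⟩
  have hy' : y ∈ V := hy
  have e : CommRingCat.ofHom (algebraMap R (Localization.Away f)) ≫ lft ≫
      (Spec R).presheaf.germ _ y hy' = stalkHom (𝟙 (Spec R)) y := by
    rw [← Category.assoc, hl]
    exact algebraMap_germ _ y hy'
  refine (congrArg (fun g => (pairFunctor O m).map g ((σ, F, G) : (pairFunctor O m).obj R))
    e).symm.trans ?_
  refine ((Functor.map_comp_apply (pairFunctor O m) _ _ _)).trans ?_
  refine (congrArg ((pairFunctor O m).map (lft ≫ (Spec R).presheaf.germ _ y hy')) hχ).symm.trans ?_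
  refine (Functor.map_comp_apply (pairFunctor O m) _ _ _).symm.trans ?_
  exact congrArg (fun g => (pairFunctor O m).map g (chartPoint ϖ i)) (Category.assoc _ _ _).symm

/-- On a basic open set inside a neighbourhood where the family comes from a chart, the universal
pair pulls back and extends to submodules over R; these local pieces are glued. Together with
`stalkFamily_injective` this identifies pairs over R with local families on Spec R having the given
structure homomorphism. -/
theorem exists_isSpl_of_isLocal {σ : O →+* R} (h2 : IsUnit (2 : R))
    {ξ : ∀ p : Spec R, (pairFunctor O m).obj ((Spec R).presheaf.stalk p)}
    (hξ : (splCharted ϖ m s).IsLocal (T := Spec R) ξ)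
    (hσ : ∀ p, (ξ p).1 = (stalkHom (𝟙 (Spec R)) p).hom.comp σ) :
    ∃ F G, IsSpl s (σ ϖ) F G ∧ ∀ p, stalkFamily σ F G p = ξ p := by
  refine Exists.imp (fun F => Exists.imp fun G h => ⟨h.1, fun p => Prod.ext (hσ p).symm
    (Prod.ext (h.2 p).1 (h.2 p).2)⟩) (exists_isSpl_of_stalks (SpecStalk R) h2 (ϖ := σ ϖ) (s := s)
    (fun p => (ξ p).2.1) (fun p => (ξ p).2.2) (fun p => ?_) fun p => ?_)
  · obtain ⟨U, hp, i, ψ, hψ⟩ := hξ p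
    have hUo : IsOpen (U.1 : Set (PrimeSpectrum R)) := U.2
    obtain ⟨_, ⟨_, ⟨f, rfl⟩, rfl⟩, hf, hfU⟩ :=
      PrimeSpectrum.isBasis_basic_opens.exists_subset_of_mem_open hp hUo
    let V : (Spec R).Opens := PrimeSpectrum.basicOpen f
    have hVU : V ≤ U := hfU
    let S := Γ(Spec R, V)
    have : IsLocalization.Away f S := isLocalization_basicOpen f V rfl
    let ψ' : CommRingCat.of (ChartRing ϖ i.setF i.setG) ⟶ S :=
      ψ ≫ (Spec R).presheaf.map (homOfLE hVU).op
    obtain ⟨F, G, hF, hG, hFG⟩ := exists_pair_of_away (P := i.setF) (P' := i.setG) f S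
      (fun p q => ψ'.hom (chartF ϖ i.setF i.setG p q))
      (fun p q => ψ'.hom (chartG ϖ i.setF i.setG p q))
    refine ⟨f, hf, F, G, i, hF, hG, fun p' hp' => ?_⟩
    have hp'' : p' ∈ V := hp'
    obtain ⟨h1, h2⟩ := hFG (SpecStalk R p') ((Spec R).presheaf.germ V p' hp'').hom
      (congrArg CommRingCat.Hom.hom (algebraMap_germ V p' hp''))
    have e' : ψ ≫ (Spec R).presheaf.germ U p' (hVU hp'') =
        ψ' ≫ (Spec R).presheaf.germ V p' hp'' :=
      (congrArg (ψ ≫ ·) (TopCat.Presheaf.germ_res _ (homOfLE hVU) p' hp'').symm).trans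
        (Category.assoc _ _ _).symm
    have hξ' : ξ p' = _ := (hψ p' (hVU hp'')).trans
      ((congrArg (fun g => (pairFunctor O m).map g (chartPoint ϖ i)) e').trans
        (map_chartPoint ϖ i _))
    exact ⟨h1.trans (congrArg (fun x => x.2.1) hξ').symm,
      h2.trans (congrArg (fun x => x.2.2) hξ').symm⟩
  · obtain ⟨U, hp, i, ψ, hψ⟩ := hξ p
    have h1 := (exists_map_chartPoint_eq_iff ϖ i (ξ p)).1 ⟨_, (hψ p hp).symm⟩
    rw [hσ p] at h1
    exact ⟨h1.1, i.down.1.1, i.down.1.2, h1.2.1⟩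

theorem stalkFamily_injective {σ : O →+* R} {F G F' G' : Submodule R (Ind m → R)}
    (h : stalkFamily σ F G = stalkFamily σ F' G') : F = F' ∧ G = G' :=
  ⟨eq_of_stalks (SpecStalk R) fun p => congrArg (fun x => x.2.1) (congrFun h p),
    eq_of_stalks (SpecStalk R) fun p => congrArg (fun x => x.2.2) (congrFun h p)⟩

theorem pullbackStalks_stalkFamily {S : CommRingCat.{u}} (f : R ⟶ S) (σ : O →+* R)
    (F G : Submodule R (Ind m → R)) :
    pullbackStalks (E := splCharted ϖ m s) (Spec.map f) (stalkFamily σ F G) =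
      stalkFamily (f.hom.comp σ) (extend f.hom F) (extend f.hom G) := by
  funext p
  refine (Functor.map_comp_apply (pairFunctor O m) _ _ _).symm.trans ?_
  have e : stalkHom (𝟙 (Spec R)) (Spec.map f p) ≫ (Spec.map f).stalkMap p =
      f ≫ stalkHom (𝟙 (Spec S)) p := by
    rw [← stalkHom_comp, Category.comp_id, stalkHom_specMap]
  refine (congrArg (fun g => (pairFunctor O m).map g ((σ, F, G) : (pairFunctor O m).obj R))
    e).trans ?_
  exact Functor.map_comp_apply (pairFunctor O m) _ _ _

end Families

/-! ### Representability of the splitting model -/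

section Structure

open Opposite ChartedFunctor

variable {O : Type u} [CommRing O] {ϖ : O} {m s : ℕ}

/-- The functor `pairFunctor` records the homomorphism from O to each stalk, and these homomorphisms
glue. The representing scheme, built without a base, thereby acquires its structure morphism. -/
theorem exists_structureMap {T : Scheme.{u}} {ξ : ∀ y : T, (pairFunctor O m).obj (T.presheaf.stalk y)}
    (hξ : (splCharted ϖ m s).IsLocal ξ) :
    ∃ g : T ⟶ Spec (CommRingCat.of O), ∀ y, stalkHom g y = CommRingCat.ofHom (ξ y).1 := by
  refine exists_stalkHom_eq_of_germs _ fun x => ?_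
  obtain ⟨U, hx, i, ψ, hψ⟩ := hξ x
  refine ⟨U, hx, CommRingCat.ofHom (chartStr ϖ i.setF i.setG) ≫ ψ, fun y hy => ?_⟩
  rw [hψ y hy]
  rfl

theorem stalkFamily_congr {R : CommRingCat.{u}} {σ σ' : O →+* R}
    {F F' G G' : Submodule R (Ind m → R)} (hσ : σ = σ') (hF : F = F') (hG : G = G') :
    stalkFamily σ F G = stalkFamily σ' F' G' := by
  rw [hσ, hF, hG]

end Structure

section Representability

open Opposite ChartedFunctor

variable {O₀ : Type u} [CommRing O₀] [IsDomain O₀] {π₀ : O₀}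
variable {F₀ : Type u} [Field F₀] [Algebra O₀ F₀] [IsFractionRing O₀ F₀] {m r s : ℕ}

/-- The element `2π` of `O_F`. -/
abbrev twoOmega (π₀ : O₀) : RingOfInt π₀ := 2 * QuadraticAlgebra.omega

variable (m s) in
/-- The splitting model as a charted functor over `O_F`. -/
abbrev ofCharted (π₀ : O₀) : ChartedFunctor.{u} := splCharted (twoOmega π₀) m s

variable {M : Scheme.{u}} (ρ : (ofCharted m s π₀).stalkFunctor.RepresentableBy M)
  (g : M ⟶ Spec (CommRingCat.of (RingOfInt π₀)))
  (h0 : π₀ ≠ 0) (h2 : (2 : O₀) ≠ 0) (hrs : r + s = 2 * m)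

/-- By Yoneda the family of `f` is pulled back from the universal family, whose structure component
is that of `g` by the choice of `g`. -/
theorem fst_homEquiv
    (hg : ∀ y, stalkHom g y = CommRingCat.ofHom ((ρ.homEquiv (𝟙 M)).1 y).1) {T : Scheme.{u}} (f : T ⟶ M) (y : T) :
    CommRingCat.ofHom ((ρ.homEquiv f).1 y).1 = stalkHom (f ≫ g) y := by
  have h : ρ.homEquiv f = (ofCharted m s π₀).stalkFunctor.map f.op (ρ.homEquiv (𝟙 M)) := by
    rw [← ρ.homEquiv_comp, Category.comp_id]
  rw [h, stalkHom_comp, hg]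
  rfl

theorem IsSpl.coordSubmodule_F {R : Type u} [CommRing R] [Algebra (RingOfInt π₀) R]
    {F G : Submodule R (Ind m → R)} (h : IsSpl s (twoPi π₀ R) F G) :
    coordSubmodule (ofBasis F₀ m h0) R (h.toSplPoint (F₀ := F₀) h0 h2 hrs).F.toSubmodule = F :=
  coordSubmodule_grassmannianOfCoord (ofBasis F₀ m h0) h.locGraph_F (by simp)

theorem IsSpl.coordSubmodule_G {R : Type u} [CommRing R] [Algebra (RingOfInt π₀) R]
    {F G : Submodule R (Ind m → R)} (h : IsSpl s (twoPi π₀ R) F G) :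
    coordSubmodule (ofBasis F₀ m h0) R (h.toSplPoint (F₀ := F₀) h0 h2 hrs).G.toSubmodule = G :=
  coordSubmodule_grassmannianOfCoord (ofBasis F₀ m h0) h.locGraph_G (by simp; omega)

/-- The local family over the stalks of `Spec R` corresponding to a point of the splitting
model over `R`. -/
def SplPoint.family (R : CommAlgCat.{u} (CommRingCat.of (RingOfInt π₀))) (x : SplPoint π₀ F₀ m r s R) :
    (ofCharted m s π₀).stalkFunctor.obj (op (Spec (CommRingCat.of R))) :=
  ⟨stalkFamily (R := CommRingCat.of R) (algebraMap (RingOfInt π₀) R)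
    (coordSubmodule (ofBasis F₀ m h0) R x.F.toSubmodule)
    (coordSubmodule (ofBasis F₀ m h0) R x.G.toSubmodule),
    (x.isSpl h0 h2 hrs).isLocal_stalkFamily (R := CommRingCat.of R)⟩

/-- The morphism corresponding to a point of the splitting model. -/
def SplPoint.toHom
    (hg : ∀ y, stalkHom g y = CommRingCat.ofHom ((ρ.homEquiv (𝟙 M)).1 y).1)
    (R : CommAlgCat.{u} (CommRingCat.of (RingOfInt π₀)))
    (x : SplPoint π₀ F₀ m r s R) :
    (algSpec (CommRingCat.of (RingOfInt π₀))).obj (op R) ⟶ Over.mk g :=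
  Over.homMk (ρ.homEquiv.symm (x.family h0 h2 hrs R)) <| by
    refine stalkHom_ext fun y => ?_
    have h := fst_homEquiv ρ g hg (ρ.homEquiv.symm (x.family h0 h2 hrs R)) y
    rw [Equiv.apply_symm_apply] at h
    exact h.symm.trans (stalkHom_specMap (R := CommRingCat.of R) _ y).symm

theorem SplPoint.toHom_bijective
    (hg : ∀ y, stalkHom g y = CommRingCat.ofHom ((ρ.homEquiv (𝟙 M)).1 y).1)
    (hu : IsUnit (2 : RingOfInt π₀))
    (R : CommAlgCat.{u} (CommRingCat.of (RingOfInt π₀))) :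
    Function.Bijective (SplPoint.toHom (F₀ := F₀) ρ g h0 h2 hrs hg R) := by
  constructor
  · intro x y h
    have h1 : ρ.homEquiv.symm (x.family h0 h2 hrs R) = ρ.homEquiv.symm (y.family h0 h2 hrs R) :=
      congrArg Over.Hom.left h
    have h3 := stalkFamily_injective (congrArg Subtype.val (ρ.homEquiv.symm.injective h1))
    exact SplPoint.ext_coord h0 h3.1 h3.2
  · intro f
    have hfst : ∀ p, ((ρ.homEquiv f.left).1 p).1 =
        (stalkHom (𝟙 (Spec (CommRingCat.of R))) p).hom.comp (algebraMap (RingOfInt π₀) R) := by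
      intro p
      have e1 := fst_homEquiv ρ g hg f.left p
      rw [show f.left ≫ g = _ from Over.w f] at e1
      exact congrArg CommRingCat.Hom.hom (e1.trans (stalkHom_specMap (R := CommRingCat.of R) _ p))
    obtain ⟨F, G, h, hFG⟩ := exists_isSpl_of_isLocal (R := CommRingCat.of R)
      (map_ofNat (algebraMap (RingOfInt π₀) R) 2 ▸ hu.map (algebraMap (RingOfInt π₀) R)) (ρ.homEquiv f.left).2 hfst
    refine ⟨h.toSplPoint h0 h2 hrs, ?_⟩
    apply Over.OverMorphism.ext
    refine (Equiv.symm_apply_eq ρ.homEquiv).2 (Subtype.ext (Eq.trans ?_ (funext hFG)))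
    exact stalkFamily_congr rfl (IsSpl.coordSubmodule_F h0 h2 hrs h)
      (IsSpl.coordSubmodule_G h0 h2 hrs h)

theorem SplPoint.toHom_map
    (hg : ∀ y, stalkHom g y = CommRingCat.ofHom ((ρ.homEquiv (𝟙 M)).1 y).1)
    {R S : CommAlgCat.{u} (CommRingCat.of (RingOfInt π₀))} (f : R ⟶ S)
    (x : SplPoint π₀ F₀ m r s R) :
    (x.map f.hom).toHom ρ g h0 h2 hrs hg S =
      (algSpec (CommRingCat.of (RingOfInt π₀))).map f.op ≫ x.toHom ρ g h0 h2 hrs hg R := by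
  apply Over.OverMorphism.ext
  change ρ.homEquiv.symm _ = Spec.map (CommRingCat.ofHom f.hom.toRingHom) ≫ ρ.homEquiv.symm _
  rw [Equiv.symm_apply_eq, ρ.homEquiv_comp, Equiv.apply_symm_apply]
  apply Subtype.ext
  refine Eq.trans ?_ (pullbackStalks_stalkFamily (ϖ := twoOmega π₀) (s := s)
    (CommRingCat.ofHom f.hom.toRingHom) _ _ _).symm
  exact stalkFamily_congr f.hom.comp_algebraMap.symm (coordSubmodule_map (ofBasis F₀ m h0) f.hom x.F)
    (coordSubmodule_map (ofBasis F₀ m h0) f.hom x.G)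

variable (F₀ r) in
theorem exists_splRepresentation (h0 : π₀ ≠ 0) (h2 : (2 : O₀) ≠ 0) (hrs : r + s = 2 * m)
    (hu : IsUnit (2 : RingOfInt π₀)) :
    ∃ M : Over (Spec (CommRingCat.of (RingOfInt π₀))),
      Nonempty (SplRepresentation π₀ F₀ m r s M) := by
  obtain ⟨M, ⟨ρ⟩⟩ := (ofCharted m s π₀).exists_representableBy
  obtain ⟨g, hg⟩ := exists_structureMap (ρ.homEquiv (𝟙 M)).2
  refine ⟨Over.mk g, ⟨NatIso.ofComponents (fun R =>
    (Equiv.ofBijective _ (SplPoint.toHom_bijective (F₀ := F₀) ρ g h0 h2 hrs hg hu R)).toIso)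
    fun {R S} f => ?_⟩⟩
  exact ConcreteCategory.hom_ext _ _ fun x => SplPoint.toHom_map ρ g h0 h2 hrs hg f x

end Representability

/-! ### The uniformizers and 2 in the residue field -/

section TwoUnit

variable {O₀ : Type u} [CommRing O₀] [IsDomain O₀] [IsDiscreteValuationRing O₀] {π₀ : O₀}

/-- The kernel is a maximal ideal and O_F is integral over O₀, so its contraction is the maximal
ideal of O₀. -/
theorem algebraMap_uniformizer_eq_zero (hπ₀ : Irreducible π₀) {k : Type*} [Field k]
    [Algebra (RingOfInt π₀) k] (hk : Function.Surjective (algebraMap (RingOfInt π₀) k)) :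
    algebraMap (RingOfInt π₀) k (algebraMap O₀ _ π₀) = 0 := by
  have hmax : (RingHom.ker (algebraMap (RingOfInt π₀) k)).IsMaximal :=
    RingHom.ker_isMaximal_of_surjective _ hk
  have hmax' := Ideal.isMaximal_comap_of_isIntegral_of_isMaximal (R := O₀)
    (RingHom.ker (algebraMap (RingOfInt π₀) k))
  have hmem : π₀ ∈ (RingHom.ker (algebraMap (RingOfInt π₀) k)).comap (algebraMap O₀ _) := by
    rw [IsLocalRing.eq_maximalIdeal hmax']
    exact hπ₀.not_isUnit
  exact hmem

theorem algebraMap_omega_eq_zero (hπ₀ : Irreducible π₀) {k : Type u} [Field k]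
    [Algebra (RingOfInt π₀) k] (hk : Function.Surjective (algebraMap (RingOfInt π₀) k)) :
    algebraMap (RingOfInt π₀) k QuadraticAlgebra.omega = 0 := by
  have h := algebraMap_uniformizer_eq_zero hπ₀ hk
  rw [algebraMap_eq_omega_mul, map_mul, mul_self_eq_zero] at h
  exact h

/-- If the residue characteristic is not `2`, then `2` is a unit in `O₀`. -/
theorem isUnit_two (hπ₀ : Irreducible π₀) {k : Type*} [Field k] [Algebra (RingOfInt π₀) k]
    (hk : Function.Surjective (algebraMap (RingOfInt π₀) k)) (h2 : (2 : k) ≠ 0) :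
    IsUnit (2 : O₀) := by
  by_contra h
  have hm : (2 : O₀) ∈ IsLocalRing.maximalIdeal O₀ := h
  rw [(IsDiscreteValuationRing.irreducible_iff_uniformizer π₀).1 hπ₀] at hm
  obtain ⟨c, hc⟩ := Ideal.mem_span_singleton.1 hm
  apply h2
  have := congrArg (fun x => algebraMap (RingOfInt π₀) k (algebraMap O₀ _ x)) hc
  simp only [map_mul, algebraMap_uniformizer_eq_zero hπ₀ hk, zero_mul] at this
  rwa [map_ofNat, map_ofNat] at this

end TwoUnit

/-! ### Isotropic subspaces and the choice of coordinates -/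

section AltForm

variable {m : ℕ} {R : Type*} [CommRing R]

theorem rev_ne_self (i : Fin (2 * m)) : i.rev ≠ i := by
  intro h
  have := congrArg Fin.val h
  have h1 := i.2
  rw [Fin.val_rev] at this
  omega

theorem sgn_cast_mul_self (i : Fin (2 * m)) : (sgn i : R) * sgn i = 1 := by
  have := congrArg (Int.cast (R := R)) (sgn_mul_self i)
  push_cast at this
  exact this

/-- The terms of i and n + 1 - i cancel, so this holds even where 2 is not invertible. -/
theorem alt_self (u : Fin (2 * m) → R) : alt u u = 0 := by
  rw [alt_apply]
  refine Finset.sum_involution (fun i _ => i.rev) (fun i _ => ?_) (fun i _ _ => rev_ne_self i)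
    (fun i _ => Finset.mem_univ _) fun i _ => Fin.rev_rev i
  rw [sgn_rev, Fin.rev_rev]
  push_cast
  ring

/-- The effect on the alternating form of a modification of the coordinates dual to `J`. -/
theorem alt_ite_left (J : Finset (Fin (2 * m))) (c u v : Fin (2 * m) → R)
    (hu : ∀ q, q.rev ∈ J → u q = 0) :
    alt (fun q => if q.rev ∈ J then c q else u q) v =
      alt u v + ∑ j ∈ J, (sgn j.rev : R) * c j.rev * v j := by
  have h : ∀ q, (if q.rev ∈ J then c q else u q) = u q + if q.rev ∈ J then c q else 0 := by
    intro q
    by_cases hq : q.rev ∈ J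
    · simp [hq, hu q hq]
    · simp [hq]
  simp only [alt_apply, h, add_mul, mul_add, Finset.sum_add_distrib]
  congr 1
  rw [← Equiv.sum_comp Fin.revPerm]
  simp only [Fin.revPerm_apply, Fin.rev_rev, ite_mul, zero_mul, mul_ite, mul_zero]
  rw [Finset.sum_ite_mem, Finset.univ_inter]
  exact Finset.sum_congr rfl fun j _ => (mul_assoc _ _ _).symm

/-- The radical of the restriction of the alternating form to a submodule. -/
def radical (U : Submodule R (Fin (2 * m) → R)) : Submodule R (Fin (2 * m) → R) :=
  U ⊓ alt.orthogonal U

theorem mem_radical {U : Submodule R (Fin (2 * m) → R)} {u : Fin (2 * m) → R} :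
    u ∈ radical U ↔ u ∈ U ∧ ∀ v ∈ U, alt u v = 0 := by
  rw [radical, Submodule.mem_inf, LinearMap.BilinForm.mem_orthogonal_iff]
  refine and_congr_right fun _ => forall₂_congr fun v _ => ?_
  rw [alt_swap, neg_eq_zero]

end AltForm

/-! ### Charts adapted to a subspace and its radical -/

section IsotropicCharts

variable {m : ℕ} {K : Type*} [Field K]

/-- An isotropic subspace has a chart which does not contain a pair of dual coordinates. -/
theorem exists_isotropic_chart (U : Submodule K (Fin (2 * m) → K))
    (hU : ∀ u ∈ U, ∀ v ∈ U, alt u v = 0) :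
    ∃ I : Finset (Fin (2 * m)), (∀ i ∈ I, i.rev ∉ I) ∧ ∃ b, U = graph I b := by
  classical
  obtain ⟨I, ⟨hI, hn⟩, hmax⟩ := Finset.exists_maximal (s := Finset.univ.filter
    fun I : Finset (Fin (2 * m)) => (∀ i ∈ I, i.rev ∉ I) ∧
      ∀ i ∈ I, ∃ u ∈ U, ∀ j ∈ I, u j = if j = i then 1 else 0) ⟨∅, by simp⟩ |>.imp fun I h =>
      (⟨by simpa using h.1, h.2⟩ : ((∀ i ∈ I, i.rev ∉ I) ∧
      ∀ i ∈ I, ∃ u ∈ U, ∀ j ∈ I, u j = if j = i then 1 else 0) ∧ _)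
  choose! n hnU hnI using hn
  refine ⟨I, hI, n, eq_graph n hnU hnI fun v hv hv0 => ?_⟩
  -- Maximality of I: if `q.rev` were not in I, scaling `v` to 1 at `q` and clearing this coordinate
  -- from the other vectors would enlarge I by `q`.
  have key : ∀ q, v q ≠ 0 → q.rev ∈ I := by
    intro q hq
    by_contra hqI
    have hq' : q ∉ I := fun h => hq (hv0 q h)
    have hmem : insert q I ∈ Finset.univ.filter fun I : Finset (Fin (2 * m)) =>
        (∀ i ∈ I, i.rev ∉ I) ∧ ∀ i ∈ I, ∃ u ∈ U, ∀ j ∈ I, u j = if j = i then 1 else 0 := by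
      rw [Finset.mem_filter]
      refine ⟨Finset.mem_univ _, fun i hi => ?_, fun i hi => ?_⟩
      · rw [Finset.mem_insert] at hi ⊢
        rcases hi with rfl | hi
        · exact not_or.2 ⟨rev_ne_self i, hqI⟩
        · refine not_or.2 ⟨fun h => hqI ?_, hI i hi⟩
          rwa [← h, Fin.rev_rev]
      · by_cases hiq : i = q
        · subst hiq
          refine ⟨(v i)⁻¹ • v, U.smul_mem _ hv, fun j hj => ?_⟩
          rcases Finset.mem_insert.1 hj with rfl | hjI
          · simp [hq]
          · rw [Pi.smul_apply, hv0 j hjI, smul_zero, if_neg]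
            rintro rfl
            exact hq' hjI
        · have hiI : i ∈ I := (Finset.mem_insert.1 hi).resolve_left hiq
          refine ⟨n i - (n i q * (v q)⁻¹) • v, U.sub_mem (hnU i hiI) (U.smul_mem _ hv),
            fun j hj => ?_⟩
          rcases Finset.mem_insert.1 hj with rfl | hj
          · simp [hq, Ne.symm hiq]
          · simp [hv0 j hj, hnI i hiI j hj]
    exact hq' (hmax hmem (Finset.subset_insert q I) (Finset.mem_insert_self q I))
  -- A nonzero `v` is supported on coordinates dual to I. Pairing it with the normalized vector of
  -- `q.rev` leaves only the coordinate `q`, which contradicts isotropy.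
  by_contra hne
  obtain ⟨q, hq⟩ := Function.ne_iff.1 hne
  have hqI := key q hq
  have h := hU _ (hnU _ hqI) v hv
  rw [alt_apply, Finset.sum_eq_single q.rev] at h
  · rw [hnI _ hqI _ hqI, if_pos rfl, one_mul, Fin.rev_rev] at h
    exact (mul_ne_zero (sgn_ne_zero _) hq) h
  · intro i _ hi
    by_cases hv' : v i.rev = 0
    · rw [hv', mul_zero, mul_zero]
    · have hiI := key _ hv'
      rw [Fin.rev_rev] at hiI
      rw [hnI _ hqI _ hiI, if_neg hi, zero_mul, mul_zero]
  · simp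

/-- The combinatorial data of a chart of the stratum `X_{h,l}`. -/
structure StratumIndex (m s h l : ℕ) where
  /-- the chart of the radical -/
  I : Finset (Fin (2 * m))
  /-- the chart of a complement of the radical -/
  K : Finset (Fin (2 * m))
  /-- the chart of `t F` -/
  I₁ : Finset (Fin (2 * m))
  rev_I : ∀ i ∈ I, i.rev ∉ I
  notMem_K : ∀ i ∈ K, i ∉ I
  rev_K : ∀ i ∈ K, i.rev ∉ I
  I₁_subset : I₁ ⊆ I
  card_I : I.card = l
  card_K : l + K.card = s
  card_I₁ : I₁.card = h

/-- The vectors of U vanishing on I form a complement V of the radical. Orthogonality to the radical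
determines their coordinates dual to I by the others, so a chart of V can be chosen disjoint from
both I and its dual. As T lies in the radical, its chart can be chosen inside I. -/
theorem exists_stratumIndex {s h l : ℕ} {U T : Submodule K (Fin (2 * m) → K)}
    (hT : T ≤ radical U) (hs : Module.finrank K U = s) (hl : Module.finrank K (radical U) = l)
    (hh : Module.finrank K T = h) :
    ∃ D : StratumIndex m s h l, (∃ b, radical U = graph D.I b) ∧
      (∃ b, U = graph (D.I ∪ D.K) b) ∧ ∃ b, T = graph D.I₁ b := by
  classical
  obtain ⟨I, hI, b, hb⟩ := exists_isotropic_chart (radical U) fun u hu v hv =>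
    (mem_radical.1 hu).2 v (mem_radical.1 hv).1
  have hrow : ∀ i ∈ I, graphRow I b i ∈ radical U := fun i hi => hb ▸ graphRow_mem b hi
  let V : Submodule K (Fin (2 * m) → K) := U ⊓ LinearMap.ker (LinearMap.funLeft K K
    ((↑) : I → Fin (2 * m)))
  have hV : ∀ v, v ∈ V ↔ v ∈ U ∧ ∀ i ∈ I, v i = 0 := fun v => by
    rw [Submodule.mem_inf, LinearMap.mem_ker]
    exact and_congr_right fun _ => ⟨fun h i hi => congrFun h ⟨i, hi⟩, fun h => funext fun i =>
      h i i.2⟩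
  obtain ⟨P, hP, -, c, hc⟩ := exists_finset_eq_graph V
    (Finset.univ.filter fun q => q ∉ I ∧ q.rev ∉ I) fun v hv h => by
      obtain ⟨hvU, hvI⟩ := (hV v).1 hv
      have h' : ∀ q, q.rev ∉ I → v q = 0 := fun q hq => by
        by_cases hqI : q ∈ I
        · exact hvI q hqI
        · exact h q (by simp [hq, hqI])
      ext q
      by_cases hq : q.rev ∈ I
      · have h1 := (mem_radical.1 (hrow _ hq)).2 v hvU
        rw [alt_apply, Finset.sum_eq_single q.rev] at h1
        · rw [graphRow_self _ _ hq, if_pos rfl, one_mul, Fin.rev_rev] at h1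
          exact (mul_eq_zero.1 h1).resolve_left (sgn_ne_zero _)
        · intro i _ hi
          by_cases hiI : i ∈ I
          · rw [graphRow_self _ _ hiI, if_neg hi, zero_mul, mul_zero]
          · rw [h' i.rev (by rwa [Fin.rev_rev]), mul_zero, mul_zero]
        · simp
      · exact h' q hq
  have hrowP : ∀ p ∈ P, graphRow P c p ∈ V := fun p hp => hc ▸ graphRow_mem c hp
  have hPI : ∀ p ∈ P, p ∉ I ∧ p.rev ∉ I := fun p hp => by simpa using hP hp
  have hU : ∃ b, U = graph (I ∪ P) b := by
    -- The rows of P already vanish on I; the rows of I only have to be cleared of their coordinates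
    -- in P.
    refine ⟨_, eq_graph (fun p => if p ∈ I then graphRow I b p - ∑ q ∈ P, graphRow I b p q •
      graphRow P c q else graphRow P c p) (fun p hp => ?_) (fun p hp q hq => ?_) fun v hv h => ?_⟩
    · split_ifs with hpI
      · exact U.sub_mem (mem_radical.1 (hrow p hpI)).1 (U.sum_mem fun q hq =>
          U.smul_mem _ ((hV _).1 (hrowP q hq)).1)
      · exact ((hV _).1 (hrowP p ((Finset.mem_union.1 hp).resolve_left hpI))).1
    · by_cases hpI : p ∈ I
      · rw [if_pos hpI, Pi.sub_apply, Finset.sum_apply]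
        rcases Finset.mem_union.1 hq with hqI | hqP
        · rw [Finset.sum_eq_zero, sub_zero, graphRow_self _ _ hqI]
          intro p' hp'
          rw [Pi.smul_apply, ((hV _).1 (hrowP p' hp')).2 q hqI, smul_zero]
        · rw [Finset.sum_eq_single q, Pi.smul_apply, graphRow_self c q hqP, if_pos rfl,
            smul_eq_mul, mul_one, sub_self, if_neg]
          · rintro rfl
            exact (hPI _ hqP).1 hpI
          · intro p' _ hp'
            rw [Pi.smul_apply, graphRow_self c p' hqP, if_neg (Ne.symm hp'), smul_zero]
          · intro h; exact absurd hqP h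
      · have hpP := (Finset.mem_union.1 hp).resolve_left hpI
        rw [if_neg hpI]
        rcases Finset.mem_union.1 hq with hqI | hqP
        · rw [((hV _).1 (hrowP p hpP)).2 q hqI, if_neg]
          rintro rfl
          exact hpI hqI
        · rw [graphRow_self c p hqP]
    · have hvV : v ∈ V := (hV v).2 ⟨hv, fun i hi => h i (Finset.mem_union_left _ hi)⟩
      rw [hc] at hvV
      exact eq_of_mem_graph hvV (Submodule.zero_mem _) fun p hp => h p (Finset.mem_union_right _ hp)
  obtain ⟨I₁, hI₁, hcard, d, hd⟩ := exists_finset_eq_graph T I fun v hv h => by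
    have : v ∈ graph I b := hb ▸ hT hv
    exact eq_of_mem_graph this (Submodule.zero_mem _) h
  have hIl : I.card = l := by rw [← hl, hb, finrank_graph]
  refine ⟨⟨I, P, I₁, hI, fun p hp => (hPI p hp).1, fun p hp => (hPI p hp).2, hI₁, hIl, ?_,
    hcard.trans hh⟩, ⟨b, hb⟩, hU, ⟨d, hd⟩⟩
  obtain ⟨b', hb'⟩ := hU
  rw [hb', finrank_graph, Finset.card_union_of_disjoint, hIl] at hs
  · exact hs
  · exact Finset.disjoint_left.2 fun p hpI hpP => (hPI p hpP).1 hpI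

end IsotropicCharts

/-! ### The parametrization of a stratum -/

/-- A matrix, placed in the second half of the coordinates. -/
def inrMat {m : ℕ} {R : Type*} [CommRing R] (b : Fin (2 * m) → Fin (2 * m) → R) : Ind m → Ind m → R
  | Sum.inr p, Sum.inr q => b p q
  | _, _ => 0

theorem mem_graph_inrMat {m : ℕ} {R : Type*} [CommRing R] {P : Finset (Fin (2 * m))}
    {b : Fin (2 * m) → Fin (2 * m) → R} {v : Ind m → R} :
    v ∈ graph ((∅ : Finset (Fin (2 * m))).disjSum P) (inrMat b) ↔
      fstHalf v = 0 ∧ sndHalf v ∈ graph P b := by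
  rw [mem_graph, Sum.forall, mem_graph, funext_iff]
  refine and_congr (forall_congr' fun q => ?_) (forall_congr' fun q => ?_)
  · rw [Finset.sum_disjSum]
    simp [inrMat]
  · rw [Finset.sum_disjSum]
    simp [inrMat]

namespace StratumIndex

variable {m s h l : ℕ} (D : StratumIndex m s h l)
variable {R S : Type*} [CommRing R] [CommRing S] (a θ : Fin (2 * m) → Fin (2 * m) → R)

/-- The entries of a family of vectors which can be chosen freely. -/
def FreeG (p q : Fin (2 * m)) : Prop :=
  (p ∈ D.I ∧ q ∉ D.I ∧ ¬ (q.rev ∈ D.I ∧ q.rev < p)) ∨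
    (p ∈ D.K ∧ q ∉ D.I ∧ q ∉ D.K ∧ q.rev ∉ D.I)

/-- The entries of the matrix describing `F` which can be chosen freely. -/
def FreeF (i j : Fin (2 * m)) : Prop :=
  i ∈ D.I₁ ∧ j ∈ D.I ∧ (j ∉ D.I₁ ∨ i < j)

/-- The elements of `I` smaller than `i`. -/
abbrev below (i : Fin (2 * m)) : Finset (Fin (2 * m)) := D.I.filter (· < i)

/-- First approximation to `rho`: the entries dual to smaller elements of I are left 0, to be solved
for afterwards. The ordering of I ensures that each relation between two vectors is used once. -/
def preRho (i q : Fin (2 * m)) : R :=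
  if q ∈ D.I then (if q = i then 1 else 0) else if q.rev ∈ D.below i then 0 else a i q

/-- The basis of the radical. -/
def rho (i q : Fin (2 * m)) : R :=
  if q.rev ∈ D.below i then -(sgn q : R) * alt (D.preRho a i) (D.preRho a q.rev)
  else D.preRho a i q

/-- First approximation to `gam`: the entries dual to I are left 0 and are later determined by
orthogonality to the radical. -/
def preGam (p q : Fin (2 * m)) : R :=
  if q ∈ D.I then 0 else if q ∈ D.K then (if q = p then 1 else 0)
  else if q.rev ∈ D.I then 0 else a p q

/-- The basis of a complement of the radical. -/
def gam (p q : Fin (2 * m)) : R :=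
  if q.rev ∈ D.I then -(sgn q : R) * alt (D.preGam a p) (D.rho a q.rev) else D.preGam a p q

/-- The basis of `t F`. -/
def eta (i q : Fin (2 * m)) : R :=
  D.rho a i q + ∑ j ∈ D.I \ D.I₁, θ i j * D.rho a j q

/-- Only the entries of θ above the diagonal matter and the diagonal is 0, so the matrix is
alternating over every ring. -/
def skew (i j : Fin (2 * m)) : R := if i < j then θ i j else if j < i then -θ j i else 0

/-- The matrix of `F` in the chart of `I₁`. -/
def matF : Ind m → Ind m → R
  | Sum.inl i, Sum.inl q => D.eta a θ i q
  -- This row and the next come from the equations {η_i, y} = ∑ x_j `skew` i j, solved for the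
  -- coordinate of y at n + 1 - i, whose coefficient is `sgn i`.
  | Sum.inl i, Sum.inr q => sgn q.rev * skew θ q.rev i
  | Sum.inr p, Sum.inr q => -(sgn q.rev * sgn p.rev * D.eta a θ q.rev p.rev)
  | Sum.inr _, Sum.inl _ => 0

/-- The subspace `F` with given parameters. -/
def paramF : Submodule R (Ind m → R) := graph (chartSet D.I₁) (D.matF a θ)

/-- The vectors `rho` are normalized on I but not on K; subtracting their K-coordinates times `gam`
normalizes them on I ∪ K. -/
def matU (p q : Fin (2 * m)) : R :=
  if p ∈ D.I then D.rho a p q - ∑ k ∈ D.K, D.rho a p k * D.gam a k q else D.gam a p q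

/-- The subspace `G`, as a subspace of the second half of the coordinates. -/
def paramU : Submodule R (Fin (2 * m) → R) := graph (D.I ∪ D.K) (D.matU a)


/-- The subspace `G` with given parameters. -/
def paramG : Submodule R (Ind m → R) := 
  graph ((∅ : Finset (Fin (2 * m))).disjSum (D.I ∪ D.K)) (inrMat (D.matU a))

/-- The Gram matrix of a family of vectors. -/
def gram (g : Fin (2 * m) → Fin (2 * m) → R) : Matrix D.K D.K R :=
  Matrix.of fun p q => alt (g p) (g q)

section Naturality

variable (φ : R →+* S)

theorem map_preRho (i q : Fin (2 * m)) :
    φ (D.preRho a i q) = D.preRho (fun p q => φ (a p q)) i q := by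
  simp only [preRho, apply_ite φ, map_one, map_zero]

theorem map_rho (i q : Fin (2 * m)) : φ (D.rho a i q) = D.rho (fun p q => φ (a p q)) i q := by
  simp only [rho, apply_ite φ, map_mul, map_neg, map_intCast, ← alt_map, map_preRho]

theorem map_preGam (i q : Fin (2 * m)) :
    φ (D.preGam a i q) = D.preGam (fun p q => φ (a p q)) i q := by
  simp only [preGam, apply_ite φ, map_one, map_zero]

theorem map_gam (i q : Fin (2 * m)) : φ (D.gam a i q) = D.gam (fun p q => φ (a p q)) i q := by
  simp only [gam, apply_ite φ, map_mul, map_neg, map_intCast, ← alt_map, map_preGam, map_rho]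

theorem map_eta (i q : Fin (2 * m)) :
    φ (D.eta a θ i q) = D.eta (fun p q => φ (a p q)) (fun p q => φ (θ p q)) i q := by
  simp only [eta, map_add, map_sum, map_mul, map_rho]

theorem map_matF (p q : Ind m) :
    φ (D.matF a θ p q) = D.matF (fun p q => φ (a p q)) (fun p q => φ (θ p q)) p q := by
  rcases p with p | p <;> rcases q with q | q <;>
    simp only [matF, map_eta, map_mul, map_intCast, map_neg, map_zero, skew, apply_ite φ]

theorem extend_paramF : extend φ (D.paramF a θ) =
    D.paramF (fun p q => φ (a p q)) (fun p q => φ (θ p q)) := by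
  rw [paramF, extend_graph]
  simp only [map_matF]
  rfl

theorem map_matU (p q : Fin (2 * m)) : φ (D.matU a p q) = D.matU (fun p q => φ (a p q)) p q := by
  simp only [matU, apply_ite φ, map_sub, map_sum, map_mul, map_rho, map_gam]

theorem extend_paramG : extend φ (D.paramG a) = D.paramG (fun p q => φ (a p q)) := by
  rw [paramG, extend_graph]
  refine graph_congr fun p _ q _ => ?_
  rcases p with p | p <;> rcases q with q | q <;> simp only [inrMat, map_zero, map_matU]

theorem map_det_gram (g : Fin (2 * m) → Fin (2 * m) → R) :
    φ (D.gram g).det = (D.gram fun p q => φ (g p q)).det := by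
  rw [RingHom.map_det]
  congr 1
  ext p q
  exact (alt_map φ (g p) (g q)).symm

end Naturality

section Relations

variable {D}

theorem rev_notMem_below {i j : Fin (2 * m)} (hj : j ∈ D.I) : j.rev ∉ D.below i :=
  fun h => D.rev_I j hj (Finset.mem_filter.1 h).1

theorem preRho_of_mem (i : Fin (2 * m)) {j : Fin (2 * m)} (hj : j ∈ D.I) :
    D.preRho a i j = if j = i then 1 else 0 := if_pos hj

theorem rho_of_mem (i : Fin (2 * m)) {j : Fin (2 * m)} (hj : j ∈ D.I) :
    D.rho a i j = if j = i then 1 else 0 := by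
  rw [rho, if_neg (rev_notMem_below hj), preRho_of_mem a i hj]

theorem gam_of_mem (p : Fin (2 * m)) {j : Fin (2 * m)} (hj : j ∈ D.I) : D.gam a p j = 0 := by
  rw [gam, if_neg (D.rev_I j hj), preGam, if_pos hj]

theorem gam_of_mem_K (p : Fin (2 * m)) {j : Fin (2 * m)} (hj : j ∈ D.K) :
    D.gam a p j = if j = p then 1 else 0 := by
  rw [gam, if_neg (D.rev_K j hj), preGam, if_neg (D.notMem_K j hj), if_pos hj]

theorem alt_rho_left (i : Fin (2 * m)) (v : Fin (2 * m) → R) :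
    alt (D.rho a i) v = alt (D.preRho a i) v -
      ∑ j ∈ D.below i, alt (D.preRho a i) (D.preRho a j) * v j := by
  have h := alt_ite_left (D.below i)
    (fun q => -(sgn q : R) * alt (D.preRho a i) (D.preRho a q.rev)) (D.preRho a i) v fun q hq => by
      have hq' : q ∉ D.I := fun h => rev_notMem_below h hq
      rw [preRho, if_neg hq', if_pos hq]
  refine h.trans ?_
  rw [sub_eq_add_neg, ← Finset.sum_neg_distrib]
  congr 1
  refine Finset.sum_congr rfl fun j _ => ?_
  rw [Fin.rev_rev, neg_mul, mul_neg, ← mul_assoc, sgn_cast_mul_self, one_mul, neg_mul]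

theorem sum_below {i i' : Fin (2 * m)} (hi' : i' ∈ D.I) (c v : Fin (2 * m) → R)
    (hv : ∀ j ∈ D.I, v j = if j = i' then 1 else 0) :
    ∑ j ∈ D.below i, c j * v j = if i' < i then c i' else 0 := by
  split_ifs with hlt
  · rw [Finset.sum_eq_single i', hv i' hi', if_pos rfl, mul_one]
    · intro j hj hne
      rw [hv j (Finset.mem_filter.1 hj).1, if_neg hne, mul_zero]
    · intro h; exact absurd (Finset.mem_filter.2 ⟨hi', hlt⟩) h
  · refine Finset.sum_eq_zero fun j hj => ?_
    have hj' := Finset.mem_filter.1 hj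
    rw [hv j hj'.1, if_neg, mul_zero]
    rintro rfl
    exact hlt hj'.2

/-- For i' < i the correction of `rho i` at the coordinate dual to i' cancels the pairing of the
uncorrected vectors, while `rho i'` is not corrected at the coordinate dual to i. Exactly one of the
two vectors solves each relation. -/
theorem alt_rho_rho {i i' : Fin (2 * m)} (hi : i ∈ D.I) (hi' : i' ∈ D.I) :
    alt (D.rho a i) (D.rho a i') = 0 := by
  rw [alt_rho_left, sum_below hi' (fun j => alt (D.preRho a i) (D.preRho a j)) _
    fun j hj => rho_of_mem a i' hj, alt_swap, alt_rho_left, sum_below hi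
    (fun j => alt (D.preRho a i') (D.preRho a j)) _ fun j hj => preRho_of_mem a i hj]
  rcases lt_trichotomy i i' with h | rfl | h
  · rw [if_pos h, if_neg h.not_gt]; simp
  · simp [alt_self]
  · rw [if_neg h.not_gt, if_pos h, alt_swap (D.preRho a i)]; ring

theorem alt_gam_left (p : Fin (2 * m)) (v : Fin (2 * m) → R) :
    alt (D.gam a p) v = alt (D.preGam a p) v -
      ∑ j ∈ D.I, alt (D.preGam a p) (D.rho a j) * v j := by
  have h := alt_ite_left D.I
    (fun q => -(sgn q : R) * alt (D.preGam a p) (D.rho a q.rev)) (D.preGam a p) v fun q hq => by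
      have hq' : q ∉ D.I := fun h => D.rev_I q h hq
      have hq'' : q ∉ D.K := fun h => D.rev_K q h hq
      rw [preGam, if_neg hq', if_neg hq'', if_pos hq]
  refine h.trans ?_
  rw [sub_eq_add_neg, ← Finset.sum_neg_distrib]
  congr 1
  refine Finset.sum_congr rfl fun j _ => ?_
  rw [Fin.rev_rev, neg_mul, mul_neg, ← mul_assoc, sgn_cast_mul_self, one_mul, neg_mul]

theorem sum_I {i : Fin (2 * m)} (hi : i ∈ D.I) (c v : Fin (2 * m) → R)
    (hv : ∀ j ∈ D.I, v j = if j = i then 1 else 0) : ∑ j ∈ D.I, c j * v j = c i := by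
  rw [Finset.sum_eq_single i, hv i hi, if_pos rfl, mul_one]
  · intro j hj hne
    rw [hv j hj, if_neg hne, mul_zero]
  · intro h; exact absurd hi h

theorem alt_gam_rho (p : Fin (2 * m)) {i : Fin (2 * m)} (hi : i ∈ D.I) :
    alt (D.gam a p) (D.rho a i) = 0 := by
  rw [alt_gam_left, sum_I hi (fun j => alt (D.preGam a p) (D.rho a j)) _
    fun j hj => rho_of_mem a i hj, sub_self]

/-- An isotropic family of normalized vectors is determined by its free entries. -/
theorem rho_eq {ρ : Fin (2 * m) → Fin (2 * m) → R}
    (hρ : ∀ i ∈ D.I, ∀ j ∈ D.I, ρ i j = if j = i then 1 else 0)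
    (hρρ : ∀ i ∈ D.I, ∀ j ∈ D.I, alt (ρ i) (ρ j) = 0)
    (ha : ∀ i ∈ D.I, ∀ q, D.FreeG i q → a i q = ρ i q) {i : Fin (2 * m)} (hi : i ∈ D.I) :
    D.rho a i = ρ i := by
  have hpre : ∀ i ∈ D.I, ∀ q, D.preRho a i q = if q.rev ∈ D.below i then 0 else ρ i q := by
    intro i hi q
    by_cases hq : q ∈ D.I
    · rw [preRho_of_mem a i hq, if_neg (rev_notMem_below hq), hρ i hi q hq]
    · rw [preRho, if_neg hq]
      split_ifs with hq'
      · rfl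
      · exact ha i hi q (Or.inl ⟨hi, hq, fun h => hq' (Finset.mem_filter.2 h)⟩)
  have hleft : ∀ i ∈ D.I, ∀ v, alt (ρ i) v = alt (D.preRho a i) v +
      ∑ j ∈ D.below i, (sgn j.rev : R) * ρ i j.rev * v j := by
    intro i hi v
    rw [← alt_ite_left (D.below i) (ρ i) (D.preRho a i) v fun q hq => by
      rw [hpre i hi, if_pos hq]]
    congr 2
    ext q
    split_ifs with hq
    · rfl
    · rw [hpre i hi, if_neg hq]
  ext q
  rw [rho]
  split_ifs with hq
  · obtain ⟨hqI, hqi⟩ := Finset.mem_filter.1 hq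
    have h := hρρ i hi _ hqI
    rw [hleft i hi, sum_below hqI (fun j => (sgn j.rev : R) * ρ i j.rev) _
      fun j hj => hρ _ hqI j hj, if_pos hqi, Fin.rev_rev, alt_swap, hleft _ hqI,
      sum_below hi (fun j => (sgn j.rev : R) * ρ q.rev j.rev) _
      fun j hj => preRho_of_mem a i hj, if_neg hqi.not_gt, add_zero] at h
    rw [alt_swap (D.preRho a i)]
    linear_combination (-(sgn q : R)) * h + ρ i q * sgn_cast_mul_self (R := R) q
  · rw [hpre i hi, if_neg hq]

/-- Orthogonality to ρ j expresses the coordinate dual to j through the remaining ones, since ρ is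
normalized on I; those remaining ones are prescribed or free. -/
theorem gam_eq {ρ g : Fin (2 * m) → Fin (2 * m) → R}
    (hρ : ∀ i ∈ D.I, ∀ j ∈ D.I, ρ i j = if j = i then 1 else 0)
    (hρa : ∀ i ∈ D.I, D.rho a i = ρ i)
    (hgI : ∀ p ∈ D.K, ∀ j ∈ D.I, g p j = 0)
    (hgK : ∀ p ∈ D.K, ∀ j ∈ D.K, g p j = if j = p then 1 else 0)
    (hgρ : ∀ p ∈ D.K, ∀ j ∈ D.I, alt (g p) (ρ j) = 0)
    (ha : ∀ p ∈ D.K, ∀ q, D.FreeG p q → a p q = g p q) {p : Fin (2 * m)} (hp : p ∈ D.K) :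
    D.gam a p = g p := by
  have hpre : ∀ q, D.preGam a p q = if q.rev ∈ D.I then 0 else g p q := by
    intro q
    by_cases hq : q ∈ D.I
    · rw [preGam, if_pos hq, if_neg (D.rev_I q hq), hgI p hp q hq]
    by_cases hqK : q ∈ D.K
    · rw [preGam, if_neg hq, if_pos hqK, if_neg (D.rev_K q hqK), hgK p hp q hqK]
    rw [preGam, if_neg hq, if_neg hqK]
    split_ifs with hq'
    · rfl
    · exact ha p hp q (Or.inr ⟨hp, hq, hqK, hq'⟩)
  have hleft : ∀ v, alt (g p) v = alt (D.preGam a p) v +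
      ∑ j ∈ D.I, (sgn j.rev : R) * g p j.rev * v j := by
    intro v
    rw [← alt_ite_left D.I (g p) (D.preGam a p) v fun q hq => by rw [hpre, if_pos hq]]
    congr 2
    ext q
    split_ifs with hq
    · rfl
    · rw [hpre, if_neg hq]
  ext q
  rw [gam]
  split_ifs with hq
  · have h := hgρ p hp _ hq
    rw [hleft, sum_I hq (fun j => (sgn j.rev : R) * g p j.rev) _ fun j hj => hρ _ hq j hj,
      Fin.rev_rev] at h
    rw [hρa _ hq]
    linear_combination (-(sgn q : R)) * h + g p q * sgn_cast_mul_self (R := R) q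
  · rw [hpre, if_neg hq]

end Relations

end StratumIndex

namespace StratumIndex

variable {m s h l : ℕ} (D : StratumIndex m s h l)

section Param

variable {R : Type*} [CommRing R] (a θ : Fin (2 * m) → Fin (2 * m) → R)

theorem graphRow_eq_gam {p : Fin (2 * m)} (hp : p ∈ D.K) :
    graphRow (D.I ∪ D.K) (D.matU a) p = D.gam a p := by
  have hpI := D.notMem_K p hp
  ext q
  by_cases hqI : q ∈ D.I
  · rw [graphRow_self _ _ (Finset.mem_union_left _ hqI), gam_of_mem a p hqI, if_neg]
    rintro rfl
    exact hpI hqI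
  by_cases hqK : q ∈ D.K
  · rw [graphRow_self _ _ (Finset.mem_union_right _ hqK), gam_of_mem_K a p hqK]
  · rw [graphRow_of_notMem _ _ (by simp [hqI, hqK]), matU, if_neg hpI]

theorem gam_mem {p : Fin (2 * m)} (hp : p ∈ D.K) : D.gam a p ∈ D.paramU a :=
  D.graphRow_eq_gam a hp ▸ graphRow_mem _ (Finset.mem_union_right _ hp)

theorem graphRow_eq_rho {i : Fin (2 * m)} (hi : i ∈ D.I) :
    graphRow (D.I ∪ D.K) (D.matU a) i = D.rho a i - ∑ p ∈ D.K, D.rho a i p • D.gam a p := by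
  ext q
  rw [Pi.sub_apply, Finset.sum_apply]
  simp only [Pi.smul_apply, smul_eq_mul]
  by_cases hqI : q ∈ D.I
  · rw [graphRow_self _ _ (Finset.mem_union_left _ hqI), rho_of_mem a i hqI, Finset.sum_eq_zero,
      sub_zero]
    intro p _
    rw [gam_of_mem a p hqI, mul_zero]
  by_cases hqK : q ∈ D.K
  · rw [graphRow_self _ _ (Finset.mem_union_right _ hqK), if_neg (fun h : q = i => hqI (h ▸ hi)),
      Finset.sum_eq_single q]
    · rw [gam_of_mem_K a q hqK, if_pos rfl, mul_one, sub_self]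
    · intro p _ hp
      rw [gam_of_mem_K a p hqK, if_neg hp.symm, mul_zero]
    · intro h; exact absurd hqK h
  · rw [graphRow_of_notMem _ _ (by simp [hqI, hqK]), matU, if_pos hi]

theorem rho_mem {i : Fin (2 * m)} (hi : i ∈ D.I) : D.rho a i ∈ D.paramU a := by
  have h := D.graphRow_eq_rho a hi
  rw [eq_sub_iff_add_eq] at h
  rw [← h]
  exact Submodule.add_mem _ (graphRow_mem _ (Finset.mem_union_left _ hi))
    (Submodule.sum_mem _ fun p hp => Submodule.smul_mem _ _ (D.gam_mem a hp))

theorem eq_sum_of_mem_paramU {v : Fin (2 * m) → R} (hv : v ∈ D.paramU a) :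
    ∃ c : Fin (2 * m) → R, v = ∑ i ∈ D.I, v i • D.rho a i + ∑ p ∈ D.K, c p • D.gam a p := by
  refine ⟨fun p => v p - ∑ i ∈ D.I, v i * D.rho a i p, eq_of_mem_graph hv ?_ fun q hq => ?_⟩
  · exact Submodule.add_mem _ (Submodule.sum_mem _ fun i hi => Submodule.smul_mem _ _ (D.rho_mem a hi))
      (Submodule.sum_mem _ fun p hp => Submodule.smul_mem _ _ (D.gam_mem a hp))
  · rw [Pi.add_apply, Finset.sum_apply, Finset.sum_apply]
    simp only [Pi.smul_apply, smul_eq_mul]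
    rcases Finset.mem_union.1 hq with hqI | hqK
    · rw [Finset.sum_eq_single q, rho_of_mem a q hqI, if_pos rfl, mul_one, Finset.sum_eq_zero,
        add_zero]
      · intro p _; rw [gam_of_mem a p hqI, mul_zero]
      · intro i _ hi; rw [rho_of_mem a i hqI, if_neg hi.symm, mul_zero]
      · intro h; exact absurd hqI h
    · rw [Finset.sum_eq_single (s := D.K) q, gam_of_mem_K a q hqK, if_pos rfl]
      · ring
      · intro p _ hp; rw [gam_of_mem_K a p hqK, if_neg hp.symm, mul_zero]
      · intro h; exact absurd hqK h

theorem eta_eq (i : Fin (2 * m)) :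
    D.eta a θ i = D.rho a i + ∑ j ∈ D.I \ D.I₁, θ i j • D.rho a j := by
  ext q
  simp [eta]

variable {D} in
theorem mem_I {i : Fin (2 * m)} (hi : i ∈ D.I₁) : i ∈ D.I := D.I₁_subset hi

variable {D} in
theorem eta_of_mem {i j : Fin (2 * m)} (hj : j ∈ D.I) :
    D.eta a θ i j = (if j = i then 1 else 0) + if j ∈ D.I₁ then 0 else θ i j := by
  rw [eta, rho_of_mem a i hj]
  congr 1
  split_ifs with h
  · refine Finset.sum_eq_zero fun j' hj' => ?_
    rw [rho_of_mem a j' hj, if_neg, mul_zero]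
    rintro rfl
    exact (Finset.mem_sdiff.1 hj').2 h
  · rw [Finset.sum_eq_single j, rho_of_mem a j hj, if_pos rfl, mul_one]
    · intro j' _ hj'
      rw [rho_of_mem a j' hj, if_neg hj'.symm, mul_zero]
    · intro h'; exact absurd (Finset.mem_sdiff.2 ⟨hj, h⟩) h'

theorem eta_of_mem_I₁ {i j : Fin (2 * m)} (hj : j ∈ D.I₁) :
    D.eta a θ i j = if j = i then 1 else 0 := by
  rw [eta_of_mem a θ (mem_I hj), if_pos hj, add_zero]

theorem eta_mem {i : Fin (2 * m)} (hi : i ∈ D.I) : D.eta a θ i ∈ D.paramU a := by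
  rw [eta_eq]
  exact Submodule.add_mem _ (D.rho_mem a hi) (Submodule.sum_mem _ fun j hj =>
    Submodule.smul_mem _ _ (D.rho_mem a (Finset.mem_sdiff.1 hj).1))

theorem alt_rho_of_mem {i : Fin (2 * m)} (hi : i ∈ D.I) {v : Fin (2 * m) → R}
    (hv : v ∈ D.paramU a) : alt (D.rho a i) v = 0 := by
  obtain ⟨c, hc⟩ := D.eq_sum_of_mem_paramU a hv
  rw [hc, map_add, map_sum, map_sum, Finset.sum_eq_zero, Finset.sum_eq_zero, add_zero]
  · intro p _
    rw [map_smul, alt_swap, alt_gam_rho a p hi, neg_zero, smul_zero]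
  · intro j hj
    rw [map_smul, alt_rho_rho a hi hj, smul_zero]

theorem alt_eta_of_mem {i : Fin (2 * m)} (hi : i ∈ D.I) {v : Fin (2 * m) → R}
    (hv : v ∈ D.paramU a) : alt (D.eta a θ i) v = 0 := by
  rw [eta_eq, map_add, LinearMap.add_apply, D.alt_rho_of_mem a hi hv, zero_add, map_sum,
    LinearMap.sum_apply]
  refine Finset.sum_eq_zero fun j hj => ?_
  rw [map_smul, LinearMap.smul_apply, D.alt_rho_of_mem a (Finset.mem_sdiff.1 hj).1 hv, smul_zero]

theorem sum_chartSet (J : Finset (Fin (2 * m))) (f : Ind m → R) :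
    ∑ p ∈ chartSet J, f p = ∑ i ∈ J, f (Sum.inl i) + ∑ q ∈ Jᶜ, f (Sum.inr q.rev) := by
  rw [chartSet, Finset.sum_disjSum, Finset.sum_map]
  rfl

-- The intrinsic description of F that replaces its chart: x is a combination of the η_i, and the
-- pairings of y with the η_i are prescribed by the skew matrix. The two systems of equations differ
-- by multiplication with signs whose square is 1.
variable {D a θ} in
theorem mem_paramF {v : Ind m → R} : v ∈ D.paramF a θ ↔
    fstHalf v = ∑ i ∈ D.I₁, v (Sum.inl i) • D.eta a θ i ∧
      ∀ i ∈ D.I₁, alt (D.eta a θ i) (sndHalf v) = ∑ j ∈ D.I₁, v (Sum.inl j) * skew θ i j := by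
  have h1 : (∀ q ∉ D.I₁, v (Sum.inl q) = ∑ i ∈ D.I₁, v (Sum.inl i) * D.eta a θ i q) ↔
      fstHalf v = ∑ i ∈ D.I₁, v (Sum.inl i) • D.eta a θ i := by
    rw [funext_iff]
    simp only [Finset.sum_apply, Pi.smul_apply, smul_eq_mul, fstHalf_apply]
    refine ⟨fun h q => ?_, fun h q _ => h q⟩
    by_cases hq : q ∈ D.I₁
    · rw [Finset.sum_eq_single q, D.eta_of_mem_I₁ a θ hq, if_pos rfl, mul_one]
      · intro i _ hi; rw [D.eta_of_mem_I₁ a θ hq, if_neg hi.symm, mul_zero]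
      · intro h'; exact absurd hq h'
    · exact h q hq
  have h2 : ∀ i ∈ D.I₁, alt (D.eta a θ i) (sndHalf v) = sgn i * v (Sum.inr i.rev) +
      ∑ q ∈ D.I₁ᶜ, sgn q * (D.eta a θ i q * v (Sum.inr q.rev)) := by
    intro i hi
    rw [alt_apply, ← Finset.sum_add_sum_compl D.I₁]
    congr 1
    rw [Finset.sum_eq_single i, D.eta_of_mem_I₁ a θ hi, if_pos rfl, one_mul, sndHalf_apply]
    · intro j hj hne; rw [D.eta_of_mem_I₁ a θ hj, if_neg hne, zero_mul, mul_zero]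
    · intro h'; exact absurd hi h'
  rw [← h1, paramF, mem_graph, Sum.forall]
  refine and_congr (forall_congr' fun q => ?_) ?_
  · rw [inl_mem_chartSet, sum_chartSet]
    simp [matF]
  · rw [← Fin.revPerm.forall_congr_right]
    refine forall_congr' fun i => ?_
    rw [Fin.revPerm_apply, inr_mem_chartSet, Fin.rev_rev, not_not]
    refine forall_congr' fun hi => ?_
    rw [h2 i hi, sum_chartSet]
    simp only [matF, Fin.rev_rev]
    have e1 : ∑ x ∈ D.I₁, v (Sum.inl x) * (sgn i * skew θ i x) =
        sgn i * ∑ x ∈ D.I₁, v (Sum.inl x) * skew θ i x := by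
      rw [Finset.mul_sum]
      exact Finset.sum_congr rfl fun x _ => by ring
    have e2 : ∑ x ∈ D.I₁ᶜ, v (Sum.inr x.rev) * -(sgn i * sgn x * D.eta a θ i x) =
        -(sgn i * ∑ q ∈ D.I₁ᶜ, sgn q * (D.eta a θ i q * v (Sum.inr q.rev))) := by
      rw [Finset.mul_sum, ← Finset.sum_neg_distrib]
      exact Finset.sum_congr rfl fun x _ => by ring
    rw [e1, e2]
    have hε := sgn_cast_mul_self (R := R) i
    constructor
    · intro h
      linear_combination (sgn i : R) * h + (∑ x ∈ D.I₁, v (Sum.inl x) * skew θ i x -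
        ∑ q ∈ D.I₁ᶜ, sgn q * (D.eta a θ i q * v (Sum.inr q.rev))) * hε
    · intro h
      linear_combination (sgn i : R) * h - v (Sum.inr i.rev) * hε

theorem mem_paramG {v : Ind m → R} :
    v ∈ D.paramG a ↔ fstHalf v = 0 ∧ sndHalf v ∈ D.paramU a := mem_graph_inrMat

theorem skew_add_skew (i j : Fin (2 * m)) : skew θ i j + skew θ j i = 0 := by
  rcases lt_trichotomy i j with h | rfl | h
  · simp [skew, h, h.not_gt]
  · simp [skew]
  · simp [skew, h, h.not_gt]

/-- G ⊆ F and the condition on t + π both hold because the η_i lie in U and are orthogonal to it.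
Isotropy of F is the skew-symmetry of the parameter matrix. No invertibility is required of the Gram
determinant or of 2. -/
theorem conditions_param : SplConditions (0 : R) (D.paramF a θ) (D.paramG a) where
  le v hv := by
    obtain ⟨hv1, hv2⟩ := (D.mem_paramG a).1 hv
    have hv1' : ∀ i, v (Sum.inl i) = 0 := fun i => congrFun hv1 i
    refine mem_paramF.2 ⟨by simp [hv1, hv1'], fun i hi => ?_⟩
    rw [D.alt_eta_of_mem a θ (mem_I hi) hv2]
    simp [hv1']
  isotropic v hv w hw := by
    obtain ⟨hv1, hv2⟩ := mem_paramF.1 hv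
    obtain ⟨hw1, hw2⟩ := mem_paramF.1 hw
    rw [symm_apply, hv1, hw1]
    simp only [map_sum, map_smul, LinearMap.sum_apply, LinearMap.smul_apply, smul_eq_mul]
    have e : ∀ {v w : Ind m → R}, (∀ i ∈ D.I₁, alt (D.eta a θ i) (sndHalf w) =
        ∑ j ∈ D.I₁, w (Sum.inl j) * skew θ i j) →
        ∑ i ∈ D.I₁, v (Sum.inl i) * alt (D.eta a θ i) (sndHalf w) =
          ∑ i ∈ D.I₁, ∑ j ∈ D.I₁, v (Sum.inl i) * (w (Sum.inl j) * skew θ i j) := fun h =>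
      Finset.sum_congr rfl fun i hi => by rw [h i hi, Finset.mul_sum]
    rw [e hw2, e hv2]
    rw [Finset.sum_comm (f := fun i j => w (Sum.inl i) * (v (Sum.inl j) * skew θ i j)),
      ← Finset.sum_add_distrib]
    refine Finset.sum_eq_zero fun i _ => ?_
    rw [← Finset.sum_add_distrib]
    refine Finset.sum_eq_zero fun j _ => ?_
    linear_combination v (Sum.inl i) * w (Sum.inl j) * skew_add_skew θ i j
  split_F v hv := by
    obtain ⟨hv1, -⟩ := mem_paramF.1 hv
    refine (D.mem_paramG a).2 ⟨by ext i; simp, ?_⟩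
    change fstHalf v ∈ _
    rw [hv1]
    exact Submodule.sum_mem _ fun i hi => Submodule.smul_mem _ _ (D.eta_mem a θ (mem_I hi))
  split_G v hv := by
    obtain ⟨hv1, -⟩ := (D.mem_paramG a).1 hv
    ext (i | i)
    · rfl
    · have : v (Sum.inl i) = 0 := congrFun hv1 i
      simp [this]

theorem map_fstHalf_paramF : (D.paramF a θ).map fstHalf = graph D.I₁ (D.eta a θ) := by
  refine le_antisymm ?_ (graph_le_iff.2 fun i hi => ?_)
  · rintro _ ⟨v, hv, rfl⟩
    obtain ⟨hv1, -⟩ := mem_paramF.1 hv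
    intro q _
    rw [hv1]
    simp only [Finset.sum_apply, Pi.smul_apply, smul_eq_mul]
    refine Finset.sum_congr rfl fun i hi => ?_
    congr 1
    exact (congrFun hv1 i).trans (by simp only [Finset.sum_apply, Pi.smul_apply, smul_eq_mul])
  · refine ⟨graphRow (chartSet D.I₁) (D.matF a θ) (Sum.inl i),
      graphRow_mem _ (inl_mem_chartSet.2 hi), ?_⟩
    ext q
    rw [fstHalf_apply]
    by_cases hq : q ∈ D.I₁
    · rw [graphRow_self _ _ (inl_mem_chartSet.2 hq), graphRow_self _ _ hq]
      simp
    · rw [graphRow_of_notMem _ _ (mt inl_mem_chartSet.1 hq), graphRow_of_notMem _ _ hq, matF]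

theorem map_sndHalf_paramG : (D.paramG a).map sndHalf = D.paramU a := by
  ext v
  constructor
  · rintro ⟨w, hw, rfl⟩
    exact ((D.mem_paramG a).1 hw).2
  · intro hv
    exact ⟨Sum.elim 0 v, (D.mem_paramG a).2 ⟨rfl, hv⟩, rfl⟩

/-- The families with a nondegenerate Gram matrix have the expected radical. -/
theorem radical_paramU (hδ : IsUnit (D.gram (D.gam a)).det) :
    radical (D.paramU a) = graph D.I (D.rho a) := by
  have hrow : ∀ i ∈ D.I, graphRow D.I (D.rho a) i = D.rho a i := fun i hi => by
    ext q
    by_cases hq : q ∈ D.I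
    · rw [graphRow_self _ _ hq, rho_of_mem a i hq]
    · rw [graphRow_of_notMem _ _ hq]
  refine le_antisymm (fun u hu => ?_) (graph_le_iff.2 fun i hi => ?_)
  · obtain ⟨huU, hu0⟩ := mem_radical.1 hu
    obtain ⟨c, hc⟩ := D.eq_sum_of_mem_paramU a huU
    have hz : Matrix.vecMul (fun p : D.K => c p) (D.gram (D.gam a)) = 0 := by
      ext q
      have h := hu0 _ (D.gam_mem a q.2)
      rw [hc, map_add, LinearMap.add_apply, map_sum, LinearMap.sum_apply, Finset.sum_eq_zero,
        zero_add, map_sum, LinearMap.sum_apply] at h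
      · rw [Matrix.vecMul, dotProduct, Pi.zero_apply, ← h, ← Finset.sum_coe_sort D.K]
        refine Finset.sum_congr rfl fun p _ => ?_
        rw [map_smul, LinearMap.smul_apply, smul_eq_mul]
        rfl
      · intro i hi
        rw [map_smul, LinearMap.smul_apply, D.alt_rho_of_mem a hi (D.gam_mem a q.2), smul_zero]
    have hc0 : ∀ p ∈ D.K, c p = 0 := by
      intro p hp
      have hinj := Matrix.vecMul_injective_of_isUnit ((Matrix.isUnit_iff_isUnit_det _).2 hδ)
      exact congrFun (hinj (hz.trans (Matrix.zero_vecMul _).symm)) ⟨p, hp⟩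
    rw [Finset.sum_eq_zero (s := D.K) fun p hp => by rw [hc0 p hp, zero_smul], add_zero] at hc
    rw [hc]
    exact Submodule.sum_mem _ fun i hi =>
      Submodule.smul_mem _ _ (hrow i hi ▸ graphRow_mem (D.rho a) hi)
  · rw [hrow i hi]
    exact mem_radical.2 ⟨D.rho_mem a hi, fun v hv => D.alt_rho_of_mem a hi hv⟩

end Param

end StratumIndex

/-- A vector, placed in the second half of the coordinates. -/
def inSnd {m : ℕ} {R : Type*} [CommRing R] (v : Fin (2 * m) → R) : Ind m → R := Sum.elim (fun _ => 0) v

namespace StratumIndex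

variable {m s h l : ℕ} (D : StratumIndex m s h l)

theorem disjoint_I_K : Disjoint D.I D.K :=
  Finset.disjoint_left.2 fun p hpI hpK => D.notMem_K p hpK hpI

theorem card_union : (D.I ∪ D.K).card = s := by
  rw [Finset.card_union_of_disjoint D.disjoint_I_K, D.card_I, D.card_K]

theorem isSpl_param {R : Type u} [CommRing R] (a θ : Fin (2 * m) → Fin (2 * m) → R)
    (hs : h ≡ s [MOD 2]) : IsSpl s (0 : R) (D.paramF a θ) (D.paramG a) where
  locGraph_F := card_chartSet D.I₁ ▸ isLocGraph_graph _ _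
  locGraph_G := by
    have h := isLocGraph_graph ((∅ : Finset (Fin (2 * m))).disjSum (D.I ∪ D.K)) (inrMat (D.matU a))
    rwa [Finset.card_disjSum, Finset.card_empty, zero_add, D.card_union] at h
  le := (D.conditions_param a θ).le
  isotropic := (D.conditions_param a θ).isotropic
  split_F := (D.conditions_param a θ).split_F
  split_G := (D.conditions_param a θ).split_G
  spin K _ φ := by
    rw [finrank_map_opPlus, extend_paramF, map_fstHalf_paramF, finrank_graph, D.card_I₁]
    exact hs

section Field

variable {K : Type*} [Field K] (a θ : Fin (2 * m) → Fin (2 * m) → K)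

theorem finrank_map_fstHalf_paramF : Module.finrank K ((D.paramF a θ).map fstHalf) = h := by
  rw [map_fstHalf_paramF, finrank_graph, D.card_I₁]

theorem finrank_radical_paramG (hδ : IsUnit (D.gram (D.gam a)).det) :
    Module.finrank K (radical ((D.paramG a).map sndHalf)) = l := by
  rw [map_sndHalf_paramG, D.radical_paramU a hδ, finrank_graph, D.card_I]

end Field

variable {R : Type*} [CommRing R]

/-- Normalized elements of `F` and `G`, from which the parameters can be read off. -/
structure IsFrame (F G : Submodule R (Ind m → R)) (ρ g : Fin (2 * m) → Fin (2 * m) → R)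
    (f : Fin (2 * m) → Ind m → R) : Prop where
  rho_mem : ∀ i ∈ D.I, inSnd (ρ i) ∈ G
  rho_I : ∀ i ∈ D.I, ∀ j ∈ D.I, ρ i j = if j = i then 1 else 0
  gam_mem : ∀ p ∈ D.K, inSnd (g p) ∈ G
  gam_I : ∀ p ∈ D.K, ∀ j ∈ D.I, g p j = 0
  gam_K : ∀ p ∈ D.K, ∀ j ∈ D.K, g p j = if j = p then 1 else 0
  -- Only orthogonality of ρ to g is demanded, not that ρ spans the radical. This normalization
  -- therefore also makes sense off the stratum.
  alt_gam_rho : ∀ p ∈ D.K, ∀ i ∈ D.I, alt (g p) (ρ i) = 0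
  isUnit_gram : IsUnit (D.gram g).det
  f_mem : ∀ i ∈ D.I₁, f i ∈ F
  f_inl : ∀ i ∈ D.I₁, ∀ j ∈ D.I₁, f i (Sum.inl j) = if j = i then 1 else 0
  f_inr : ∀ i ∈ D.I₁, ∀ q, q.rev ∉ D.I₁ → f i (Sum.inr q) = 0

/-- The parameters of `G` read off from normalized elements. -/
def readG (ρ g : Fin (2 * m) → Fin (2 * m) → R) (p q : Fin (2 * m)) : R :=
  if p ∈ D.I then ρ p q else g p q

/-- The parameters of `F` read off from normalized elements. -/
def readF (f : Fin (2 * m) → Ind m → R) (i j : Fin (2 * m)) : R :=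
  -- For j ∈ I₁ this is the pairing of η_i with the y-part of f_j: all other terms vanish by the
  -- normalization of both.
  if j ∈ D.I₁ then sgn i * f j (Sum.inr i.rev) else f i (Sum.inl j)

variable {D}

theorem IsFrame.map {F G : Submodule R (Ind m → R)} {ρ g : Fin (2 * m) → Fin (2 * m) → R}
    {f : Fin (2 * m) → Ind m → R} (hf : D.IsFrame F G ρ g f) {S : Type*} [CommRing S]
    (φ : R →+* S) :
    D.IsFrame (extend φ F) (extend φ G) (fun p q => φ (ρ p q)) (fun p q => φ (g p q))
      fun p q => φ (f p q) where
  rho_mem i hi := by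
    convert mem_extend φ (hf.rho_mem i hi) using 1
    ext (q | q) <;> simp [inSnd]
  rho_I i hi j hj := by simp [hf.rho_I i hi j hj, apply_ite φ]
  gam_mem i hi := by
    convert mem_extend φ (hf.gam_mem i hi) using 1
    ext (q | q) <;> simp [inSnd]
  gam_I i hi j hj := by simp [hf.gam_I i hi j hj]
  gam_K i hi j hj := by simp [hf.gam_K i hi j hj, apply_ite φ]
  alt_gam_rho p hp i hi := by rw [alt_map, hf.alt_gam_rho p hp i hi, map_zero]
  isUnit_gram := by
    rw [← map_det_gram]
    exact hf.isUnit_gram.map φ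
  f_mem i hi := mem_extend φ (hf.f_mem i hi)
  f_inl i hi j hj := by simp [hf.f_inl i hi j hj, apply_ite φ]
  f_inr i hi q hq := by simp [hf.f_inr i hi q hq]

theorem map_readG {S : Type*} [CommRing S] (φ : R →+* S) (ρ g : Fin (2 * m) → Fin (2 * m) → R)
    (p q : Fin (2 * m)) :
    φ (D.readG ρ g p q) = D.readG (fun p q => φ (ρ p q)) (fun p q => φ (g p q)) p q :=
  apply_ite φ _ _ _

theorem map_readF {S : Type*} [CommRing S] (φ : R →+* S) (f : Fin (2 * m) → Ind m → R)
    (p q : Fin (2 * m)) : φ (D.readF f p q) = D.readF (fun p q => φ (f p q)) p q := by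
  simp only [readF, apply_ite φ, map_mul, map_intCast]

theorem alt_of_normalized {i : Fin (2 * m)} (hi : i ∈ D.I₁) {η : Fin (2 * m) → R}
    (hη : ∀ j ∈ D.I₁, η j = if j = i then 1 else 0) {y : Fin (2 * m) → R}
    (hy : ∀ q, q.rev ∉ D.I₁ → y q = 0) : alt η y = sgn i * y i.rev := by
  rw [alt_apply, Finset.sum_eq_single i, hη i hi, if_pos rfl, one_mul]
  · intro j _ hj
    by_cases hjI : j ∈ D.I₁
    · rw [hη j hjI, if_neg hj, zero_mul, mul_zero]
    · rw [hy _ (by rwa [Fin.rev_rev]), mul_zero, mul_zero]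
  · simp

theorem eq_zero_of_sum_gram {g : Fin (2 * m) → Fin (2 * m) → R} (hg : IsUnit (D.gram g).det)
    {c : Fin (2 * m) → R} (hc : ∀ q ∈ D.K, alt (∑ p ∈ D.K, c p • g p) (g q) = 0) :
    ∀ p ∈ D.K, c p = 0 := by
  have hz : Matrix.vecMul (fun p : D.K => c p) (D.gram g) = 0 := by
    ext q
    have h := hc q q.2
    rw [map_sum, LinearMap.sum_apply] at h
    rw [Matrix.vecMul, dotProduct, Pi.zero_apply, ← h, ← Finset.sum_coe_sort D.K]
    refine Finset.sum_congr rfl fun p _ => ?_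
    rw [map_smul, LinearMap.smul_apply, smul_eq_mul]
    rfl
  intro p hp
  have hinj := Matrix.vecMul_injective_of_isUnit ((Matrix.isUnit_iff_isUnit_det _).2 hg)
  exact congrFun (hinj (hz.trans (Matrix.zero_vecMul _).symm)) ⟨p, hp⟩

theorem readG_of_mem_I (ρ g : Fin (2 * m) → Fin (2 * m) → R) {p : Fin (2 * m)} (hp : p ∈ D.I) :
    D.readG ρ g p = ρ p := funext fun _ => if_pos hp

theorem readG_of_mem_K (ρ g : Fin (2 * m) → Fin (2 * m) → R) {p : Fin (2 * m)} (hp : p ∈ D.K) :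
    D.readG ρ g p = g p := funext fun _ => if_neg (D.notMem_K p hp)

theorem rho_of_freeG (a : Fin (2 * m) → Fin (2 * m) → R) {p q : Fin (2 * m)} (hp : p ∈ D.I)
    (hpq : D.FreeG p q) : D.rho a p q = a p q := by
  obtain ⟨-, hq, hq'⟩ := hpq.resolve_right fun h => D.notMem_K p h.1 hp
  rw [rho, if_neg (by simpa using hq'), preRho, if_neg hq, if_neg (by simpa using hq')]

theorem gam_of_freeG (a : Fin (2 * m) → Fin (2 * m) → R) {p q : Fin (2 * m)} (hp : p ∈ D.K)
    (hpq : D.FreeG p q) : D.gam a p q = a p q := by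
  obtain ⟨-, hq, hqK, hq'⟩ := hpq.resolve_left fun h => D.notMem_K p hp h.1
  rw [gam, if_neg hq', preGam, if_neg hq, if_neg hqK, if_neg hq']

/-- The parameters of a parametrized pair are recovered from normalized elements. -/
theorem IsFrame.read_param {a θ : Fin (2 * m) → Fin (2 * m) → R}
    {ρ g : Fin (2 * m) → Fin (2 * m) → R} {f : Fin (2 * m) → Ind m → R}
    (hf : D.IsFrame (D.paramF a θ) (D.paramG a) ρ g f) :
    (∀ p q, D.FreeG p q → D.readG ρ g p q = a p q) ∧
      ∀ i j, D.FreeF i j → D.readF f i j = θ i j := by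
  have hg : ∀ p ∈ D.K, g p = D.gam a p := fun p hp => by
    refine eq_of_mem_graph ((D.mem_paramG a).1 (hf.gam_mem p hp)).2 (D.gam_mem a hp) fun q hq => ?_
    rcases Finset.mem_union.1 hq with hq | hq
    · exact (hf.gam_I p hp q hq).trans (gam_of_mem a p hq).symm
    · exact (hf.gam_K p hp q hq).trans (gam_of_mem_K a p hq).symm
  -- The difference is a combination of the vectors g and is orthogonal to all of them; the
  -- invertible Gram matrix forces it to be 0.
  have hρ : ∀ i ∈ D.I, ρ i = D.rho a i := fun i hi => by
    obtain ⟨c, hc⟩ := D.eq_sum_of_mem_paramU a ((D.mem_paramG a).1 (hf.rho_mem i hi)).2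
    have hc' : ρ i = D.rho a i + ∑ p ∈ D.K, c p • g p := by
      refine hc.trans ?_
      congr 1
      · rw [Finset.sum_eq_single i]
        · change ρ i i • _ = _
          rw [hf.rho_I i hi i hi, if_pos rfl, one_smul]
        · intro j hj hji
          change ρ i j • _ = _
          rw [hf.rho_I i hi j hj, if_neg hji, zero_smul]
        · intro h'; exact absurd hi h'
      · exact Finset.sum_congr rfl fun p hp => by rw [hg p hp]
    have hc0 := eq_zero_of_sum_gram hf.isUnit_gram (c := c) fun q hq => by
      have h1 := hf.alt_gam_rho q hq i hi
      rw [hc', map_add, hg q hq, D.alt_gam_rho a q hi, zero_add, ← hg q hq, alt_swap,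
        neg_eq_zero] at h1
      exact h1
    rw [hc', Finset.sum_eq_zero fun p hp => by rw [hc0 p hp, zero_smul], add_zero]
  have hη : ∀ i ∈ D.I₁, fstHalf (f i) = D.eta a θ i := fun i hi => by
    rw [(mem_paramF.1 (hf.f_mem i hi)).1, Finset.sum_eq_single i]
    · rw [hf.f_inl i hi i hi, if_pos rfl, one_smul]
    · intro j hj hji
      rw [hf.f_inl i hi j hj, if_neg hji, zero_smul]
    · intro h'; exact absurd hi h'
  refine ⟨fun p q hpq => ?_, fun i j hij => ?_⟩
  · by_cases hp : p ∈ D.I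
    · rw [readG_of_mem_I _ _ hp, hρ p hp, rho_of_freeG a hp hpq]
    · have hpK : p ∈ D.K := by
        rcases hpq with hpq | hpq
        · exact absurd hpq.1 hp
        · exact hpq.1
      rw [readG_of_mem_K _ _ hpK, hg p hpK, gam_of_freeG a hpK hpq]
  · obtain ⟨hi, hj, hij⟩ := hij
    by_cases hj1 : j ∈ D.I₁
    · have hlt := hij.resolve_left (not_not.2 hj1)
      rw [readF, if_pos hj1]
      have h1 := (mem_paramF.1 (hf.f_mem j hj1)).2 i hi
      rw [alt_of_normalized (η := D.eta a θ i) (y := sndHalf (f j)) hi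
        (fun j hj => D.eta_of_mem_I₁ a θ hj) (hf.f_inr j hj1),
        sndHalf_apply, Finset.sum_eq_single j] at h1
      · rw [h1, hf.f_inl j hj1 j hj1, if_pos rfl, one_mul, skew, if_pos hlt]
      · intro j' hj' hne
        rw [hf.f_inl j hj1 j' hj', if_neg hne, zero_mul]
      · intro h'; exact absurd hj1 h'
    · rw [readF, if_neg hj1]
      refine (congrFun (hη i hi) j).trans ?_
      rw [eta_of_mem a θ hj, if_neg hj1, if_neg, zero_add]
      rintro rfl
      exact hj1 hi

end StratumIndex

/-! ### Pairs with 2π = 0: G as a subspace of Rⁿ and tF in its radical -/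

section Pairs

variable {m : ℕ} {R : Type*} [CommRing R] {F G : Submodule R (Ind m → R)}

theorem SplConditions.fstHalf_eq_zero (hc : SplConditions 0 F G) {v : Ind m → R} (hv : v ∈ G) :
    fstHalf v = 0 := by
  ext i
  have := congrFun (hc.split_G v hv) (Sum.inr i)
  simpa using this

theorem SplConditions.inSnd_mem_iff (hc : SplConditions 0 F G) {v : Fin (2 * m) → R} :
    inSnd v ∈ G ↔ v ∈ G.map sndHalf := by
  refine ⟨fun h => ⟨_, h, rfl⟩, ?_⟩
  rintro ⟨w, hw, rfl⟩
  have : inSnd (sndHalf w) = w := by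
    ext (q | q)
    · exact (congrFun (hc.fstHalf_eq_zero hw) q).symm
    · rfl
  exact this ▸ hw

theorem SplConditions.mem_iff (hc : SplConditions 0 F G) {v : Ind m → R} :
    v ∈ G ↔ fstHalf v = 0 ∧ sndHalf v ∈ G.map sndHalf := by
  refine ⟨fun h => ⟨hc.fstHalf_eq_zero h, v, h, rfl⟩, fun ⟨h1, h2⟩ => ?_⟩
  have : inSnd (sndHalf v) = v := by
    ext (q | q)
    · exact (congrFun h1 q).symm
    · rfl
  exact this ▸ hc.inSnd_mem_iff.2 h2

/-- `t F` is contained in the radical of `G`. -/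
theorem SplConditions.map_fstHalf_le (hc : SplConditions 0 F G) :
    F.map fstHalf ≤ radical (G.map sndHalf) := by
  rintro _ ⟨v, hv, rfl⟩
  have h1 : inSnd (fstHalf v) ∈ G := by
    have : opPlus 0 v = inSnd (fstHalf v) := by
      ext (q | q)
      · simp [inSnd]
      · rfl
    exact this ▸ hc.split_F v hv
  refine mem_radical.2 ⟨⟨_, h1, rfl⟩, fun u hu => ?_⟩
  have h2 := hc.isotropic v hv _ (hc.le (hc.inSnd_mem_iff.2 hu))
  rw [symm_apply] at h2
  have h3 : fstHalf (inSnd u) = 0 := rfl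
  rw [h3, map_zero, LinearMap.zero_apply, add_zero] at h2
  exact h2

theorem SplConditions.finrank_map_sndHalf {K : Type*} [Field K] {F G : Submodule K (Ind m → K)}
    (hc : SplConditions 0 F G) : Module.finrank K (G.map sndHalf) = Module.finrank K G := by
  have hinj : Function.Injective (sndHalf ∘ₗ G.subtype) := by
    intro v w hvw
    refine Subtype.ext (funext fun q => ?_)
    rcases q with q | q
    · exact (congrFun (hc.fstHalf_eq_zero v.2) q).trans (congrFun (hc.fstHalf_eq_zero w.2) q).symm
    · exact congrFun hvw q
  rw [← LinearMap.finrank_range_of_inj hinj, LinearMap.range_comp, Submodule.range_subtype]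

end Pairs

namespace StratumIndex

variable {m s h l : ℕ} {D : StratumIndex m s h l}

section Field

variable {K : Type*} [Field K]

/-- A field-valued point of the stratum is determined by its parameters. -/
theorem IsFrame.eq_param (h2 : (2 : K) ≠ 0) {F G : Submodule K (Ind m → K)}
    (hc : SplConditions 0 F G) (hF : Module.finrank K F = 2 * m) (hG : Module.finrank K G = s)
    (hh : Module.finrank K (F.map fstHalf) = h)
    (hl : Module.finrank K (radical (G.map sndHalf)) = l)
    {ρ g : Fin (2 * m) → Fin (2 * m) → K} {f : Fin (2 * m) → Ind m → K}
    (hf : D.IsFrame F G ρ g f) {a θ : Fin (2 * m) → Fin (2 * m) → K}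
    (ha : ∀ p q, D.FreeG p q → a p q = D.readG ρ g p q)
    (hθ : ∀ i j, D.FreeF i j → θ i j = D.readF f i j) :
    F = D.paramF a θ ∧ G = D.paramG a ∧ IsUnit (D.gram (D.gam a)).det := by
  set U := G.map sndHalf with hU
  have hUs : Module.finrank K U = s := hc.finrank_map_sndHalf.trans hG
  have hρU : ∀ i ∈ D.I, ρ i ∈ U := fun i hi => hc.inSnd_mem_iff.1 (hf.rho_mem i hi)
  have hgU : ∀ p ∈ D.K, g p ∈ U := fun i hi => hc.inSnd_mem_iff.1 (hf.gam_mem i hi)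
  -- The frame vectors make the restriction of U to I ∪ K surjective, and both sides have dimension
  -- s.
  have hzero : ∀ v ∈ U, (∀ q ∈ D.I ∪ D.K, v q = 0) → v = 0 := by
    have hinj : Function.Injective (restrictTo U (D.I ∪ D.K)) := by
      refine (LinearMap.injective_iff_surjective_of_finrank_eq_finrank ?_).2 fun w => ?_
      · rw [hUs, Module.finrank_fintype_fun_eq_card, Fintype.card_coe, D.card_union]
      let w' : Fin (2 * m) → K := fun q => if hq : q ∈ D.I ∪ D.K then w ⟨q, hq⟩ else 0
      refine ⟨⟨∑ i ∈ D.I, w' i • ρ i + ∑ p ∈ D.K, (w' p - ∑ i ∈ D.I, w' i * ρ i p) • g p,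
        U.add_mem (U.sum_mem fun i hi => U.smul_mem _ (hρU i hi))
          (U.sum_mem fun i hi => U.smul_mem _ (hgU i hi))⟩, ?_⟩
      ext ⟨q, hq⟩
      have hw' : w ⟨q, hq⟩ = w' q := by simp only [w', dif_pos hq]
      rw [restrictTo_apply, hw']
      change (∑ i ∈ D.I, w' i • ρ i + ∑ p ∈ D.K, (w' p - ∑ i ∈ D.I, w' i * ρ i p) • g p) q = w' q
      rw [Pi.add_apply, Finset.sum_apply, Finset.sum_apply]
      simp only [Pi.smul_apply, smul_eq_mul]
      rcases Finset.mem_union.1 hq with hqI | hqK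
      · rw [Finset.sum_eq_single q, hf.rho_I q hqI q hqI, if_pos rfl, mul_one, Finset.sum_eq_zero,
          add_zero]
        · intro p hp; rw [hf.gam_I p hp q hqI, mul_zero]
        · intro i hi hne; rw [hf.rho_I i hi q hqI, if_neg hne.symm, mul_zero]
        · intro h; exact absurd hqI h
      · rw [Finset.sum_eq_single (s := D.K) q, hf.gam_K q hqK q hqK, if_pos rfl]
        · ring
        · intro p hp hne; rw [hf.gam_K p hp q hqK, if_neg hne.symm, mul_zero]
        · intro h; exact absurd hqK h
    intro v hv h0
    have := @hinj ⟨v, hv⟩ 0 (funext fun q => h0 q q.2)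
    exact congrArg Subtype.val this
  have hsum : ∀ v ∈ U, (∀ i ∈ D.I, v i = 0) → v = ∑ p ∈ D.K, v p • g p := by
    intro v hv hvI
    rw [← sub_eq_zero]
    refine hzero _ (U.sub_mem hv (U.sum_mem fun p hp => U.smul_mem _ (hgU p hp))) fun q hq => ?_
    rw [Pi.sub_apply, Finset.sum_apply]
    simp only [Pi.smul_apply, smul_eq_mul]
    rcases Finset.mem_union.1 hq with hqI | hqK
    · rw [hvI q hqI, Finset.sum_eq_zero, sub_zero]
      intro p hp; rw [hf.gam_I p hp q hqI, mul_zero]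
    · rw [Finset.sum_eq_single q, hf.gam_K q hqK q hqK, if_pos rfl, mul_one, sub_self]
      · intro p hp hne; rw [hf.gam_K p hp q hqK, if_neg hne.symm, mul_zero]
      · intro h; exact absurd hqK h
  have hperp : ∀ v ∈ U, (∀ i ∈ D.I, v i = 0) → (∀ q ∈ D.K, alt v (g q) = 0) → v = 0 := by
    intro v hv hvI hvg
    have h0 := eq_zero_of_sum_gram hf.isUnit_gram (c := v) fun q hq => by
      rw [← hsum v hv hvI]; exact hvg q hq
    rw [hsum v hv hvI]
    exact Finset.sum_eq_zero fun p hp => by rw [h0 p hp, zero_smul]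
  -- Here membership in the stratum is used: the radical has dimension l = |I|, so I is a chart of
  -- it. The vectors ρ are then its rows, as the differences vanish on I and are orthogonal to every
  -- g.
  obtain ⟨b, hb⟩ := exists_eq_graph_of_card (radical U) D.I (D.card_I.trans hl.symm)
    fun u hu hu0 => hperp u (mem_radical.1 hu).1 hu0 fun q hq => (mem_radical.1 hu).2 _ (hgU q hq)
  have hρrad : ∀ i ∈ D.I, ρ i ∈ radical U := by
    intro i hi
    have hrow : graphRow D.I b i ∈ radical U := hb ▸ graphRow_mem b hi
    have h0 : ρ i - graphRow D.I b i = 0 := by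
      refine hperp _ (U.sub_mem (hρU i hi) (mem_radical.1 hrow).1) (fun j hj => ?_) fun q hq => ?_
      · rw [Pi.sub_apply, hf.rho_I i hi j hj, graphRow_self _ _ hj, sub_self]
      · rw [map_sub, LinearMap.sub_apply, alt_swap, hf.alt_gam_rho q hq i hi,
          (mem_radical.1 hrow).2 _ (hgU q hq), neg_zero, sub_zero]
    rw [sub_eq_zero.1 h0]
    exact hrow
  have hρa : ∀ i ∈ D.I, D.rho a i = ρ i := fun i hi =>
    rho_eq a hf.rho_I (fun i hi j hj => (mem_radical.1 (hρrad i hi)).2 _ (hρU j hj))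
      (fun i hi q hq => by rw [ha i q hq, readG_of_mem_I _ _ hi]) hi
  have hga : ∀ p ∈ D.K, D.gam a p = g p := fun p hp =>
    gam_eq a hf.rho_I hρa hf.gam_I hf.gam_K hf.alt_gam_rho
      (fun p hp q hq => by rw [ha p q hq, readG_of_mem_K _ _ hp]) hp
  have hUa : D.paramU a = U := by
    refine Submodule.eq_of_le_of_finrank_eq (graph_le_iff.2 fun p hp => ?_) ?_
    · by_cases hpI : p ∈ D.I
      · rw [D.graphRow_eq_rho a hpI, hρa p hpI]
        exact U.sub_mem (hρU p hpI) (U.sum_mem fun q hq => U.smul_mem _ (hga q hq ▸ hgU q hq))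
      · have hpK := (Finset.mem_union.1 hp).resolve_left hpI
        rw [D.graphRow_eq_gam a hpK, hga p hpK]
        exact hgU p hpK
    · rw [paramU, finrank_graph, hUs, D.card_union]
  have hGa : G = D.paramG a := by
    ext v
    rw [hc.mem_iff, D.mem_paramG a, hUa]
  have hη : ∀ i ∈ D.I₁, D.eta a θ i = fstHalf (f i) := by
    intro i hi
    have h1 : fstHalf (f i) ∈ graph D.I b := hb ▸ hc.map_fstHalf_le ⟨_, hf.f_mem i hi, rfl⟩
    have h3 : D.eta a θ i ∈ graph D.I b := by
      rw [← hb, eta_eq]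
      refine Submodule.add_mem _ (hρa i (mem_I hi) ▸ hρrad i (mem_I hi))
        (Submodule.sum_mem _ fun j hj => Submodule.smul_mem _ _ ?_)
      have hj' := (Finset.mem_sdiff.1 hj).1
      exact hρa j hj' ▸ hρrad j hj'
    refine eq_of_mem_graph h3 h1 fun j hj => ?_
    rw [eta_of_mem a θ hj, fstHalf_apply]
    by_cases hj1 : j ∈ D.I₁
    · rw [if_pos hj1, add_zero, hf.f_inl i hi j hj1]
    · rw [if_neg hj1, if_neg (by rintro rfl; exact hj1 hi), zero_add,
        hθ i j ⟨hi, hj, Or.inl hj1⟩, readF, if_neg hj1]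
  have hskew : ∀ i ∈ D.I₁, ∀ j ∈ D.I₁, alt (D.eta a θ i) (sndHalf (f j)) = skew θ i j := by
    have hanti : ∀ i ∈ D.I₁, ∀ j ∈ D.I₁, alt (D.eta a θ i) (sndHalf (f j)) +
        alt (D.eta a θ j) (sndHalf (f i)) = 0 := by
      intro i hi j hj
      have := hc.isotropic _ (hf.f_mem i hi) _ (hf.f_mem j hj)
      rwa [symm_apply, ← hη i hi, ← hη j hj] at this
    have hlt : ∀ i ∈ D.I₁, ∀ j ∈ D.I₁, i < j → alt (D.eta a θ i) (sndHalf (f j)) = θ i j := by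
      intro i hi j hj hij
      rw [alt_of_normalized (η := D.eta a θ i) (y := sndHalf (f j)) hi
        (fun j hj => D.eta_of_mem_I₁ a θ hj) (hf.f_inr j hj), sndHalf_apply,
        hθ i j ⟨hi, mem_I hj, Or.inr hij⟩, readF, if_pos hj]
    intro i hi j hj
    rcases lt_trichotomy i j with hij | rfl | hij
    · rw [skew, if_pos hij, hlt i hi j hj hij]
    -- Isotropy only gives that twice the diagonal entry vanishes; this is where characteristic ≠ 2
    -- enters.
    · rw [skew, if_neg (lt_irrefl _), if_neg (lt_irrefl _)]
      have := hanti i hi i hi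
      rw [← two_mul] at this
      exact (mul_eq_zero.1 this).resolve_left h2
    · rw [skew, if_neg hij.not_gt, if_pos hij, ← hlt j hj i hi hij]
      exact eq_neg_of_add_eq_zero_left (hanti i hi j hj)
  have hT : graph D.I₁ (D.eta a θ) = F.map fstHalf := by
    refine Submodule.eq_of_le_of_finrank_eq (graph_le_iff.2 fun i hi => ?_) ?_
    · refine ⟨f i, hf.f_mem i hi, ?_⟩
      rw [← hη i hi]
      ext q
      by_cases hq : q ∈ D.I₁
      · rw [graphRow_self _ _ hq, D.eta_of_mem_I₁ a θ hq]
      · rw [graphRow_of_notMem _ _ hq]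
    · rw [finrank_graph, D.card_I₁, hh]
  refine ⟨Submodule.eq_of_le_of_finrank_eq (fun v hv => ?_) ?_, hGa, ?_⟩
  · have h1 : fstHalf v = ∑ i ∈ D.I₁, v (Sum.inl i) • D.eta a θ i := by
      have : fstHalf v ∈ (D.paramF a θ).map fstHalf := by
        rw [map_fstHalf_paramF, hT]; exact ⟨v, hv, rfl⟩
      obtain ⟨w, hw, hwv⟩ := this
      rw [← hwv, (mem_paramF.1 hw).1]
      exact Finset.sum_congr rfl fun i _ => by rw [← fstHalf_apply v, ← hwv, fstHalf_apply]
    refine mem_paramF.2 ⟨h1, fun i hi => ?_⟩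
    have h3 := hc.isotropic _ (hf.f_mem i hi) _ hv
    rw [symm_apply, ← hη i hi, h1, map_sum, LinearMap.sum_apply] at h3
    rw [eq_neg_of_add_eq_zero_left h3, ← Finset.sum_neg_distrib]
    refine Finset.sum_congr rfl fun j hj => ?_
    rw [map_smul, LinearMap.smul_apply, hskew j hj i hi, smul_eq_mul]
    linear_combination (-v (Sum.inl j)) * skew_add_skew θ j i
  · rw [hF, paramF, finrank_graph, card_chartSet]
  · convert hf.isUnit_gram using 2
    ext p q
    change alt (D.gam a p) (D.gam a q) = alt (g p) (g q)
    rw [hga p p.2, hga q q.2]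

/-- A relation between the rows of the Gram matrix gives a combination `u` of the vectors g
orthogonal to all of them, hence to U, which they span together with the radical. So `u` is in the
radical and vanishes on its chart I, that is `u = 0`. -/
theorem det_gram_ne_zero {U : Submodule K (Fin (2 * m) → K)} {b b' : Fin (2 * m) → Fin (2 * m) → K}
    (hb : radical U = graph D.I b) (hb' : U = graph (D.I ∪ D.K) b')
    {g : Fin (2 * m) → Fin (2 * m) → K} (hg : ∀ p ∈ D.K, g p ∈ U) {c : K} (hc : c ≠ 0)
    (hgI : ∀ p ∈ D.K, ∀ j ∈ D.I, g p j = 0)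
    (hgK : ∀ p ∈ D.K, ∀ j ∈ D.K, g p j = if j = p then c else 0) :
    (D.gram g).det ≠ 0 := by
  intro hdet
  obtain ⟨w, hw, hw0⟩ := Matrix.exists_vecMul_eq_zero_iff.2 hdet
  let w' : Fin (2 * m) → K := fun q => if hq : q ∈ D.K then w ⟨q, hq⟩ else 0
  have hw' : ∀ p : D.K, w' p = w p := fun p => dif_pos p.2
  set u := ∑ p ∈ D.K, w' p • g p with hu
  have huU : u ∈ U := U.sum_mem fun p hp => U.smul_mem _ (hg p hp)
  have huI : ∀ i ∈ D.I, u i = 0 := fun i hi => by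
    rw [hu, Finset.sum_apply]
    refine Finset.sum_eq_zero fun p hp => ?_
    rw [Pi.smul_apply, hgI p hp i hi, smul_zero]
  have huK : ∀ q ∈ D.K, u q = w' q * c := fun q hq => by
    rw [hu, Finset.sum_apply, Finset.sum_eq_single q, Pi.smul_apply, hgK q hq q hq, if_pos rfl,
      smul_eq_mul]
    · intro p hp hne
      rw [Pi.smul_apply, hgK p hp q hq, if_neg hne.symm, smul_zero]
    · intro h'; exact absurd hq h'
  have hug : ∀ q ∈ D.K, alt u (g q) = 0 := fun q hq => by
    rw [hu, map_sum, LinearMap.sum_apply]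
    refine Eq.trans ?_ (congrFun hw0 ⟨q, hq⟩)
    rw [Matrix.vecMul, dotProduct, ← Finset.sum_coe_sort D.K]
    refine Finset.sum_congr rfl fun p _ => ?_
    rw [map_smul, LinearMap.smul_apply, smul_eq_mul, hw' p]
    rfl
  have hrad : u ∈ radical U := by
    refine mem_radical.2 ⟨huU, fun v hv => ?_⟩
    have hrow : ∀ i ∈ D.I, graphRow D.I b i ∈ radical U := fun i hi => hb ▸ graphRow_mem b hi
    set v' := v - ∑ i ∈ D.I, v i • graphRow D.I b i with hv'
    have hv'U : v' ∈ U :=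
      U.sub_mem hv (U.sum_mem fun i hi => U.smul_mem _ (mem_radical.1 (hrow i hi)).1)
    have hv'I : ∀ i ∈ D.I, v' i = 0 := fun i hi => by
      rw [hv', Pi.sub_apply, Finset.sum_apply, Finset.sum_eq_single i, Pi.smul_apply,
        graphRow_self _ _ hi, if_pos rfl, smul_eq_mul, mul_one, sub_self]
      · intro j _ hne
        rw [Pi.smul_apply, graphRow_self _ _ hi, if_neg hne.symm, smul_zero]
      · intro h'; exact absurd hi h'
    have hv'eq : v' = ∑ p ∈ D.K, (v' p * c⁻¹) • g p := by
      refine eq_of_mem_graph (hb' ▸ hv'U) (hb' ▸ U.sum_mem fun p hp => U.smul_mem _ (hg p hp))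
        fun q hq => ?_
      rw [Finset.sum_apply]
      simp only [Pi.smul_apply, smul_eq_mul]
      rcases Finset.mem_union.1 hq with hqI | hqK
      · rw [hv'I q hqI, Finset.sum_eq_zero]
        intro p hp; rw [hgI p hp q hqI, mul_zero]
      · rw [Finset.sum_eq_single q, hgK q hqK q hqK, if_pos rfl, inv_mul_cancel_right₀ hc]
        · intro p hp hne; rw [hgK p hp q hqK, if_neg hne.symm, mul_zero]
        · intro h'; exact absurd hqK h'
    have : v = v' + ∑ i ∈ D.I, v i • graphRow D.I b i := by rw [hv', sub_add_cancel]
    have e1 : alt u v' = 0 := by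
      rw [hv'eq, map_sum]
      refine Finset.sum_eq_zero fun p hp => ?_
      rw [map_smul, hug p hp, smul_zero]
    rw [this, map_add, e1, zero_add, map_sum]
    refine Finset.sum_eq_zero fun i hi => ?_
    rw [map_smul, alt_swap, (mem_radical.1 (hrow i hi)).2 u huU, neg_zero, smul_zero]
  have hu0 : u = 0 := by
    rw [hb] at hrad
    exact eq_of_mem_graph hrad (Submodule.zero_mem _) huI
  apply hw
  ext p
  have := huK p p.2
  rw [hu0, Pi.zero_apply, hw'] at this
  exact (mul_eq_zero.1 this.symm).resolve_right hc

end Field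

end StratumIndex

namespace StratumIndex

variable {m s h l : ℕ} {D : StratumIndex m s h l}

/-- The vectors of index in K serve as g. Those of index in I are projected orthogonally off their
span, with coefficients given by the inverse Gram matrix; this leaves the coordinates in I
unchanged, since the g vanish there. -/
theorem exists_frame_of_normalized {R : Type*} [CommRing R] {F G : Submodule R (Ind m → R)}
    (hc : SplConditions 0 F G) {c d : R} (hcu : IsUnit c) (hdu : IsUnit d)
    {n n' : Ind m → Ind m → R} (hn : ∀ p, n p ∈ F)
    (hnn : ∀ p ∈ chartSet D.I₁, ∀ q ∈ chartSet D.I₁, n p q = if q = p then c else 0)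
    (hn' : ∀ p, n' p ∈ G)
    (hnn' : ∀ p ∈ D.I ∪ D.K, ∀ q ∈ D.I ∪ D.K, n' (Sum.inr p) (Sum.inr q) = if q = p then d else 0)
    (hδ : IsUnit (D.gram fun p q => n' (Sum.inr p) (Sum.inr q)).det) :
    ∃ ρ g f, D.IsFrame F G ρ g f := by
  obtain ⟨c, rfl⟩ := hcu
  obtain ⟨d, rfl⟩ := hdu
  let r : Fin (2 * m) → Fin (2 * m) → R := fun p => (↑d⁻¹ : R) • sndHalf (n' (Sum.inr p))
  have hr : ∀ p ∈ D.I ∪ D.K, ∀ q ∈ D.I ∪ D.K, r p q = if q = p then 1 else 0 := by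
    intro p hp q hq
    change (↑d⁻¹ : R) * n' (Sum.inr p) (Sum.inr q) = _
    rw [hnn' p hp q hq, mul_ite, Units.inv_mul, mul_zero]
  have hI : ∀ {p}, p ∈ D.I → p ∈ D.I ∪ D.K := fun hp => Finset.mem_union_left _ hp
  have hK : ∀ {p}, p ∈ D.K → p ∈ D.I ∪ D.K := fun hp => Finset.mem_union_right _ hp
  have hrU : ∀ p, r p ∈ G.map sndHalf := fun p =>
    Submodule.smul_mem _ _ ⟨_, hn' _, rfl⟩
  have hδ' : IsUnit (D.gram r).det := by
    have : D.gram r = ((↑d⁻¹ : R) * (↑d⁻¹ : R)) • D.gram fun p q => n' (Sum.inr p) (Sum.inr q) := by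
      ext p q
      change alt (r p) (r q) = _ * alt (sndHalf (n' _)) (sndHalf (n' _))
      simp only [r, map_smul, LinearMap.smul_apply, smul_eq_mul]
      ring
    rw [this, Matrix.det_smul]
    exact ((d⁻¹.isUnit.mul d⁻¹.isUnit).pow _).mul hδ
  let x : Fin (2 * m) → D.K → R := fun i => (D.gram r)⁻¹.mulVec fun q : D.K => alt (r q) (r i)
  have hx : ∀ i, (D.gram r).mulVec (x i) = fun q : D.K => alt (r q) (r i) := by
    intro i
    rw [Matrix.mulVec_mulVec, Matrix.mul_nonsing_inv _ hδ', Matrix.one_mulVec]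
  let ρ : Fin (2 * m) → Fin (2 * m) → R := fun i => r i - ∑ p : D.K, x i p • r p
  refine ⟨ρ, r, fun i => (↑c⁻¹ : R) • n (Sum.inl i), ?_, ?_, ?_, ?_, ?_, ?_, hδ', ?_, ?_, ?_⟩
  · intro i _
    exact hc.inSnd_mem_iff.2 (Submodule.sub_mem _ (hrU i) (Submodule.sum_mem _ fun p _ =>
      Submodule.smul_mem _ _ (hrU p)))
  · intro i hi j hj
    change r i j - (∑ p : D.K, x i p • r p) j = _
    rw [hr i (hI hi) j (hI hj), Finset.sum_apply, Finset.sum_eq_zero, sub_zero]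
    intro p _
    rw [Pi.smul_apply, hr p (hK p.2) j (hI hj), if_neg, smul_zero]
    rintro rfl
    exact D.notMem_K _ p.2 hj
  · intro p _
    exact hc.inSnd_mem_iff.2 (hrU p)
  · intro p hp j hj
    rw [hr p (hK hp) j (hI hj), if_neg]
    rintro rfl
    exact D.notMem_K _ hp hj
  · intro p hp j hj
    exact hr p (hK hp) j (hK hj)
  · intro p hp i _
    have h1 := congrFun (hx i) ⟨p, hp⟩
    change alt (r p) (r i - ∑ q : D.K, x i q • r q) = 0
    rw [map_sub, ← h1, map_sum, sub_eq_zero, Matrix.mulVec, dotProduct]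
    refine Finset.sum_congr rfl fun q _ => ?_
    rw [map_smul, smul_eq_mul, mul_comm]
    rfl
  · intro i _
    exact F.smul_mem _ (hn _)
  · intro i hi j hj
    rw [Pi.smul_apply, hnn _ (inl_mem_chartSet.2 hi) _ (inl_mem_chartSet.2 hj), smul_ite,
      smul_zero, smul_eq_mul, Units.inv_mul]
    simp
  · intro i hi q hq
    rw [Pi.smul_apply, hnn _ (inl_mem_chartSet.2 hi) _ (inr_mem_chartSet.2 hq), if_neg (by simp),
      smul_zero]

/-- Near a point of the stratum, there are normalized elements. -/
theorem exists_frame {A : Type u} [CommRing A] {K : Type*} [Field K] (φ : A →+* K)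
    {F G : Submodule A (Ind m → A)} (hc : SplConditions 0 F G)
    (hF : ∃ b, extend φ F = graph (chartSet D.I₁) b)
    (hI : ∃ b, radical ((extend φ G).map sndHalf) = graph D.I b)
    (hIK : ∃ b, (extend φ G).map sndHalf = graph (D.I ∪ D.K) b) :
    ∃ e : A, φ e ≠ 0 ∧ ∀ (B : Type u) [CommRing B] (ψ : A →+* B), IsUnit (ψ e) →
      ∃ ρ g f, D.IsFrame (extend ψ F) (extend ψ G) ρ g f := by
  obtain ⟨b₁, hb₁⟩ := hF
  obtain ⟨b₂, hb₂⟩ := hI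
  obtain ⟨b₃, hb₃⟩ := hIK
  have hcφ : SplConditions 0 (extend φ F) (extend φ G) := map_zero φ ▸ hc.extend φ
  have hG : extend φ G = graph ((∅ : Finset (Fin (2 * m))).disjSum (D.I ∪ D.K)) (inrMat b₃) := by
    ext v
    rw [hcφ.mem_iff, mem_graph_inrMat, hb₃]
  obtain ⟨c, hc0, n, hn, hnn⟩ := exists_normalized_of_extend φ hb₁
  obtain ⟨d, hd0, n', hn', hnn'⟩ := exists_normalized_of_extend φ hG
  have hnn'' : ∀ p ∈ D.I ∪ D.K, ∀ q ∈ D.I ∪ D.K,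
      n' (Sum.inr p) (Sum.inr q) = if q = p then d else 0 := fun p hp q hq => by
    rw [hnn' _ (Finset.inr_mem_disjSum.2 hp) _ (Finset.inr_mem_disjSum.2 hq)]
    simp
  -- Inverting `c` and `d` normalizes elements of F and G; inverting the Gram determinant permits
  -- the orthogonal projection.
  refine ⟨c * d * (D.gram fun p q => n' (Sum.inr p) (Sum.inr q)).det, ?_, fun B _ ψ hψ => ?_⟩
  · rw [map_mul, map_mul]
    refine mul_ne_zero (mul_ne_zero hc0 hd0) ?_
    rw [map_det_gram]
    refine det_gram_ne_zero hb₂ hb₃ (fun p _ => ⟨_, mem_extend φ (hn' (Sum.inr p)), rfl⟩) hd0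
      (fun p hp j hj => ?_) fun p hp j hj => ?_
    · rw [hnn'' p (Finset.mem_union_right _ hp) j (Finset.mem_union_left _ hj), if_neg, map_zero]
      rintro rfl
      exact D.notMem_K _ hp hj
    · rw [hnn'' p (Finset.mem_union_right _ hp) j (Finset.mem_union_right _ hj), apply_ite φ,
        map_zero]
  · rw [map_mul, map_mul, IsUnit.mul_iff, IsUnit.mul_iff, map_det_gram] at hψ
    refine exists_frame_of_normalized (n := fun p q => ψ (n p q)) (n' := fun p q => ψ (n' p q))
      (map_zero ψ ▸ hc.extend ψ) hψ.1.1 hψ.1.2 (fun p => mem_extend ψ (hn p))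
      (fun p hp q hq => ?_) (fun p => mem_extend ψ (hn' p)) (fun p hp q hq => ?_) hψ.2
    · rw [hnn p hp q hq, apply_ite ψ, map_zero]
    · rw [hnn'' p hp q hq, apply_ite ψ, map_zero]

end StratumIndex

/-- The invariants `(h, l)` of a field-valued point of the special fiber. -/
structure HasType {m : ℕ} {K : Type*} [Field K] (F G : Submodule K (Ind m → K)) (h l : ℕ) :
    Prop where
  finrank_F : Module.finrank K (F.map fstHalf) = h
  finrank_G : Module.finrank K (radical (G.map sndHalf)) = l

theorem exists_frame_of_hasType {m s h l : ℕ} {A : Type u} [CommRing A] {K : Type*} [Field K]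
    (φ : A →+* K) {F G : Submodule A (Ind m → A)} (hFG : IsSpl s 0 F G)
    (ht : HasType (extend φ F) (extend φ G) h l) :
    ∃ D : StratumIndex m s h l, ∃ e : A, φ e ≠ 0 ∧
      ∀ (B : Type u) [CommRing B] (ψ : A →+* B), IsUnit (ψ e) →
        ∃ ρ g f, D.IsFrame (extend ψ F) (extend ψ G) ρ g f := by
  have hcφ : SplConditions 0 (extend φ F) (extend φ G) := map_zero φ ▸ hFG.conditions.extend φ
  obtain ⟨D, h1, h2, b, hb⟩ := exists_stratumIndex hcφ.map_fstHalf_le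
    (hcφ.finrank_map_sndHalf.trans (hFG.locGraph_G.finrank φ)) ht.finrank_G ht.finrank_F
  exact ⟨D, StratumIndex.exists_frame φ hFG.conditions (exists_eq_graph_chartSet
    (hFG.locGraph_F.finrank φ) hcφ.isotropic hb) h1 h2⟩

/-- The invariants of the points of the special fiber. -/
theorem exists_hasType {m s : ℕ} {K : Type u} [Field K] (h2 : (2 : K) ≠ 0)
    {F G : Submodule K (Ind m → K)} (hFG : IsSpl s 0 F G) :
    ∃ p ∈ strataIndex s, HasType F G p.1 p.2 := by
  have hc := hFG.conditions
  refine ⟨(_, _), ⟨?_, ?_, ?_, ?_⟩, rfl, rfl⟩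
  · exact Submodule.finrank_mono hc.map_fstHalf_le
  · refine (Submodule.finrank_mono (inf_le_left : radical (G.map sndHalf) ≤ _)).trans ?_
    rw [hc.finrank_map_sndHalf, ← extend_id G, hFG.locGraph_G.finrank]
  · have h := hFG.spin K (RingHom.id K)
    rwa [finrank_map_opPlus, extend_id] at h
  · set U := G.map sndHalf with hU
    have hUs : Module.finrank K U = s := by
      rw [hU, hc.finrank_map_sndHalf, ← extend_id G, hFG.locGraph_G.finrank]
    -- The parity of l: s - l is the rank of the alternating form restricted to U.
    let B : LinearMap.BilinForm K U := alt.compl₁₂ U.subtype U.subtype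
    have heven := even_finrank_sub_finrank_ker h2 B fun x y => alt_swap _ _
    have hker : (LinearMap.ker B).map U.subtype = radical U := by
      ext v
      rw [mem_radical]
      constructor
      · rintro ⟨u, hu, rfl⟩
        exact ⟨u.2, fun v hv => LinearMap.congr_fun (LinearMap.mem_ker.1 hu) ⟨v, hv⟩⟩
      · rintro ⟨hv, h0⟩
        exact ⟨⟨v, hv⟩, LinearMap.mem_ker.2 (LinearMap.ext fun w => h0 w w.2), rfl⟩
    have hk : Module.finrank K (LinearMap.ker B) = Module.finrank K (radical U) := by
      rw [← hker, Submodule.finrank_map_subtype_eq]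
    have hle := Submodule.finrank_le (LinearMap.ker B)
    rw [hk] at heven hle
    rw [hUs] at heven hle
    obtain ⟨c, hc⟩ := heven
    change Module.finrank K (radical U) % 2 = s % 2
    omega

/-! ### The number of free parameters -/

section Cardinality

theorem two_mul_card_lt {α : Type*} [LinearOrder α] (J : Finset α) :
    2 * ((J ×ˢ J).filter fun x => x.1 < x.2).card + J.card = J.card * J.card := by
  have h1 : ((J ×ˢ J).filter fun x => x.2 < x.1).card =
      ((J ×ˢ J).filter fun x => x.1 < x.2).card := by
    refine Finset.card_bij (fun x _ => x.swap) ?_ ?_ ?_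
    · rintro ⟨x, y⟩ h; simp at h ⊢; tauto
    · rintro ⟨x, y⟩ _ ⟨x', y'⟩ _ h; simp at h ⊢; tauto
    · rintro ⟨x, y⟩ h; exact ⟨(y, x), by simp at h ⊢; tauto, rfl⟩
  have h2 : ((J ×ˢ J).filter fun x => x.1 = x.2).card = J.card := by
    rw [← Finset.diag_card J]
    congr 1
    ext ⟨x, y⟩
    simp only [Finset.mem_filter, Finset.mem_product, Finset.mem_diag]
    exact ⟨fun h => ⟨h.1.1, h.2⟩, fun h => ⟨⟨h.1, h.2 ▸ h.1⟩, h.2⟩⟩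
  have h3 := Finset.card_filter_add_card_filter_not (s := J ×ˢ J) fun x => x.1 = x.2
  have h4 := Finset.card_filter_add_card_filter_not
    (s := (J ×ˢ J).filter fun x => ¬ x.1 = x.2) fun x => x.1 < x.2
  rw [Finset.filter_filter, Finset.filter_filter] at h4
  have e1 : (J ×ˢ J).filter (fun x => ¬ x.1 = x.2 ∧ x.1 < x.2) =
      (J ×ˢ J).filter fun x => x.1 < x.2 :=
    Finset.filter_congr fun x _ => ⟨fun h => h.2, fun h => ⟨h.ne, h⟩⟩
  have e2 : (J ×ˢ J).filter (fun x => ¬ x.1 = x.2 ∧ ¬ x.1 < x.2) =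
      (J ×ˢ J).filter fun x => x.2 < x.1 :=
    Finset.filter_congr fun x _ => ⟨fun h => lt_of_le_of_ne (not_lt.1 h.2) (Ne.symm h.1),
      fun h => ⟨h.ne', h.not_gt⟩⟩
  rw [e1, e2, h1] at h4
  rw [h2, Finset.card_product] at h3
  omega

end Cardinality

namespace StratumIndex

variable {m s h l : ℕ} (D : StratumIndex m s h l)

open Classical in
/-- The coordinates of a chart of a stratum. -/
def vars : Finset ((Fin (2 * m) × Fin (2 * m)) ⊕ (Fin (2 * m) × Fin (2 * m))) :=
  (Finset.univ.filter fun x => D.FreeG x.1 x.2).disjSum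
    (Finset.univ.filter fun x => D.FreeF x.1 x.2)

theorem inl_mem_vars {p q : Fin (2 * m)} : Sum.inl (p, q) ∈ D.vars ↔ D.FreeG p q := by
  simp [vars]

theorem inr_mem_vars {p q : Fin (2 * m)} : Sum.inr (p, q) ∈ D.vars ↔ D.FreeF p q := by
  simp [vars]

/-- The contributions are l(n - l) - l(l - 1)/2 from `rho`, (s - l)(n - s - l) from `gam`, h(l - h)
from `eta` and h(h - 1)/2 from `skew`. -/
theorem card_vars {r : ℕ} (hrs : r + s = 2 * m) :
    D.vars.card = r * s - (l - h) * (l - h - 1) / 2 := by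
  classical
  let rI : Finset (Fin (2 * m)) := D.I.map Fin.revPerm.toEmbedding
  have hrI : ∀ q, q ∈ rI ↔ q.rev ∈ D.I := fun q => by
    simp only [rI, Finset.mem_map, Equiv.coe_toEmbedding, Fin.revPerm_apply]
    exact ⟨by rintro ⟨j, hj, rfl⟩; rwa [Fin.rev_rev], fun h => ⟨_, h, Fin.rev_rev _⟩⟩
  have hG : (Finset.univ.filter fun x : Fin (2 * m) × Fin (2 * m) => D.FreeG x.1 x.2).card +
      ((D.I ×ˢ D.I).filter fun x => x.1 < x.2).card =
      l * (2 * m - l) + D.K.card * (2 * m - (l + D.K.card + l)) := by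
    -- The entries of `rho` that isotropy determines correspond to the ordered pairs in I: the entry
    -- of row i dual to i' for i' < i.
    have e1 : ((D.I ×ˢ D.I).filter fun x => x.1 < x.2).card =
        ((D.I ×ˢ D.Iᶜ).filter fun x => x.2.rev ∈ D.I ∧ x.2.rev < x.1).card := by
      refine Finset.card_bij (fun x _ => (x.2, x.1.rev)) ?_ ?_ ?_
      · rintro ⟨x, y⟩ h
        simp only [Finset.mem_filter, Finset.mem_product, Finset.mem_compl, Fin.rev_rev] at h ⊢
        exact ⟨⟨h.1.2, D.rev_I _ h.1.1⟩, h.1.1, h.2⟩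
      · rintro ⟨x, y⟩ _ ⟨x', y'⟩ _ h
        simp only [Prod.mk.injEq, Fin.rev_inj] at h ⊢
        exact ⟨h.2, h.1⟩
      · rintro ⟨x, y⟩ h
        simp only [Finset.mem_filter, Finset.mem_product, Finset.mem_compl] at h
        refine ⟨(y.rev, x), ?_, ?_⟩
        · simp only [Finset.mem_filter, Finset.mem_product]
          exact ⟨⟨h.2.1, h.1.1⟩, h.2.2⟩
        · simp
    have e2 : (Finset.univ.filter fun x : Fin (2 * m) × Fin (2 * m) => D.FreeG x.1 x.2) =
        ((D.I ×ˢ D.Iᶜ).filter fun x => ¬ (x.2.rev ∈ D.I ∧ x.2.rev < x.1)) ∪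
          D.K ×ˢ (D.I ∪ D.K ∪ rI)ᶜ := by
      ext ⟨x, y⟩
      rw [Finset.mem_filter_univ]
      simp only [FreeG, Finset.mem_filter, Finset.mem_union, Finset.mem_product, Finset.mem_compl,
        hrI]
      tauto
    have hdisj : Disjoint ((D.I ×ˢ D.Iᶜ).filter fun x => ¬ (x.2.rev ∈ D.I ∧ x.2.rev < x.1))
        (D.K ×ˢ (D.I ∪ D.K ∪ rI)ᶜ) := by
      rw [Finset.disjoint_left]
      rintro ⟨x, y⟩ h h'
      exact D.notMem_K x (Finset.mem_product.1 h').1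
        (Finset.mem_product.1 (Finset.mem_filter.1 h).1).1
    have h3 := Finset.card_filter_add_card_filter_not (s := D.I ×ˢ D.Iᶜ)
      fun x => x.2.rev ∈ D.I ∧ x.2.rev < x.1
    have hIKr : (D.I ∪ D.K ∪ rI).card = l + D.K.card + l := by
      rw [Finset.card_union_of_disjoint, Finset.card_union_of_disjoint D.disjoint_I_K,
        Finset.card_map, D.card_I]
      rw [Finset.disjoint_left]
      intro q hq hq'
      rw [hrI] at hq'
      rcases Finset.mem_union.1 hq with hq | hq
      · exact D.rev_I q hq hq'
      · exact D.rev_K q hq hq'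
    rw [e2, Finset.card_union_of_disjoint hdisj, e1, Finset.card_product, Finset.card_compl,
      hIKr, Fintype.card_fin]
    rw [Finset.card_product, Finset.card_compl, D.card_I, Fintype.card_fin] at h3
    omega
  have hF : (Finset.univ.filter fun x : Fin (2 * m) × Fin (2 * m) => D.FreeF x.1 x.2).card =
      h * (l - h) + ((D.I₁ ×ˢ D.I₁).filter fun x => x.1 < x.2).card := by
    have e2 : (Finset.univ.filter fun x : Fin (2 * m) × Fin (2 * m) => D.FreeF x.1 x.2) =
        D.I₁ ×ˢ (D.I \ D.I₁) ∪ ((D.I₁ ×ˢ D.I₁).filter fun x => x.1 < x.2) := by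
      ext ⟨x, y⟩
      rw [Finset.mem_filter_univ]
      simp only [FreeF, Finset.mem_filter, Finset.mem_union, Finset.mem_product, Finset.mem_sdiff]
      have := @D.I₁_subset y
      tauto
    rw [e2, Finset.card_union_of_disjoint, Finset.card_product,
      Finset.card_sdiff_of_subset D.I₁_subset, D.card_I, D.card_I₁]
    rw [Finset.disjoint_left]
    rintro ⟨x, y⟩ h h'
    exact (Finset.mem_sdiff.1 (Finset.mem_product.1 h).2).2
      (Finset.mem_product.1 (Finset.mem_filter.1 h').1).2
  have h1 := two_mul_card_lt D.I
  have h2 := two_mul_card_lt D.I₁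
  have hIK : l + D.K.card + l ≤ 2 * m := by
    have : (D.I ∪ D.K ∪ rI).card ≤ 2 * m := (Finset.card_le_univ _).trans_eq (Fintype.card_fin _)
    rwa [Finset.card_union_of_disjoint, Finset.card_union_of_disjoint D.disjoint_I_K,
        Finset.card_map, D.card_I] at this
    rw [Finset.disjoint_left]
    intro q hq hq'
    rw [hrI] at hq'
    rcases Finset.mem_union.1 hq with hq | hq
    · exact D.rev_I q hq hq'
    · exact D.rev_K q hq hq'
  have hhl : h ≤ l := D.card_I₁.symm.le.trans ((Finset.card_le_card D.I₁_subset).trans D.card_I.le)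
  rw [D.card_I] at h1
  rw [D.card_I₁] at h2
  rw [vars, Finset.card_disjSum, hF]
  have hK := D.card_K
  set g := (Finset.univ.filter fun x : Fin (2 * m) × Fin (2 * m) => D.FreeG x.1 x.2).card
  set x := ((D.I ×ˢ D.I).filter fun x => x.1 < x.2).card
  set y := ((D.I₁ ×ˢ D.I₁).filter fun x => x.1 < x.2).card
  set t := D.K.card
  -- With e = l - h and f = n - s - l every size becomes a sum, for instance r = h + e + f, and the
  -- truncated subtractions disappear.
  obtain ⟨e, rfl⟩ := Nat.exists_eq_add_of_le hhl
  obtain ⟨f, hf⟩ := Nat.exists_eq_add_of_le hIK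
  have hT : ∃ T, e * (e - 1) = 2 * T := by
    obtain ⟨T, hT⟩ := (Nat.even_mul_pred_self e)
    exact ⟨T, by omega⟩
  obtain ⟨T, hT⟩ := hT
  have hee : e * (e - 1) + e = e * e := by
    cases e with
    | zero => rfl
    | succ n => simp; ring
  have r1 : h + e - h = e := by omega
  have r2 : 2 * m - (h + e) = t + (h + e) + f := by omega
  have r3 : 2 * m - (h + e + t + (h + e)) = f := by omega
  have r4 : r = h + e + f := by omega
  rw [r2, r3] at hG
  rw [r1, hT, Nat.mul_div_cancel_left _ two_pos, ← hK, r4]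
  symm
  rw [Nat.sub_eq_iff_eq_add]
  · zify at *
    linarith
  · zify at *
    nlinarith

end StratumIndex

/-! ### Pairs in terms of their free coordinates -/

namespace StratumIndex

variable {m s h l : ℕ} (D : StratumIndex m s h l)
variable {R S : Type*} [CommRing R] [CommRing S]

open Classical in
/-- The parameters of `G`, as a matrix. -/
def entryG (c : D.vars → R) (p q : Fin (2 * m)) : R :=
  if hx : Sum.inl (p, q) ∈ D.vars then c ⟨_, hx⟩ else 0

open Classical in
/-- The parameters of `F`, as a matrix. -/
def entryF (c : D.vars → R) (p q : Fin (2 * m)) : R :=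
  if hx : Sum.inr (p, q) ∈ D.vars then c ⟨_, hx⟩ else 0

/-- The subspace `F` with given coordinates. -/
def pairF (c : D.vars → R) : Submodule R (Ind m → R) := D.paramF (D.entryG c) (D.entryF c)

/-- The subspace `G` with given coordinates. -/
def pairG (c : D.vars → R) : Submodule R (Ind m → R) := D.paramG (D.entryG c)

/-- The Gram determinant of the point with given coordinates. -/
def disc (c : D.vars → R) : R := (D.gram (D.gam (D.entryG c))).det

theorem map_entryG (φ : R →+* S) (c : D.vars → R) (p q : Fin (2 * m)) :
    φ (D.entryG c p q) = D.entryG (fun x => φ (c x)) p q := by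
  simp only [entryG]
  split_ifs <;> simp

theorem map_entryF (φ : R →+* S) (c : D.vars → R) (p q : Fin (2 * m)) :
    φ (D.entryF c p q) = D.entryF (fun x => φ (c x)) p q := by
  simp only [entryF]
  split_ifs <;> simp

theorem extend_pairF (φ : R →+* S) (c : D.vars → R) :
    extend φ (D.pairF c) = D.pairF fun x => φ (c x) := by
  rw [pairF, extend_paramF]
  simp only [map_entryG, map_entryF]
  rfl

theorem extend_pairG (φ : R →+* S) (c : D.vars → R) :
    extend φ (D.pairG c) = D.pairG fun x => φ (c x) := by
  rw [pairG, extend_paramG]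
  simp only [map_entryG]
  rfl

theorem map_disc (φ : R →+* S) (c : D.vars → R) : φ (D.disc c) = D.disc fun x => φ (c x) := by
  rw [disc, map_det_gram]
  simp only [map_gam, map_entryG]
  rfl

theorem isSpl_pair {R : Type u} [CommRing R] (hs : h ≡ s [MOD 2]) (c : D.vars → R) :
    IsSpl s 0 (D.pairF c) (D.pairG c) :=
  D.isSpl_param _ _ hs

theorem hasType_pair {K : Type*} [Field K] {c : D.vars → K} (hc : D.disc c ≠ 0) :
    HasType (D.pairF c) (D.pairG c) h l :=
  ⟨D.finrank_map_fstHalf_paramF _ _, D.finrank_radical_paramG _ (isUnit_iff_ne_zero.2 hc)⟩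

/-- The coordinates read off from normalized elements. -/
def readCoord (ρ g : Fin (2 * m) → Fin (2 * m) → R) (f : Fin (2 * m) → Ind m → R)
    (x : D.vars) : R :=
  Sum.elim (fun y => D.readG ρ g y.1 y.2) (fun y => D.readF f y.1 y.2) x.1

theorem map_readCoord (φ : R →+* S) (ρ g : Fin (2 * m) → Fin (2 * m) → R)
    (f : Fin (2 * m) → Ind m → R) (x : D.vars) :
    φ (D.readCoord ρ g f x) = D.readCoord (fun p q => φ (ρ p q)) (fun p q => φ (g p q))
      (fun p q => φ (f p q)) x := by
  obtain ⟨x | x, hx⟩ := x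
  · exact map_readG φ ρ g x.1 x.2
  · exact map_readF φ f x.1 x.2

variable {D} {ρ g : Fin (2 * m) → Fin (2 * m) → R} {f : Fin (2 * m) → Ind m → R}

theorem IsFrame.readCoord_pair {c : D.vars → R} (hf : D.IsFrame (D.pairF c) (D.pairG c) ρ g f) :
    D.readCoord ρ g f = c := by
  obtain ⟨h1, h2⟩ := hf.read_param
  ext ⟨⟨p, q⟩ | ⟨p, q⟩, hx⟩
  · exact (h1 p q (D.inl_mem_vars.1 hx)).trans (dif_pos hx)
  · exact (h2 p q (D.inr_mem_vars.1 hx)).trans (dif_pos hx)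

theorem IsFrame.eq_pair {K : Type u} [Field K] (h2 : (2 : K) ≠ 0) {F G : Submodule K (Ind m → K)}
    (hFG : IsSpl s 0 F G) (ht : HasType F G h l)
    {ρ g : Fin (2 * m) → Fin (2 * m) → K} {f : Fin (2 * m) → Ind m → K}
    (hf : D.IsFrame F G ρ g f) :
    F = D.pairF (D.readCoord ρ g f) ∧ G = D.pairG (D.readCoord ρ g f) ∧
      D.disc (D.readCoord ρ g f) ≠ 0 := by
  have hF : Module.finrank K F = 2 * m := by
    rw [← extend_id F, hFG.locGraph_F.finrank]
  have hG : Module.finrank K G = s := by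
    rw [← extend_id G, hFG.locGraph_G.finrank]
  obtain ⟨e1, e2, e3⟩ := hf.eq_param h2 hFG.conditions hF hG ht.finrank_F ht.finrank_G
    (a := D.entryG (D.readCoord ρ g f)) (θ := D.entryF (D.readCoord ρ g f))
    (fun p q hpq => dif_pos (D.inl_mem_vars.2 hpq)) (fun p q hpq => dif_pos (D.inr_mem_vars.2 hpq))
  exact ⟨e1, e2, e3.ne_zero⟩

end StratumIndex

theorem alt_single_single {m : ℕ} {R : Type*} [CommRing R] (i j : Fin (2 * m)) :
    alt (Pi.single i (1 : R)) (Pi.single j 1) = if j = i.rev then (sgn i : R) else 0 := by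
  rw [alt_apply, Finset.sum_eq_single i]
  · simp [Pi.single_apply, eq_comm]
  · intro q _ hq
    rw [Pi.single_eq_of_ne hq, zero_mul, mul_zero]
  · simp

/-- There is a chart whose origin is a point of the stratum. -/
theorem exists_stratumIndex_disc {m r s h l : ℕ} (hrs : r + s = 2 * m) (hsr : s ≤ r)
    (hhl : (h, l) ∈ strataIndex s) (R : Type*) [CommRing R] :
    ∃ D : StratumIndex m s h l, IsUnit (D.disc (0 : D.vars → R)) := by
  classical
  obtain ⟨h1, h2, -, h4⟩ := hhl
  dsimp only at h1 h2 h4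
  obtain ⟨q, hq⟩ : ∃ q, s = l + 2 * q := by
    have : l % 2 = s % 2 := h4
    exact ⟨(s - l) / 2, by omega⟩
  -- This uses s ≤ m, which is s ≤ r. Below, I and I₁ consist of the first l and h indices, and K of
  -- q hyperbolic pairs disjoint from I and its dual.
  have hm : l + q ≤ m := by omega
  let I : Finset (Fin (2 * m)) := Finset.univ.filter fun i => (i : ℕ) < l
  let I₁ : Finset (Fin (2 * m)) := Finset.univ.filter fun i => (i : ℕ) < h
  let K : Finset (Fin (2 * m)) := Finset.univ.filter fun i =>
    (l ≤ (i : ℕ) ∧ (i : ℕ) < l + q) ∨ (l ≤ (i.rev : ℕ) ∧ (i.rev : ℕ) < l + q)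
  have hI : ∀ i, i ∈ I ↔ (i : ℕ) < l := fun i => Finset.mem_filter_univ i
  have hI₁ : ∀ i, i ∈ I₁ ↔ (i : ℕ) < h := fun i => Finset.mem_filter_univ i
  have hK : ∀ i, i ∈ K ↔ (l ≤ (i : ℕ) ∧ (i : ℕ) < l + q) ∨
    (l ≤ (i.rev : ℕ) ∧ (i.rev : ℕ) < l + q) := fun i => Finset.mem_filter_univ i
  have hcard : ∀ a b, a ≤ b → b ≤ 2 * m →
      (Finset.univ.filter fun i : Fin (2 * m) => a ≤ (i : ℕ) ∧ (i : ℕ) < b).card = b - a := by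
    intro a b _ hb
    rw [← Nat.card_Ico, ← Finset.card_map Fin.valEmbedding]
    congr 1
    ext x
    simp only [Finset.mem_map, Finset.mem_filter_univ, Fin.valEmbedding_apply, Finset.mem_Ico]
    exact ⟨by rintro ⟨i, hi, rfl⟩; exact hi, fun hx => ⟨⟨x, by omega⟩, hx, rfl⟩⟩
  have hrev : ∀ i : Fin (2 * m), (i.rev : ℕ) + i + 1 = 2 * m := fun i => by
    rw [Fin.val_rev]; omega
  have hKcard : K.card = q + q := by
    let A : Finset (Fin (2 * m)) := Finset.univ.filter fun i => l ≤ (i : ℕ) ∧ (i : ℕ) < l + q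
    have hA : A.card = q := (hcard l (l + q) (by omega) (by omega)).trans (by omega)
    have : K = A ∪ A.map Fin.revPerm.toEmbedding := by
      ext i
      rw [hK, Finset.mem_union, Finset.mem_filter_univ, Finset.mem_map]
      refine or_congr_right ⟨fun hi => ⟨i.rev, Finset.mem_filter_univ _ |>.2 hi, by simp⟩, ?_⟩
      rintro ⟨j, hj, rfl⟩
      have := (Finset.mem_filter_univ _).1 hj
      simpa using this
    rw [this, Finset.card_union_of_disjoint, Finset.card_map, hA]
    rw [Finset.disjoint_left]
    intro i hi hi'
    obtain ⟨j, hj, rfl⟩ := Finset.mem_map.1 hi'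
    have h5 := (Finset.mem_filter_univ _).1 hi
    have h6 := (Finset.mem_filter_univ _).1 hj
    have h7 := hrev j
    simp only [Equiv.coe_toEmbedding, Fin.revPerm_apply] at h5
    omega
  let D : StratumIndex m s h l :=
    { I := I
      K := K
      I₁ := I₁
      rev_I := fun i hi => by
        rw [hI] at hi ⊢
        have := hrev i
        omega
      notMem_K := fun i hi => by
        rw [hK] at hi
        rw [hI]
        have := hrev i
        omega
      rev_K := fun i hi => by
        rw [hK] at hi
        rw [hI]
        have := hrev i
        omega
      I₁_subset := fun i hi => by
        rw [hI₁] at hi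
        rw [hI]
        omega
      card_I := by
        have := hcard 0 l (by omega) (by omega)
        simpa using this
      card_K := by rw [hKcard]; omega
      card_I₁ := by
        have := hcard 0 h (by omega) (by omega)
        simpa using this }
  have hrevK : ∀ i ∈ D.K, i.rev ∈ D.K := fun i hi => by
    rw [hK] at hi ⊢
    rw [Fin.rev_rev]
    exact hi.symm
  have hentry : D.entryG (0 : D.vars → R) = fun _ _ => 0 := by
    ext p q
    simp [StratumIndex.entryG]
  have hpre : ∀ i ∈ D.I, D.preRho (fun _ _ => (0 : R)) i = Pi.single i 1 := fun i hi => by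
    ext q
    rw [StratumIndex.preRho, Pi.single_apply]
    split_ifs <;> first | rfl | (subst_vars; contradiction)
  have hrho : ∀ i ∈ D.I, D.rho (fun _ _ => (0 : R)) i = Pi.single i 1 := fun i hi => by
    ext q
    rw [StratumIndex.rho]
    split_ifs with hq
    · have hq' := (Finset.mem_filter.1 hq).1
      rw [hpre i hi, hpre _ hq', alt_single_single, if_neg, mul_zero, Pi.single_apply, if_neg]
      · rintro rfl
        exact D.rev_I _ hi hq'
      · intro hqi
        exact D.rev_I _ hi (hqi ▸ hq')
    · rw [hpre i hi]
  have hpreG : ∀ i ∈ D.K, D.preGam (fun _ _ => (0 : R)) i = Pi.single i 1 := fun i hi => by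
    ext q
    have := D.notMem_K i hi
    rw [StratumIndex.preGam, Pi.single_apply]
    split_ifs <;> first | rfl | (subst_vars; contradiction)
  have hgam : ∀ i ∈ D.K, D.gam (fun _ _ => (0 : R)) i = Pi.single i 1 := fun i hi => by
    ext q
    rw [StratumIndex.gam]
    split_ifs with hq
    · rw [hpreG i hi, hrho _ hq, alt_single_single, if_neg, mul_zero, Pi.single_apply, if_neg]
      · rintro rfl
        exact D.rev_K _ hi hq
      · intro hqi
        exact D.rev_K _ hi (hqi ▸ hq)
    · rw [hpreG i hi]
  refine ⟨D, ?_⟩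
  set N := D.gram (D.gam (D.entryG (0 : D.vars → R))) with hN
  have hNe : ∀ p q : D.K, N p q = if (q : Fin (2 * m)) = (p : Fin (2 * m)).rev then (sgn p.1 : R) else 0 := by
    intro p q
    change alt (D.gam (D.entryG 0) p) (D.gam (D.entryG 0) q) = _
    rw [hentry, hgam p p.2, hgam q q.2, alt_single_single]
  -- At the origin the vectors are standard basis vectors, so the Gram matrix is a signed
  -- permutation matrix.
  have hNN : N * N.transpose = 1 := by
    ext p q
    rw [Matrix.mul_apply, Finset.sum_eq_single ⟨_, hrevK p p.2⟩, Matrix.transpose_apply, hNe, hNe,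
      if_pos rfl, Matrix.one_apply]
    · by_cases hpq : p = q
      · subst hpq
        rw [if_pos rfl, if_pos rfl, sgn_cast_mul_self]
      · rw [if_neg hpq, if_neg, mul_zero]
        intro h'
        exact hpq (Subtype.ext (Fin.rev_injective h'))
    · intro t _ ht
      rw [hNe, if_neg, zero_mul]
      intro h'
      exact ht (Subtype.ext h')
    · simp
  have := congrArg Matrix.det hNN
  rw [Matrix.det_mul, Matrix.det_one] at this
  exact IsUnit.of_mul_eq_one _ this

/-! ### Points of the special fiber in coordinates -/

section Invariants

variable {O₀ : Type u} [CommRing O₀] [IsDomain O₀] {π₀ : O₀}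
variable {F₀ : Type u} [Field F₀] [Algebra O₀ F₀] [IsFractionRing O₀ F₀] {m r s : ℕ}
variable {K : Type u} [Field K] [Algebra (RingOfInt π₀) K]

theorem twoPi_eq_zero_of_omega
    (hω : algebraMap (RingOfInt π₀) K QuadraticAlgebra.omega = 0) : twoPi π₀ K = 0 := by
  rw [twoPi, map_mul, hω, mul_zero]

/-- As π acts by 0, t coincides with t + π, whose rank is that of the x-projection. -/
theorem finrank_map_tOp (h0 : π₀ ≠ 0)
    (hω : algebraMap (RingOfInt π₀) K QuadraticAlgebra.omega = 0)
    (F : Submodule K (K ⊗[RingOfInt π₀] OFLattice π₀ F₀ m)) :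
    Module.finrank K (F.map (tOp π₀ F₀ m K)) =
      Module.finrank K ((coordSubmodule (ofBasis F₀ m h0) K F).map fstHalf) := by
  rw [← finrank_map_opPlus 0, ← finrank_coordSubmodule (h0 := h0),
    coordSubmodule_map_op (tOp π₀ F₀ m K) (opPlus 0) fun x => ?_]
  obtain ⟨h1, h2⟩ := coordEquiv_tOp F₀ h0 x
  ext (i | i)
  · rw [h1, hω, opPlus_inl]
  · rw [h2, hω, opPlus_inr, zero_mul, sub_zero]

/-- Since G = 0 ⊕ U, pairing with G only sees x-parts: G^⊥ consists of the vectors with x in the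
orthogonal complement of U, and t moves x to the second half. So the intersection is 0 ⊕ (U ∩ U^⊥).
-/
theorem finrank_inf_modDual (h0 : π₀ ≠ 0) (h2 : (2 : O₀) ≠ 0)
    (hω : algebraMap (RingOfInt π₀) K QuadraticAlgebra.omega = 0)
    {F G : Submodule K (K ⊗[RingOfInt π₀] OFLattice π₀ F₀ m)}
    (hc : SplConditions 0 (coordSubmodule (ofBasis F₀ m h0) K F)
      (coordSubmodule (ofBasis F₀ m h0) K G)) :
    Module.finrank K (G ⊓ modDual π₀ F₀ m G : Submodule K _) =
      Module.finrank K (radical ((coordSubmodule (ofBasis F₀ m h0) K G).map sndHalf)) := by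
  set c := coordEquiv (ofBasis F₀ m h0) K with hcdef
  set G' := coordSubmodule (ofBasis F₀ m h0) K G with hG'
  have hmem : ∀ v, c v ∈ G' ↔ v ∈ G := fun v => mem_coordSubmodule G v
  have hτ : twoPi π₀ K = 0 := twoPi_eq_zero_of_omega hω
  have hform : ∀ g ∈ G, ∀ y, formOver π₀ F₀ m K g y = alt (fstHalf (c y)) (sndHalf (c g)) := by
    intro g hg y
    rw [formOver_coordEquiv F₀ h0 h2, symm_apply, ← hcdef,
      hc.fstHalf_eq_zero ((hmem g).2 hg), map_zero, LinearMap.zero_apply, zero_add]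
  have hop : ∀ y, c ((tOp π₀ F₀ m K - piOp π₀ F₀ m K) y) = inSnd (fstHalf (c y)) := by
    intro y
    rw [hcdef, coordEquiv_tOp_sub_piOp, hτ]
    ext (i | i)
    · rfl
    · simp [inSnd]
  have hinj : Function.Injective ((sndHalf ∘ₗ c.toLinearMap) ∘ₗ
      (G ⊓ modDual π₀ F₀ m G : Submodule K _).subtype) := by
    intro v w hvw
    refine Subtype.ext (c.injective (funext fun q => ?_))
    rcases q with q | q
    · exact (congrFun (hc.fstHalf_eq_zero ((hmem _).2 v.2.1)) q).trans
        (congrFun (hc.fstHalf_eq_zero ((hmem _).2 w.2.1)) q).symm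
    · exact congrFun hvw q
  rw [← LinearMap.finrank_range_of_inj hinj, LinearMap.range_comp, Submodule.range_subtype]
  suffices hmap : (G ⊓ modDual π₀ F₀ m G).map (sndHalf ∘ₗ c.toLinearMap) =
      radical (G'.map sndHalf) by rw [hmap]
  ext u
  rw [mem_radical]
  constructor
  · rintro ⟨v, ⟨hvG, y, hy, rfl⟩, rfl⟩
    refine ⟨⟨_, (hmem _).2 hvG, rfl⟩, ?_⟩
    rintro _ ⟨g, ⟨g, hg, rfl⟩, rfl⟩
    change alt (sndHalf (c _)) (sndHalf (c g)) = 0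
    rw [hop]
    have := LinearMap.BilinForm.mem_orthogonal_iff.1 hy g hg
    exact (hform g hg y).symm.trans this
  · rintro ⟨hu, h⟩
    let y := c.symm (Sum.elim u fun _ => 0)
    have hy : c y = Sum.elim u fun _ => 0 := c.apply_symm_apply _
    have hfy : fstHalf (c y) = u := by rw [hy]; rfl
    refine ⟨(tOp π₀ F₀ m K - piOp π₀ F₀ m K) y, ⟨?_, ⟨y, ?_, rfl⟩⟩, ?_⟩
    · refine (hmem _).1 ?_
      rw [hop, hfy]
      exact hc.inSnd_mem_iff.2 hu
    · refine LinearMap.BilinForm.mem_orthogonal_iff.2 fun g hg => ?_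
      refine (hform g hg y).trans ?_
      rw [hfy]
      exact h _ ⟨_, (hmem g).2 hg, rfl⟩
    · change sndHalf (c _) = u
      rw [hop, hfy]
      rfl

end Invariants

/-! ### Morphisms to the special fiber and the corresponding pairs (F, G) -/

section Points

open Limits Opposite

variable {O₀ : Type u} [CommRing O₀] [IsDomain O₀] {π₀ : O₀}
variable {F₀ : Type u} [Field F₀] [Algebra O₀ F₀] [IsFractionRing O₀ F₀] {m r s : ℕ}
variable {M : Over (Spec (CommRingCat.of (RingOfInt π₀)))}
  (e : SplRepresentation π₀ F₀ m r s M) {k : Type u} [Field k] [Algebra (RingOfInt π₀) k]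

/-- A ring homomorphism from `O_F`, as an algebra. -/
def algOf {R : CommRingCat.{u}} (ψ : RingOfInt π₀ →+* R) :
    CommAlgCat.{u} (CommRingCat.of (RingOfInt π₀)) :=
  letI := ψ.toAlgebra
  CommAlgCat.of (CommRingCat.of (RingOfInt π₀)) R

/-- A morphism of affine schemes over `O_F`, as a morphism of algebras. -/
def algHomOf {R R' : CommRingCat.{u}} (ψ : RingOfInt π₀ →+* R) (φ : R ⟶ R') :
    algOf ψ ⟶ algOf (φ.hom.comp ψ) :=
  letI := ψ.toAlgebra
  letI := (φ.hom.comp ψ).toAlgebra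
  CommAlgCat.ofHom (show R →ₐ[CommRingCat.of (RingOfInt π₀)] R' from
    { φ.hom with commutes' := fun _ => rfl })

/-- The morphism to `M` corresponding to a morphism to the special fiber. -/
def toModel {R : CommRingCat.{u}} (ψ : RingOfInt π₀ →+* R) (z : Spec R ⟶ specialFiber M k)
    (hz : z ≫ (specialFiberOver M k).hom = Spec.map (CommRingCat.ofHom ψ)) :
    (algSpec (CommRingCat.of (RingOfInt π₀))).obj (op (algOf ψ)) ⟶ M :=
  Over.homMk (z ≫ pullback.fst M.hom _) ((Category.assoc _ _ _).trans hz)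

/-- The point of the splitting model corresponding to a morphism to the special fiber. -/
def pointOf {R : CommRingCat.{u}} (ψ : RingOfInt π₀ →+* R) (z : Spec R ⟶ specialFiber M k)
    (hz : z ≫ (specialFiberOver M k).hom = Spec.map (CommRingCat.ofHom ψ)) :
    SplPoint π₀ F₀ m r s (algOf ψ) :=
  e.inv.app (algOf ψ) (toModel ψ z hz)

/-- The pair of submodules `(F, G)` corresponds to the morphism `z` to the special fiber. -/
def Corresponds (h0 : π₀ ≠ 0) {R : CommRingCat.{u}} (z : Spec R ⟶ specialFiber M k)
    (F G : Submodule R (Ind m → R)) : Prop :=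
  ∃ (ψ : RingOfInt π₀ →+* R) (hz : z ≫ (specialFiberOver M k).hom = Spec.map (CommRingCat.ofHom ψ)),
    coordSubmodule (ofBasis F₀ m h0) (algOf ψ) (pointOf e ψ z hz).F.toSubmodule = F ∧
      coordSubmodule (ofBasis F₀ m h0) (algOf ψ) (pointOf e ψ z hz).G.toSubmodule = G

variable {e} {h0 : π₀ ≠ 0} {R R' : CommRingCat.{u}}

theorem exists_corresponds (e : SplRepresentation π₀ F₀ m r s M) (h0 : π₀ ≠ 0)
    (z : Spec R ⟶ specialFiber M k) : ∃ F G, Corresponds e h0 z F G :=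
  ⟨_, _, (Spec.preimage (z ≫ (specialFiberOver M k).hom)).hom, (Spec.map_preimage _).symm, rfl, rfl⟩

theorem specMap_ofHom_injective {A B : CommRingCat.{u}} {ψ ψ' : A →+* B}
    (h : Spec.map (CommRingCat.ofHom ψ) = Spec.map (CommRingCat.ofHom ψ')) : ψ = ψ' :=
  congrArg CommRingCat.Hom.hom (Spec.map_injective h)

/-- The structure homomorphism hidden in `Corresponds` is determined by `z` because Spec is
faithful. -/
theorem Corresponds.unique {z : Spec R ⟶ specialFiber M k} {F G F' G' : Submodule R (Ind m → R)}
    (h : Corresponds e h0 z F G) (h' : Corresponds e h0 z F' G') : F = F' ∧ G = G' := by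
  obtain ⟨ψ, hz, rfl, rfl⟩ := h
  obtain ⟨ψ', hz', rfl, rfl⟩ := h'
  obtain rfl := specMap_ofHom_injective (A := CommRingCat.of (RingOfInt π₀)) (hz.symm.trans hz')
  exact ⟨rfl, rfl⟩

theorem over_hom_eq (z : Spec R ⟶ specialFiber M k) (φ : k →+* R)
    (hφ : z ≫ specialFiberToSpec M k = Spec.map (CommRingCat.ofHom φ)) :
    z ≫ (specialFiberOver M k).hom =
      Spec.map (CommRingCat.ofHom (φ.comp (algebraMap (RingOfInt π₀) k))) := by
  rw [CommRingCat.ofHom_comp, Spec.map_comp, ← hφ, Category.assoc, ← pullback.condition]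
  rfl

theorem exists_base (z : Spec R ⟶ specialFiber M k) :
    ∃ φ : k →+* R, z ≫ specialFiberToSpec M k = Spec.map (CommRingCat.ofHom φ) :=
  ⟨(Spec.preimage (R := CommRingCat.of k) (z ≫ specialFiberToSpec M k)).hom,
    (Spec.map_preimage _).symm⟩

theorem Corresponds.exists_factor {z : Spec R ⟶ specialFiber M k} {ψ : RingOfInt π₀ →+* R}
    (hz : z ≫ (specialFiberOver M k).hom = Spec.map (CommRingCat.ofHom ψ)) :
    ∃ φ : k →+* R, ψ = φ.comp (algebraMap (RingOfInt π₀) k) := by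
  obtain ⟨φ, hφ⟩ := exists_base z
  exact ⟨φ, specMap_ofHom_injective (A := CommRingCat.of (RingOfInt π₀))
    (hz.symm.trans (over_hom_eq z φ hφ))⟩

/-- The structure homomorphism of R factors through k, where π is 0, so the parameter 2π of the
coordinate description vanishes. -/
theorem Corresponds.isSpl {z : Spec R ⟶ specialFiber M k} {F G : Submodule R (Ind m → R)}
    (h : Corresponds e h0 z F G) (h2 : (2 : O₀) ≠ 0) (hrs : r + s = 2 * m)
    (hω : algebraMap (RingOfInt π₀) k QuadraticAlgebra.omega = 0) : IsSpl s 0 F G := by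
  obtain ⟨ψ, hz, rfl, rfl⟩ := h
  obtain ⟨φ, hφ⟩ := Corresponds.exists_factor hz
  have h1 := (pointOf e ψ z hz).isSpl h0 h2 hrs
  have h3 : twoPi π₀ (algOf ψ) = 0 := by
    change ψ (2 * QuadraticAlgebra.omega) = 0
    rw [hφ, RingHom.comp_apply, map_mul, hω, mul_zero, map_zero]
  rwa [h3] at h1

theorem Corresponds.map {z : Spec R ⟶ specialFiber M k} {F G : Submodule R (Ind m → R)}
    (h : Corresponds e h0 z F G) (φ : R ⟶ R') :
    Corresponds e h0 (Spec.map φ ≫ z) (extend φ.hom F) (extend φ.hom G) := by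
  obtain ⟨ψ, hz, rfl, rfl⟩ := h
  have hz' : (Spec.map φ ≫ z) ≫ (specialFiberOver M k).hom =
      Spec.map (CommRingCat.ofHom (φ.hom.comp ψ)) := by
    rw [Category.assoc, hz, CommRingCat.ofHom_comp, Spec.map_comp]
    rfl
  have hnat : pointOf e (φ.hom.comp ψ) (Spec.map φ ≫ z) hz' =
      (pointOf e ψ z hz).map (algHomOf ψ φ).hom := by
    have h1 : toModel (φ.hom.comp ψ) (Spec.map φ ≫ z) hz' =
        (algSpec (CommRingCat.of (RingOfInt π₀))).map (algHomOf ψ φ).op ≫ toModel ψ z hz :=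
      Over.OverMorphism.ext (Category.assoc _ _ _)
    rw [pointOf, h1]
    exact ConcreteCategory.congr_hom (e.inv.naturality (algHomOf ψ φ)) (toModel ψ z hz)
  refine ⟨φ.hom.comp ψ, hz', ?_, ?_⟩
  · rw [hnat]
    exact coordSubmodule_map (ofBasis F₀ m h0) (algHomOf ψ φ).hom (pointOf e ψ z hz).F
  · rw [hnat]
    exact coordSubmodule_map (ofBasis F₀ m h0) (algHomOf ψ φ).hom (pointOf e ψ z hz).G

/-- A morphism to the fiber product is a morphism to M together with one to Spec k; the former is
determined by the pair and the structure homomorphism. -/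
theorem Corresponds.hom_ext {z z' : Spec R ⟶ specialFiber M k} {F G : Submodule R (Ind m → R)}
    (h : Corresponds e h0 z F G) (h' : Corresponds e h0 z' F G)
    (hzz : z ≫ specialFiberToSpec M k = z' ≫ specialFiberToSpec M k) : z = z' := by
  obtain ⟨ψ, hz, hF, hG⟩ := h
  obtain ⟨ψ', hz', hF', hG'⟩ := h'
  have hψ : ψ = ψ' := by
    obtain ⟨φ, hφ⟩ := exists_base z
    have h1 := over_hom_eq z φ hφ
    have h3 := over_hom_eq z' φ (hzz.symm.trans hφ)
    exact specMap_ofHom_injective (A := CommRingCat.of (RingOfInt π₀))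
      (hz.symm.trans (h1.trans (h3.symm.trans hz')))
  subst hψ
  have hp : pointOf e ψ z hz = pointOf e ψ z' hz' :=
    SplPoint.ext_coord h0 (hF.trans hF'.symm) (hG.trans hG'.symm)
  have hm : toModel ψ z hz = toModel ψ z' hz' := by
    have := congrArg (e.hom.app (algOf ψ)) hp
    have hid := fun t => ConcreteCategory.congr_hom (e.inv_hom_id_app (algOf ψ)) t
    exact (hid _).symm.trans (this.trans (hid _))
  exact pullback.hom_ext (congrArg Over.Hom.left hm) hzz

theorem IsSpl.exists_splPoint {A : CommAlgCat.{u} (CommRingCat.of (RingOfInt π₀))} (h0 : π₀ ≠ 0)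
    (h2 : (2 : O₀) ≠ 0) (hrs : r + s = 2 * m) {F G : Submodule A (Ind m → A)}
    (h : IsSpl s (twoPi π₀ A) F G) :
    ∃ p : SplPoint π₀ F₀ m r s A,
      coordSubmodule (ofBasis F₀ m h0) A p.F.toSubmodule = F ∧
        coordSubmodule (ofBasis F₀ m h0) A p.G.toSubmodule = G :=
  ⟨h.toSplPoint h0 h2 hrs, h.coordSubmodule_F h0 h2 hrs, h.coordSubmodule_G h0 h2 hrs⟩

theorem IsSpl.exists_corresponds (e : SplRepresentation π₀ F₀ m r s M) (h0 : π₀ ≠ 0)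
    (h2 : (2 : O₀) ≠ 0) (hrs : r + s = 2 * m)
    (hω : algebraMap (RingOfInt π₀) k QuadraticAlgebra.omega = 0)
    {F G : Submodule R (Ind m → R)} (hFG : IsSpl s 0 F G) (φ : k →+* R) :
    ∃ z : Spec R ⟶ specialFiber M k,
      z ≫ specialFiberToSpec M k = Spec.map (CommRingCat.ofHom φ) ∧ Corresponds e h0 z F G := by
  set ψ := φ.comp (algebraMap (RingOfInt π₀) k) with hψ
  have h3 : twoPi π₀ (algOf ψ) = 0 := by
    change ψ (2 * QuadraticAlgebra.omega) = 0
    rw [hψ, RingHom.comp_apply, map_mul, hω, mul_zero, map_zero]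
  obtain ⟨p, hpF, hpG⟩ : ∃ p : SplPoint π₀ F₀ m r s (algOf ψ),
      coordSubmodule (ofBasis F₀ m h0) (algOf ψ) p.F.toSubmodule = F ∧
      coordSubmodule (ofBasis F₀ m h0) (algOf ψ) p.G.toSubmodule = G :=
    IsSpl.exists_splPoint (A := algOf ψ) h0 h2 hrs (h3.symm ▸ hFG)
  let z₁ := e.hom.app (algOf ψ) p
  have hz₁ : z₁.left ≫ M.hom = Spec.map (CommRingCat.ofHom φ) ≫
      Spec.map (CommRingCat.ofHom (algebraMap (RingOfInt π₀) k)) := by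
    rw [← Spec.map_comp, ← CommRingCat.ofHom_comp]
    exact Over.w z₁
  let z : Spec R ⟶ specialFiber M k := pullback.lift z₁.left (Spec.map (CommRingCat.ofHom φ)) hz₁
  have hz : z ≫ specialFiberToSpec M k = Spec.map (CommRingCat.ofHom φ) := pullback.lift_snd _ _ _
  have hzo := over_hom_eq z φ hz
  have hm : toModel ψ z hzo = z₁ := Over.OverMorphism.ext (pullback.lift_fst _ _ _)
  have hp : pointOf e ψ z hzo = p := by
    rw [pointOf, hm]
    exact ConcreteCategory.congr_hom (e.hom_inv_id_app (algOf ψ)) p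
  exact ⟨z, hz, ψ, hzo, by rw [hp, hpF], by rw [hp, hpG]⟩

theorem mem_stratum_iff (e : SplRepresentation π₀ F₀ m r s M) (h0 : π₀ ≠ 0)
    (h2 : (2 : O₀) ≠ 0) (hrs : r + s = 2 * m)
    (hω : algebraMap (RingOfInt π₀) k QuadraticAlgebra.omega = 0) (x : specialFiber M k) {h l : ℕ}
    {F G : Submodule ((specialFiber M k).residueField x) (Ind m → (specialFiber M k).residueField x)}
    (hc : Corresponds e h0 ((specialFiber M k).fromSpecResidueField x) F G) :
    x ∈ stratum e k h l ↔ HasType F G h l := by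
  set z := (specialFiber M k).fromSpecResidueField x
  have hspl := hc.isSpl h2 hrs hω
  obtain ⟨ψ', hz', hF, hG⟩ := hc
  let ψ := (Spec.preimage (z ≫ (specialFiberOver M k).hom)).hom
  have hz : z ≫ (specialFiberOver M k).hom = Spec.map (CommRingCat.ofHom ψ) :=
    (Spec.map_preimage _).symm
  obtain rfl := specMap_ofHom_injective (A := CommRingCat.of (RingOfInt π₀)) (hz'.symm.trans hz)
  obtain ⟨φ, hφ⟩ := Corresponds.exists_factor hz
  have hω' : ψ QuadraticAlgebra.omega = 0 := by
    rw [hφ, RingHom.comp_apply, hω, map_zero]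
  subst hF hG
  let _ : Algebra (RingOfInt π₀) ((specialFiber M k).residueField x) := ψ.toAlgebra
  have e1 := finrank_map_tOp (K := (specialFiber M k).residueField x) (F₀ := F₀) h0 hω'
    (pointOf e ψ z hz).F.toSubmodule
  have e2 := finrank_inf_modDual (K := (specialFiber M k).residueField x) (F₀ := F₀) h0 h2 hω'
    hspl.conditions
  constructor
  · rintro ⟨h1, h3⟩
    exact ⟨e1.symm.trans h1, e2.symm.trans h3⟩
  · rintro ⟨h1, h3⟩
    exact ⟨e1.trans h1, e2.trans h3⟩

end Points

/-! ### Dimension of locally closed pieces of affine spaces -/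

-- An irreducible open set meeting the component C is contained in C, as its trace on C is its only
-- irreducible component. So C is covered by open sets of dimension d, and the coheight of an
-- irreducible closed subset may be computed in any of them that it meets.
open Topology TopologicalSpace in
theorem topologicalKrullDim_irreducibleComponent {Y : Type u} [TopologicalSpace Y] {d : WithBot ℕ∞}
    (H : ∀ y : Y, ∃ (U : Type u) (_ : TopologicalSpace U) (f : U → Y), IrreducibleSpace U ∧
      IsOpenEmbedding f ∧ y ∈ Set.range f ∧ topologicalKrullDim U = d)
    {C : Set Y} (hC : C ∈ irreducibleComponents Y) : topologicalKrullDim C = d := by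
  have key : ∀ y : C, ∃ (U : Type u) (_ : TopologicalSpace U) (f : U → C),
      IsOpenEmbedding f ∧ y ∈ Set.range f ∧ topologicalKrullDim U = d := by
    rintro ⟨y, hy⟩
    obtain ⟨U, _, f, _, hf, ⟨z, rfl⟩, hd⟩ := H y
    have h1 := preimage_mem_irreducibleComponents hC hf ⟨f z, hy, z, rfl⟩
    rw [irreducibleComponents_eq_singleton, Set.mem_singleton_iff] at h1
    have h2 : ∀ u, f u ∈ C := fun u => by
      have : u ∈ f ⁻¹' C := h1 ▸ Set.mem_univ u
      exact this
    refine ⟨U, inferInstance, Set.codRestrict f C h2, ?_, ⟨z, rfl⟩, hd⟩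
    refine ⟨hf.isEmbedding.codRestrict C h2, ?_⟩
    convert! hf.isOpen_range.preimage (continuous_subtype_val (p := (· ∈ C))) using 1
    ext ⟨y, hy⟩
    simp [Set.mem_range]
  apply le_antisymm
  · rw [topologicalKrullDim, Order.krullDim_eq_iSup_coheight]
    refine iSup_le fun T => ?_
    obtain ⟨y, hy⟩ := T.isIrreducible.nonempty
    obtain ⟨U, _, f, hf, ⟨z, rfl⟩, rfl⟩ := key y
    let V : {V : IrreducibleCloseds C | (f ⁻¹' V).Nonempty} := ⟨T, z, hy⟩
    have hV : T = IrreducibleCloseds.map f hf.continuous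
        ((IrreducibleCloseds.orderIsoOfIsOpenEmbedding f hf).symm V) :=
      congrArg Subtype.val
        ((IrreducibleCloseds.orderIsoOfIsOpenEmbedding f hf).apply_symm_apply V).symm
    rw [hV, hf.coheight_map]
    exact Order.coheight_le_krullDim _
  · obtain ⟨y, hy⟩ := hC.1.nonempty
    obtain ⟨U, _, f, hf, -, rfl⟩ := key ⟨y, hy⟩
    exact hf.isInducing.topologicalKrullDim_le

/-- Induction on the number of variables: over a Jacobson ring a maximal ideal of the polynomial
ring contracts to a maximal ideal, and adjoining the variable raises the height by exactly 1. -/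
theorem height_of_isMaximal_mvPolynomial (k : Type u) [Field k] {σ : Type*} [Finite σ] :
    ∀ P : Ideal (MvPolynomial σ k), P.IsMaximal → P.height = Nat.card σ := by
  induction σ using Finite.induction_empty_option with
  | of_equiv e H =>
    intro P hP
    have e' := (MvPolynomial.renameEquiv k e).toRingEquiv
    rw [← e'.height_comap, ← Nat.card_congr e]
    exact H _ (Ideal.comap_isMaximal_of_equiv e')
  | h_empty =>
    intro P hP
    have e := (MvPolynomial.isEmptyRingEquiv k PEmpty)
    have : IsField (MvPolynomial PEmpty k) := e.toMulEquiv.isField (Field.toIsField k)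
    let _ := this.toField
    rw [(Ideal.eq_bot_or_top P).resolve_right hP.ne_top]
    simp
  | @h_option α _ IH =>
    intro P hP
    have e := (MvPolynomial.optionEquivLeft k α).symm.toRingEquiv
    rw [← e.height_comap]
    have hQ := Ideal.comap_isMaximal_of_equiv e (p := P)
    generalize P.comap e = Q at hQ
    have := Polynomial.isMaximal_comap_C_of_isJacobsonRing Q
    have hl : Q.LiesOver (Q.comap Polynomial.C) := ⟨rfl⟩
    rw [Polynomial.height_eq_height_add_one (Q.comap Polynomial.C) Q, IH _ this]
    simp

/-! ### Reduced locally closed subschemes from charts -/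

section Reduced

open Limits TopologicalSpace

/-- Around the point `x`, the subset `S` of the `T`-scheme `X` is the image of a closed immersion
from a smooth integral affine `T`-scheme of dimension `d`. -/
def HasSmoothChart {X T : Scheme.{u}} (f : X ⟶ T) (S : Set X) (d : WithBot ℕ∞) (x : X) : Prop :=
  ∃ (A B : CommRingCat.{u}) (j : Spec A ⟶ X) (q : A ⟶ B), IsOpenImmersion j ∧ x ∈ Set.range j ∧
    Function.Surjective q.hom ∧ j ⁻¹' S = Set.range (Spec.map q) ∧ IsDomain B ∧
    ringKrullDim B = d ∧ Smooth (Spec.map q ≫ j ≫ f)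

theorem isReduced_subscheme_vanishingIdeal {W : Scheme.{u}} (Z : Closeds W) :
    IsReduced (Scheme.IdealSheafData.vanishingIdeal Z).subscheme := by
  have (i : (Scheme.IdealSheafData.vanishingIdeal Z).subschemeCover.openCover.I₀) :
      AlgebraicGeometry.IsReduced ((Scheme.IdealSheafData.vanishingIdeal Z).subschemeCover.openCover.X i) := by
    change W.affineOpens at i
    have : _root_.IsReduced (Γ(W, i) ⧸ (Scheme.IdealSheafData.vanishingIdeal Z).ideal i) := by
      rw [← Ideal.isRadical_iff_quotient_reduced]
      exact PrimeSpectrum.isRadical_vanishingIdeal _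
    exact inferInstanceAs (AlgebraicGeometry.IsReduced (Spec (.of (Γ(W, i) ⧸
      (Scheme.IdealSheafData.vanishingIdeal Z).ideal i))))
  exact AlgebraicGeometry.IsReduced.of_openCover _ (Scheme.IdealSheafData.vanishingIdeal Z).subschemeCover.openCover

/-- As Y is reduced, the kernel of g is the vanishing ideal of the closure of its image. -/
theorem vanishingIdeal_le_ker {W Y : Scheme.{u}} [IsReduced Y] (Z : Closeds W) (g : Y ⟶ W)
    (hg : Set.range g ⊆ Z) : Scheme.IdealSheafData.vanishingIdeal Z ≤ g.ker := by
  rw [← Scheme.IdealSheafData.map_bot, ← Scheme.nilradical_eq_bot,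
    ← Scheme.IdealSheafData.vanishingIdeal_top, Scheme.IdealSheafData.map_vanishingIdeal]
  apply Scheme.IdealSheafData.vanishingIdeal_antimono
  rw [Closeds.closure_le]
  simpa using hg

/-- A chart of a reduced closed subscheme. -/
theorem exists_isOpenImmersion_vanishingIdeal {W : Scheme.{u}} (Z : Closeds W)
    {A B : CommRingCat.{u}} (j : Spec A ⟶ W) [IsOpenImmersion j] (q : A ⟶ B)
    (hq : Function.Surjective q.hom) [IsDomain B] (hS : j ⁻¹' Z = Set.range (Spec.map q)) :
    ∃ h : Spec B ⟶ (Scheme.IdealSheafData.vanishingIdeal Z).subscheme, IsOpenImmersion h ∧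
      h ≫ (Scheme.IdealSheafData.vanishingIdeal Z).subschemeι = Spec.map q ≫ j := by
  set I := Scheme.IdealSheafData.vanishingIdeal Z with hI
  have hred : IsReduced I.subscheme := isReduced_subscheme_vanishingIdeal Z
  have hcq : IsClosedImmersion (Spec.map q) := IsClosedImmersion.spec_of_surjective q hq
  have hle : I.subschemeι.ker ≤ (Spec.map q ≫ j).ker := by
    rw [Scheme.IdealSheafData.ker_subschemeι]
    refine vanishingIdeal_le_ker Z _ ?_
    rintro _ ⟨b, rfl⟩
    have : Spec.map q b ∈ j ⁻¹' Z := hS ▸ ⟨b, rfl⟩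
    exact this
  let h := IsClosedImmersion.lift I.subschemeι (Spec.map q ≫ j) hle
  have hh : h ≫ I.subschemeι = Spec.map q ≫ j := IsClosedImmersion.lift_fac _ _ _
  refine ⟨h, ?_, hh⟩
  -- The comparison with the restriction of the subscheme to the chart is a surjective closed
  -- immersion into a reduced scheme, hence an isomorphism.
  let h' : Spec B ⟶ pullback I.subschemeι j := pullback.lift h (Spec.map q) hh
  have h1 : h' ≫ pullback.fst I.subschemeι j = h := pullback.lift_fst _ _ _
  have h2 : h' ≫ pullback.snd I.subschemeι j = Spec.map q := pullback.lift_snd _ _ _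
  have hc : IsClosedImmersion (h' ≫ pullback.snd I.subschemeι j) := h2 ▸ hcq
  have hc' : IsClosedImmersion h' := IsClosedImmersion.of_comp _ (pullback.snd I.subschemeι j)
  have hred' : IsReduced (pullback I.subschemeι j) :=
    isReduced_of_isOpenImmersion (pullback.fst I.subschemeι j)
  have hsurj : Surjective h' := by
    refine ⟨fun p => ?_⟩
    have hp : pullback.snd I.subschemeι j p ∈ j ⁻¹' Z := by
      have h3 : j (pullback.snd I.subschemeι j p) =
          I.subschemeι (pullback.fst I.subschemeι j p) := by
        rw [← Scheme.Hom.comp_apply, ← Scheme.Hom.comp_apply, pullback.condition]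
      have h4 : I.subschemeι (pullback.fst I.subschemeι j p) ∈ Set.range I.subschemeι := ⟨_, rfl⟩
      rw [Scheme.IdealSheafData.range_subschemeι] at h4
      rw [Set.mem_preimage, h3]
      simpa [hI] using h4
    rw [hS] at hp
    obtain ⟨b, hb⟩ := hp
    refine ⟨b, (pullback.snd I.subschemeι j).isEmbedding.injective ?_⟩
    rw [← hb, ← h2]
    rfl
  have := isIso_of_isClosedImmersion_of_surjective h'
  rw [← h1]
  infer_instance

/-- S is closed in the union W of the charts, because it is closed in each of them. The reduced
structure on it is Spec B in each chart, B being a domain, so smoothness and dimension are inherited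
from the charts. -/
theorem exists_reducedSubscheme {X T : Scheme.{u}} (f : X ⟶ T) (S : Set X) (d : ℕ)
    (H : ∀ x ∈ S, HasSmoothChart f S d x) :
    ∃ (Y : Scheme.{u}) (ι : Y ⟶ X), IsReducedSubscheme ι S ∧ Smooth (ι ≫ f) ∧
      IsEquidimensional Y d := by
  have H' (x : S) := H x.1 x.2
  choose A B j q hj hx hq hS hB hd hs using H'
  let W : X.Opens := ⨆ x : S, ⟨Set.range (j x), (j x).isOpenEmbedding.isOpen_range⟩
  have hSW : S ⊆ W := fun x hxS => Opens.mem_iSup.2 ⟨⟨x, hxS⟩, hx ⟨x, hxS⟩⟩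
  have hW : ∀ x : S, Set.range (j x) ⊆ Set.range W.ι := by
    intro x
    rw [Scheme.Opens.range_ι]
    intro y hy
    exact Opens.mem_iSup.2 ⟨x, hy⟩
  have hclosed : IsClosed (W.ι ⁻¹' S) := by
    refine ⟨isOpen_iff_forall_mem_open.2 fun w hw => ?_⟩
    obtain ⟨x, p, hp⟩ := Opens.mem_iSup.1 w.2
    have hcl : IsClosed (j x ⁻¹' S) := by
      rw [hS x]
      have : IsClosedImmersion (Spec.map (q x)) :=
        IsClosedImmersion.spec_of_surjective _ (hq x)
      exact (Spec.map (q x)).isClosedEmbedding.isClosed_range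
    refine ⟨W.ι ⁻¹' (j x '' (j x ⁻¹' S)ᶜ), ?_, ?_, ⟨p, ?_, hp⟩⟩
    · rintro v ⟨p', hp', hv⟩ hvS
      exact hp' (show j x p' ∈ S from hv ▸ hvS)
    · exact ((j x).isOpenEmbedding.isOpenMap _ hcl.isOpen_compl).preimage W.ι.continuous
    · intro hpS
      exact hw (show w.1 ∈ S from hp ▸ hpS)
  let Z : Closeds W := ⟨W.ι ⁻¹' S, hclosed⟩
  set I := Scheme.IdealSheafData.vanishingIdeal Z with hI
  have hred : IsReduced I.subscheme := isReduced_subscheme_vanishingIdeal Z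
  have hrange : Set.range (I.subschemeι ≫ W.ι) = S := by
    rw [Scheme.Hom.comp_base, TopCat.coe_comp, Set.range_comp,
      Scheme.IdealSheafData.range_subschemeι]
    have : (I.support : Set W) = W.ι ⁻¹' S := by simp [hI, Z]
    rw [this, Set.image_preimage_eq_inter_range, Scheme.Opens.range_ι]
    exact Set.inter_eq_left.2 hSW
  have chart : ∀ y : I.subscheme, ∃ (x : S) (h : Spec (B x) ⟶ I.subscheme),
      IsOpenImmersion h ∧ y ∈ Set.range h ∧ h ≫ I.subschemeι ≫ W.ι = Spec.map (q x) ≫ j x := by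
    intro y
    let x : S := ⟨(I.subschemeι ≫ W.ι) y, hrange ▸ ⟨y, rfl⟩⟩
    let j' := IsOpenImmersion.lift W.ι (j x) (hW x)
    have hj' : j' ≫ W.ι = j x := IsOpenImmersion.lift_fac _ _ _
    have : IsOpenImmersion j' := by
      have : IsOpenImmersion (j' ≫ W.ι) := hj' ▸ hj x
      exact IsOpenImmersion.of_comp j' W.ι
    obtain ⟨h, hh, hhι⟩ := exists_isOpenImmersion_vanishingIdeal Z j' (q x) (hq x) (by
      rw [← hS x, ← hj']
      rfl)
    have hcomp : h ≫ I.subschemeι ≫ W.ι = Spec.map (q x) ≫ j x := by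
      rw [← hj', ← Category.assoc, hhι, Category.assoc]
    refine ⟨x, h, hh, ?_, hcomp⟩
    obtain ⟨p, hp⟩ := hx x
    have hpS : p ∈ j x ⁻¹' S := show j x p ∈ S from hp ▸ x.2
    rw [hS x] at hpS
    obtain ⟨b, rfl⟩ := hpS
    refine ⟨b, (I.subschemeι ≫ W.ι).isEmbedding.injective ?_⟩
    rw [← Scheme.Hom.comp_apply, hcomp, Scheme.Hom.comp_apply, hp]
  choose c h hopen hmem hcomp using chart
  refine ⟨I.subscheme, I.subschemeι ≫ W.ι, ⟨inferInstance, hred, hrange⟩, ?_, ?_⟩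
  · let 𝒰 : I.subscheme.OpenCover := Scheme.Cover.mkOfCovers I.subscheme (fun y => Spec (B (c y))) h
      (fun y => ⟨y, hmem y⟩) hopen
    have : IsZariskiLocalAtSource @AlgebraicGeometry.Smooth.{u} :=
      HasRingHomProperty.instIsZariskiLocalAtSource (Q := RingHom.Smooth)
    refine IsZariskiLocalAtSource.of_openCover (P := @AlgebraicGeometry.Smooth.{u}) 𝒰 fun y => ?_
    have h1 : 𝒰.f y ≫ (I.subschemeι ≫ W.ι) ≫ f = Spec.map (q (c y)) ≫ j (c y) ≫ f := by
      rw [← Category.assoc, ← Category.assoc (Spec.map _), ← hcomp y]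
      rfl
    rw [h1]
    exact hs (c y)
  · intro C hC
    refine topologicalKrullDim_irreducibleComponent (fun y => ?_) hC
    refine ⟨Spec (B (c y)), inferInstance, h y, inferInstance, (h y).isOpenEmbedding, hmem y, ?_⟩
    rw [← hd (c y)]
    exact PrimeSpectrum.topologicalKrullDim_eq_ringKrullDim _

end Reduced

/-! ### Strata in coordinates -/

section Coordinates

variable {m s h l : ℕ}

/-- The pair `(F, G)` has a frame for `D`, with coordinates `c`. -/
def StratumIndex.HasCoord (D : StratumIndex m s h l) {R : Type u} [CommRing R]
    (F G : Submodule R (Ind m → R)) (c : D.vars → R) : Prop :=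
  ∃ ρ g f, D.IsFrame F G ρ g f ∧ D.readCoord ρ g f = c

namespace StratumIndex

variable {D : StratumIndex m s h l} {R : Type u} [CommRing R] {F G : Submodule R (Ind m → R)}
  {c : D.vars → R}

theorem HasCoord.map (H : D.HasCoord F G c) {S : Type u} [CommRing S] (φ : R →+* S) :
    D.HasCoord (extend φ F) (extend φ G) fun x => φ (c x) := by
  obtain ⟨ρ, g, f, hf, rfl⟩ := H
  exact ⟨_, _, _, hf.map φ, funext fun x => (D.map_readCoord φ ρ g f x).symm⟩

theorem HasCoord.unique {c' : D.vars → R} (H : D.HasCoord (D.pairF c) (D.pairG c) c') : c' = c := by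
  obtain ⟨ρ, g, f, hf, rfl⟩ := H
  exact hf.readCoord_pair

theorem HasCoord.eq_pair {K : Type u} [Field K] (h2 : (2 : K) ≠ 0)
    {F G : Submodule K (Ind m → K)} {c : D.vars → K} (H : D.HasCoord F G c) (hFG : IsSpl s 0 F G)
    (ht : HasType F G h l) : F = D.pairF c ∧ G = D.pairG c ∧ D.disc c ≠ 0 := by
  obtain ⟨ρ, g, f, hf, rfl⟩ := H
  exact hf.eq_pair h2 hFG ht

end StratumIndex

/-- Such a pair is the parametrized pair of its coordinates with nonzero discriminant, and this form
is visibly stable under field extension; compatibility of the radical with base change is never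
needed directly. -/
theorem HasType.extend {K K' : Type u} [Field K] [Field K'] (h2 : (2 : K) ≠ 0)
    {F G : Submodule K (Ind m → K)} (hFG : IsSpl s 0 F G) (ht : HasType F G h l) (φ : K →+* K') :
    HasType (extend φ F) (extend φ G) h l := by
  have hid := ht
  rw [← extend_id F, ← extend_id G] at hid
  obtain ⟨D, e, he, H⟩ := exists_frame_of_hasType (RingHom.id K) hFG hid
  obtain ⟨ρ, g, f, hf⟩ := H K (RingHom.id K) (isUnit_iff_ne_zero.2 he)
  rw [extend_id, extend_id] at hf
  obtain ⟨hF, hG, hd⟩ := hf.eq_pair h2 hFG ht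
  rw [hF, hG, D.extend_pairF, D.extend_pairG]
  refine D.hasType_pair ?_
  rw [← D.map_disc]
  exact (map_ne_zero φ).2 hd

theorem HasType.unique {K : Type u} [Field K] {F G : Submodule K (Ind m → K)} {h' l' : ℕ}
    (ht : HasType F G h l) (ht' : HasType F G h' l') : h = h' ∧ l = l' :=
  ⟨ht.finrank_F.symm.trans ht'.finrank_F, ht.finrank_G.symm.trans ht'.finrank_G⟩

/-- For the converse, the pair has some type over K, which persists over K' and is unique there. -/
theorem hasType_extend_iff {K K' : Type u} [Field K] [Field K'] (h2 : (2 : K) ≠ 0)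
    {F G : Submodule K (Ind m → K)} (hFG : IsSpl s 0 F G) (φ : K →+* K') :
    HasType (extend φ F) (extend φ G) h l ↔ HasType F G h l := by
  refine ⟨fun ht => ?_, fun ht => ht.extend h2 hFG φ⟩
  obtain ⟨p, -, hp⟩ := exists_hasType h2 hFG
  obtain ⟨rfl, rfl⟩ := ht.unique (hp.extend h2 hFG φ)
  exact hp

end Coordinates

/-! ### Covering, disjointness and nonemptiness of the strata -/

section Strata

open Limits

variable {O₀ : Type u} [CommRing O₀] [IsDomain O₀] {π₀ : O₀}
variable {F₀ : Type u} [Field F₀] [Algebra O₀ F₀] [IsFractionRing O₀ F₀] {m r s h l : ℕ}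
variable {M : Over (Spec (CommRingCat.of (RingOfInt π₀)))}
  (e : SplRepresentation π₀ F₀ m r s M) {k : Type u} [Field k] [Algebra (RingOfInt π₀) k]

theorem two_ne_zero_of_hom (h2k : (2 : k) ≠ 0) {K : Type u} [CommRing K] [Nontrivial K]
    (φ : k →+* K) : (2 : K) ≠ 0 := by
  rw [← map_ofNat φ 2]
  exact (map_ne_zero φ).2 h2k

theorem two_ne_zero_residueField (h2k : (2 : k) ≠ 0) (x : specialFiber M k) :
    (2 : (specialFiber M k).residueField x) ≠ 0 := by
  obtain ⟨φ, -⟩ := exists_base ((specialFiber M k).fromSpecResidueField x)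
  exact two_ne_zero_of_hom h2k φ

theorem iUnion_stratum (h0 : π₀ ≠ 0) (h2 : (2 : O₀) ≠ 0) (h2k : (2 : k) ≠ 0) (hrs : r + s = 2 * m)
    (hω : algebraMap (RingOfInt π₀) k QuadraticAlgebra.omega = 0) :
    (⋃ p ∈ strataIndex s, stratum e k p.1 p.2) = Set.univ := by
  refine Set.eq_univ_of_forall fun x => ?_
  obtain ⟨F, G, hc⟩ := exists_corresponds e h0 ((specialFiber M k).fromSpecResidueField x)
  obtain ⟨p, hp, ht⟩ := exists_hasType (two_ne_zero_residueField h2k x) (hc.isSpl h2 hrs hω)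
  exact Set.mem_biUnion hp ((mem_stratum_iff e h0 h2 hrs hω x hc).2 ht)

theorem pairwiseDisjoint_stratum :
    (strataIndex s).PairwiseDisjoint fun p => stratum e k p.1 p.2 := by
  refine fun p _ q _ hpq => Set.disjoint_left.2 fun x hx hx' => hpq (Prod.ext ?_ ?_)
  · exact hx.1.symm.trans hx'.1
  · exact hx.2.symm.trans hx'.2

theorem exists_specMap_fromSpecResidueField {X : Scheme.{u}} (K : Type u) [Field K]
    (z : Spec (CommRingCat.of K) ⟶ X) (p : Spec (CommRingCat.of K)) :
    ∃ φ : X.residueField (z p) ⟶ CommRingCat.of K,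
      z = Spec.map φ ≫ X.fromSpecResidueField (z p) := by
  have h1 := (Scheme.SpecToEquivOfField K X).symm_apply_apply z
  set t := Scheme.SpecToEquivOfField K X z
  have h3 : Spec.map t.2 ≫ X.fromSpecResidueField t.1 = z := h1
  have h4 : t.1 = z p := by
    rw [← h3, Scheme.Hom.comp_apply]
    exact (Set.mem_singleton_iff.1
      ((X.range_fromSpecResidueField t.1) ▸ Set.mem_range_self _)).symm
  clear_value t
  obtain ⟨y, φ⟩ := t
  obtain rfl : y = z p := h4
  exact ⟨φ, h3.symm⟩

/-- Membership in a stratum may be tested on any field-valued point. -/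
theorem mem_stratum_iff_of_field (h0 : π₀ ≠ 0) (h2 : (2 : O₀) ≠ 0) (h2k : (2 : k) ≠ 0)
    (hrs : r + s = 2 * m)
    (hω : algebraMap (RingOfInt π₀) k QuadraticAlgebra.omega = 0) {K : Type u} [Field K]
    (z : Spec (CommRingCat.of K) ⟶ specialFiber M k) (p : Spec (CommRingCat.of K))
    {F G : Submodule K (Ind m → K)} (hc : Corresponds (R := CommRingCat.of K) e h0 z F G) :
    z p ∈ stratum e k h l ↔ HasType F G h l := by
  obtain ⟨φ, hφ⟩ := exists_specMap_fromSpecResidueField K z p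
  obtain ⟨F', G', hc'⟩ := exists_corresponds e h0 ((specialFiber M k).fromSpecResidueField (z p))
  rw [mem_stratum_iff e h0 h2 hrs hω _ hc']
  have h1 := hc'.map φ
  rw [← hφ] at h1
  obtain ⟨rfl, rfl⟩ := hc.unique h1
  exact (hasType_extend_iff (two_ne_zero_residueField h2k _) (hc'.isSpl h2 hrs hω) φ.hom).symm

theorem stratum_nonempty (h0 : π₀ ≠ 0) (h2 : (2 : O₀) ≠ 0) (h2k : (2 : k) ≠ 0)
    (hrs : r + s = 2 * m) (hsr : s ≤ r)
    (hω : algebraMap (RingOfInt π₀) k QuadraticAlgebra.omega = 0) (hhl : (h, l) ∈ strataIndex s) :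
    (stratum e k h l).Nonempty := by
  obtain ⟨D, hD⟩ := exists_stratumIndex_disc hrs hsr hhl k
  obtain ⟨z, -, hz⟩ := (D.isSpl_pair hhl.2.2.1 0).exists_corresponds
    (R := CommRingCat.of k) e h0 h2 hrs hω (RingHom.id k)
  let p : Spec (CommRingCat.of k) := (⊥ : PrimeSpectrum k)
  exact ⟨z p, (mem_stratum_iff_of_field e h0 h2 h2k hrs hω z p hz).2 (D.hasType_pair hD.ne_zero)⟩

end Strata

/-! ### Charts of the strata -/

section Cells

/-- All maximal ideals of the Jacobson ring `R` have height `d`. -/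
structure IsEquicodimensional (R : Type u) [CommRing R] (d : ℕ) : Prop where
  jacobson : IsJacobsonRing R
  height_eq : ∀ P : Ideal R, P.IsMaximal → P.height = d

theorem isEquicodimensional_mvPolynomial (k : Type u) [Field k] (σ : Type*) [Finite σ] :
    IsEquicodimensional (MvPolynomial σ k) (Nat.card σ) :=
  ⟨inferInstance, height_of_isMaximal_mvPolynomial k⟩

/-- In a Jacobson ring the maximal ideals of a localization at one element contract to maximal
ideals, with the same height. So inverting an element does not lower the dimension unless the
localization is zero. -/
theorem IsEquicodimensional.away {R : Type u} [CommRing R] {d : ℕ} (hR : IsEquicodimensional R d)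
    (g : R) : IsEquicodimensional (Localization.Away g) d := by
  have := hR.jacobson
  refine ⟨isJacobsonRing_localization g, fun Q hQ => ?_⟩
  rw [← IsLocalization.height_under (Submonoid.powers g) Q]
  exact hR.height_eq _ ((IsLocalization.isMaximal_iff_isMaximal_disjoint _ g Q).1 hQ).1

theorem IsEquicodimensional.ringKrullDim {R : Type u} [CommRing R] [Nontrivial R] {d : ℕ}
    (hR : IsEquicodimensional R d) : ringKrullDim R = d := by
  apply le_antisymm
  · exact (ringKrullDim_le_iff_isMaximal_height_le _).2 fun Q hQ => by rw [hR.height_eq Q hQ]; rfl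
  · obtain ⟨Q, hQ⟩ := Ideal.exists_maximal R
    have := Ideal.height_le_ringKrullDim_of_ne_top hQ.ne_top
    rw [hR.height_eq Q hQ] at this
    exact this

theorem smooth_C (k : Type u) [Field k] (σ : Type) [Finite σ] :
    (MvPolynomial.C : k →+* MvPolynomial σ k).Smooth := by
  have h : Algebra.Smooth k (MvPolynomial σ k) := ⟨inferInstance, inferInstance⟩
  exact (RingHom.smooth_algebraMap (R := k) (S := MvPolynomial σ k)).2 h

theorem smooth_comp_away {R R' : Type u} [CommRing R] [CommRing R'] {φ : R →+* R'} (h : φ.Smooth)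
    (g : R') : ((algebraMap R' (Localization.Away g)).comp φ).Smooth :=
  h.comp (RingHom.Smooth.holdsForLocalizationAway _ g)

theorem isDomain_away {R : Type u} [CommRing R] [IsDomain R] {g : R} (hg : g ≠ 0) :
    IsDomain (Localization.Away g) :=
  IsLocalization.isDomain_localization (powers_le_nonZeroDivisors_of_noZeroDivisors hg)

end Cells

/-! ### Affine charts and their field-valued points -/

section Charts

open Limits

variable {X : Scheme.{u}}

/-- The morphism of affine schemes of a ring homomorphism. -/
abbrev specHom {A B : Type u} [CommRing A] [CommRing B] (φ : A →+* B) :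
    Spec (CommRingCat.of B) ⟶ Spec (CommRingCat.of A) :=
  Spec.map (CommRingCat.ofHom φ)

theorem specHom_comp {A B C : Type u} [CommRing A] [CommRing B] [CommRing C] (φ : A →+* B)
    (ψ : B →+* C) : specHom (ψ.comp φ) = specHom ψ ≫ specHom φ :=
  Spec.map_comp (CommRingCat.ofHom φ) (CommRingCat.ofHom ψ)

theorem exists_affine_chart (x : X) :
    ∃ (A : Type u) (_ : CommRing A) (j : Spec (CommRingCat.of A) ⟶ X)
      (p : Spec (CommRingCat.of A)), IsOpenImmersion j ∧ j p = x := by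
  obtain ⟨A, j, hj, ⟨p, hp⟩, -⟩ := Scheme.exists_affine_mem_range_and_range_subset (U := ⊤) (x := x) trivial
  exact ⟨A, inferInstance, j, p, hj, hp⟩

variable {A : Type u} [CommRing A]

theorem exists_specHom_away_eq (p : Spec (CommRingCat.of A)) {a : A} (ha : a ∉ p.asIdeal) :
    ∃ p' : Spec (CommRingCat.of (Localization.Away a)),
      specHom (algebraMap A (Localization.Away a)) p' = p := by
  have h1 := PrimeSpectrum.localization_away_comap_range (Localization.Away a) a
  have h3 : p ∈ Set.range (PrimeSpectrum.comap (algebraMap A (Localization.Away a))) := by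
    rw [h1]; exact ha
  exact h3

/-- Every point of `Spec A` is the image of a field-valued point. -/
theorem exists_field_point (p : Spec (CommRingCat.of A)) :
    ∃ (K : Type u) (_ : Field K) (φ : A →+* K) (t : Spec (CommRingCat.of K)),
      specHom φ t = p ∧ ∀ a, φ a = 0 ↔ a ∈ p.asIdeal := by
  have : p.asIdeal.IsPrime := PrimeSpectrum.isPrime p
  refine ⟨p.asIdeal.ResidueField, inferInstance, algebraMap A _, (⊥ : PrimeSpectrum _), ?_, ?_⟩
  · refine PrimeSpectrum.ext ?_
    exact Ideal.ker_algebraMap_residueField p.asIdeal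
  · intro a
    rw [← RingHom.mem_ker, Ideal.ker_algebraMap_residueField]

end Charts

/-! ### Charts of the special fiber carrying coordinates -/

section StratumCharts

open Limits

variable {O₀ : Type u} [CommRing O₀] [IsDomain O₀] {π₀ : O₀}
variable {F₀ : Type u} [Field F₀] [Algebra O₀ F₀] [IsFractionRing O₀ F₀] {m r s h l : ℕ}
variable {M : Over (Spec (CommRingCat.of (RingOfInt π₀)))}
  {e : SplRepresentation π₀ F₀ m r s M} {k : Type u} [Field k] [Algebra (RingOfInt π₀) k]

/-- A chart of the special fiber over which the pair `(F, G)` has coordinates for `D`. -/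
structure IsFramedChart (e : SplRepresentation π₀ F₀ m r s M) (h0 : π₀ ≠ 0)
    (D : StratumIndex m s h l) {A : Type u} [CommRing A]
    (j : Spec (CommRingCat.of A) ⟶ specialFiber M k) (F G : Submodule A (Ind m → A))
    (c : D.vars → A) : Prop where
  isOpenImmersion : IsOpenImmersion j
  corresponds : Corresponds (R := CommRingCat.of A) e h0 j F G
  hasCoord : D.HasCoord F G c
  isUnit_disc : IsUnit (D.disc c)

/-- An affine neighbourhood is shrunk twice: first so that normalized elements exist, then so that
the discriminant of their coordinates is invertible. The latter is nonzero at x, where the pair is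
the parametrized one. -/
theorem exists_isFramedChart (h0 : π₀ ≠ 0) (h2 : (2 : O₀) ≠ 0) (h2k : (2 : k) ≠ 0)
    (hrs : r + s = 2 * m)
    (hω : algebraMap (RingOfInt π₀) k QuadraticAlgebra.omega = 0) {x : specialFiber M k}
    (hx : x ∈ stratum e k h l) :
    ∃ (D : StratumIndex m s h l) (A : Type u) (_ : CommRing A)
      (j : Spec (CommRingCat.of A) ⟶ specialFiber M k) (F G : Submodule A (Ind m → A))
      (c : D.vars → A) (p : Spec (CommRingCat.of A)), j p = x ∧ IsFramedChart e h0 D j F G c := by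
  obtain ⟨A, _, j, p, hj, hp⟩ := exists_affine_chart x
  obtain ⟨F, G, hc⟩ := exists_corresponds (R := CommRingCat.of A) e h0 j
  obtain ⟨K, _, φ, t, ht, hφ⟩ := exists_field_point p
  have hK := hc.map (CommRingCat.ofHom φ)
  have hmem : (specHom φ ≫ j) t ∈ stratum e k h l := by
    rw [Scheme.Hom.comp_apply, ht, hp]
    exact hx
  have hT := (mem_stratum_iff_of_field e h0 h2 h2k hrs hω _ t hK).1 hmem
  obtain ⟨D, a, ha, H⟩ := exists_frame_of_hasType φ (hc.isSpl h2 hrs hω) hT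
  obtain ⟨p₁, hp₁⟩ := exists_specHom_away_eq p (a := a) fun h => ha ((hφ a).2 h)
  obtain ⟨ρ, g, f, hf⟩ := H (Localization.Away a) (algebraMap A _)
    (IsLocalization.Away.algebraMap_isUnit a)
  have hc₁ := hc.map (CommRingCat.ofHom (algebraMap A (Localization.Away a)))
  have hco : D.HasCoord (extend (algebraMap A (Localization.Away a)) F)
    (extend (algebraMap A (Localization.Away a)) G) _ := ⟨ρ, g, f, hf, rfl⟩
  set c₁ := D.readCoord ρ g f
  obtain ⟨K₁, _, φ₁, t₁, ht₁, hφ₁⟩ := exists_field_point p₁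
  have hK₁ := hc₁.map (CommRingCat.ofHom φ₁)
  have hmem₁ : (specHom φ₁ ≫ specHom (algebraMap A (Localization.Away a)) ≫ j) t₁ ∈
      stratum e k h l := by
    rw [Scheme.Hom.comp_apply, ht₁, Scheme.Hom.comp_apply, hp₁, hp]
    exact hx
  have hT₁ := (mem_stratum_iff_of_field e h0 h2 h2k hrs hω _ t₁ hK₁).1 hmem₁
  obtain ⟨β, -⟩ := exists_base (specHom φ₁ ≫ specHom (algebraMap A (Localization.Away a)) ≫ j)
  have hd := ((hco.map φ₁).eq_pair (two_ne_zero_of_hom h2k β) (hK₁.isSpl h2 hrs hω) hT₁).2.2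
  rw [← D.map_disc] at hd
  obtain ⟨p₂, hp₂⟩ := exists_specHom_away_eq p₁ (a := D.disc c₁) fun h => hd ((hφ₁ _).2 h)
  refine ⟨D, Localization.Away (D.disc c₁), inferInstance,
    specHom (algebraMap _ _) ≫ specHom (algebraMap A (Localization.Away a)) ≫ j, _, _, _, p₂, ?_,
    inferInstance, hc₁.map (CommRingCat.ofHom (algebraMap _ (Localization.Away (D.disc c₁)))),
    hco.map _, ?_⟩
  · rw [Scheme.Hom.comp_apply, hp₂, Scheme.Hom.comp_apply, hp₁, hp]
  · rw [← D.map_disc]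
    exact IsLocalization.Away.algebraMap_isUnit _

end StratumCharts

/-! ### The model of a stratum and its comparison with the special fiber -/

section StratumCharts

open Limits

variable {O₀ : Type u} [CommRing O₀] [IsDomain O₀] {π₀ : O₀}
variable {F₀ : Type u} [Field F₀] [Algebra O₀ F₀] [IsFractionRing O₀ F₀] {m r s h l : ℕ}
variable {M : Over (Spec (CommRingCat.of (RingOfInt π₀)))}
  {e : SplRepresentation π₀ F₀ m r s M} {k : Type u} [Field k] [Algebra (RingOfInt π₀) k]

namespace StratumIndex

variable (D : StratumIndex m s h l) (k)

/-- The coordinate ring of the model of the stratum: polynomials with the discriminant inverted. -/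
abbrev Cell : Type u :=
  Localization.Away (D.disc (MvPolynomial.X : D.vars → MvPolynomial D.vars k))

/-- The coordinates on the model. -/
def coord (i : D.vars) : D.Cell k := algebraMap (MvPolynomial D.vars k) (D.Cell k) (.X i)

/-- The structure map of the coordinate ring of the model. -/
def cellBase : k →+* D.Cell k :=
  (algebraMap (MvPolynomial D.vars k) (D.Cell k)).comp MvPolynomial.C

theorem isUnit_disc_coord : IsUnit (D.disc (D.coord k)) := by
  have h1 := IsLocalization.Away.algebraMap_isUnit (S := D.Cell k)
    (D.disc (MvPolynomial.X : D.vars → MvPolynomial D.vars k))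
  rwa [D.map_disc] at h1

variable {k}

theorem cell_hom_ext {A : Type u} [CommRing A] {φ ψ : D.Cell k →+* A}
    (h1 : φ.comp (D.cellBase k) = ψ.comp (D.cellBase k))
    (h2 : ∀ i, φ (D.coord k i) = ψ (D.coord k i)) : φ = ψ :=
  IsLocalization.ringHom_ext
    (Submonoid.powers (D.disc (MvPolynomial.X : D.vars → MvPolynomial D.vars k)))
    (MvPolynomial.ringHom_ext (fun a => RingHom.congr_fun h1 a) h2)

theorem exists_cell_hom {A : Type u} [CommRing A] (β : k →+* A) (c : D.vars → A)
    (hc : IsUnit (D.disc c)) :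
    ∃ γ : D.Cell k →+* A, γ.comp (D.cellBase k) = β ∧ ∀ i, γ (D.coord k i) = c i := by
  have hu : IsUnit (MvPolynomial.eval₂Hom β c
      (D.disc (MvPolynomial.X : D.vars → MvPolynomial D.vars k))) := by
    rw [D.map_disc]
    simpa using hc
  refine ⟨IsLocalization.Away.lift _ hu, RingHom.ext fun a => ?_, fun i => ?_⟩
  · simp [cellBase, IsLocalization.Away.lift_eq]
  · simp [coord, IsLocalization.Away.lift_eq]

theorem disc_X_ne_zero (hc : ∃ (A : Type u) (_ : CommRing A) (_ : Nontrivial A) (_ : k →+* A)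
    (c : D.vars → A), IsUnit (D.disc c)) :
    D.disc (MvPolynomial.X : D.vars → MvPolynomial D.vars k) ≠ 0 := by
  obtain ⟨A, _, _, β, c, hc⟩ := hc
  intro h0
  have h1 : MvPolynomial.eval₂Hom β c
      (D.disc (MvPolynomial.X : D.vars → MvPolynomial D.vars k)) = D.disc c := by
    rw [D.map_disc]
    simp
  rw [h0, map_zero] at h1
  exact hc.ne_zero h1.symm

end StratumIndex

/-- A field-valued point of a framed chart lying in the stratum factors through the model. -/
theorem IsFramedChart.eq_of_mem {h0 : π₀ ≠ 0} (h2 : (2 : O₀) ≠ 0) (h2k : (2 : k) ≠ 0)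
    (hrs : r + s = 2 * m) (hω : algebraMap (RingOfInt π₀) k QuadraticAlgebra.omega = 0)
    {D : StratumIndex m s h l} {A : Type u} [CommRing A]
    {j : Spec (CommRingCat.of A) ⟶ specialFiber M k} {F G : Submodule A (Ind m → A)}
    {c : D.vars → A} (H : IsFramedChart e h0 D j F G c) {β : k →+* A}
    (hβ : j ≫ specialFiberToSpec M k = specHom β)
    {z : Spec (CommRingCat.of (D.Cell k)) ⟶ specialFiber M k}
    (hz : z ≫ specialFiberToSpec M k = specHom (D.cellBase k))
    (hzc : Corresponds (R := CommRingCat.of (D.Cell k)) e h0 z (D.pairF (D.coord k))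
      (D.pairG (D.coord k)))
    {γ : D.Cell k →+* A} (hγ : γ.comp (D.cellBase k) = β) (hγc : ∀ i, γ (D.coord k i) = c i)
    {K : Type u} [Field K] (θ : A →+* K) (t : Spec (CommRingCat.of K))
    (ht : (specHom θ ≫ j) t ∈ stratum e k h l) :
    specHom θ ≫ j = specHom (θ.comp γ) ≫ z := by
  have hK := H.corresponds.map (CommRingCat.ofHom θ)
  have hT := (mem_stratum_iff_of_field e h0 h2 h2k hrs hω _ t hK).1 ht
  obtain ⟨hF, hG, -⟩ := (H.hasCoord.map θ).eq_pair (two_ne_zero_of_hom h2k (θ.comp β))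
    (hK.isSpl h2 hrs hω) hT
  have hK' := hzc.map (CommRingCat.ofHom (θ.comp γ))
  have hcc : (fun x => (θ.comp γ) (D.coord k x)) = fun x => θ (c x) :=
    funext fun x => congrArg θ (hγc x)
  have eF : extend (θ.comp γ) (D.pairF (D.coord k)) = extend θ F := by
    rw [D.extend_pairF, hcc, hF]
  have eG : extend (θ.comp γ) (D.pairG (D.coord k)) = extend θ G := by
    rw [D.extend_pairG, hcc, hG]
  have hK'' : Corresponds (R := CommRingCat.of K) e h0 (specHom (θ.comp γ) ≫ z) (extend θ F)
      (extend θ G) := by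
    rw [← eF, ← eG]
    exact hK'
  refine hK.hom_ext hK'' ?_
  rw [Category.assoc, Category.assoc, hβ, hz, ← hγ, specHom_comp, specHom_comp, Category.assoc]

theorem exists_basicOpen_subset {B : Type u} [CommRing B] {U : Set (Spec (CommRingCat.of B))}
    (hU : IsOpen U) {b : Spec (CommRingCat.of B)} (hb : b ∈ U) :
    ∃ g : B, g ∉ b.asIdeal ∧ ∀ b' : Spec (CommRingCat.of B), g ∉ b'.asIdeal → b' ∈ U := by
  obtain ⟨_, ⟨g, rfl⟩, hg, hgU⟩ :=
    PrimeSpectrum.isTopologicalBasis_basic_opens.exists_subset_of_mem_open (u := U) hb hU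
  exact ⟨g, hg, fun b' hb' => hgU hb'⟩

/-- The coordinates on the chart define γ from the model ring to A, and the universal pair defines z
from the model to the special fiber. Once z is restricted to land in the chart, it is given by a
homomorphism q with q ∘ γ' = id, because the coordinates of a parametrized pair are its parameters
(`HasCoord.unique`). So q is surjective and z is a closed immersion there. Its image is the stratum:
points of the stratum factor through z by `IsFramedChart.eq_of_mem`, and parametrized pairs with
invertible discriminant have type (h, l). -/
theorem hasSmoothChart_stratum {h0 : π₀ ≠ 0} (h2 : (2 : O₀) ≠ 0) (h2k : (2 : k) ≠ 0)
    (hrs : r + s = 2 * m) (hs : h ≡ s [MOD 2])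
    (hω : algebraMap (RingOfInt π₀) k QuadraticAlgebra.omega = 0)
    {D : StratumIndex m s h l} {A : Type u} [CommRing A]
    {j : Spec (CommRingCat.of A) ⟶ specialFiber M k} {F G : Submodule A (Ind m → A)}
    {c : D.vars → A} (H : IsFramedChart e h0 D j F G c) (p : Spec (CommRingCat.of A))
    (hp : j p ∈ stratum e k h l) :
    HasSmoothChart (specialFiberToSpec M k) (stratum e k h l) (D.vars.card : ℕ) (j p) := by
  have hj := H.isOpenImmersion
  obtain ⟨β, hβ⟩ : ∃ β : k →+* A, j ≫ specialFiberToSpec M k = specHom β := exists_base j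
  obtain ⟨γ, hγ, hγc⟩ := D.exists_cell_hom β c H.isUnit_disc
  obtain ⟨z, hz, hzc⟩ : ∃ z : Spec (CommRingCat.of (D.Cell k)) ⟶ specialFiber M k,
      z ≫ specialFiberToSpec M k = specHom (D.cellBase k) ∧
      Corresponds (R := CommRingCat.of (D.Cell k)) e h0 z (D.pairF (D.coord k))
        (D.pairG (D.coord k)) := (D.isSpl_pair hs (D.coord k)).exists_corresponds
    (R := CommRingCat.of (D.Cell k)) e h0 h2 hrs hω (D.cellBase k)
  have key : ∀ (K : Type u) [Field K] (θ : A →+* K) (t : Spec (CommRingCat.of K)),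
      (specHom θ ≫ j) t ∈ stratum e k h l → specHom θ ≫ j = specHom (θ.comp γ) ≫ z :=
    fun K _ θ t ht => H.eq_of_mem h2 h2k hrs hω hβ hz hzc hγ hγc θ t ht
  obtain ⟨K, _, φ, t, ht, hφ⟩ := exists_field_point p
  have hφz := key K φ t (by rw [Scheme.Hom.comp_apply, ht]; exact hp)
  -- The preimage under z of the chart is open in the model and contains the point with the
  -- coordinates of p, since z maps it to `j p`. A basic neighbourhood of that point is inverted
  -- both in the model and, through γ, in the chart.
  obtain ⟨g, hg, hgU⟩ := exists_basicOpen_subset (b := specHom (φ.comp γ) t)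
    (j.isOpenEmbedding.isOpen_range.preimage z.continuous) (by
      refine ⟨p, ?_⟩
      rw [← Scheme.Hom.comp_apply, ← hφz, Scheme.Hom.comp_apply, ht])
  have hg' : γ g ∉ p.asIdeal := by
    intro hgp
    refine hg ?_
    have h1 : φ (γ g) = 0 := (hφ _).2 hgp
    have h3 : (φ.comp γ) g ∈ t.asIdeal := by
      rw [RingHom.comp_apply, h1]
      exact t.asIdeal.zero_mem
    exact h3
  let B := Localization.Away g
  let ιB : D.Cell k →+* B := algebraMap _ _
  let A' := Localization.Away (γ g)
  let ιA : A →+* A' := algebraMap _ _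
  have hrange : Set.range (specHom ιB ≫ z) ⊆ Set.range j := by
    rintro _ ⟨b, rfl⟩
    rw [Scheme.Hom.comp_apply]
    refine hgU _ fun hgb => ?_
    have h1 : ιB g ∈ b.asIdeal := hgb
    exact b.isPrime.ne_top (Ideal.eq_top_of_isUnit_mem _ h1
      (IsLocalization.Away.algebraMap_isUnit g))
  obtain ⟨q₀, hq₀⟩ : ∃ q₀ : A →+* B, specHom q₀ ≫ j = specHom ιB ≫ z := by
    refine ⟨(Spec.preimage (R := CommRingCat.of A) (IsOpenImmersion.lift j _ hrange)).hom, ?_⟩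
    exact (congrArg (· ≫ j) (Spec.map_preimage (R := CommRingCat.of A) _)).trans
      (IsOpenImmersion.lift_fac _ _ _)
  have hq₀γ : q₀.comp γ = ιB := by
    apply D.cell_hom_ext
    · rw [RingHom.comp_assoc, hγ]
      refine specMap_ofHom_injective (A := CommRingCat.of k) (B := CommRingCat.of B) ?_
      change specHom (q₀.comp β) = specHom (ιB.comp (D.cellBase k))
      rw [specHom_comp, specHom_comp, ← hβ, ← hz, ← Category.assoc, ← Category.assoc, hq₀]
    · intro i
      have h1 := H.corresponds.map (CommRingCat.ofHom q₀)
      have h3 := hzc.map (CommRingCat.ofHom ιB)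
      have h1' : Corresponds (R := CommRingCat.of B) e h0 (specHom ιB ≫ z) (extend q₀ F)
          (extend q₀ G) := by
        rw [← hq₀]
        exact h1
      obtain ⟨hF, hG⟩ := h1'.unique h3
      have h4 := H.hasCoord.map q₀
      rw [hF, hG] at h4
      have h5 : D.HasCoord (D.pairF fun x => ιB (D.coord k x)) (D.pairG fun x => ιB (D.coord k x))
          fun x => q₀ (c x) := by
        rw [← D.extend_pairF, ← D.extend_pairG]
        exact h4
      rw [RingHom.comp_apply, hγc]
      exact congrFun h5.unique i
  have hγu : IsUnit (q₀ (γ g)) := by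
    rw [← RingHom.comp_apply, hq₀γ]
    exact IsLocalization.Away.algebraMap_isUnit g
  let q : A' →+* B := IsLocalization.Away.lift (γ g) hγu
  have hq : q.comp ιA = q₀ := IsLocalization.Away.lift_comp (γ g) hγu
  have hγu' : IsUnit ((ιA.comp γ) g) := IsLocalization.Away.algebraMap_isUnit (γ g)
  let γ' : B →+* A' := IsLocalization.Away.lift g hγu'
  have hγ' : γ'.comp ιB = ιA.comp γ := IsLocalization.Away.lift_comp g hγu'
  have hqγ : q.comp γ' = RingHom.id B := by
    apply IsLocalization.ringHom_ext (Submonoid.powers g)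
    change (q.comp γ').comp ιB = (RingHom.id B).comp ιB
    rw [RingHom.comp_assoc, hγ', ← RingHom.comp_assoc, hq, hq₀γ, RingHom.id_comp]
  have hqz : specHom q ≫ specHom ιA ≫ j = specHom ιB ≫ z := by
    rw [← Category.assoc, ← specHom_comp, hq, hq₀]
  obtain ⟨p', hp'⟩ := exists_specHom_away_eq p hg'
  have hopen : IsOpenImmersion (specHom ιA ≫ j) := by
    have : IsOpenImmersion (specHom ιA) := IsOpenImmersion.of_isLocalization (γ g)
    infer_instance
  have hne : g ≠ 0 := fun h => hg (h ▸ Ideal.zero_mem _)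
  have hdisc := D.disc_X_ne_zero (k := k) ⟨K, inferInstance, inferInstance, φ.comp β,
    fun x => φ (c x), D.map_disc φ c ▸ H.isUnit_disc.map φ⟩
  have hdom : IsDomain (D.Cell k) := isDomain_away hdisc
  have hdomB : IsDomain B := isDomain_away hne
  refine ⟨CommRingCat.of A', CommRingCat.of B, specHom ιA ≫ j, CommRingCat.ofHom q, hopen,
    ⟨p', ?_⟩, fun b => ⟨γ' b, RingHom.congr_fun hqγ b⟩, ?_, hdomB, ?_, ?_⟩
  · rw [Scheme.Hom.comp_apply]
    exact congrArg j hp'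
  · ext w
    constructor
    · intro hw
      obtain ⟨K', _, θ, t', ht', -⟩ := exists_field_point w
      have hw' : (specHom (θ.comp ιA) ≫ j) t' ∈ stratum e k h l := by
        rw [specHom_comp, Category.assoc, Scheme.Hom.comp_apply, ht']
        exact hw
      have h1 := key K' (θ.comp ιA) t' hw'
      -- The equality holds after composing with the open immersion of the shrunken chart, which is
      -- a monomorphism.
      have h3 : specHom θ = specHom (θ.comp γ') ≫ specHom q := by
        rw [← cancel_mono (specHom ιA ≫ j), Category.assoc, hqz, ← Category.assoc (specHom (θ.comp γ')),
          ← specHom_comp, RingHom.comp_assoc, hγ', ← RingHom.comp_assoc, ← h1,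
          specHom_comp ιA θ, Category.assoc]
      refine ⟨specHom (θ.comp γ') t', ?_⟩
      rw [← ht', h3]
      rfl
    · rintro ⟨b, rfl⟩
      obtain ⟨K', _, θ, t', ht', -⟩ := exists_field_point b
      have h1 := hzc.map (CommRingCat.ofHom (θ.comp ιB))
      have h3 : HasType (extend (θ.comp ιB) (D.pairF (D.coord k)))
          (extend (θ.comp ιB) (D.pairG (D.coord k))) h l := by
        rw [D.extend_pairF, D.extend_pairG]
        refine D.hasType_pair ?_
        rw [← D.map_disc]
        exact ((D.isUnit_disc_coord k).map (θ.comp ιB)).ne_zero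
      have h4 := (mem_stratum_iff_of_field e h0 h2 h2k hrs hω _ t' h1).2 h3
      have h5 : (specHom (θ.comp ιB) ≫ z) t' = (specHom ιA ≫ j) (specHom q b) := by
        rw [specHom_comp, Category.assoc, ← hqz, Scheme.Hom.comp_apply, ht']
        rfl
      have h6 : (specHom ιA ≫ j) (specHom q b) ∈ stratum e k h l := h5 ▸ h4
      exact h6
  · have h1 := ((isEquicodimensional_mvPolynomial k D.vars).away
      (D.disc (MvPolynomial.X : D.vars → MvPolynomial D.vars k))).away g
    rw [Nat.card_eq_fintype_card, Fintype.card_coe] at h1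
    exact h1.ringKrullDim
  · have h1 : specHom q ≫ (specHom ιA ≫ j) ≫ specialFiberToSpec M k =
        specHom (ιB.comp (D.cellBase k)) := by
      rw [← Category.assoc, hqz, Category.assoc, hz, specHom_comp (D.cellBase k) ιB]
    change Smooth (specHom q ≫ (specHom ιA ≫ j) ≫ specialFiberToSpec M k)
    rw [h1]
    exact (HasRingHomProperty.Spec_iff (P := @AlgebraicGeometry.Smooth.{u})
      (Q := RingHom.Smooth)).2 (smooth_comp_away (smooth_comp_away (smooth_C k D.vars) _) g)

end StratumCharts

theorem exists_reducedSubscheme_stratum {O₀ : Type u} [CommRing O₀] [IsDomain O₀] {π₀ : O₀}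
    {F₀ : Type u} [Field F₀] [Algebra O₀ F₀] [IsFractionRing O₀ F₀] {m r s h l : ℕ}
    {M : Over (Spec (CommRingCat.of (RingOfInt π₀)))}
    (e : SplRepresentation π₀ F₀ m r s M) {k : Type u} [Field k] [Algebra (RingOfInt π₀) k]
    (h0 : π₀ ≠ 0) (h2 : (2 : O₀) ≠ 0) (h2k : (2 : k) ≠ 0) (hrs : r + s = 2 * m)
    (hs : h ≡ s [MOD 2]) (hω : algebraMap (RingOfInt π₀) k QuadraticAlgebra.omega = 0) :
    ∃ (Y : Scheme.{u}) (ι : Y ⟶ specialFiber M k),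
      IsReducedSubscheme ι (stratum e k h l) ∧ Smooth (ι ≫ specialFiberToSpec M k) ∧
        IsEquidimensional Y (r * s - (l - h) * (l - h - 1) / 2) := by
  refine exists_reducedSubscheme _ _ _ fun x hx => ?_
  obtain ⟨D, A, _, j, F, G, c, p, rfl, H⟩ := exists_isFramedChart h0 h2 h2k hrs hω hx
  rw [← D.card_vars hrs]
  exact hasSmoothChart_stratum h2 h2k hrs hs hω H p hx

end
end SplittingModel

open SplittingModel

theorem mainTheorem4
    {O₀ : Type u} [CommRing O₀] [IsDomain O₀] [IsDiscreteValuationRing O₀]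
    [IsAdicComplete (IsLocalRing.maximalIdeal O₀) O₀]
    {π₀ : O₀} (hπ₀ : Irreducible π₀)
    {F₀ : Type u} [Field F₀] [Algebra O₀ F₀] [IsFractionRing O₀ F₀]
    {k : Type u} [Field k] [PerfectField k] [Algebra (RingOfInt π₀) k]
    (hk : Function.Surjective (algebraMap (RingOfInt π₀) k)) (h2 : (2 : k) ≠ 0)
    (m r s : ℕ) (hm : 3 < 2 * m) (hrs : r + s = 2 * m) (hsr : s ≤ r) :
    (∃ M : Over (Spec (CommRingCat.of (RingOfInt π₀))),
      Nonempty (SplRepresentation π₀ F₀ m r s M)) ∧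
    ∀ (M : Over (Spec (CommRingCat.of (RingOfInt π₀)))) (e : SplRepresentation π₀ F₀ m r s M),
      (⋃ p ∈ strataIndex s, stratum e k p.1 p.2) = Set.univ ∧
      (strataIndex s).PairwiseDisjoint (fun p => stratum e k p.1 p.2) ∧
      ∀ h l : ℕ, (h, l) ∈ strataIndex s →
        (stratum e k h l).Nonempty ∧
        ∃ (X : Scheme.{u}) (ι : X ⟶ specialFiber M k),
          IsReducedSubscheme ι (stratum e k h l) ∧
          Smooth (ι ≫ specialFiberToSpec M k) ∧
          IsEquidimensional X (r * s - (l - h) * (l - h - 1) / 2) := by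
  have hu : IsUnit (2 : O₀) := isUnit_two hπ₀ hk h2
  have hu' : IsUnit (2 : RingOfInt π₀) := by
    have := hu.map (algebraMap O₀ (RingOfInt π₀))
    rwa [map_ofNat] at this
  refine ⟨exists_splRepresentation F₀ r hπ₀.ne_zero hu.ne_zero hrs hu', fun M e => ?_⟩
  have hω := algebraMap_omega_eq_zero hπ₀ hk
  refine ⟨iUnion_stratum e hπ₀.ne_zero hu.ne_zero h2 hrs hω, pairwiseDisjoint_stratum e,
    fun h l hhl => ⟨stratum_nonempty e hπ₀.ne_zero hu.ne_zero h2 hrs hsr hω hhl, ?_⟩⟩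
  exact exists_reducedSubscheme_stratum e hπ₀.ne_zero hu.ne_zero h2 hrs hhl.2.2.1 hω
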